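/- Let $n\ge 1$ and let $q>0$ be real. Repeated indices are summed. **R-matrix.** Let $R_n=q^{-1/n}\bigl(q\sum_iE_{ii}\otimes E_{ii}+\sum_{i\ne j}E_{ii}\otimes E_{jj}+(q-q^{-1})\sum_{j>i}E_{ij}\otimes E_{ji}\bigr)$, with entries $R^{ij}{}_{kl}$ (the first tensor factor carries $i,k$, the second $j,l$). Put $\widetilde R=((R_n^{t_2})^{-1})^{t_2}$, where $t_2$ is transposition in the second factor, $\lambda_n=q^{1-1/n}$ and $g_a{}^b=\lambda_n\widetilde R^{bc}{}_{ca}$. **Quantum groups.** $A(R_n)$ is the complex algebra generated by $t^i{}_j$ ($1\le i,j\le n$) with relations $R^{ij}{}_{kl}t^k{}_at^l{}_b=t^j{}_lt^i{}_kR^{kl}{}_{ab}$. Let $\varepsilon_{a_1\dots a_n}=\varepsilon^{a_1\dots a_n}=(-q)^{l(\sigma)}$ if $(a_1,\dots,a_n)=\sigma(1,\dots,n)$ for a permutation $\sigma$ of length $l(\sigma)$, and $0$ otherwise. Let $\det_{q,n}=\nu_n^{-1}\varepsilon_{a_1\dots a_n}t^{a_1}{}_{b_1}\cdots t^{a_n}{}_{b_n}\varepsilon^{b_n\dots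 b_1}$ with $\nu_n=\varepsilon_{a_1\dots a_n}\varepsilon^{a_n\dots a_1}$. Let $SU_q(n)=A(R_n)/(\det_{q,n}=1)$, and let $U_q(n)$ be $A(R_n)$ with an element $\det_{q,n}^*$ adjoined, subject to $\det_{q,n}\det_{q,n}^*=\det_{q,n}^*\det_{q,n}=1$ (so $U_q(0)=\mathbb C$, and $U_q(1)$ is generated by $z=t^1{}_1$ and $z^*=z^{-1}$). **Projective space.** The quantum sphere $S_q^{2n-1}$ is the $*$-algebra generated by $v^i,x_i$ ($1\le i\le n$), $x_i^*=v^i$, with relations $v^iv^j=\lambda_n^{-1}R^{ij}{}_{kl}v^lv^k$, $x_ix_j=\lambda_n^{-1}x_lx_kR^{kl}{}_{ij}$, $x_iv^j=\lambda_n\widetilde R^{lj}{}_{ik}v^kx_l$ and $v^ag_a{}^bx_b=1$. The algebra $\mathbb{CP}^{n-1}_q$ is the subalgebra of elements of $S^{2n-1}_q$ invariant under the coaction $S_q^{2n-1}\to S_q^{2n-1}\otimes U_q(1)$, $x_i\mapsto x_i\otimes z$, $v^i\mapsto v^i\otimes z^*$. **Bundles.** For a left coaction $\beta:P\to A\otimes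 P$ (an algebra map) of a Hopf algebra $A$ on an algebra $P$, let $P^A=\{u:\beta(u)=1\otimes u\}$ and $\chi:P\otimes P\to A\otimes P$, $\chi(u\otimes w)=\beta(u)(1\otimes w)$. $P$ is a *quantum principal bundle* with structure quantum group $A$ and base $B$ if $B=P^A$, $\chi$ is surjective (freeness), and $\ker\chi\cap\ker(P\otimes P\xrightarrow{\ \cdot\ }P)$ is the linear span of the elements $u\otimes bw-ub\otimes w$ with $u,w\in P$, $b\in B$ (exactness). If $P$ is a Hopf algebra and $\beta=(\pi\otimes\mathrm{id})\circ\Delta$ for a Hopf algebra map $\pi:P\to A$, then $\pi$ is called *exact* if every element of $\ker\pi$ is a finite sum of products $bw$ with $b\in B$, $\pi(b)=0$, $w\in P$. **Theorem.** $SU_q(n)$ and $U_q(n-1)$ are Hopf $*$-algebras with $\Delta t^i{}_j=t^i{}_k\otimes t^k{}_j$, $\epsilon(t^i{}_j)=\delta^i_j$ and $(t^i{}_j)^*=S(t^j{}_i)$, where in $U_q(n-1)$ the adjoined element is the adjoint of $\det_{q,n-1}$. There is a surjective morphism of Hopf $*$-algebras $\delta_n:SU_q(n)\to U_q(n-1)$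 with $$\delta_n(t^1{}_1)=\det{}_{q,n-1}^*,\qquad \delta_n(t^1{}_i)=\delta_n(t^i{}_1)=0,\qquad \delta_n(t^i{}_j)=t^{i-1}{}_{j-1}\qquad(2\le i,j\le n).$$ With the coaction $(\delta_n\otimes\mathrm{id})\circ\Delta$ of $U_q(n-1)$, the algebra $SU_q(n)$ is a quantum principal bundle with structure quantum group $U_q(n-1)$ and base $SU_q(n)^{U_q(n-1)}$; the map $\delta_n$ is exact; and $\mathbb{CP}^{n-1}_q\cong SU_q(n)^{U_q(n-1)}$ as $*$-algebras (in particular $\mathbb{CP}^{n-1}_q$ is closed under $*$). -/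

import Mathlib

open scoped TensorProduct

noncomputable section

/-! ### Hopf algebras, Hopf `*`-algebras and quantum principal bundles -/

/-- A Hopf algebra structure on a given complex algebra. -/
structure HopfStructure (A : Type) [Ring A] [Algebra ℂ A] where
  comul : A →ₐ[ℂ] A ⊗[ℂ] A
  counit : A →ₐ[ℂ] ℂ
  antipode : A →ₗ[ℂ] A
  coassoc : ((Algebra.TensorProduct.assoc ℂ ℂ ℂ A A A).toAlgHom.comp
      (Algebra.TensorProduct.map comul (AlgHom.id ℂ A))).comp comul =
    (Algebra.TensorProduct.map (AlgHom.id ℂ A) comul).comp comul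
  rTensor_counit_comp_comul :
    (Algebra.TensorProduct.map counit (AlgHom.id ℂ A)).comp comul =
      (Algebra.TensorProduct.lid ℂ A).symm.toAlgHom
  lTensor_counit_comp_comul :
    (Algebra.TensorProduct.map (AlgHom.id ℂ A) counit).comp comul =
      (Algebra.TensorProduct.rid ℂ ℂ A).symm.toAlgHom
  mul_antipode_rTensor_comul :
    LinearMap.mul' ℂ A ∘ₗ antipode.rTensor A ∘ₗ comul.toLinearMap =
      Algebra.linearMap ℂ A ∘ₗ counit.toLinearMap
  mul_antipode_lTensor_comul :
    LinearMap.mul' ℂ A ∘ₗ antipode.lTensor A ∘ₗ comul.toLinearMap =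
      Algebra.linearMap ℂ A ∘ₗ counit.toLinearMap

/-- A `HopfStructure` is the same thing as Mathlib's `HopfAlgebra`. -/
abbrev HopfStructure.toHopfAlgebra {A : Type} [Ring A] [Algebra ℂ A] (H : HopfStructure A) :
    HopfAlgebra ℂ A :=
  letI : Bialgebra ℂ A := Bialgebra.ofAlgHom H.comul H.counit H.coassoc
    H.rTensor_counit_comp_comul H.lTensor_counit_comp_comul
  { antipode := H.antipode
    mul_antipode_rTensor_comul := H.mul_antipode_rTensor_comul
    mul_antipode_lTensor_comul := H.mul_antipode_lTensor_comul }

/-- A Hopf `*`-algebra structure on a given complex algebra: a Hopf algebra structure and a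
conjugate-linear, involutive, antimultiplicative `*` for which the coproduct and the counit are
`*`-maps (the `*` on the tensor square is `(a ⊗ b)^* = a^* ⊗ b^*`). -/
structure HopfStarStructure (A : Type) [Ring A] [Algebra ℂ A] extends HopfStructure A where
  starRing : StarRing A
  starModule : StarModule ℂ A
  comul_star : ∀ a : A, comul (star a) = star (comul a)
  counit_star : ∀ a : A, counit (star a) = star (counit a)

/-- `f` is a morphism of Hopf `*`-algebras. -/
structure IsHopfStarHom {A A' : Type} [Ring A] [Algebra ℂ A] [Ring A'] [Algebra ℂ A']
    (H : HopfStarStructure A) (H' : HopfStarStructure A') (f : A →ₐ[ℂ] A') : Prop where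
  map_comul : H'.comul.comp f = (Algebra.TensorProduct.map f f).comp H.comul
  map_counit : H'.counit.comp f = H.counit
  map_antipode : ∀ a : A, f (H.antipode a) = H'.antipode (f a)
  map_star : ∀ a : A, f (H.starRing.star a) = H'.starRing.star (f a)

/-- The left coaction `(π ⊗ id) ∘ Δ` of `A` on the Hopf algebra `P` defined by `π : P → A`. -/
def inducedCoaction {P A : Type} [Ring P] [Algebra ℂ P] [Ring A] [Algebra ℂ A]
    (H : HopfStructure P) (π : P →ₐ[ℂ] A) : P →ₐ[ℂ] A ⊗[ℂ] P :=
  (Algebra.TensorProduct.map π (AlgHom.id ℂ P)).comp H.comul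

/-- The subalgebra `P^A = {u | β u = 1 ⊗ u}` of a left coaction `β : P → A ⊗ P`. -/
def coinvariants {P A : Type} [Ring P] [Algebra ℂ P] [Ring A] [Algebra ℂ A]
    (β : P →ₐ[ℂ] A ⊗[ℂ] P) : Subalgebra ℂ P :=
  AlgHom.equalizer β Algebra.TensorProduct.includeRight

/-- The map `P ⊗ P → A ⊗ P`, `u ⊗ w ↦ β(u) (1 ⊗ w)`. -/
def canonicalMap {P A : Type} [Ring P] [Algebra ℂ P] [Ring A] [Algebra ℂ A]
    (β : P →ₐ[ℂ] A ⊗[ℂ] P) : P ⊗[ℂ] P →ₗ[ℂ] A ⊗[ℂ] P :=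
  LinearMap.mul' ℂ (A ⊗[ℂ] P) ∘ₗ
    TensorProduct.map β.toLinearMap
      (Algebra.TensorProduct.includeRight : P →ₐ[ℂ] A ⊗[ℂ] P).toLinearMap

/-- Universal one-forms `Ω¹P = ker (P ⊗ P → P)`. -/
def universalForms (P : Type) [Ring P] [Algebra ℂ P] : Submodule ℂ (P ⊗[ℂ] P) :=
  LinearMap.ker (LinearMap.mul' ℂ P)

/-- Horizontal forms `P (dB) P`, where `db = 1 ⊗ b - b ⊗ 1`. -/
def horizontalForms {P : Type} [Ring P] [Algebra ℂ P] (B : Subalgebra ℂ P) :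
    Submodule ℂ (P ⊗[ℂ] P) :=
  Submodule.span ℂ {w | ∃ u : P, ∃ b ∈ B, ∃ v : P, w = u ⊗ₜ[ℂ] (b * v) - (u * b) ⊗ₜ[ℂ] v}

/-- The algebra `P` with left coaction `β` is a quantum principal bundle (with the universal
differential calculus) with structure quantum group the Hopf algebra `A` and base `B`:
`P` is a left `A`-comodule algebra, `B = P^A`, the canonical map is onto (freeness), and the
universal one-forms killed by the canonical map are exactly the horizontal ones (exactness). -/
structure IsQuantumPrincipalBundle {P A : Type} [Ring P] [Algebra ℂ P] [Ring A] [Algebra ℂ A]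
    (H : HopfStructure A) (β : P →ₐ[ℂ] A ⊗[ℂ] P) (B : Subalgebra ℂ P) : Prop where
  coassoc : ((Algebra.TensorProduct.assoc ℂ ℂ ℂ A A P).toAlgHom.comp
      (Algebra.TensorProduct.map H.comul (AlgHom.id ℂ P))).comp β =
    (Algebra.TensorProduct.map (AlgHom.id ℂ A) β).comp β
  counit : (Algebra.TensorProduct.map H.counit (AlgHom.id ℂ P)).comp β =
    (Algebra.TensorProduct.lid ℂ P).symm.toAlgHom
  base : B = coinvariants β
  free : Function.Surjective (canonicalMap β)
  exact : LinearMap.ker (canonicalMap β) ⊓ universalForms P = horizontalForms B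

/-- `π : P → A` is exact with respect to `B ⊆ P`: `ker π ⊆ (ker π|_B) P`. -/
def IsExactFor {P A : Type} [Ring P] [Algebra ℂ P] [Ring A] [Algebra ℂ A]
    (π : P →ₐ[ℂ] A) (B : Subalgebra ℂ P) : Prop :=
  ∀ u : P, π u = 0 → u ∈ Submodule.span ℂ {w : P | ∃ b ∈ B, π b = 0 ∧ ∃ v : P, w = b * v}

/-! ### The R-matrices -/

/-- The standard `SU_q(n)` R-matrix; the entry at `((i, j), (k, l))` is `R^{ij}_{kl}`, i.e.
`E_{ab} ⊗ E_{cd}` has its only non-zero entry at `((a, c), (b, d))`. -/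
def Rmat (n : ℕ) (q : ℝ) : Matrix (Fin n × Fin n) (Fin n × Fin n) ℝ :=
  Matrix.of fun x y =>
    q ^ (-(1 / n : ℝ)) *
      ((if x.1 = y.1 ∧ x.2 = y.2 ∧ x.1 = x.2 then q else 0)
        + (if x.1 = y.1 ∧ x.2 = y.2 ∧ x.1 ≠ x.2 then 1 else 0)
        + (if x.1 = y.2 ∧ x.2 = y.1 ∧ x.1 < x.2 then q - q⁻¹ else 0))

/-- Transposition in the second tensor factor. -/
def transposeSnd {n : ℕ} (M : Matrix (Fin n × Fin n) (Fin n × Fin n) ℝ) :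
    Matrix (Fin n × Fin n) (Fin n × Fin n) ℝ :=
  Matrix.of fun x y => M (x.1, y.2) (y.1, x.2)

/-- `R̃ = ((R^{t₂})⁻¹)^{t₂}`. -/
def Rtilde (n : ℕ) (q : ℝ) : Matrix (Fin n × Fin n) (Fin n × Fin n) ℝ :=
  transposeSnd (transposeSnd (Rmat n q))⁻¹

/-- The normalisation `λ_n = q^{1 - 1/n}`. -/
def lam (n : ℕ) (q : ℝ) : ℝ := q ^ (1 - 1 / n : ℝ)

/-- The q-metric `g_a^b = λ_n R̃^{bc}_{ca}`. -/
def qMetric (n : ℕ) (q : ℝ) (a b : Fin n) : ℝ := lam n q * ∑ c, Rtilde n q (b, c) (c, a)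

/-- The explicit form of `R̃`. -/
def RtildeExplicit (n : ℕ) (q : ℝ) : Matrix (Fin n × Fin n) (Fin n × Fin n) ℝ :=
  Matrix.of fun x y =>
    q ^ (1 / n : ℝ) *
      ((if x.1 = y.1 ∧ x.2 = y.2 ∧ x.1 = x.2 then q⁻¹ else 0)
        + (if x.1 = y.1 ∧ x.2 = y.2 ∧ x.1 ≠ x.2 then 1 else 0)
        - (if x.1 = y.2 ∧ x.2 = y.1 ∧ x.1 < x.2 then
            (q - q⁻¹) * q⁻¹ ^ (2 * ((x.2 : ℕ) - (x.1 : ℕ))) else 0))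

theorem geom_aux (q : ℝ) (hq : 0 < q) (i d : ℕ) :
    (q - q⁻¹) * ∑ a ∈ Finset.Ioo i (i + d + 1), q⁻¹ ^ (2 * (i + d + 1 - a)) =
      q⁻¹ - q * q⁻¹ ^ (2 * (d + 1)) := by
  have hq' : q ≠ 0 := hq.ne'
  induction d generalizing i with
  | zero =>
    have : Finset.Ioo i (i + 0 + 1) = ∅ := by ext; simp
    rw [this, Finset.sum_empty]
    linear_combination q⁻¹ * mul_inv_cancel₀ hq'
  | succ d ih =>
    have h1 : Finset.Ioo i (i + (d + 1) + 1) =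
        insert (i + 1) (Finset.Ioo (i + 1) ((i + 1) + d + 1)) := by
      ext; simp; omega
    rw [h1, Finset.sum_insert (by simp), mul_add]
    have h2 : i + (d + 1) + 1 = (i + 1) + d + 1 := by omega
    rw [h2, ih (i + 1)]
    have h3 : (i + 1) + d + 1 - (i + 1) = d + 1 := by omega
    rw [h3]
    linear_combination q⁻¹ ^ (2 * d + 3) * mul_inv_cancel₀ hq'

theorem Rtilde_key (n : ℕ) (q : ℝ) (hq : 0 < q) (i k : Fin n) :
    q * ((if i = k then q⁻¹ else 0)
        - if i < k then (q - q⁻¹) * q⁻¹ ^ (2 * ((k : ℕ) - (i : ℕ))) else 0)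
      + (q - q⁻¹) * ∑ a : Fin n, (if i < a then ((if a = k then q⁻¹ else 0)
        - if a < k then (q - q⁻¹) * q⁻¹ ^ (2 * ((k : ℕ) - (a : ℕ))) else 0) else 0)
      = if i = k then 1 else 0 := by
  have hq' : q ≠ 0 := hq.ne'
  have e1 : ∑ a : Fin n, (if i < a then ((if a = k then q⁻¹ else 0)
        - if a < k then (q - q⁻¹) * q⁻¹ ^ (2 * ((k : ℕ) - (a : ℕ))) else 0) else 0)
      = (if i < k then q⁻¹ else 0)
        - (q - q⁻¹) * ∑ a ∈ Finset.Ioo (i : ℕ) k, q⁻¹ ^ (2 * ((k : ℕ) - a)) := by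
    have : ∀ a : Fin n, (if i < a then ((if a = k then q⁻¹ else 0)
        - if a < k then (q - q⁻¹) * q⁻¹ ^ (2 * ((k : ℕ) - (a : ℕ))) else 0) else 0)
        = (if a = k then (if i < k then q⁻¹ else 0) else 0)
          - (q - q⁻¹) * (if i < a ∧ a < k then q⁻¹ ^ (2 * ((k : ℕ) - (a : ℕ))) else 0) := by
      intro a
      by_cases h1 : i < a <;> by_cases h2 : a = k <;> by_cases h3 : a < k <;>
        simp only [h1, h2, h3, if_true, if_false, true_and, false_and] <;> grind
    simp_rw [this]
    rw [Finset.sum_sub_distrib, ← Finset.mul_sum]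
    congr 1
    · simp
    · congr 1
      rw [← Finset.sum_filter]
      have h4 : Finset.Ioo (i : ℕ) k =
          (Finset.univ.filter fun a : Fin n => i < a ∧ a < k).map Fin.valEmbedding := by
        ext a
        simp only [Finset.mem_Ioo, Finset.mem_map, Finset.mem_filter, Finset.mem_univ, true_and,
          Fin.valEmbedding_apply]
        constructor
        · rintro ⟨h, h'⟩
          exact ⟨⟨a, h'.trans k.2⟩, ⟨h, h'⟩, rfl⟩
        · rintro ⟨b, ⟨h, h'⟩, rfl⟩
          exact ⟨h, h'⟩
      rw [h4, Finset.sum_map]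
      rfl
  rw [e1]
  rcases lt_trichotomy i k with h | h | h
  · have hd : (k : ℕ) = i + ((k : ℕ) - i - 1) + 1 := by
      have : (i : ℕ) < k := h
      omega
    have := geom_aux q hq i ((k : ℕ) - i - 1)
    rw [← hd] at this
    rw [this]
    have h5 : (k : ℕ) - i - 1 + 1 = k - i := by
      have : (i : ℕ) < k := h
      omega
    rw [h5]
    simp only [h, h.ne, if_true, if_false]
    ring
  · subst h
    simp [hq']
  · have : Finset.Ioo (i : ℕ) k = ∅ := by
      ext a
      have : (k : ℕ) < i := h
      simp
      omega
    rw [this]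
    simp [h.ne', h.not_gt]

/-- `R^{t₂}` is invertible, so that the inverse in the definition of `R̃` is a true inverse. -/
theorem transposeSnd_mul_explicit (n : ℕ) (q : ℝ) (hq : 0 < q) :
    transposeSnd (Rmat n q) * transposeSnd (RtildeExplicit n q) = 1 := by
  ext ⟨i, j⟩ ⟨k, l⟩
  have hc : q ^ (-(1 / n : ℝ)) * q ^ (1 / n : ℝ) = 1 := by
    rw [← Real.rpow_add hq]; simp
  have hq' : q ≠ 0 := hq.ne'
  have hR : ∀ a b : Fin n, transposeSnd (Rmat n q) (i, j) (a, b) = q ^ (-(1 / n : ℝ)) *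
      ((if a = i ∧ b = j then (if i = j then q else 1) else 0)
        + (if i = j ∧ a = b ∧ i < a then q - q⁻¹ else 0)) := by
    intro a b
    simp only [transposeSnd, Rmat, Matrix.of_apply]
    congr 1
    grind
  have hT : ∀ a b : Fin n, transposeSnd (RtildeExplicit n q) (a, b) (k, l) = q ^ (1 / n : ℝ) *
      ((if a = k ∧ b = l then (if a = b then q⁻¹ else 1) else 0)
        - (if a = b ∧ k = l ∧ a < k then
          (q - q⁻¹) * q⁻¹ ^ (2 * ((k : ℕ) - (a : ℕ))) else 0)) := by
    intro a b
    simp only [transposeSnd, RtildeExplicit, Matrix.of_apply]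
    congr 1
    grind
  rw [Matrix.mul_apply, Fintype.sum_prod_type]
  simp_rw [hR, hT]
  have hm : ∀ x y : ℝ, q ^ (-(1 / n : ℝ)) * x * (q ^ (1 / n : ℝ) * y) = x * y := by
    intro x y
    calc _ = (q ^ (-(1 / n : ℝ)) * q ^ (1 / n : ℝ)) * (x * y) := by ring
      _ = _ := by rw [hc, one_mul]
  simp_rw [hm]
  by_cases hij : i = j
  · subst hij
    by_cases hkl : k = l
    · subst hkl
      have key := Rtilde_key n q hq i k
      rw [Matrix.one_apply]
      have hone : (if (i, i) = (k, k) then (1 : ℝ) else 0) = if i = k then 1 else 0 := by simp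
      refine Eq.trans ?_ (key.trans hone.symm)
      have : ∀ a b : Fin n,
          ((if a = i ∧ b = i then if i = i then q else 1 else 0)
            + if i = i ∧ a = b ∧ i < a then q - q⁻¹ else 0) *
          ((if a = k ∧ b = k then if a = b then q⁻¹ else 1 else 0) -
            if a = b ∧ k = k ∧ a < k then (q - q⁻¹) * q⁻¹ ^ (2 * ((k : ℕ) - (a : ℕ))) else 0)
          = if b = a then (if a = i then q * ((if i = k then q⁻¹ else 0)
              - if i < k then (q - q⁻¹) * q⁻¹ ^ (2 * ((k : ℕ) - (i : ℕ))) else 0) else 0)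
            + (q - q⁻¹) * (if i < a then ((if a = k then q⁻¹ else 0)
              - if a < k then (q - q⁻¹) * q⁻¹ ^ (2 * ((k : ℕ) - (a : ℕ))) else 0) else 0)
            else 0 := by
        intro a b
        grind
      rw [Finset.sum_congr rfl fun a _ => Finset.sum_congr rfl fun b _ => this a b]
      simp [Finset.sum_add_distrib, Finset.mul_sum]
    · have : ∀ a b : Fin n,
          ((if a = i ∧ b = i then if i = i then q else 1 else 0)
            + if i = i ∧ a = b ∧ i < a then q - q⁻¹ else 0) *
          ((if a = k ∧ b = l then if a = b then q⁻¹ else 1 else 0) -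
            if a = b ∧ k = l ∧ a < k then (q - q⁻¹) * q⁻¹ ^ (2 * ((k : ℕ) - (a : ℕ))) else 0)
          = 0 := by
        intro a b
        grind
      rw [Finset.sum_congr rfl fun a _ => Finset.sum_congr rfl fun b _ => this a b]
      rw [Matrix.one_apply]
      simp
      grind
  · have : ∀ a b : Fin n,
          ((if a = i ∧ b = j then if i = j then q else 1 else 0)
            + if i = j ∧ a = b ∧ i < a then q - q⁻¹ else 0) *
          ((if a = k ∧ b = l then if a = b then q⁻¹ else 1 else 0) -
            if a = b ∧ k = l ∧ a < k then (q - q⁻¹) * q⁻¹ ^ (2 * ((k : ℕ) - (a : ℕ))) else 0)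
          = if a = i then (if b = j then (if i = k ∧ j = l then 1 else 0) else 0) else 0 := by
        intro a b
        grind
    simp_rw [this]
    rw [Matrix.one_apply]
    simp

theorem Rtilde_eq (n : ℕ) (q : ℝ) (hq : 0 < q) : Rtilde n q = RtildeExplicit n q := by
  rw [Rtilde, Matrix.inv_eq_right_inv (transposeSnd_mul_explicit n q hq)]
  rfl

/-! ### Quantum determinants and the quantum groups `SU_q(n)`, `U_q(n)` -/

/-- The length (number of inversions) of a permutation. -/
def permLength {n : ℕ} (σ : Equiv.Perm (Fin n)) : ℕ :=
  (Finset.univ.filter fun p : Fin n × Fin n => p.1 < p.2 ∧ σ p.2 < σ p.1).card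

/-- `ε_{a_1 … a_n} = (-q)^{l(σ)}` for `(a_1, …, a_n) = σ (1, …, n)`. -/
def qEps {n : ℕ} (q : ℝ) (σ : Equiv.Perm (Fin n)) : ℝ := (-q) ^ permLength σ

/-- `ν_n = ε_{a_1 … a_n} ε^{a_n … a_1}`. -/
def qNu (n : ℕ) (q : ℝ) : ℝ :=
  ∑ σ : Equiv.Perm (Fin n), qEps q σ * qEps q (σ * Fin.revPerm)

/-- `ν_n⁻¹ ε_{a_1 … a_n} t^{a_1}_{b_1} ⋯ t^{a_n}_{b_n} ε^{b_n … b_1}` for a matrix `t` with entries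
in any complex algebra; `ε` vanishes on words that are not permutations. -/
def qDet {n : ℕ} (q : ℝ) {A : Type} [Ring A] [Algebra ℂ A] (t : Fin n → Fin n → A) : A :=
  (((qNu n q)⁻¹ : ℝ) : ℂ) • ∑ σ : Equiv.Perm (Fin n), ∑ τ : Equiv.Perm (Fin n),
    ((qEps q σ * qEps q (τ * Fin.revPerm) : ℝ) : ℂ) •
      (List.ofFn fun k => t (σ k) (τ k)).prod

/-- Left side `R^{ij}_{kl} t^k_a t^l_b` of the relations of `A(R_n)`. -/
def frtLeft {n : ℕ} (q : ℝ) {A : Type} [Ring A] [Algebra ℂ A] (t : Fin n → Fin n → A)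
    (i j a b : Fin n) : A :=
  ∑ k, ∑ l, (Rmat n q (i, j) (k, l) : ℂ) • (t k a * t l b)

/-- Right side `t^j_l t^i_k R^{kl}_{ab}` of the relations of `A(R_n)`. -/
def frtRight {n : ℕ} (q : ℝ) {A : Type} [Ring A] [Algebra ℂ A] (t : Fin n → Fin n → A)
    (i j a b : Fin n) : A :=
  ∑ k, ∑ l, (Rmat n q (k, l) (a, b) : ℂ) • (t j l * t i k)

/-- The free generators `t^i_j`. -/
def suFree {n : ℕ} (i j : Fin n) : FreeAlgebra ℂ (Fin n × Fin n) := FreeAlgebra.ι ℂ (i, j)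

/-- The relations of `SU_q(n)`: those of `A(R_n)` and `det_{q,n} = 1`. -/
inductive SUqRel (n : ℕ) (q : ℝ) :
    FreeAlgebra ℂ (Fin n × Fin n) → FreeAlgebra ℂ (Fin n × Fin n) → Prop
  | frt (i j a b : Fin n) : SUqRel n q (frtLeft q suFree i j a b) (frtRight q suFree i j a b)
  | det : SUqRel n q (qDet q suFree) 1

/-- The algebra `SU_q(n) = A(R_n) / (det_{q,n} = 1)`. -/
def SUq (n : ℕ) (q : ℝ) : Type := RingQuot (SUqRel n q)

instance (n : ℕ) (q : ℝ) : Ring (SUq n q) := inferInstanceAs (Ring (RingQuot (SUqRel n q)))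

instance (n : ℕ) (q : ℝ) : Algebra ℂ (SUq n q) :=
  inferInstanceAs (Algebra ℂ (RingQuot (SUqRel n q)))

/-- The generators `t^i_j` of `SU_q(n)`. -/
def SUq.t {n : ℕ} {q : ℝ} (i j : Fin n) : SUq n q :=
  RingQuot.mkAlgHom ℂ (SUqRel n q) (suFree i j)

/-- The free generators `t^i_j` (`some (i, j)`) and `det^*` (`none`). -/
def uFree {n : ℕ} (i j : Fin n) : FreeAlgebra ℂ (Option (Fin n × Fin n)) :=
  FreeAlgebra.ι ℂ (some (i, j))

/-- The relations of `U_q(n)`: those of `A(R_n)`, and `det^*` is inverse to `det_{q,n}`. -/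
inductive UqRel (n : ℕ) (q : ℝ) :
    FreeAlgebra ℂ (Option (Fin n × Fin n)) → FreeAlgebra ℂ (Option (Fin n × Fin n)) → Prop
  | frt (i j a b : Fin n) : UqRel n q (frtLeft q uFree i j a b) (frtRight q uFree i j a b)
  | det_mul : UqRel n q (qDet q uFree * FreeAlgebra.ι ℂ none) 1
  | mul_det : UqRel n q (FreeAlgebra.ι ℂ none * qDet q uFree) 1

/-- The algebra `U_q(n)`: `A(R_n)` with the element `det^*` adjoined, subject to
`det det^* = det^* det = 1`. -/
def Uq (n : ℕ) (q : ℝ) : Type := RingQuot (UqRel n q)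

instance (n : ℕ) (q : ℝ) : Ring (Uq n q) := inferInstanceAs (Ring (RingQuot (UqRel n q)))

instance (n : ℕ) (q : ℝ) : Algebra ℂ (Uq n q) :=
  inferInstanceAs (Algebra ℂ (RingQuot (UqRel n q)))

/-- The generators `t^i_j` of `U_q(n)`. -/
def Uq.t {n : ℕ} {q : ℝ} (i j : Fin n) : Uq n q :=
  RingQuot.mkAlgHom ℂ (UqRel n q) (uFree i j)

/-- The generator `det^*` of `U_q(n)`. -/
def Uq.detStar (n : ℕ) (q : ℝ) : Uq n q :=
  RingQuot.mkAlgHom ℂ (UqRel n q) (FreeAlgebra.ι ℂ none)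

theorem map_qDet {n : ℕ} (q : ℝ) {A A' : Type} [Ring A] [Algebra ℂ A] [Ring A'] [Algebra ℂ A']
    (f : A →ₐ[ℂ] A') (t : Fin n → Fin n → A) :
    f (qDet q t) = qDet q fun i j => f (t i j) := by
  simp only [qDet, map_smul, map_sum, map_list_prod, List.map_ofFn]
  rfl

theorem Uq.det_mul_detStar (n : ℕ) (q : ℝ) : qDet q (Uq.t (n := n)) * Uq.detStar n q = 1 := by
  have := RingQuot.mkAlgHom_rel ℂ (UqRel.det_mul (n := n) (q := q))
  rw [map_mul, map_qDet, map_one] at this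
  exact this

theorem Uq.detStar_mul_det (n : ℕ) (q : ℝ) : Uq.detStar n q * qDet q (Uq.t (n := n)) = 1 := by
  have := RingQuot.mkAlgHom_rel ℂ (UqRel.mul_det (n := n) (q := q))
  rw [map_mul, map_qDet, map_one] at this
  exact this

/-- The standard Hopf `*`-structure on `SU_q(n)`:
`Δ t^i_j = t^i_k ⊗ t^k_j`, `ε t^i_j = δ^i_j`, `(t^i_j)^* = S t^j_i`. -/
structure SUq.IsStandard {n : ℕ} {q : ℝ} (H : HopfStarStructure (SUq n q)) : Prop where
  comul_t : ∀ i j : Fin n, H.comul (SUq.t i j) = ∑ k, SUq.t i k ⊗ₜ[ℂ] SUq.t k j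
  counit_t : ∀ i j : Fin n, H.counit (SUq.t i j) = if i = j then 1 else 0
  star_t : ∀ i j : Fin n, H.starRing.star (SUq.t i j) = H.antipode (SUq.t j i)

/-- The standard Hopf `*`-structure on `U_q(n)`; the adjoined inverse of the quantum determinant
is its adjoint. -/
structure Uq.IsStandard {n : ℕ} {q : ℝ} (H : HopfStarStructure (Uq n q)) : Prop where
  comul_t : ∀ i j : Fin n, H.comul (Uq.t i j) = ∑ k, Uq.t i k ⊗ₜ[ℂ] Uq.t k j
  counit_t : ∀ i j : Fin n, H.counit (Uq.t i j) = if i = j then 1 else 0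
  star_t : ∀ i j : Fin n, H.starRing.star (Uq.t i j) = H.antipode (Uq.t j i)
  star_det : H.starRing.star (qDet q Uq.t) = Uq.detStar n q

/-! ### `U_q(1)` -/

/-- The generator `z` of `U_q(1)`. -/
def Uq.z (q : ℝ) : Uq 1 q := Uq.t 0 0

/-- The generator `z^*` of `U_q(1)`; for `n = 1` the quantum determinant is `z` itself. -/
def Uq.zStar (q : ℝ) : Uq 1 q := Uq.detStar 1 q

theorem qDet_one (q : ℝ) {A : Type} [Ring A] [Algebra ℂ A] (t : Fin 1 → Fin 1 → A) :
    qDet q t = t 0 0 := by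
  have h : ∀ σ : Equiv.Perm (Fin 1), permLength σ = 0 := by
    intro σ
    simp [permLength, Subsingleton.elim _ (0 : Fin 1)]
  simp [qDet, qNu, qEps, h, Subsingleton.elim _ (0 : Fin 1)]

theorem Uq.z_mul_zStar (q : ℝ) : Uq.z q * Uq.zStar q = 1 := by
  have := Uq.det_mul_detStar 1 q
  rwa [qDet_one] at this

theorem Uq.zStar_mul_z (q : ℝ) : Uq.zStar q * Uq.z q = 1 := by
  have := Uq.detStar_mul_det 1 q
  rwa [qDet_one] at this

/-! ### Quantum spheres -/

/-- The free generators `v^i`. -/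
def sphereFreeV {n : ℕ} (i : Fin n) : FreeAlgebra ℂ (Fin n ⊕ Fin n) := FreeAlgebra.ι ℂ (Sum.inl i)

/-- The free generators `x_i`. -/
def sphereFreeX {n : ℕ} (i : Fin n) : FreeAlgebra ℂ (Fin n ⊕ Fin n) := FreeAlgebra.ι ℂ (Sum.inr i)

/-- The relations of the quantum sphere. The first three present the braided tensor product
`ℂ_q^n` of the quantum vectors `v^i` and the quantum covectors `x_i` (the third one is the braiding
`Ψ (x_i ⊗ v^j) = v^k ⊗ x_l λ_n R̃^{lj}_{ik}`); the last one sets the quantum norm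
`v^a g_a^b x_b` equal to `1`. -/
inductive SphereRel (n : ℕ) (q : ℝ) :
    FreeAlgebra ℂ (Fin n ⊕ Fin n) → FreeAlgebra ℂ (Fin n ⊕ Fin n) → Prop
  | vec (i j : Fin n) : SphereRel n q (sphereFreeV i * sphereFreeV j)
      (∑ k, ∑ l, (((lam n q)⁻¹ * Rmat n q (i, j) (k, l) : ℝ) : ℂ) •
        (sphereFreeV l * sphereFreeV k))
  | covec (i j : Fin n) : SphereRel n q (sphereFreeX i * sphereFreeX j)
      (∑ k, ∑ l, (((lam n q)⁻¹ * Rmat n q (k, l) (i, j) : ℝ) : ℂ) •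
        (sphereFreeX l * sphereFreeX k))
  | braid (i j : Fin n) : SphereRel n q (sphereFreeX i * sphereFreeV j)
      (∑ k, ∑ l, ((lam n q * Rtilde n q (l, j) (i, k) : ℝ) : ℂ) •
        (sphereFreeV k * sphereFreeX l))
  | norm : SphereRel n q
      (∑ a, ∑ b, (qMetric n q a b : ℂ) • (sphereFreeV a * sphereFreeX b)) 1

/-- The quantum sphere `S_q^{2n-1}`. -/
def QSphere (n : ℕ) (q : ℝ) : Type := RingQuot (SphereRel n q)

instance (n : ℕ) (q : ℝ) : Ring (QSphere n q) := inferInstanceAs (Ring (RingQuot (SphereRel n q)))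

instance (n : ℕ) (q : ℝ) : Algebra ℂ (QSphere n q) :=
  inferInstanceAs (Algebra ℂ (RingQuot (SphereRel n q)))

/-- The generators `v^i` of the quantum sphere. -/
def QSphere.v {n : ℕ} {q : ℝ} (i : Fin n) : QSphere n q :=
  RingQuot.mkAlgHom ℂ (SphereRel n q) (sphereFreeV i)

/-- The generators `x_i` of the quantum sphere. -/
def QSphere.x {n : ℕ} {q : ℝ} (i : Fin n) : QSphere n q :=
  RingQuot.mkAlgHom ℂ (SphereRel n q) (sphereFreeX i)

theorem QSphere.vec {n : ℕ} {q : ℝ} (i j : Fin n) : (v i * v j : QSphere n q) =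
    ∑ k, ∑ l, (((lam n q)⁻¹ * Rmat n q (i, j) (k, l) : ℝ) : ℂ) • (v l * v k) := by
  have := RingQuot.mkAlgHom_rel ℂ (SphereRel.vec (n := n) (q := q) i j)
  simp only [map_mul, map_sum, map_smul] at this
  exact this

theorem QSphere.covec {n : ℕ} {q : ℝ} (i j : Fin n) : (x i * x j : QSphere n q) =
    ∑ k, ∑ l, (((lam n q)⁻¹ * Rmat n q (k, l) (i, j) : ℝ) : ℂ) • (x l * x k) := by
  have := RingQuot.mkAlgHom_rel ℂ (SphereRel.covec (n := n) (q := q) i j)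
  simp only [map_mul, map_sum, map_smul] at this
  exact this

theorem QSphere.braid {n : ℕ} {q : ℝ} (i j : Fin n) : (x i * v j : QSphere n q) =
    ∑ k, ∑ l, ((lam n q * Rtilde n q (l, j) (i, k) : ℝ) : ℂ) • (v k * x l) := by
  have := RingQuot.mkAlgHom_rel ℂ (SphereRel.braid (n := n) (q := q) i j)
  simp only [map_mul, map_sum, map_smul] at this
  exact this

theorem QSphere.norm_eq {n : ℕ} {q : ℝ} :
    (∑ a, ∑ b, (qMetric n q a b : ℂ) • (v a * x b) : QSphere n q) = 1 := by
  have := RingQuot.mkAlgHom_rel ℂ (SphereRel.norm (n := n) (q := q))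
  simp only [map_mul, map_sum, map_smul, map_one] at this
  exact this

/-- Images of the generators under the coaction of `U_q(1)`. -/
def QSphere.coactGen (n : ℕ) (q : ℝ) : Fin n ⊕ Fin n → QSphere n q ⊗[ℂ] Uq 1 q :=
  Sum.elim (fun i => v i ⊗ₜ[ℂ] Uq.zStar q) (fun i => x i ⊗ₜ[ℂ] Uq.z q)

theorem QSphere.coact_rel (n : ℕ) (q : ℝ) ⦃a b : FreeAlgebra ℂ (Fin n ⊕ Fin n)⦄
    (h : SphereRel n q a b) :
    FreeAlgebra.lift ℂ (coactGen n q) a = FreeAlgebra.lift ℂ (coactGen n q) b := by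
  have hv : ∀ i : Fin n, FreeAlgebra.lift ℂ (coactGen n q) (sphereFreeV i) =
      v i ⊗ₜ[ℂ] Uq.zStar q := fun i => by simp [sphereFreeV, coactGen]
  have hx : ∀ i : Fin n, FreeAlgebra.lift ℂ (coactGen n q) (sphereFreeX i) =
      x i ⊗ₜ[ℂ] Uq.z q := fun i => by simp [sphereFreeX, coactGen]
  cases h with
  | vec i j =>
    simp only [map_mul, map_sum, map_smul, hv, Algebra.TensorProduct.tmul_mul_tmul]
    rw [vec i j]
    simp only [TensorProduct.sum_tmul, TensorProduct.smul_tmul']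
  | covec i j =>
    simp only [map_mul, map_sum, map_smul, hx, Algebra.TensorProduct.tmul_mul_tmul]
    rw [covec i j]
    simp only [TensorProduct.sum_tmul, TensorProduct.smul_tmul']
  | braid i j =>
    simp only [map_mul, map_sum, map_smul, hv, hx, Algebra.TensorProduct.tmul_mul_tmul,
      Uq.z_mul_zStar, Uq.zStar_mul_z]
    rw [braid i j]
    simp only [TensorProduct.sum_tmul, TensorProduct.smul_tmul']
  | norm =>
    simp only [map_mul, map_sum, map_smul, hv, hx, Algebra.TensorProduct.tmul_mul_tmul,
      Uq.zStar_mul_z, map_one]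
    rw [Algebra.TensorProduct.one_def, ← norm_eq]
    simp only [TensorProduct.sum_tmul, TensorProduct.smul_tmul']

/-- The right coaction of `U_q(1)` on the quantum sphere: `x_i ↦ x_i ⊗ z`, `v^i ↦ v^i ⊗ z^*`. -/
def QSphere.coaction (n : ℕ) (q : ℝ) : QSphere n q →ₐ[ℂ] QSphere n q ⊗[ℂ] Uq 1 q :=
  RingQuot.liftAlgHom ℂ ⟨FreeAlgebra.lift ℂ (coactGen n q), coact_rel n q⟩

theorem QSphere.coaction_gen {n : ℕ} {q : ℝ} (g : Fin n ⊕ Fin n) :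
    coaction n q (RingQuot.mkAlgHom ℂ (SphereRel n q) (FreeAlgebra.ι ℂ g)) = coactGen n q g :=
  (RingQuot.liftAlgHom_mkAlgHom_apply ℂ (FreeAlgebra.lift ℂ (coactGen n q)) (coact_rel n q)
    (FreeAlgebra.ι ℂ g)).trans (FreeAlgebra.lift_ι_apply _ _)

theorem QSphere.coaction_x {n : ℕ} {q : ℝ} (i : Fin n) :
    coaction n q (x i) = x i ⊗ₜ[ℂ] Uq.z q := coaction_gen (Sum.inr i)

theorem QSphere.coaction_v {n : ℕ} {q : ℝ} (i : Fin n) :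
    coaction n q (v i) = v i ⊗ₜ[ℂ] Uq.zStar q := coaction_gen (Sum.inl i)

/-- Complex projective quantum space `ℂP_q^{n-1}` (indexed by `n`): the subalgebra of
`U_q(1)`-invariant elements `{u | β u = u ⊗ 1}` of `S_q^{2n-1}`. -/
def CPq (n : ℕ) (q : ℝ) : Subalgebra ℂ (QSphere n q) :=
  AlgHom.equalizer (QSphere.coaction n q) Algebra.TensorProduct.includeLeft

/-! ### The `*`-structure of the quantum sphere, `(x_i)^* = v^i` -/

theorem Rmat_symm (n : ℕ) (q : ℝ) (i j k l : Fin n) :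
    Rmat n q (i, j) (k, l) = Rmat n q (l, k) (j, i) := by
  simp only [Rmat, Matrix.of_apply]
  congr 1
  grind (splits := 20)

theorem Rtilde_symm (n : ℕ) (q : ℝ) (i j k l : Fin n) :
    Rtilde n q (i, j) (k, l) = Rtilde n q (l, k) (j, i) := by
  have h : (transposeSnd (Rmat n q)).submatrix (Equiv.prodComm _ _) (Equiv.prodComm _ _) =
      transposeSnd (Rmat n q) := by
    ext ⟨a, b⟩ ⟨c, d⟩
    simp only [Matrix.submatrix_apply, transposeSnd, Matrix.of_apply, Equiv.prodComm_apply,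
      Prod.swap_prod_mk]
    exact (Rmat_symm n q a d c b).symm
  have h' := Matrix.inv_submatrix_equiv (transposeSnd (Rmat n q)) (Equiv.prodComm _ _)
    (Equiv.prodComm _ _)
  rw [h] at h'
  have := congrFun (congrFun h' (i, l)) (k, j)
  simpa [Rtilde, transposeSnd] using this

theorem qMetric_symm (n : ℕ) (q : ℝ) (a b : Fin n) : qMetric n q a b = qMetric n q b a := by
  simp only [qMetric]
  congr 1
  exact Finset.sum_congr rfl fun c _ => Rtilde_symm n q b c c a

/-- The conjugate-linear opposite algebra of the quantum sphere: the opposite ring, on which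
scalars act through complex conjugation. -/
def QSphere.ConjOp (n : ℕ) (q : ℝ) : Type := (QSphere n q)ᵐᵒᵖ

instance (n : ℕ) (q : ℝ) : Ring (QSphere.ConjOp n q) := inferInstanceAs (Ring (QSphere n q)ᵐᵒᵖ)

instance (n : ℕ) (q : ℝ) : Algebra ℂ (QSphere.ConjOp n q) :=
  ((algebraMap ℂ (QSphere n q)ᵐᵒᵖ).comp (starRingEnd ℂ)).toAlgebra' fun c x =>
    Algebra.commutes (A := (QSphere n q)ᵐᵒᵖ) ((starRingEnd ℂ) c) x

/-- The identity map of the quantum sphere onto its conjugate-linear opposite. -/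
def QSphere.toConjOp {n : ℕ} {q : ℝ} (a : QSphere n q) : ConjOp n q := MulOpposite.op a

/-- The identity map of the conjugate-linear opposite onto the quantum sphere. -/
def QSphere.ofConjOp {n : ℕ} {q : ℝ} (a : ConjOp n q) : QSphere n q := MulOpposite.unop a

theorem QSphere.toConjOp_mul {n : ℕ} {q : ℝ} (a b : QSphere n q) :
    toConjOp a * toConjOp b = toConjOp (b * a) := rfl

theorem QSphere.toConjOp_one {n : ℕ} {q : ℝ} : toConjOp (1 : QSphere n q) = 1 := rfl

theorem QSphere.toConjOp_sum {n : ℕ} {q : ℝ} {ι : Type} (s : Finset ι) (f : ι → QSphere n q) :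
    toConjOp (∑ i ∈ s, f i) = ∑ i ∈ s, toConjOp (f i) :=
  map_sum (MulOpposite.opAddEquiv : QSphere n q ≃+ (QSphere n q)ᵐᵒᵖ) f s

theorem QSphere.smul_toConjOp {n : ℕ} {q : ℝ} (c : ℂ) (a : QSphere n q) :
    c • toConjOp a = toConjOp ((starRingEnd ℂ) c • a) := by
  rw [Algebra.smul_def, Algebra.smul_def, Algebra.commutes]
  rfl

/-- Images of the generators under the `*`-operation. -/
def QSphere.starGen (n : ℕ) (q : ℝ) : Fin n ⊕ Fin n → ConjOp n q :=
  Sum.elim (fun i => toConjOp (x i)) (fun i => toConjOp (v i))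

theorem QSphere.star_rel (n : ℕ) (q : ℝ) ⦃a b : FreeAlgebra ℂ (Fin n ⊕ Fin n)⦄
    (h : SphereRel n q a b) :
    FreeAlgebra.lift ℂ (starGen n q) a = FreeAlgebra.lift ℂ (starGen n q) b := by
  have hv : ∀ i : Fin n, FreeAlgebra.lift ℂ (starGen n q) (sphereFreeV i) =
      toConjOp (x i) := fun i => by simp [sphereFreeV, starGen]
  have hx : ∀ i : Fin n, FreeAlgebra.lift ℂ (starGen n q) (sphereFreeX i) =
      toConjOp (v i) := fun i => by simp [sphereFreeX, starGen]
  cases h with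
  | vec i j =>
    simp only [map_mul, map_sum, map_smul, hv, toConjOp_mul, smul_toConjOp, ← toConjOp_sum,
      Complex.conj_ofReal]
    rw [covec j i, Finset.sum_comm]
    simp only [Rmat_symm n q i j]
  | covec i j =>
    simp only [map_mul, map_sum, map_smul, hx, toConjOp_mul, smul_toConjOp, ← toConjOp_sum,
      Complex.conj_ofReal]
    rw [vec j i, Finset.sum_comm]
    simp only [Rmat_symm n q j i]
  | braid i j =>
    simp only [map_mul, map_sum, map_smul, hv, hx, toConjOp_mul, smul_toConjOp, ← toConjOp_sum,
      Complex.conj_ofReal]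
    rw [braid j i, Finset.sum_comm]
    congr 1
    refine Finset.sum_congr rfl fun k _ => Finset.sum_congr rfl fun l _ => ?_
    rw [Rtilde_symm n q k i j l]
  | norm =>
    simp only [map_mul, map_sum, map_smul, hv, hx, toConjOp_mul, smul_toConjOp, ← toConjOp_sum,
      Complex.conj_ofReal, map_one]
    rw [← toConjOp_one, ← norm_eq, Finset.sum_comm]
    simp only [qMetric_symm n q]

/-- The `*`-operation, as an algebra map to the conjugate-linear opposite algebra. -/
def QSphere.starHom (n : ℕ) (q : ℝ) : QSphere n q →ₐ[ℂ] ConjOp n q :=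
  RingQuot.liftAlgHom ℂ ⟨FreeAlgebra.lift ℂ (starGen n q), star_rel n q⟩

instance (n : ℕ) (q : ℝ) : Star (QSphere n q) :=
  ⟨fun a => QSphere.ofConjOp (QSphere.starHom n q a)⟩

theorem QSphere.star_def {n : ℕ} {q : ℝ} (a : QSphere n q) :
    star a = ofConjOp (starHom n q a) := rfl

theorem QSphere.starHom_gen {n : ℕ} {q : ℝ} (g : Fin n ⊕ Fin n) :
    starHom n q (RingQuot.mkAlgHom ℂ (SphereRel n q) (FreeAlgebra.ι ℂ g)) = starGen n q g :=
  (RingQuot.liftAlgHom_mkAlgHom_apply ℂ (FreeAlgebra.lift ℂ (starGen n q)) (star_rel n q)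
    (FreeAlgebra.ι ℂ g)).trans (FreeAlgebra.lift_ι_apply _ _)

theorem QSphere.star_x {n : ℕ} {q : ℝ} (i : Fin n) : star (x i : QSphere n q) = v i :=
  congrArg ofConjOp (starHom_gen (Sum.inr i))

theorem QSphere.star_v {n : ℕ} {q : ℝ} (i : Fin n) : star (v i : QSphere n q) = x i :=
  congrArg ofConjOp (starHom_gen (Sum.inl i))

theorem QSphere.star_mul' {n : ℕ} {q : ℝ} (a b : QSphere n q) :
    star (a * b) = star b * star a := by
  rw [star_def, map_mul]
  rfl

theorem QSphere.star_add' {n : ℕ} {q : ℝ} (a b : QSphere n q) :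
    star (a + b) = star a + star b := by
  rw [star_def, map_add]
  rfl

theorem QSphere.star_algebraMap {n : ℕ} {q : ℝ} (c : ℂ) :
    star (algebraMap ℂ (QSphere n q) c) = algebraMap ℂ (QSphere n q) (star c) := by
  rw [star_def, AlgHom.commutes]
  rfl

theorem QSphere.star_star' {n : ℕ} {q : ℝ} (a : QSphere n q) : star (star a) = a := by
  obtain ⟨a, rfl⟩ := RingQuot.mkAlgHom_surjective ℂ (SphereRel n q) a
  induction a using FreeAlgebra.induction with
  | grade0 c =>
    have h : (RingQuot.mkAlgHom ℂ (SphereRel n q)) (algebraMap ℂ _ c) =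
      algebraMap ℂ (QSphere n q) c := AlgHom.commutes _ c
    rw [h, star_algebraMap, star_algebraMap, star_star]
  | grade1 i =>
    cases i with
    | inl i => exact (congrArg star (star_v i)).trans (star_x i)
    | inr i => exact (congrArg star (star_x i)).trans (star_v i)
  | mul a b ha hb =>
    rw [map_mul]
    exact (congrArg star (star_mul' _ _)).trans ((star_mul' _ _).trans (congrArg₂ (· * ·) ha hb))
  | add a b ha hb =>
    rw [map_add]
    exact (congrArg star (star_add' _ _)).trans ((star_add' _ _).trans (congrArg₂ (· + ·) ha hb))

instance (n : ℕ) (q : ℝ) : StarRing (QSphere n q) where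
  star_involutive := QSphere.star_star'
  star_mul := QSphere.star_mul'
  star_add := QSphere.star_add'

instance (n : ℕ) (q : ℝ) : StarModule ℂ (QSphere n q) where
  star_smul c a := by
    rw [Algebra.smul_def, star_mul, QSphere.star_algebraMap, Algebra.smul_def, Algebra.commutes]

end

open scoped TensorProduct

noncomputable section

/-! ### Words, inversions and bubble sort -/

/-! The relations are used through words. For a matrix `t` satisfying them, the product `wmono t I
J` along a row word `I` and a column word `J` intertwines the Hecke operators in `I` with those in
`J` (`wmono_hecke`). A function of words on which every Hecke operator acts by `-q⁻¹` is, in top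
length, a multiple of the `q`-antisymmetric tensor (`IsAlt.eq_top`). This uniqueness makes the
determinant the same along rows and columns and yields Laplace expansions, centrality and
multiplicativity. Both quantum groups satisfy one universal property, `IsQGen`: a quantum matrix
with inverse determinant. The inverse matrix `s` satisfies the relations in the opposite algebra, so
coproduct, antipode and `*` all come from that property.

Exactness. The off-diagonal entries of the first row and column generate a left ideal that is
two-sided; modulo it the generating matrix is block diagonal, so `U_q(n-1)` maps to the quotient and
the ideal contains the kernel of `δ`. The ideal lies in the left ideal generated by the coinvariants
`s^a_0 t^0_b`, corrected by their counit, thanks to `∑ t^0_a s^a_0 = 1` and `∑ q^{2a} s^a_0 t^0_a =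
1`. Applying `*` gives the exactness of `δ`. The canonical map of the bundle is that of the Hopf
algebra on itself, with left inverse `u ⊗ w ↦ u₁ ⊗ S(u₂)w`, followed by `δ ⊗ id`. Its kernel
therefore comes from `ker δ ⊗ P`, and coinvariant first legs of the generators turn that into
horizontal forms.

Projective space. The sphere maps to `SU_q(n)` by sending `v` to the first row of `t` and `x` to the
first column of `s`, rescaled and with the order of indices reversed. The braid relation moves every
`v` to the left and the norm relation puts `1` in `VX`, where `V` and `X` are the spans of the `v`
and of the `x`; so `ℂP` is the increasing union of the `V^k X^k`. Injectivity there is proved in a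
representation of `SU_q(n)` by operators on the space with basis the multisets of letters. Its
generating matrix is a product of commuting `2 × 2` blocks made of creation operators and `q^{±N}`.
The images of sorted monomials, applied to the vacuum, have distinct lowest terms
(`sphereMap_eq_zero`).

Surjectivity is a first fundamental theorem. A coinvariant is a combination of coefficients of
tensor powers of the generating matrix, padded by a `1` so that all words have equal length. These
powers are unitary, so an orthogonal projection makes the coefficients invariant covectors
(`exists_invariant_covectors`). Hecke operators sort such a covector by blocks; stripping letters of
the one-dimensional blocks leaves an eigencovector `ξ` of the tensor powers of the matrix of
`U_q(n-1)` with eigenvalue `det^z`, to be contracted with the lower rows. Families of Hecke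
intertwiners carry a quantum matrix of operators, `snocOp`, and the projections whose kernels are
the covectors contracting into a fixed subspace form such a family. After localization at the
central determinant, `ε^{⊗s} ⊗ ξ` and `ε^{⊗(s+z)}` are eigencovectors of `snocOp` with the same
eigenvalue, and evaluation on this family shows that the first contracts into products of maximal
minors because the second does (`mem_contractMem_of_eigencovector`). The maximal minors of the lower
rows span the first column of `s`, and `1 ∈ V · (minors)` removes `ε^{⊗s}`. -/

/-- The number of inversions of a word. -/
def invCount {N : ℕ} {α : Type*} [LinearOrder α] (J : Fin N → α) : ℕ :=
  (Finset.univ.filter fun p : Fin N × Fin N => p.1 < p.2 ∧ J p.2 < J p.1).card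

theorem invCount_comp_strictMono {N : ℕ} {α β : Type*} [LinearOrder α] [LinearOrder β]
    {f : α → β} (hf : StrictMono f) (J : Fin N → α) : invCount (f ∘ J) = invCount J := by
  simp [invCount, hf.lt_iff_lt]

/-- No place lies strictly between adjacent places, so only their own pair can be reversed. -/
theorem swap_lt_swap_of_adjacent {N : ℕ} {a b : Fin N} (h : (a : ℕ) + 1 = b) {c d : Fin N}
    (hcd : c < d) (hne : ¬(c = a ∧ d = b)) : Equiv.swap a b c < Equiv.swap a b d := by
  simp only [Equiv.swap_apply_def]
  rw [Fin.lt_def] at *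
  simp only [Fin.ext_iff] at *
  split_ifs <;> omega

/-- The transposition carries the inversions of the sorted word bijectively to those of `J`, except
for the descent `(a, b)` itself. -/
theorem invCount_swap {N : ℕ} {α : Type*} [LinearOrder α] {J : Fin N → α} {a b : Fin N}
    (h : (a : ℕ) + 1 = b) (hJ : J b < J a) :
    invCount J = invCount (J ∘ Equiv.swap a b) + 1 := by
  have hab : a < b := by rw [Fin.lt_def]; omega
  have key : (Finset.univ.filter fun p : Fin N × Fin N => p.1 < p.2 ∧ J p.2 < J p.1) =
      insert (a, b) ((Finset.univ.filter fun p : Fin N × Fin N => p.1 < p.2 ∧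
        (J ∘ Equiv.swap a b) p.2 < (J ∘ Equiv.swap a b) p.1).map
        ((Equiv.swap a b).prodCongr (Equiv.swap a b)).toEmbedding) := by
    ext ⟨c, d⟩
    simp only [Finset.mem_filter, Finset.mem_univ, true_and, Finset.mem_insert, Finset.mem_map,
      Prod.exists, Function.comp_apply, Equiv.coe_toEmbedding, Equiv.prodCongr_apply, Prod.map_apply,
      Prod.mk.injEq]
    constructor
    · rintro ⟨h1, h2⟩
      by_cases hc : c = a ∧ d = b
      · exact Or.inl hc
      · exact Or.inr ⟨Equiv.swap a b c, Equiv.swap a b d,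
          ⟨swap_lt_swap_of_adjacent h h1 hc, by simpa using h2⟩, by simp⟩
    · rintro (⟨rfl, rfl⟩ | ⟨c, d, ⟨h1, h2⟩, rfl, rfl⟩)
      · exact ⟨hab, hJ⟩
      · refine ⟨swap_lt_swap_of_adjacent h h1 ?_, h2⟩
        rintro ⟨rfl, rfl⟩
        simp only [Equiv.swap_apply_left, Equiv.swap_apply_right] at h2
        exact lt_asymm h2 hJ
  rw [invCount, key, Finset.card_insert_of_notMem, Finset.card_map]
  · rfl
  · simp only [Finset.mem_map, Finset.mem_filter, Finset.mem_univ, true_and, Prod.exists,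
      Equiv.coe_toEmbedding, Equiv.prodCongr_apply, Prod.map_apply, Prod.mk.injEq, not_exists,
      not_and]
    rintro c d ⟨h1, -⟩ h2 h3
    rw [Equiv.swap_apply_eq_iff, Equiv.swap_apply_left] at h2
    rw [Equiv.swap_apply_eq_iff, Equiv.swap_apply_right] at h3
    subst h2 h3
    exact lt_asymm h1 hab

theorem exists_descent {N : ℕ} {α : Type*} [LinearOrder α] {J : Fin N → α} (hJ : ¬ Monotone J) :
    ∃ a b : Fin N, (a : ℕ) + 1 = b ∧ J b < J a := by
  cases N with
  | zero => exact absurd (fun i => i.elim0) hJ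
  | succ N =>
    rw [Fin.monotone_iff_le_succ] at hJ
    push Not at hJ
    obtain ⟨i, hi⟩ := hJ
    exact ⟨_, _, by simp, hi⟩

/-- Bubble sort terminates, since each exchange at a descent lowers the inversion number by one. -/
theorem bubble_induction {N : ℕ} {α : Type*} [LinearOrder α] {C : (Fin N → α) → Prop}
    (h0 : ∀ J, Monotone J → C J)
    (h1 : ∀ J, ∀ a b : Fin N, (a : ℕ) + 1 = b → J b < J a → C (J ∘ Equiv.swap a b) → C J)
    (J : Fin N → α) : C J := by
  induction hn : invCount J using Nat.strong_induction_on generalizing J with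
  | _ k ih =>
    by_cases hJ : Monotone J
    · exact h0 J hJ
    · obtain ⟨a, b, h, hlt⟩ := exists_descent hJ
      have := invCount_swap h hlt
      exact h1 J a b h hlt (ih _ (by omega) _ rfl)

/-! ### The Hecke operators on words and alternating functions -/

/-- The diagonal coefficient of the braid matrix. -/
def diagC {α : Type*} [DecidableEq α] (q : ℝ) (i j : α) : ℂ := if i = j then (q : ℂ) else 1

/-- The off-diagonal coefficient of the braid matrix. -/
def offC {α : Type*} [LinearOrder α] (q : ℝ) (i j : α) : ℂ :=
  if i < j then (q : ℂ) - (q : ℂ)⁻¹ else 0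

theorem diagC_comm {α : Type*} [DecidableEq α] (q : ℝ) (i j : α) : diagC q i j = diagC q j i := by
  simp only [diagC, eq_comm]

/-- The Hecke operator at the adjacent places `a`, `b` on functions of words. -/
def hecke {N : ℕ} {α M : Type*} [LinearOrder α] [AddCommMonoid M] [Module ℂ M] (q : ℝ) (a b : Fin N)
    (f : (Fin N → α) → M) (I : Fin N → α) : M :=
  diagC q (I a) (I b) • f (I ∘ Equiv.swap a b) + offC q (I b) (I a) • f I

/-- Functions of words that are `q`-alternating: all Hecke operators act by `-q⁻¹`. -/
def IsAlt {N : ℕ} {α M : Type*} [LinearOrder α] [AddCommGroup M] [Module ℂ M] (q : ℝ)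
    (f : (Fin N → α) → M) : Prop :=
  ∀ a b : Fin N, (a : ℕ) + 1 = b → ∀ I, hecke q a b f I = -(q : ℂ)⁻¹ • f I

/-! ### Alternating functions and the `q`-antisymmetric tensor -/

section Alt

variable {N : ℕ} {α M : Type*} [LinearOrder α] [AddCommGroup M] [Module ℂ M] {q : ℝ}

theorem ofReal_ne_zero' (hq : 0 < q) : (q : ℂ) ≠ 0 := by exact_mod_cast hq.ne'

/-- On such a word the Hecke operator multiplies by `q`, and `q ≠ -q⁻¹` because `q` is positive. -/
theorem IsAlt.of_eq (hq : 0 < q) {f : (Fin N → α) → M} (hf : IsAlt q f) {a b : Fin N}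
    (h : (a : ℕ) + 1 = b) {I : Fin N → α} (hI : I a = I b) : f I = 0 := by
  have := hf a b h I
  have e : I ∘ Equiv.swap a b = I := by
    ext k
    simp only [Function.comp_apply, Equiv.swap_apply_def]
    split_ifs <;> simp_all
  simp only [hecke, e, diagC, offC, hI, if_true, lt_irrefl, if_false, zero_smul, add_zero] at this
  have h2 : ((q : ℂ) + (q : ℂ)⁻¹) • f I = 0 := by
    rw [add_smul, this, neg_smul, neg_add_cancel]
  refine (smul_eq_zero.1 h2).resolve_left ?_
  have : (0 : ℝ) < q + q⁻¹ := by positivity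
  exact_mod_cast this.ne'

theorem IsAlt.of_gt (hq : 0 < q) {f : (Fin N → α) → M} (hf : IsAlt q f) {a b : Fin N}
    (h : (a : ℕ) + 1 = b) {I : Fin N → α} (hI : I b < I a) :
    f I = -(q : ℂ)⁻¹ • f (I ∘ Equiv.swap a b) := by
  have := hf a b h I
  have hq' := ofReal_ne_zero' hq
  simp only [hecke, diagC, offC, hI, hI.ne', if_true, if_false, one_smul] at this
  have h2 : f (I ∘ Equiv.swap a b) = (-(q : ℂ)) • f I := by
    rw [eq_sub_of_add_eq this, ← sub_smul]
    congr 1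
    ring
  rw [h2, smul_smul]
  simp [hq']

/-- The `q`-antisymmetric tensor: `(-q⁻¹)^{inv}` on injective words. -/
def epsW (q : ℝ) (I : Fin N → α) : ℂ :=
  open Classical in if Function.Injective I then (-(q : ℂ)⁻¹) ^ invCount I else 0

theorem epsW_of_inj {I : Fin N → α} (h : Function.Injective I) :
    epsW q I = (-(q : ℂ)⁻¹) ^ invCount I := if_pos h

theorem epsW_of_not_inj {I : Fin N → α} (h : ¬ Function.Injective I) : epsW q I = 0 := if_neg h

theorem isAlt_epsW (hq : 0 < q) : IsAlt q (epsW q : (Fin N → α) → ℂ) := by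
  intro a b h I
  have hq' := ofReal_ne_zero' hq
  have hab : a ≠ b := by rintro rfl; omega
  by_cases hI : Function.Injective I
  · have hI' : Function.Injective (I ∘ Equiv.swap a b) := hI.comp (Equiv.swap a b).injective
    rcases lt_trichotomy (I a) (I b) with hlt | heq | hgt
    · have hc := invCount_swap (J := I ∘ Equiv.swap a b) h (by simpa using hlt)
      have e : (I ∘ Equiv.swap a b) ∘ Equiv.swap a b = I := by ext; simp
      rw [e] at hc
      simp only [hecke, diagC, offC, hlt.ne, not_lt_of_gt hlt, if_false, epsW_of_inj hI', epsW_of_inj hI, hc, smul_eq_mul]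
      ring
    · exact absurd (hI heq) hab
    · have hc := invCount_swap h hgt
      simp only [hecke, diagC, offC, hgt.ne', hgt, if_false, if_true, epsW_of_inj hI', epsW_of_inj hI, hc, smul_eq_mul]
      linear_combination (-(-(q : ℂ)⁻¹) ^ invCount (I ∘ Equiv.swap a b)) * mul_inv_cancel₀ hq'
  · have hI' : ¬ Function.Injective (I ∘ Equiv.swap a b) := by
      simpa using hI
    simp [hecke, epsW_of_not_inj hI, epsW_of_not_inj hI']

/-- Sorting only multiplies the value by powers of `-q⁻¹`, and a sorted word with a repeated letter
has two equal neighbours. -/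
theorem IsAlt.of_not_inj (hq : 0 < q) {f : (Fin N → α) → M} (hf : IsAlt q f) {I : Fin N → α}
    (hI : ¬ Function.Injective I) : f I = 0 := by
  induction I using bubble_induction with
  | h0 J hJ =>
    cases N with
    | zero => exact absurd (fun i => i.elim0) hI
    | succ N =>
      have : ¬ StrictMono J := fun h => hI h.injective
      rw [Fin.strictMono_iff_lt_succ] at this
      push Not at this
      obtain ⟨i, hi⟩ := this
      exact hf.of_eq hq (a := i.castSucc) (b := i.succ) (by simp)
        (le_antisymm (hJ (Fin.castSucc_le_succ i)) hi)
  | h1 J a b h hlt ih =>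
    rw [hf.of_gt hq h hlt, ih (by simpa using hI), smul_zero]

theorem IsAlt.comp_perm (hq : 0 < q) {f : (Fin N → α) → M} (hf : IsAlt q f) {I : Fin N → α}
    (hI : StrictMono I) (σ : Equiv.Perm (Fin N)) :
    f (I ∘ σ) = (-(q : ℂ)⁻¹) ^ invCount σ • f I := by
  have key : ∀ J : Fin N → Fin N, Function.Injective J →
      f (I ∘ J) = (-(q : ℂ)⁻¹) ^ invCount J • f I := by
    intro J
    induction J using bubble_induction with
    | h0 J hJ =>
      intro hinj
      have hs : StrictMono J := hJ.strictMono_of_injective hinj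
      have : J = id := by
        -- The identity is the only order automorphism of `Fin N`.
        have := Subsingleton.elim (hs.orderIsoOfSurjective J (Finite.surjective_of_injective hinj))
          (OrderIso.refl _)
        ext k
        exact congrArg (fun e : Fin N ≃o Fin N => ((e k : Fin N) : ℕ)) this
      subst this
      have h0 : invCount (id : Fin N → Fin N) = 0 := by
        rw [invCount, Finset.card_eq_zero, Finset.filter_eq_empty_iff]
        rintro p - ⟨h1, h2⟩
        exact lt_asymm h1 h2
      simp [h0]
    | h1 J a b h hlt ih =>
      intro hinj
      rw [hf.of_gt hq h (show (I ∘ J) b < (I ∘ J) a from hI hlt), Function.comp_assoc,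
        ih (hinj.comp (Equiv.swap a b).injective), invCount_swap h hlt, smul_smul, pow_succ']
  exact key σ σ.injective

theorem IsAlt.eq_of_range (hq : 0 < q) {f : (Fin N → α) → M} (hf : IsAlt q f) {I J : Fin N → α}
    (hI : StrictMono I) (hJ : Function.Injective J) (h : ∀ k, J k ∈ Set.range I) :
    f J = epsW q J • f I := by
  choose g hg using h
  have hginj : Function.Injective g := fun x y hxy => hJ (by rw [← hg, ← hg, hxy])
  have hJ' : J = I ∘ Equiv.ofBijective g (Finite.injective_iff_bijective.1 hginj) := by
    ext k
    simp [hg]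
  rw [epsW_of_inj hJ, hJ', hf.comp_perm hq hI, invCount_comp_strictMono hI]

/-- An alternating function of words of top length is determined by one value. -/
theorem IsAlt.eq_top (hq : 0 < q) {f : (Fin N → Fin N) → M} (hf : IsAlt q f) (J : Fin N → Fin N) :
    f J = epsW q J • f id := by
  by_cases hJ : Function.Injective J
  · exact hf.eq_of_range hq strictMono_id hJ (by simp)
  · rw [hf.of_not_inj hq hJ, epsW_of_not_inj hJ, zero_smul]

end Alt

theorem hecke_sum {N : ℕ} {α M ι : Type*} [LinearOrder α] [AddCommGroup M] [Module ℂ M] (q : ℝ)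
    (a b : Fin N) (s : Finset ι) (c : ι → ℂ) (F : ι → (Fin N → α) → M) (J : Fin N → α) :
    hecke q a b (fun J => ∑ x ∈ s, c x • F x J) J = ∑ x ∈ s, c x • hecke q a b (F x) J := by
  simp only [hecke, Finset.smul_sum, smul_add, Finset.sum_add_distrib]
  congr 1 <;> exact Finset.sum_congr rfl fun x _ => smul_comm _ _ _

/-- The Hecke operators are symmetric. -/
theorem sum_hecke_smul {N : ℕ} {α M : Type*} [LinearOrder α] [Fintype α] [AddCommGroup M]
    [Module ℂ M] (q : ℝ) (a b : Fin N) (ξ : (Fin N → α) → ℂ) (f : (Fin N → α) → M) :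
    ∑ I, ξ I • hecke q a b f I = ∑ I, hecke q a b ξ I • f I := by
  simp only [hecke, smul_add, add_smul, Finset.sum_add_distrib]
  congr 1
  · rw [← Equiv.sum_comp (Equiv.arrowCongr (Equiv.swap a b) (Equiv.refl α))]
    refine Finset.sum_congr rfl fun I _ => ?_
    have e : ∀ I : Fin N → α, (Equiv.swap a b).arrowCongr (Equiv.refl α) I = I ∘ Equiv.swap a b :=
      fun I => by ext; simp [Equiv.arrowCongr]
    rw [e]
    have e2 : (I ∘ Equiv.swap a b) ∘ Equiv.swap a b = I := by ext; simp
    rw [e2, smul_smul]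
    simp only [Function.comp_apply, Equiv.swap_apply_left, Equiv.swap_apply_right, smul_eq_mul]
    rw [diagC_comm, mul_comm]
  · exact Finset.sum_congr rfl fun I _ => by rw [smul_smul, smul_eq_mul, mul_comm]

/-! ### Matrices satisfying the relations of `A(R)` and their quantum determinants -/

/-- The product of the entries of `t` along a pair of words. -/
def wmono {ι κ A : Type*} [Monoid A] (t : ι → κ → A) {N : ℕ} (I : Fin N → ι) (J : Fin N → κ) : A :=
  (List.ofFn fun k => t (I k) (J k)).prod

theorem wmono_zero {ι κ A : Type*} [Monoid A] (t : ι → κ → A) (I : Fin 0 → ι) (J : Fin 0 → κ) :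
    wmono t I J = 1 := by simp [wmono]

theorem wmono_succ {ι κ A : Type*} [Monoid A] (t : ι → κ → A) {N : ℕ} (I : Fin (N + 1) → ι)
    (J : Fin (N + 1) → κ) : wmono t I J =
      t (I 0) (J 0) * wmono t (fun k => I k.succ) (fun k => J k.succ) := by
  simp [wmono, List.ofFn_succ]

theorem wmono_cons {ι κ A : Type*} [Monoid A] (t : ι → κ → A) {N : ℕ} (i : ι) (j : κ)
    (I : Fin N → ι) (J : Fin N → κ) :
    wmono t (Fin.cons i I : Fin (N + 1) → ι) (Fin.cons j J : Fin (N + 1) → κ) =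
      t i j * wmono t I J := by
  simp [wmono_succ]

theorem wmono_snoc {ι κ A : Type*} [Monoid A] (t : ι → κ → A) {N : ℕ} (i : ι) (j : κ)
    (I : Fin N → ι) (J : Fin N → κ) :
    wmono t (Fin.snoc I i : Fin (N + 1) → ι) (Fin.snoc J j : Fin (N + 1) → κ) =
      wmono t I J * t i j := by
  rw [wmono, List.ofFn_succ']
  simp [wmono]

theorem wmono_append {ι κ A : Type*} [Monoid A] (t : ι → κ → A) {N N' : ℕ} (I : Fin N → ι)
    (J : Fin N → κ) (I' : Fin N' → ι) (J' : Fin N' → κ) :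
    wmono t (Fin.append I I') (Fin.append J J') = wmono t I J * wmono t I' J' := by
  rw [wmono, wmono, wmono, ← List.prod_append, ← List.ofFn_fin_append]
  congr 2
  ext k
  refine Fin.addCases (fun k => ?_) (fun k => ?_) k <;> simp

theorem map_wmono {ι κ A A' F : Type*} [Monoid A] [Monoid A'] [FunLike F A A']
    [MonoidHomClass F A A'] (f : F) (t : ι → κ → A) {N : ℕ} (I : Fin N → ι) (J : Fin N → κ) :
    f (wmono t I J) = wmono (fun i j => f (t i j)) I J := by
  simp only [wmono, map_list_prod, List.map_ofFn]
  rfl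

/-- The relations of `A(R)`, for a rectangular matrix. -/
def Frt {ι κ A : Type*} [LinearOrder ι] [LinearOrder κ] [Ring A] [Algebra ℂ A] (q : ℝ)
    (t : ι → κ → A) : Prop :=
  ∀ i j a b, diagC q i j • (t i a * t j b) + offC q i j • (t j a * t i b) =
    diagC q a b • (t j b * t i a) + offC q b a • (t j a * t i b)

section Frt

variable {ι κ : Type*} {A : Type*} [LinearOrder ι] [LinearOrder κ] [Ring A] [Algebra ℂ A]
  {q : ℝ} {t : ι → κ → A}

theorem Frt.transpose (ht : Frt q t) : Frt q fun j i => t i j := by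
  intro a b i j
  have := ht j i b a
  rw [diagC_comm q a b, diagC_comm q i j]
  exact this.symm

theorem Frt.map {A' : Type*} [Ring A'] [Algebra ℂ A'] (ht : Frt q t) (f : A →ₐ[ℂ] A') :
    Frt q fun i j => f (t i j) := by
  intro i j a b
  simpa using congrArg f (ht i j a b)

theorem Frt.comp {ι' κ' : Type*} [LinearOrder ι'] [LinearOrder κ'] (ht : Frt q t) {f : ι' → ι}
    {g : κ' → κ} (hf : StrictMono f) (hg : StrictMono g) : Frt q fun i j => t (f i) (g j) := by
  intro i j a b
  have := ht (f i) (f j) (g a) (g b)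
  simpa only [diagC, offC, hf.injective.eq_iff, hg.injective.eq_iff, hf.lt_iff_lt,
    hg.lt_iff_lt] using this

/-- At two adjacent places this is the defining relation between two entries; the remaining factors
are not touched. It lets a Hecke operator pass from row words to column words. -/
theorem wmono_hecke (ht : Frt q t) {N : ℕ} {a b : Fin N} (h : (a : ℕ) + 1 = b) (I : Fin N → ι)
    (J : Fin N → κ) : hecke q a b (fun I => wmono t I J) I = hecke q a b (fun J => wmono t I J) J := by
  induction N with
  | zero => exact a.elim0
  | succ N ih =>
    rcases Fin.eq_zero_or_eq_succ b with rfl | ⟨b, rfl⟩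
    · simp at h
    rcases Fin.eq_zero_or_eq_succ a with rfl | ⟨a, rfl⟩
    · cases N with
      | zero => exact b.elim0
      | succ N =>
        have hb : b = 0 := by ext; simp at h ⊢; omega
        subst hb
        have e : ∀ k : Fin N, Equiv.swap (0 : Fin (N + 2)) (Fin.succ 0) k.succ.succ = k.succ.succ :=
          fun k => Equiv.swap_apply_of_ne_of_ne (by simp [Fin.ext_iff]) (by simp [Fin.ext_iff])
        simp only [hecke, wmono_succ, Function.comp_apply, Equiv.swap_apply_left,
          Equiv.swap_apply_right, e, ← mul_assoc, ← smul_mul_assoc, ← add_mul]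
        congr 1
        rw [diagC_comm]
        -- The row letters enter the relation in reverse order, to match the arguments of `offC` in
        -- `hecke`.
        simpa only [smul_mul_assoc] using ht (I (Fin.succ 0)) (I 0) (J 0) (J (Fin.succ 0))
    · have e : ∀ k : Fin N, Equiv.swap a.succ b.succ k.succ = (Equiv.swap a b k).succ :=
        fun k => by simp only [Equiv.swap_apply_def, Fin.succ_inj]; split_ifs <;> rfl
      have e0 : Equiv.swap a.succ b.succ 0 = 0 :=
        Equiv.swap_apply_of_ne_of_ne (Fin.succ_ne_zero _).symm (Fin.succ_ne_zero _).symm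
      have := congrArg (t (I 0) (J 0) * ·) (ih (a := a) (b := b) (by simpa using h)
        (fun k => I k.succ) (fun k => J k.succ))
      simp only [hecke, mul_add, mul_smul_comm] at this
      simp only [hecke, wmono_succ, Function.comp_apply, e, e0]
      exact this

/-- The Hecke operator moves from `J` to `I` by `wmono_hecke`, and then onto the coefficients `f`
because it is symmetric. -/
theorem Frt.isAlt_sum_left [Fintype ι] (ht : Frt q t) {N : ℕ} {f : (Fin N → ι) → ℂ}
    (hf : IsAlt q f) : IsAlt q fun J : Fin N → κ => ∑ I, f I • wmono t I J := by
  intro a b h J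
  rw [hecke_sum]
  simp only [← wmono_hecke ht h]
  rw [sum_hecke_smul q a b f fun I => wmono t I J, Finset.smul_sum]
  exact Finset.sum_congr rfl fun I _ => by rw [hf a b h, smul_assoc]

theorem Frt.isAlt_sum_right [Fintype κ] (ht : Frt q t) {N : ℕ} {f : (Fin N → κ) → ℂ}
    (hf : IsAlt q f) : IsAlt q fun I : Fin N → ι => ∑ J, f J • wmono t I J :=
  ht.transpose.isAlt_sum_left hf

end Frt

/-- The quantum determinant as a sum over words. -/
def detW {n : ℕ} {A : Type*} [Ring A] [Algebra ℂ A] (q : ℝ) (t : Fin n → Fin n → A) : A :=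
  ∑ J : Fin n → Fin n, epsW q J • wmono t id J

theorem sum_words_eq_sum_perm {n : ℕ} {M : Type*} [AddCommMonoid M] (F : (Fin n → Fin n) → M)
    (hF : ∀ J, ¬ Function.Injective J → F J = 0) :
    ∑ J, F J = ∑ σ : Equiv.Perm (Fin n), F σ := by
  symm
  refine Finset.sum_of_injOn (fun σ => (σ : Fin n → Fin n)) (fun σ _ τ _ h => DFunLike.coe_injective h)
    (by simp) (fun J _ hJ => hF J fun hinj => hJ ?_) (fun _ _ => rfl)
  exact ⟨Equiv.ofBijective J (Finite.injective_iff_bijective.1 hinj), by simp, rfl⟩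

/-! ### Row, column and normalised forms of the determinant -/

section Det

variable {n : ℕ} {A : Type} [Ring A] [Algebra ℂ A] {q : ℝ} {t : Fin n → Fin n → A}

theorem epsW_perm (σ : Equiv.Perm (Fin n)) : epsW q σ = (-(q : ℂ)⁻¹) ^ invCount σ :=
  epsW_of_inj σ.injective

/-- The tensor has real coefficients, nonzero on permutations, so this is a sum of positive squares.
No closed form of the norm is needed. -/
theorem sum_epsW_sq_ne_zero (hq : 0 < q) : ∑ J : Fin n → Fin n, epsW q J * epsW q J ≠ 0 := by
  rw [sum_words_eq_sum_perm _ fun J hJ => by simp [epsW_of_not_inj hJ]]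
  have : ∑ σ : Equiv.Perm (Fin n), epsW q σ * epsW q σ =
      ((∑ σ : Equiv.Perm (Fin n), (-q⁻¹) ^ invCount σ * (-q⁻¹) ^ invCount σ : ℝ) : ℂ) := by
    push_cast
    exact Finset.sum_congr rfl fun σ _ => by rw [epsW_perm]
  rw [this]
  have h : 0 < ∑ σ : Equiv.Perm (Fin n), (-q⁻¹) ^ invCount σ * (-q⁻¹) ^ invCount σ :=
    Finset.sum_pos (fun σ _ => mul_self_pos.2 (pow_ne_zero _ (neg_ne_zero.2 (inv_ne_zero hq.ne'))))
      Finset.univ_nonempty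
  exact_mod_cast h.ne'

theorem Frt.sum_eps_right (hq : 0 < q) (ht : Frt q t) (I : Fin n → Fin n) :
    ∑ J, epsW q J • wmono t I J = epsW q I • detW q t :=
  (ht.isAlt_sum_right (isAlt_epsW hq)).eq_top hq I

/-- By uniqueness of alternating functions the column sums are `epsW q J` times a constant. The
double sum over rows and columns, evaluated in both orders, shows that this constant is the row
determinant. -/
theorem Frt.sum_eps_left (hq : 0 < q) (ht : Frt q t) (J : Fin n → Fin n) :
    ∑ I, epsW q I • wmono t I J = epsW q J • detW q t := by
  have key : ∀ J : Fin n → Fin n, ∑ I, epsW q I • wmono t I J = epsW q J • ∑ I, epsW q I • wmono t I id :=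
    (ht.isAlt_sum_left (isAlt_epsW hq)).eq_top hq
  rw [key]
  congr 1
  generalize ∑ I : Fin n → Fin n, epsW q I • wmono t I id = C at key ⊢
  have h1 : ∑ J : Fin n → Fin n, epsW q J • ∑ I : Fin n → Fin n, epsW q I • wmono t I J =
      ∑ I : Fin n → Fin n, epsW q I • ∑ J : Fin n → Fin n, epsW q J • wmono t I J := by
    simp only [Finset.smul_sum]
    rw [Finset.sum_comm]
    exact Finset.sum_congr rfl fun I _ => Finset.sum_congr rfl fun J _ => smul_comm _ _ _
  simp only [key, ht.sum_eps_right hq, smul_smul, ← Finset.sum_smul] at h1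
  exact smul_right_injective A (sum_epsW_sq_ne_zero (n := n) hq) h1

theorem epsW_id : epsW q (id : Fin n → Fin n) = 1 := by
  rw [epsW_of_inj Function.injective_id]
  have h0 : invCount (id : Fin n → Fin n) = 0 := by
    rw [invCount, Finset.card_eq_zero, Finset.filter_eq_empty_iff]
    rintro p - ⟨h1, h2⟩
    exact lt_asymm h1 h2
  rw [h0, pow_zero]

theorem Frt.detW_transpose (hq : 0 < q) (ht : Frt q t) : detW q (fun i j => t j i) = detW q t := by
  have h := ht.sum_eps_left hq id
  rwa [epsW_id, one_smul] at h

/-- Reversing the places exchanges inversions and non-inversions. -/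
theorem invCount_rev (σ : Equiv.Perm (Fin n)) : invCount (σ * Fin.revPerm : Equiv.Perm (Fin n)) +
    invCount σ = (Finset.univ.filter fun p : Fin n × Fin n => p.1 < p.2).card := by
  have h1 : invCount (σ * Fin.revPerm : Equiv.Perm (Fin n)) =
      (Finset.univ.filter fun p : Fin n × Fin n => p.1 < p.2 ∧ σ p.1 < σ p.2).card := by
    refine Finset.card_bij (fun p _ => (Fin.rev p.2, Fin.rev p.1)) ?_ ?_ ?_
    · rintro p hp
      simpa using hp
    · rintro ⟨a, b⟩ - ⟨c, d⟩ - h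
      simp only [Prod.mk.injEq, Fin.rev_inj] at h
      simp [h]
    · rintro ⟨a, b⟩ hp
      exact ⟨(Fin.rev b, Fin.rev a), by simpa using hp, by simp⟩
  rw [h1, invCount, ← Finset.card_union_of_disjoint]
  · congr 1
    ext ⟨a, b⟩
    simp only [Finset.mem_union, Finset.mem_filter, Finset.mem_univ, true_and, ← and_or_left]
    refine ⟨fun h => h.1, fun h => ⟨h, lt_or_gt_of_ne fun h' => h.ne (σ.injective h')⟩⟩
  · rw [Finset.disjoint_filter]
    rintro p - h1 h2
    exact lt_asymm h1.2 h2.2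

/-- By `invCount_rev`, the reversed tensor with base `-q` is a fixed multiple of the tensor with
base `-q⁻¹`. -/
theorem qEps_rev (hq : 0 < q) (τ : Equiv.Perm (Fin n)) : (qEps q (τ * Fin.revPerm) : ℂ) =
    (-(q : ℂ)) ^ (Finset.univ.filter fun p : Fin n × Fin n => p.1 < p.2).card * epsW q τ := by
  have hq' := ofReal_ne_zero' hq
  rw [epsW_perm, ← invCount_rev τ, pow_add, mul_assoc, ← mul_pow]
  have : -(q : ℂ) * -(q : ℂ)⁻¹ = 1 := by simp [hq']
  rw [this, one_pow, mul_one, qEps]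
  push_cast
  rfl

theorem qEps_mul_eps (hq : 0 < q) (σ : Equiv.Perm (Fin n)) : (qEps q σ : ℂ) * epsW q σ = 1 := by
  have hq' := ofReal_ne_zero' hq
  rw [epsW_perm, qEps]
  push_cast
  have e : permLength σ = invCount σ := rfl
  rw [e, ← mul_pow]
  have : -(q : ℂ) * -(q : ℂ)⁻¹ = 1 := by simp [hq']
  rw [this, one_pow]

/-- Each row permutation contributes the same multiple `L` of `detW`, since `qEps q σ` cancels `epsW
q σ`. The same cancellation gives `ν_n = L · n!`, so the normalisation removes both factors. -/
theorem Frt.qDet_eq (hq : 0 < q) (ht : Frt q t) : qDet q t = detW q t := by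
  have hq' := ofReal_ne_zero' hq
  set L := (-(q : ℂ)) ^ (Finset.univ.filter fun p : Fin n × Fin n => p.1 < p.2).card with hL
  have hL0 : L ≠ 0 := pow_ne_zero _ (neg_ne_zero.2 hq')
  have hnu : (qNu n q : ℂ) = L * (Fintype.card (Equiv.Perm (Fin n)) : ℂ) := by
    rw [qNu]
    push_cast
    simp only [qEps_rev hq, ← hL]
    rw [Finset.sum_congr rfl fun σ _ => (by rw [mul_left_comm, qEps_mul_eps hq, mul_one] :
      (qEps q σ : ℂ) * (L * epsW q σ) = L)]
    simp [mul_comm]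
  have hsum : ∑ σ : Equiv.Perm (Fin n), ∑ τ : Equiv.Perm (Fin n),
      ((qEps q σ * qEps q (τ * Fin.revPerm) : ℝ) : ℂ) • (List.ofFn fun k => t (σ k) (τ k)).prod =
      (L * (Fintype.card (Equiv.Perm (Fin n)) : ℂ)) • detW q t := by
    have h1 : ∀ σ : Equiv.Perm (Fin n), ∑ τ : Equiv.Perm (Fin n),
        ((qEps q σ * qEps q (τ * Fin.revPerm) : ℝ) : ℂ) • (List.ofFn fun k => t (σ k) (τ k)).prod =
        L • detW q t := by
      intro σ
      have h2 := ht.sum_eps_right hq σ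
      rw [sum_words_eq_sum_perm _ fun J hJ => by simp [epsW_of_not_inj hJ]] at h2
      have h3 : ∀ τ : Equiv.Perm (Fin n), ((qEps q σ * qEps q (τ * Fin.revPerm) : ℝ) : ℂ) •
          (List.ofFn fun k => t (σ k) (τ k)).prod =
          ((qEps q σ : ℂ) * L) • (epsW q τ • wmono t σ τ) := by
        intro τ
        push_cast
        rw [qEps_rev hq, smul_smul, mul_assoc]
        rfl
      rw [Finset.sum_congr rfl fun τ _ => h3 τ, ← Finset.smul_sum, h2, smul_smul, mul_right_comm,
        qEps_mul_eps hq, one_mul]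
    rw [Finset.sum_congr rfl fun σ _ => h1 σ]
    simp only [Finset.sum_const, Finset.card_univ, mul_smul, ← Nat.cast_smul_eq_nsmul ℂ]
    rw [smul_comm]
  rw [qDet, hsum, smul_smul]
  push_cast
  rw [hnu, inv_mul_cancel₀, one_smul]
  exact mul_ne_zero hL0 (by exact_mod_cast Fintype.card_ne_zero)

end Det

/-! ### Cofactors -/

theorem invCount_eq_sum {N : ℕ} {α : Type*} [LinearOrder α] (J : Fin N → α) :
    invCount J = ∑ a, ∑ b, if a < b ∧ J b < J a then 1 else 0 := by
  rw [invCount, Finset.card_filter, Fintype.sum_prod_type]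

theorem invCount_cons {N : ℕ} {α : Type*} [LinearOrder α] (k : α) (J : Fin N → α) :
    invCount (Fin.cons k J : Fin (N + 1) → α) =
      (Finset.univ.filter fun b => J b < k).card + invCount J := by
  simp only [invCount_eq_sum, Fin.sum_univ_succ, Finset.card_filter]
  simp

theorem invCount_snoc {N : ℕ} {α : Type*} [LinearOrder α] (k : α) (J : Fin N → α) :
    invCount (Fin.snoc J k : Fin (N + 1) → α) =
      (Finset.univ.filter fun b => k < J b).card + invCount J := by
  have h : ∀ a : Fin N, ¬ Fin.last N < a.castSucc := fun a => not_lt_of_ge (Fin.le_last _)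
  simp only [invCount_eq_sum, Fin.sum_univ_castSucc, Finset.card_filter]
  simp [h, Finset.sum_add_distrib, add_comm]

/-- `epsW` on words avoiding the letter `k`, zero on the others. -/
def epsAvoid {m : ℕ} (q : ℝ) (k : Fin (m + 1)) (I : Fin m → Fin (m + 1)) : ℂ :=
  open Classical in if k ∈ Set.range I then 0 else epsW q I

theorem exists_perm_succAbove {m : ℕ} {k : Fin (m + 1)} {I : Fin m → Fin (m + 1)}
    (hI : Function.Injective I) (hk : k ∉ Set.range I) :
    ∃ σ : Equiv.Perm (Fin m), I = k.succAbove ∘ σ := by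
  have h : ∀ b, I b ∈ Set.range k.succAbove := fun b => by
    rw [Fin.range_succAbove]
    rintro rfl
    exact hk ⟨b, rfl⟩
  choose g hg using h
  have hginj : Function.Injective g := fun x y hxy => hI (by rw [← hg, ← hg, hxy])
  exact ⟨Equiv.ofBijective g (Finite.injective_iff_bijective.1 hginj), by ext; simp [hg]⟩

theorem card_succAbove_lt {m : ℕ} (k : Fin (m + 1)) :
    (Finset.univ.filter fun b : Fin m => k.succAbove b < k).card = k := by
  simp only [Fin.succAbove_lt_iff_castSucc_lt]
  rw [← Finset.card_range (k : ℕ)]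
  refine Finset.card_bij (fun b _ => (b : ℕ)) (fun b hb => ?_) (fun a _ b _ h => Fin.ext h)
    (fun b hb => ?_)
  · simpa [Fin.lt_def] using hb
  · have hb' := Finset.mem_range.1 hb
    exact ⟨⟨b, by omega⟩, by simpa [Fin.lt_def] using hb', rfl⟩

theorem card_lt_succAbove {m : ℕ} (k : Fin (m + 1)) :
    (Finset.univ.filter fun b : Fin m => k < k.succAbove b).card = m - k := by
  have h := Finset.card_filter_add_card_filter_not (s := (Finset.univ : Finset (Fin m)))
    (fun b => k.succAbove b < k)
  rw [card_succAbove_lt] at h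
  have h2 : ∀ b : Fin m, ¬ k.succAbove b < k ↔ k < k.succAbove b := fun b =>
    ⟨fun h => lt_of_le_of_ne (not_lt.1 h) (Fin.succAbove_ne k b).symm, fun h => not_lt.2 h.le⟩
  simp only [h2, Finset.card_univ, Fintype.card_fin] at h
  omega

/-- In an injective word the first letter `k` is followed by all `k` smaller letters, hence makes
exactly `k` inversions. -/
theorem epsW_cons {m : ℕ} (q : ℝ) (k : Fin (m + 1)) (I : Fin m → Fin (m + 1)) :
    epsW q (Fin.cons k I : Fin (m + 1) → Fin (m + 1)) =
      (-(q : ℂ)⁻¹) ^ (k : ℕ) * epsAvoid q k I := by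
  by_cases hk : k ∈ Set.range I
  · rw [epsW_of_not_inj (by simp [Fin.cons_injective_iff, hk]), epsAvoid, if_pos hk, mul_zero]
  by_cases hI : Function.Injective I
  · rw [epsW_of_inj (Fin.cons_injective_iff.2 ⟨hk, hI⟩), epsAvoid, if_neg hk, epsW_of_inj hI,
      invCount_cons, pow_add]
    obtain ⟨σ, rfl⟩ := exists_perm_succAbove hI hk
    congr 2
    rw [← card_succAbove_lt k]
    exact Finset.card_equiv σ (by simp)
  · rw [epsW_of_not_inj (by simp [Fin.cons_injective_iff, hI]), epsAvoid, if_neg hk,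
      epsW_of_not_inj hI, mul_zero]

theorem epsW_snoc {m : ℕ} (q : ℝ) (k : Fin (m + 1)) (I : Fin m → Fin (m + 1)) :
    epsW q (Fin.snoc I k : Fin (m + 1) → Fin (m + 1)) =
      (-(q : ℂ)⁻¹) ^ (m - k : ℕ) * epsAvoid q k I := by
  by_cases hk : k ∈ Set.range I
  · rw [epsW_of_not_inj (by simp [Fin.snoc_injective_iff, hk]), epsAvoid, if_pos hk, mul_zero]
  by_cases hI : Function.Injective I
  · rw [epsW_of_inj (Fin.snoc_injective_iff.2 ⟨hI, hk⟩), epsAvoid, if_neg hk, epsW_of_inj hI,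
      invCount_snoc, pow_add]
    obtain ⟨σ, rfl⟩ := exists_perm_succAbove hI hk
    congr 2
    rw [← card_lt_succAbove k]
    exact Finset.card_equiv σ (by simp)
  · rw [epsW_of_not_inj (by simp [Fin.snoc_injective_iff, hI]), epsAvoid, if_neg hk,
      epsW_of_not_inj hI, mul_zero]

theorem sum_words_avoid {m : ℕ} {M : Type*} [AddCommMonoid M] (k : Fin (m + 1))
    (F : (Fin m → Fin (m + 1)) → M)
    (hF : ∀ I, ¬ (Function.Injective I ∧ k ∉ Set.range I) → F I = 0) :
    ∑ I, F I = ∑ σ : Equiv.Perm (Fin m), F (k.succAbove ∘ σ) := by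
  symm
  refine Finset.sum_of_injOn (fun σ : Equiv.Perm (Fin m) => k.succAbove ∘ σ) (fun σ _ τ _ h => ?_)
    (by simp) (fun I _ hI => hF I fun h => hI ?_) (fun _ _ => rfl)
  · ext b
    have := congrFun h b
    simp only [Function.comp_apply] at this
    rw [(Fin.succAbove_right_injective).eq_iff.1 this]
  · obtain ⟨σ, rfl⟩ := exists_perm_succAbove h.1 h.2
    exact ⟨σ, by simp, rfl⟩

/-- The squared norm of the `q`-antisymmetric tensor. -/
def epsNorm (m : ℕ) (q : ℝ) : ℂ := ∑ J : Fin m → Fin m, epsW q J * epsW q J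

theorem epsAvoid_eq_zero {m : ℕ} {q : ℝ} {k : Fin (m + 1)} {I : Fin m → Fin (m + 1)}
    (h : ¬ (Function.Injective I ∧ k ∉ Set.range I)) : epsAvoid q k I = 0 := by
  rw [epsAvoid]
  split_ifs with hk
  · rfl
  · exact epsW_of_not_inj fun hI => h ⟨hI, hk⟩

theorem epsAvoid_succAbove {m : ℕ} {q : ℝ} (k : Fin (m + 1)) (σ : Equiv.Perm (Fin m)) :
    epsAvoid q k (k.succAbove ∘ σ) = epsW q σ := by
  rw [epsAvoid, if_neg, epsW_of_inj (Fin.succAbove_right_injective.comp σ.injective),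
    epsW_of_inj σ.injective, invCount_comp_strictMono (Fin.strictMono_succAbove k)]
  rintro ⟨b, hb⟩
  exact Fin.succAbove_ne k _ hb

/-- An injective word of length `m` misses exactly one letter of `Fin (m + 1)`, so it cannot avoid
both `i` and `k` when they differ. -/
theorem sum_epsAvoid_mul {m : ℕ} (q : ℝ) (i k : Fin (m + 1)) :
    ∑ I, epsAvoid q i I * epsAvoid q k I = if i = k then epsNorm m q else 0 := by
  split_ifs with h
  · subst h
    rw [sum_words_avoid i _ fun I hI => by rw [epsAvoid_eq_zero hI, zero_mul], epsNorm,
      sum_words_eq_sum_perm _ fun J hJ => by rw [epsW_of_not_inj hJ, zero_mul]]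
    simp only [epsAvoid_succAbove]
  · refine Finset.sum_eq_zero fun I _ => ?_
    by_cases h1 : Function.Injective I ∧ i ∉ Set.range I
    · obtain ⟨σ, rfl⟩ := exists_perm_succAbove h1.1 h1.2
      rw [epsAvoid_eq_zero (k := k), mul_zero]
      rintro ⟨-, h3⟩
      obtain ⟨b, hb⟩ := Fin.exists_succAbove_eq (Ne.symm h)
      exact h3 ⟨σ.symm b, by simpa using hb⟩
    · rw [epsAvoid_eq_zero h1, zero_mul]

/-- The cofactor matrix. -/
def cofactor {m : ℕ} {A : Type*} [Ring A] [Algebra ℂ A] (q : ℝ) (t : Fin (m + 1) → Fin (m + 1) → A)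
    (j k : Fin (m + 1)) : A :=
  ((-(q : ℂ)⁻¹) ^ (j : ℕ) * ((-(q : ℂ)⁻¹) ^ (k : ℕ))⁻¹ * (epsNorm m q)⁻¹) •
    ∑ I, ∑ J, (epsAvoid q k I * epsAvoid q j J) • wmono t I J

section Cofactor

variable {m : ℕ} {A : Type} [Ring A] [Algebra ℂ A] {q : ℝ} {t : Fin (m + 1) → Fin (m + 1) → A}

/-- Laplace expansion by the first letter: `sum_eps_right` for the row word `i I` is split over the
first column letter and paired with `epsAvoid q k I`, which keeps only `i = k`. The cofactor sums
over whole row and column words, whence the division by `epsNorm`; this symmetric form serves the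
expansion by the last letter as well. -/
theorem Frt.mul_cofactor (hq : 0 < q) (ht : Frt q t) (i k : Fin (m + 1)) :
    ∑ j, t i j * cofactor q t j k = if i = k then detW q t else 0 := by
  have hq' := ofReal_ne_zero' hq
  have hw : -(q : ℂ)⁻¹ ≠ 0 := neg_ne_zero.2 (inv_ne_zero hq')
  have hL : epsNorm m q ≠ 0 := sum_epsW_sq_ne_zero hq
  have h1 : ∀ I : Fin m → Fin (m + 1), ∑ j : Fin (m + 1), (-(q : ℂ)⁻¹) ^ (j : ℕ) •
      (t i j * ∑ J, epsAvoid q j J • wmono t I J) =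
        ((-(q : ℂ)⁻¹) ^ (i : ℕ) * epsAvoid q i I) • detW q t := by
    intro I
    rw [← epsW_cons, ← ht.sum_eps_right hq, ← (Fin.consEquiv fun _ => Fin (m + 1)).sum_comp,
      Fintype.sum_prod_type]
    refine Finset.sum_congr rfl fun j _ => ?_
    rw [Finset.mul_sum, Finset.smul_sum]
    refine Finset.sum_congr rfl fun J _ => ?_
    have e : (Fin.consEquiv fun _ => Fin (m + 1)) (j, J) = (Fin.cons j J : Fin (m + 1) → _) := rfl
    rw [e, epsW_cons, mul_smul, mul_smul_comm]
    congr 2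
    exact (wmono_cons t i j I J).symm
  have h2 : ∑ I, epsAvoid q k I • ∑ j : Fin (m + 1), (-(q : ℂ)⁻¹) ^ (j : ℕ) •
      (t i j * ∑ J, epsAvoid q j J • wmono t I J) =
      (if i = k then (-(q : ℂ)⁻¹) ^ (i : ℕ) * epsNorm m q else 0) • detW q t := by
    simp only [h1, smul_smul, ← Finset.sum_smul]
    congr 1
    rw [← mul_zero ((-(q : ℂ)⁻¹) ^ (i : ℕ)), ← mul_ite, ← sum_epsAvoid_mul, Finset.mul_sum]
    exact Finset.sum_congr rfl fun I _ => by ring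
  have h3 : ∑ j, t i j * cofactor q t j k = (((-(q : ℂ)⁻¹) ^ (k : ℕ))⁻¹ * (epsNorm m q)⁻¹) •
      ∑ I, epsAvoid q k I • ∑ j : Fin (m + 1), (-(q : ℂ)⁻¹) ^ (j : ℕ) •
      (t i j * ∑ J, epsAvoid q j J • wmono t I J) := by
    simp only [cofactor, Finset.smul_sum, Finset.mul_sum, mul_smul_comm, smul_smul]
    rw [Finset.sum_comm]
    refine Finset.sum_congr rfl fun I _ => Finset.sum_congr rfl fun j _ =>
      Finset.sum_congr rfl fun J _ => ?_
    congr 1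
    ring
  rw [h3, h2, smul_smul]
  split_ifs with h
  · subst h
    rw [mul_mul_mul_comm, inv_mul_cancel₀ (pow_ne_zero _ hw), inv_mul_cancel₀ hL, one_mul, one_smul]
  · simp

/-- The same expansion by the last letter of the words, with `sum_eps_left`. The sign factors now
have exponent `m - i` in place of `i`, and the extra power `m` cancels. -/
theorem Frt.cofactor_mul (hq : 0 < q) (ht : Frt q t) (j k : Fin (m + 1)) :
    ∑ i, cofactor q t j i * t i k = if j = k then detW q t else 0 := by
  have hq' := ofReal_ne_zero' hq
  have hw : -(q : ℂ)⁻¹ ≠ 0 := neg_ne_zero.2 (inv_ne_zero hq')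
  have hL : epsNorm m q ≠ 0 := sum_epsW_sq_ne_zero hq
  have hpow : ∀ i : Fin (m + 1), (-(q : ℂ)⁻¹) ^ (m - i : ℕ) =
      (-(q : ℂ)⁻¹) ^ m * ((-(q : ℂ)⁻¹) ^ (i : ℕ))⁻¹ := fun i =>
    pow_sub₀ _ hw (Nat.lt_succ_iff.1 i.2)
  have h1 : ∀ J : Fin m → Fin (m + 1), ∑ i : Fin (m + 1), (-(q : ℂ)⁻¹) ^ (m - i : ℕ) •
      ((∑ I, epsAvoid q i I • wmono t I J) * t i k) =
        ((-(q : ℂ)⁻¹) ^ (m - k : ℕ) * epsAvoid q k J) • detW q t := by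
    intro J
    rw [← epsW_snoc, ← ht.sum_eps_left hq, ← (Fin.snocEquiv fun _ => Fin (m + 1)).sum_comp,
      Fintype.sum_prod_type]
    refine Finset.sum_congr rfl fun i _ => ?_
    rw [Finset.sum_mul, Finset.smul_sum]
    refine Finset.sum_congr rfl fun I _ => ?_
    have e : (Fin.snocEquiv fun _ => Fin (m + 1)) (i, I) = (Fin.snoc I i : Fin (m + 1) → _) := rfl
    rw [e, epsW_snoc, mul_smul, smul_mul_assoc]
    congr 2
    exact (wmono_snoc t i k I J).symm
  have h2 : ∑ J, epsAvoid q j J • ∑ i : Fin (m + 1), (-(q : ℂ)⁻¹) ^ (m - i : ℕ) •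
      ((∑ I, epsAvoid q i I • wmono t I J) * t i k) =
      (if j = k then (-(q : ℂ)⁻¹) ^ (m - k : ℕ) * epsNorm m q else 0) • detW q t := by
    simp only [h1, smul_smul, ← Finset.sum_smul]
    congr 1
    rw [← mul_zero ((-(q : ℂ)⁻¹) ^ (m - k : ℕ)), ← mul_ite, ← sum_epsAvoid_mul, Finset.mul_sum]
    exact Finset.sum_congr rfl fun I _ => by ring
  have h3 : ∑ i, cofactor q t j i * t i k = ((-(q : ℂ)⁻¹) ^ (j : ℕ) * ((-(q : ℂ)⁻¹) ^ m)⁻¹ *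
      (epsNorm m q)⁻¹) • ∑ J, epsAvoid q j J • ∑ i : Fin (m + 1), (-(q : ℂ)⁻¹) ^ (m - i : ℕ) •
      ((∑ I, epsAvoid q i I • wmono t I J) * t i k) := by
    simp only [cofactor, Finset.smul_sum, Finset.sum_mul, smul_mul_assoc, smul_smul]
    rw [Finset.sum_comm]
    have : ∀ i : Fin (m + 1), ∀ I J : Fin m → Fin (m + 1),
        (-(q : ℂ)⁻¹) ^ (j : ℕ) * ((-(q : ℂ)⁻¹) ^ (i : ℕ))⁻¹ * (epsNorm m q)⁻¹ *
          (epsAvoid q i I * epsAvoid q j J) =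
        (-(q : ℂ)⁻¹) ^ (j : ℕ) * ((-(q : ℂ)⁻¹) ^ m)⁻¹ * (epsNorm m q)⁻¹ *
          (epsAvoid q j J * ((-(q : ℂ)⁻¹) ^ (m - i : ℕ) * epsAvoid q i I)) := by
      intro i I J
      rw [hpow]
      have hm := pow_ne_zero m hw
      generalize (-(q : ℂ)⁻¹) ^ m = x at *
      generalize ((-(q : ℂ)⁻¹) ^ (i : ℕ))⁻¹ = y
      generalize (epsNorm m q)⁻¹ = z
      field_simp
    simp only [this]
    rw [Finset.sum_comm]
    rw [Finset.sum_congr rfl fun i _ => Finset.sum_comm, Finset.sum_comm]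
  rw [h3, h2, smul_smul]
  split_ifs with h
  · subst h
    rw [hpow]
    have hm := pow_ne_zero m hw
    have hj := pow_ne_zero j.val hw
    rw [show (-(q : ℂ)⁻¹) ^ (j : ℕ) * ((-(q : ℂ)⁻¹) ^ m)⁻¹ * (epsNorm m q)⁻¹ *
      ((-(q : ℂ)⁻¹) ^ m * ((-(q : ℂ)⁻¹) ^ (j : ℕ))⁻¹ * epsNorm m q) = 1 by
        generalize (-(q : ℂ)⁻¹) ^ m = x at *
        generalize (-(q : ℂ)⁻¹) ^ (j : ℕ) = y at *
        field_simp, one_smul]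
  · simp

end Cofactor

/-! ### Matrices over a noncommutative algebra, in two tensor legs -/

/-- `s` is the two-sided inverse of the matrix `t`. -/
def MatInv {n : ℕ} {A : Type*} [Ring A] (t s : Fin n → Fin n → A) : Prop :=
  Matrix.of t * Matrix.of s = 1 ∧ Matrix.of s * Matrix.of t = 1

section MatInv

variable {n : ℕ} {A : Type*} [Ring A] {t s s' : Fin n → Fin n → A}

theorem MatInv.mul_eq (h : MatInv t s) (i k : Fin n) :
    ∑ j, t i j * s j k = if i = k then 1 else 0 := by
  have := congrFun (congrFun h.1 i) k
  rwa [Matrix.mul_apply, Matrix.one_apply] at this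

theorem MatInv.eq_mul (h : MatInv t s) (i k : Fin n) :
    ∑ j, s i j * t j k = if i = k then 1 else 0 := by
  have := congrFun (congrFun h.2 i) k
  rwa [Matrix.mul_apply, Matrix.one_apply] at this

theorem MatInv.symm (h : MatInv t s) : MatInv s t := ⟨h.2, h.1⟩

theorem MatInv.of_sums (h1 : ∀ i k, ∑ j, t i j * s j k = if i = k then 1 else 0)
    (h2 : ∀ i k, ∑ j, s i j * t j k = if i = k then 1 else 0) : MatInv t s :=
  ⟨by ext i k; simp [Matrix.mul_apply, Matrix.one_apply, h1],
    by ext i k; simp [Matrix.mul_apply, Matrix.one_apply, h2]⟩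

theorem MatInv.eq_of_left (h : MatInv t s)
    (h' : ∀ i k, ∑ j, s' i j * t j k = if i = k then 1 else 0) : s' = s :=
  Matrix.of.injective (left_inv_eq_right_inv
    (by ext i k; simp [Matrix.mul_apply, Matrix.one_apply, h']) h.1)

theorem MatInv.eq_of_right (h : MatInv t s)
    (h' : ∀ i k, ∑ j, t i j * s' j k = if i = k then 1 else 0) : s' = s :=
  Matrix.of.injective (left_inv_eq_right_inv h.2
    (by ext i k; simp [Matrix.mul_apply, Matrix.one_apply, h'])).symm

theorem MatInv.map {A' F : Type*} [Ring A'] [FunLike F A A'] [RingHomClass F A A'] (h : MatInv t s)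
    (f : F) : MatInv (fun i j => f (t i j)) (fun i j => f (s i j)) := by
  refine MatInv.of_sums (fun i k => ?_) fun i k => ?_
  · rw [← map_one f, ← map_zero f, ← apply_ite f, ← h.mul_eq, map_sum]
    simp only [map_mul]
  · rw [← map_one f, ← map_zero f, ← apply_ite f, ← h.eq_mul, map_sum]
    simp only [map_mul]

/-- The matrix acting in the first tensor leg. -/
def legFst (X : Fin n → Fin n → A) : Matrix (Fin n × Fin n) (Fin n × Fin n) A :=
  Matrix.of fun x y => if x.2 = y.2 then X x.1 y.1 else 0

/-- The matrix acting in the second tensor leg. -/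
def legSnd (X : Fin n → Fin n → A) : Matrix (Fin n × Fin n) (Fin n × Fin n) A :=
  Matrix.of fun x y => if x.1 = y.1 then X x.2 y.2 else 0

theorem legFst_mul_apply (X : Fin n → Fin n → A) (M : Matrix (Fin n × Fin n) (Fin n × Fin n) A)
    (i j : Fin n) (y : Fin n × Fin n) : (legFst X * M) (i, j) y = ∑ k, X i k * M (k, j) y := by
  rw [Matrix.mul_apply, Fintype.sum_prod_type]
  exact Finset.sum_congr rfl fun k _ => by simp [legFst]

theorem legSnd_mul_apply (X : Fin n → Fin n → A) (M : Matrix (Fin n × Fin n) (Fin n × Fin n) A)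
    (i j : Fin n) (y : Fin n × Fin n) : (legSnd X * M) (i, j) y = ∑ k, X j k * M (i, k) y := by
  rw [Matrix.mul_apply, Fintype.sum_prod_type, Finset.sum_comm]
  exact Finset.sum_congr rfl fun k _ => by simp [legSnd]

theorem legFst_mul_legSnd (X Y : Fin n → Fin n → A) (i j a b : Fin n) :
    (legFst X * legSnd Y) (i, j) (a, b) = X i a * Y j b := by
  rw [legFst_mul_apply]
  simp [legSnd]

theorem legSnd_mul_legFst (X Y : Fin n → Fin n → A) (i j a b : Fin n) :
    (legSnd Y * legFst X) (i, j) (a, b) = Y j b * X i a := by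
  rw [legSnd_mul_apply]
  simp [legFst]

theorem MatInv.legFst_mul (h : MatInv t s) : legFst t * legFst s = 1 := by
  ext ⟨i, j⟩ ⟨a, b⟩
  rw [legFst_mul_apply, Matrix.one_apply]
  by_cases hjb : j = b
  · simp [legFst, hjb, h.mul_eq]
  · simp [legFst, hjb]

theorem MatInv.legSnd_mul (h : MatInv t s) : legSnd t * legSnd s = 1 := by
  ext ⟨i, j⟩ ⟨a, b⟩
  rw [legSnd_mul_apply, Matrix.one_apply]
  by_cases hia : i = a
  · simp [legSnd, hia, h.mul_eq]
  · simp [legSnd, hia]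

theorem legFst_matMul (X Y : Fin n → Fin n → A) :
    legFst (fun i k => ∑ j, X i j * Y j k) = legFst X * legFst Y := by
  ext ⟨i, j⟩ ⟨a, b⟩
  rw [legFst_mul_apply]
  by_cases hjb : j = b <;> simp [legFst, hjb]

theorem legSnd_matMul (X Y : Fin n → Fin n → A) :
    legSnd (fun i k => ∑ j, X i j * Y j k) = legSnd X * legSnd Y := by
  ext ⟨i, j⟩ ⟨a, b⟩
  rw [legSnd_mul_apply]
  by_cases hia : i = a <;> simp [legSnd, hia]

theorem wmono_matMul {X Y : Fin n → Fin n → A} (hc : ∀ i j k l, Commute (X i j) (Y k l)) {N : ℕ}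
    (I J : Fin N → Fin n) : wmono (fun i k => ∑ j, X i j * Y j k) I J =
      ∑ K : Fin N → Fin n, wmono X I K * wmono Y K J := by
  induction N with
  | zero => simp [wmono_zero]
  | succ N ih =>
    rw [wmono_succ, ih, ← (Fin.consEquiv fun _ => Fin n).sum_comp, Fintype.sum_prod_type,
      Finset.sum_mul]
    refine Finset.sum_congr rfl fun k _ => ?_
    rw [Finset.mul_sum]
    refine Finset.sum_congr rfl fun K _ => ?_
    have e : (Fin.consEquiv fun _ => Fin n) (k, K) = (Fin.cons k K : Fin (N + 1) → Fin n) := rfl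
    have hcomm : Commute (Y k (J 0)) (wmono X (fun k => I k.succ) K) := by
      refine Commute.list_prod_right _ _ fun x hx => ?_
      obtain ⟨l, rfl⟩ := (List.mem_ofFn' _ _).1 hx
      exact (hc _ _ _ _).symm
    rw [e, wmono_succ X I, wmono_succ Y]
    simp only [Fin.cons_zero, Fin.cons_succ]
    rw [mul_assoc, ← mul_assoc (Y k (J 0)), hcomm.eq]
    simp only [mul_assoc]

/-- Passing through the opposite algebra reverses the second product, so the factors cancel from the
inside outwards: the sum over the tails is a scalar and the first letters then meet. -/
theorem wmono_mul_inv (h : MatInv t s) {N : ℕ} (I J : Fin N → Fin n) :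
    ∑ K : Fin N → Fin n, wmono t I K *
      (wmono (fun i j => MulOpposite.op (s i j)) K J).unop = if I = J then 1 else 0 := by
  induction N with
  | zero => simp [wmono_zero, Subsingleton.elim I J]
  | succ N ih =>
    rw [← (Fin.consEquiv fun _ => Fin n).sum_comp, Fintype.sum_prod_type]
    have e : ∀ k K, (Fin.consEquiv fun _ => Fin n) (k, K) = (Fin.cons k K : Fin (N + 1) → Fin n) :=
      fun k K => rfl
    have h1 : ∀ k : Fin n, ∑ K : Fin N → Fin n, wmono t I (Fin.cons k K : Fin (N + 1) → Fin n) *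
        (wmono (fun i j => MulOpposite.op (s i j)) (Fin.cons k K : Fin (N + 1) → Fin n) J).unop =
        t (I 0) k * (if (fun k : Fin N => I k.succ) = (fun k => J k.succ) then 1 else 0) * s k (J 0) := by
      intro k
      rw [← ih, Finset.mul_sum, Finset.sum_mul]
      refine Finset.sum_congr rfl fun K _ => ?_
      rw [wmono_succ t, wmono_succ]
      simp [mul_assoc]
    simp only [e, h1]
    have h2 : I = J ↔ I 0 = J 0 ∧ (fun k : Fin N => I k.succ) = (fun k => J k.succ) := by
      rw [funext_iff, Fin.forall_fin_succ, funext_iff]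
    by_cases h3 : (fun k : Fin N => I k.succ) = (fun k => J k.succ)
    · simp [h2, h3, h.mul_eq]
    · simp [h2, h3]

variable [Algebra ℂ A]

/-- The unnormalised R-matrix with entries in an algebra. -/
def rMat (n : ℕ) (A : Type*) [Ring A] [Algebra ℂ A] (q : ℝ) :
    Matrix (Fin n × Fin n) (Fin n × Fin n) A :=
  Matrix.of fun x y => algebraMap ℂ A ((if y = x then diagC q x.1 x.2 else 0) +
    if y = (x.2, x.1) then offC q x.1 x.2 else 0)

theorem rMat_mul_apply (q : ℝ) (M : Matrix (Fin n × Fin n) (Fin n × Fin n) A) (i j : Fin n)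
    (y : Fin n × Fin n) : (rMat n A q * M) (i, j) y =
      diagC q i j • M (i, j) y + offC q i j • M (j, i) y := by
  simp [rMat, Matrix.mul_apply, Algebra.smul_def, add_mul, Finset.sum_add_distrib,
    apply_ite (algebraMap ℂ A), ite_mul]

theorem mul_rMat_apply (q : ℝ) (M : Matrix (Fin n × Fin n) (Fin n × Fin n) A) (a b : Fin n)
    (x : Fin n × Fin n) : (M * rMat n A q) x (a, b) =
      diagC q a b • M x (a, b) + offC q b a • M x (b, a) := by
  have e : ∀ k : Fin n × Fin n, (a, b) = (k.2, k.1) ↔ (b, a) = k := fun k => by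
    rw [Prod.ext_iff, Prod.ext_iff]; exact and_comm
  simp [rMat, Matrix.mul_apply, Algebra.smul_def, mul_add, Algebra.commutes,
    Finset.sum_add_distrib, apply_ite (algebraMap ℂ A), mul_ite, e]

/-- In the form `R t₁ t₂ = t₂ t₁ R` the relations can be multiplied by an inverse in one leg at a
time. -/
theorem frt_iff (q : ℝ) : Frt q t ↔ rMat n A q * (legFst t * legSnd t) =
    legSnd t * legFst t * rMat n A q := by
  constructor
  · intro h
    ext ⟨i, j⟩ ⟨a, b⟩
    rw [rMat_mul_apply, mul_rMat_apply]
    simp only [legFst_mul_legSnd, legSnd_mul_legFst]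
    exact h i j a b
  · intro h i j a b
    have := congrFun (congrFun h (i, j)) (a, b)
    rw [rMat_mul_apply, mul_rMat_apply] at this
    simpa only [legFst_mul_legSnd, legSnd_mul_legFst] using this

/-- The entries of the inverse matrix satisfy the relations in the opposite algebra. -/
theorem Frt.op_inv {q : ℝ} (ht : Frt q t) (h : MatInv t s) :
    Frt q fun i j => MulOpposite.op (s i j) := by
  have h1 := (frt_iff q).1 ht
  -- The relation `R t₁ t₂ = t₂ t₁ R` is multiplied by `s₁ s₂` on the left and by `s₂ s₁` on the
  -- right.
  have h2 : legFst s * legSnd s * rMat n A q = rMat n A q * (legSnd s * legFst s) := by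
    calc _ = legFst s * legSnd s * rMat n A q *
          ((legFst t * (legSnd t * legSnd s)) * legFst s) := by
            rw [h.legSnd_mul, mul_one, h.legFst_mul, mul_one]
      _ = legFst s * legSnd s * (rMat n A q * (legFst t * legSnd t)) * (legSnd s * legFst s) := by
            simp only [mul_assoc]
      _ = legFst s * (legSnd s * legSnd t) * legFst t * rMat n A q * (legSnd s * legFst s) := by
            rw [h1]; simp only [mul_assoc]
      _ = _ := by rw [h.symm.legSnd_mul, mul_one, h.symm.legFst_mul, one_mul]
  intro i j a b
  have := congrFun (congrFun h2 (i, j)) (a, b)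
  rw [rMat_mul_apply, mul_rMat_apply] at this
  simp only [legFst_mul_legSnd, legSnd_mul_legFst] at this
  simp only [← MulOpposite.op_mul, ← MulOpposite.op_smul, ← MulOpposite.op_add]
  exact congrArg MulOpposite.op this.symm

/-- The exchange relations between a matrix and its inverse. -/
theorem Frt.exchange {q : ℝ} (ht : Frt q t) (h : MatInv t s) (i j a b : Fin n) :
    diagC q i b • (s j b * t i a) +
        (if i = b then ∑ l, offC q i l • (s j l * t l a) else 0) =
      diagC q a j • (t i a * s j b) +
        if j = a then ∑ k, offC q k j • (t i k * s k b) else 0 := by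
  have h1 := (frt_iff q).1 ht
  -- Here only the second leg is inverted: multiplication by `s₂` on both sides gives `s₂ R t₁ = t₁
  -- R s₂`.
  have h2 : legSnd s * (rMat n A q * legFst t) = legFst t * (rMat n A q * legSnd s) := by
    calc _ = legSnd s * (rMat n A q * legFst t) * (legSnd t * legSnd s) := by
            rw [h.legSnd_mul, mul_one]
      _ = legSnd s * (rMat n A q * (legFst t * legSnd t)) * legSnd s := by simp only [mul_assoc]
      _ = legSnd s * legSnd t * legFst t * rMat n A q * legSnd s := by
            rw [h1]; simp only [mul_assoc]
      _ = _ := by rw [h.symm.legSnd_mul, one_mul]; simp only [mul_assoc]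
  have := congrFun (congrFun h2 (i, j)) (a, b)
  rw [legSnd_mul_apply, legFst_mul_apply] at this
  simp only [rMat_mul_apply, mul_add, Finset.sum_add_distrib] at this
  convert this using 2
  · simp [legFst]
  · simp only [legFst, Matrix.of_apply]
    split_ifs <;> simp
  · simp [legSnd]
  · simp only [legSnd, Matrix.of_apply]
    split_ifs <;> simp

/-- The relations pass to products of matrices with commuting entries. -/
theorem Frt.matMul {q : ℝ} {X Y : Fin n → Fin n → A} (hX : Frt q X) (hY : Frt q Y)
    (hc : ∀ i j k l, Commute (X i j) (Y k l)) : Frt q fun i k => ∑ j, X i j * Y j k := by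
  rw [frt_iff, legFst_matMul, legSnd_matMul]
  have h1 : legFst Y * legSnd X = legSnd X * legFst Y := by
    ext ⟨i, j⟩ ⟨a, b⟩
    rw [legFst_mul_legSnd, legSnd_mul_legFst, hc]
  have h2 : legFst X * legSnd Y = legSnd Y * legFst X := by
    ext ⟨i, j⟩ ⟨a, b⟩
    rw [legFst_mul_legSnd, legSnd_mul_legFst, hc]
  have hX := (frt_iff q).1 hX
  have hY := (frt_iff q).1 hY
  calc _ = rMat n A q * (legFst X * (legFst Y * legSnd X) * legSnd Y) := by simp only [mul_assoc]
    _ = (rMat n A q * (legFst X * legSnd X)) * (legFst Y * legSnd Y) := by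
      rw [h1]; simp only [mul_assoc]
    _ = legSnd X * legFst X * (rMat n A q * (legFst Y * legSnd Y)) := by
      rw [hX]; simp only [mul_assoc]
    _ = legSnd X * (legFst X * legSnd Y) * legFst Y * rMat n A q := by
      rw [hY]; simp only [mul_assoc]
    _ = _ := by rw [h2]; simp only [mul_assoc]

end MatInv

theorem commute_inv_of_commute {A : Type*} [Ring A] {d e a : A} (h1 : d * e = 1) (h2 : e * d = 1) (h : Commute d a) :
    Commute e a := by
  have := congrArg (fun x => e * x * e) h.eq
  simp only [← mul_assoc, h2, one_mul] at this
  simp only [mul_assoc, h1, mul_one] at this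
  exact this.symm

/-! ### Determinants of inverses and products, and the inverse matrix -/

section Det

variable {n : ℕ} {A : Type} [Ring A] [Algebra ℂ A] {q : ℝ} {t s : Fin n → Fin n → A}

/-- The telescoping identity `wmono_mul_inv` is contracted with `epsW`. The sum over row words
produces the determinant of `t`, and the sum left over the intermediate words is the determinant of
`s` in the opposite algebra. -/
theorem Frt.detW_mul_op_inv (hq : 0 < q) (ht : Frt q t) (h : MatInv t s) :
    detW q t * (detW q fun i j => MulOpposite.op (s i j)).unop = 1 := by
  have hs := (ht.op_inv h)
  have h1 : ∑ I : Fin n → Fin n, ∑ K : Fin n → Fin n, epsW q I • (wmono t I K *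
      (wmono (fun i j => MulOpposite.op (s i j)) K id).unop) = 1 := by
    simp only [← Finset.smul_sum, wmono_mul_inv h]
    simp [epsW_id]
  rw [Finset.sum_comm] at h1
  simp only [← smul_mul_assoc, ← Finset.sum_mul] at h1
  simp only [ht.sum_eps_left hq] at h1
  rw [← h1, ← one_smul ℂ (detW q fun i j => MulOpposite.op (s i j)), ← epsW_id (n := n) (q := q),
    ← hs.sum_eps_left hq]
  simp only [Finset.unop_sum, MulOpposite.unop_smul, Finset.mul_sum]
  exact Finset.sum_congr rfl fun K _ => by rw [mul_smul_comm, smul_mul_assoc]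

theorem Frt.detW_matMul (hq : 0 < q) {X Y : Fin n → Fin n → A} (hX : Frt q X) (hY : Frt q Y)
    (hc : ∀ i j k l, Commute (X i j) (Y k l)) :
    detW q (fun i k => ∑ j, X i j * Y j k) = detW q X * detW q Y := by
  have hXY := hX.matMul hY hc
  have h1 := hXY.sum_eps_left hq id
  rw [epsW_id, one_smul] at h1
  rw [← h1]
  simp only [wmono_matMul hc, Finset.smul_sum]
  rw [Finset.sum_comm]
  simp only [← smul_mul_assoc, ← Finset.sum_mul]
  simp only [hX.sum_eps_left hq, smul_mul_assoc, ← mul_smul_comm, ← Finset.mul_sum]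
  rw [hY.sum_eps_left hq, epsW_id, one_smul]

/-- Both products equal an entry of `t · cofactor · t`, associated in the two possible ways. -/
theorem Frt.commute_detW (hq : 0 < q) (ht : Frt q t) (i j : Fin n) :
    Commute (detW q t) (t i j) := by
  cases n with
  | zero => exact i.elim0
  | succ m =>
    have h1 : detW q t * t i j = ∑ l, (∑ k, t i k * cofactor q t k l) * t l j := by
      simp [ht.mul_cofactor hq]
    have h2 : t i j * detW q t = ∑ k, t i k * ∑ l, cofactor q t k l * t l j := by
      simp [ht.cofactor_mul hq]
    rw [Commute, SemiconjBy, h1, h2]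
    simp only [Finset.sum_mul, Finset.mul_sum, mul_assoc]
    exact Finset.sum_comm

/-- The two expansions give a right inverse `cofactor · d` and a left inverse `d · cofactor`, which
must coincide. -/
theorem Frt.matInv_cofactor {m : ℕ} {t : Fin (m + 1) → Fin (m + 1) → A} {d : A} (hq : 0 < q)
    (ht : Frt q t) (h1 : detW q t * d = 1) (h2 : d * detW q t = 1) :
    MatInv t fun i j => cofactor q t i j * d := by
  have hc := fun i j => commute_inv_of_commute h1 h2 (ht.commute_detW hq i j)
  have hr : ∀ i k, ∑ j, t i j * (cofactor q t j k * d) = if i = k then 1 else 0 := fun i k => by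
    simp only [← mul_assoc, ← Finset.sum_mul, ht.mul_cofactor hq]
    split_ifs <;> simp [h1]
  have hl : ∀ i k, ∑ j, (d * cofactor q t i j) * t j k = if i = k then 1 else 0 := fun i k => by
    simp only [mul_assoc, ← Finset.mul_sum, ht.cofactor_mul hq]
    split_ifs <;> simp [h2]
  have e : (Matrix.of fun i j => d * cofactor q t i j) = Matrix.of fun i j => cofactor q t i j * d :=
    left_inv_eq_right_inv (a := Matrix.of t)
      (by ext i k; simp [Matrix.mul_apply, Matrix.one_apply, hl])
      (by ext i k; simp [Matrix.mul_apply, Matrix.one_apply, hr])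
  refine MatInv.of_sums hr fun i k => ?_
  rw [← hl]
  exact Finset.sum_congr rfl fun j _ => by
    rw [show cofactor q t i j * d = d * cofactor q t i j from (congrFun (congrFun e i) j).symm]

theorem Frt.exists_matInv {d : A} (hq : 0 < q) (ht : Frt q t) (h1 : detW q t * d = 1)
    (h2 : d * detW q t = 1) : ∃ s, MatInv t s := by
  cases n with
  | zero => exact ⟨t, Matrix.ext fun i => i.elim0, Matrix.ext fun i => i.elim0⟩
  | succ m => exact ⟨_, ht.matInv_cofactor hq h1 h2⟩

end Det

/-! ### Algebras presented by the relations of `A(R)` and an inverse of the determinant -/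

/-- `A` is the universal algebra generated by a matrix `t` with the relations of `A(R)` and an
inverse `d` of its quantum determinant, where moreover `d = 1` if `su` holds. -/
structure IsQGen (n : ℕ) (q : ℝ) (su : Prop) (A : Type) [Ring A] [Algebra ℂ A]
    (t : Fin n → Fin n → A) (d : A) : Prop where
  frt : Frt q t
  det_mul : detW q t * d = 1
  mul_det : d * detW q t = 1
  inv_eq_one : su → d = 1
  adjoin : Algebra.adjoin ℂ (Set.range (fun p : Fin n × Fin n => t p.1 p.2) ∪ {d}) = ⊤
  lift : ∀ {C : Type} [Ring C] [Algebra ℂ C] (u : Fin n → Fin n → C) (e : C), Frt q u →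
    detW q u * e = 1 → e * detW q u = 1 → (su → e = 1) →
      ∃ f : A →ₐ[ℂ] C, (∀ i j, f (t i j) = u i j) ∧ f d = e

/-- The opposite algebra, on which scalars act through complex conjugation. -/
def ConjOp (A : Type) : Type := Aᵐᵒᵖ

instance (A : Type) [Ring A] : Ring (ConjOp A) := inferInstanceAs (Ring Aᵐᵒᵖ)

instance (A : Type) [Ring A] [Algebra ℂ A] : Algebra ℂ (ConjOp A) :=
  ((algebraMap ℂ Aᵐᵒᵖ).comp (starRingEnd ℂ)).toAlgebra' fun c x =>
    Algebra.commutes (A := Aᵐᵒᵖ) ((starRingEnd ℂ) c) x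

/-- The identity map from the opposite algebra to its conjugate. -/
def toConjOp {A : Type} [Ring A] : Aᵐᵒᵖ ≃+* ConjOp A := RingEquiv.refl _

theorem smul_toConjOp {A : Type} [Ring A] [Algebra ℂ A] (c : ℂ) (x : Aᵐᵒᵖ) :
    c • toConjOp x = toConjOp ((starRingEnd ℂ) c • x) := by
  rw [Algebra.smul_def, Algebra.smul_def]
  rfl

theorem conj_diagC {α : Type*} [DecidableEq α] (q : ℝ) (i j : α) :
    (starRingEnd ℂ) (diagC q i j) = diagC q i j := by
  rw [diagC]; split_ifs <;> simp

theorem conj_offC {α : Type*} [LinearOrder α] (q : ℝ) (i j : α) :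
    (starRingEnd ℂ) (offC q i j) = offC q i j := by
  rw [offC]; split_ifs <;> simp

theorem conj_epsW {α : Type*} [LinearOrder α] {N : ℕ} (q : ℝ) (I : Fin N → α) :
    (starRingEnd ℂ) (epsW q I) = epsW q I := by
  rw [epsW]; split_ifs <;> simp

theorem Frt.conj {ι κ : Type*} [LinearOrder ι] [LinearOrder κ] {A : Type} [Ring A] [Algebra ℂ A]
    {q : ℝ} {t : ι → κ → Aᵐᵒᵖ} (ht : Frt q t) : Frt q fun i j => toConjOp (t i j) := by
  intro i j a b
  simp only [← map_mul, smul_toConjOp, conj_diagC, conj_offC, ← map_add]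
  exact congrArg toConjOp (ht i j a b)

theorem detW_conj {n : ℕ} {A : Type} [Ring A] [Algebra ℂ A] (q : ℝ) (t : Fin n → Fin n → Aᵐᵒᵖ) :
    detW q (fun i j => toConjOp (t i j)) = toConjOp (detW q t) := by
  simp only [detW, ← map_wmono, smul_toConjOp, conj_epsW, ← map_sum]

theorem map_detW {n : ℕ} (q : ℝ) {A A' : Type*} [Ring A] [Algebra ℂ A] [Ring A'] [Algebra ℂ A']
    (f : A →ₐ[ℂ] A') (t : Fin n → Fin n → A) :
    f (detW q t) = detW q fun i j => f (t i j) := by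
  simp only [detW, map_smul, map_sum, map_wmono]

theorem frt_one (n : ℕ) (q : ℝ) : Frt q fun i j : Fin n => if i = j then (1 : ℂ) else 0 := by
  intro i j a b
  simp only [diagC, offC, smul_eq_mul, mul_ite, mul_one, mul_zero]
  grind

theorem wmono_one {n N : ℕ} (I J : Fin N → Fin n) :
    wmono (fun i j : Fin n => if i = j then (1 : ℂ) else 0) I J = if I = J then 1 else 0 := by
  rw [wmono, List.prod_ofFn]
  split_ifs with h
  · simp [h]
  · obtain ⟨k, hk⟩ := Function.ne_iff.1 h
    exact Finset.prod_eq_zero (Finset.mem_univ k) (if_neg hk)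

theorem detW_one (n : ℕ) (q : ℝ) : detW q (fun i j : Fin n => if i = j then (1 : ℂ) else 0) = 1 := by
  simp [detW, wmono_one, epsW_id]

theorem star_tmul_mul {A : Type} [Ring A] [Algebra ℂ A] [StarRing A] [StarModule ℂ A]
    (x y : A ⊗[ℂ] A) : star (x * y) = star y * star x := by
  induction x using TensorProduct.induction_on with
  | zero => simp
  | add x x' hx hx' => rw [add_mul, star_add, hx, hx', star_add, mul_add]
  | tmul a b =>
    induction y using TensorProduct.induction_on with
    | zero => simp
    | add y y' hy hy' => rw [mul_add, star_add, hy, hy', star_add, add_mul]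
    | tmul c d => simp

theorem inv_unique_of_mul {A : Type*} [Monoid A] {x a b : A} (h1 : a * x = 1) (h2 : x * b = 1) :
    a = b := left_inv_eq_right_inv h1 h2

namespace IsQGen

variable {n : ℕ} {q : ℝ} {su : Prop} {A : Type} [Ring A] [Algebra ℂ A]
  {t : Fin n → Fin n → A} {d : A}

theorem induction (h : IsQGen n q su A t d) {P : A → Prop} (algebraMap : ∀ c, P (algebraMap ℂ A c))
    (add : ∀ a b, P a → P b → P (a + b)) (mul : ∀ a b, P a → P b → P (a * b))
    (gen : ∀ i j, P (t i j)) (inv : P d) (a : A) : P a := by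
  have ha : a ∈ Algebra.adjoin ℂ (Set.range (fun p : Fin n × Fin n => t p.1 p.2) ∪ {d}) := by
    rw [h.adjoin]; trivial
  induction ha using Algebra.adjoin_induction with
  | mem x hx =>
    rcases hx with ⟨p, rfl⟩ | rfl
    · exact gen _ _
    · exact inv
  | algebraMap c => exact algebraMap c
  | add x y _ _ hx hy => exact add x y hx hy
  | mul x y _ _ hx hy => exact mul x y hx hy

/-- Agreement on `d` is automatic, `d` being the two-sided inverse of a polynomial in the matrix
entries. -/
theorem hom_ext (h : IsQGen n q su A t d) {C : Type*} [Ring C] [Algebra ℂ C] {f g : A →ₐ[ℂ] C}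
    (hfg : ∀ i j, f (t i j) = g (t i j)) : f = g := by
  have hd : f d = g d := by
    refine inv_unique_of_mul (x := f (detW q t)) ?_ ?_
    · rw [← map_mul, h.mul_det, map_one]
    · rw [map_detW]
      simp only [hfg]
      rw [← map_detW, ← map_mul, h.det_mul, map_one]
  refine AlgHom.ext_of_adjoin_eq_top h.adjoin ?_
  rintro _ (⟨p, rfl⟩ | rfl)
  · exact hfg _ _
  · exact hd

/-- The inverse matrix of the generators. -/
def s (hq : 0 < q) (h : IsQGen n q su A t d) : Fin n → Fin n → A :=
  (h.frt.exists_matInv hq h.det_mul h.mul_det).choose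

theorem matInv (hq : 0 < q) (h : IsQGen n q su A t d) : MatInv t (h.s hq) :=
  (h.frt.exists_matInv hq h.det_mul h.mul_det).choose_spec

/-- An algebra map out of `A` given by its values on generators. -/
def liftHom (h : IsQGen n q su A t d) {C : Type} [Ring C] [Algebra ℂ C] (u : Fin n → Fin n → C)
    (e : C) (hu : Frt q u) (h1 : detW q u * e = 1) (h2 : e * detW q u = 1) (hs : su → e = 1) :
    A →ₐ[ℂ] C := (h.lift u e hu h1 h2 hs).choose

section liftHom

variable (h : IsQGen n q su A t d) {C : Type} [Ring C] [Algebra ℂ C] (u : Fin n → Fin n → C)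
    (e : C) (hu : Frt q u) (h1 : detW q u * e = 1) (h2 : e * detW q u = 1) (hs : su → e = 1)

theorem liftHom_t (i j : Fin n) : h.liftHom u e hu h1 h2 hs (t i j) = u i j :=
  (h.lift u e hu h1 h2 hs).choose_spec.1 i j

theorem liftHom_d : h.liftHom u e hu h1 h2 hs d = e :=
  (h.lift u e hu h1 h2 hs).choose_spec.2

end liftHom

theorem det_eq_one (h : IsQGen n q su A t d) (hs : su) : detW q t = 1 := by
  have := h.det_mul
  rwa [h.inv_eq_one hs, mul_one] at this

theorem commute_tmul (i j k l : Fin n) :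
    Commute ((Algebra.TensorProduct.includeLeft : A →ₐ[ℂ] A ⊗[ℂ] A) (t i j))
      ((Algebra.TensorProduct.includeRight : A →ₐ[ℂ] A ⊗[ℂ] A) (t k l)) := by
  simp [Commute, SemiconjBy]

theorem frt_comul (h : IsQGen n q su A t d) : Frt q fun i j => ∑ k, t i k ⊗ₜ[ℂ] t k j := by
  have := (h.frt.map (Algebra.TensorProduct.includeLeft : A →ₐ[ℂ] A ⊗[ℂ] A)).matMul
    (h.frt.map (Algebra.TensorProduct.includeRight : A →ₐ[ℂ] A ⊗[ℂ] A)) commute_tmul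
  simpa using this

theorem det_comul (hq : 0 < q) (h : IsQGen n q su A t d) :
    detW q (fun i j => ∑ k, t i k ⊗ₜ[ℂ] t k j) = detW q t ⊗ₜ[ℂ] detW q t := by
  have := Frt.detW_matMul hq (h.frt.map (Algebra.TensorProduct.includeLeft : A →ₐ[ℂ] A ⊗[ℂ] A))
    (h.frt.map (Algebra.TensorProduct.includeRight : A →ₐ[ℂ] A ⊗[ℂ] A)) commute_tmul
  rw [← map_detW, ← map_detW] at this
  simpa using this

/-- The coproduct. -/
def comul (hq : 0 < q) (h : IsQGen n q su A t d) : A →ₐ[ℂ] A ⊗[ℂ] A :=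
  h.liftHom (fun i j => ∑ k, t i k ⊗ₜ[ℂ] t k j) (d ⊗ₜ[ℂ] d) h.frt_comul
    (by simp [h.det_comul hq, h.det_mul, Algebra.TensorProduct.one_def])
    (by simp [h.det_comul hq, h.mul_det, Algebra.TensorProduct.one_def])
    (fun hs => by rw [h.inv_eq_one hs, Algebra.TensorProduct.one_def])

theorem comul_t (hq : 0 < q) (h : IsQGen n q su A t d) (i j : Fin n) :
    h.comul hq (t i j) = ∑ k, t i k ⊗ₜ[ℂ] t k j := h.liftHom_t _ _ _ _ _ _ i j

theorem comul_d (hq : 0 < q) (h : IsQGen n q su A t d) : h.comul hq d = d ⊗ₜ[ℂ] d :=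
  h.liftHom_d _ _ _ _ _ _

/-- The counit. -/
def counit (h : IsQGen n q su A t d) : A →ₐ[ℂ] ℂ :=
  h.liftHom (fun i j => if i = j then 1 else 0) 1 (frt_one n q)
    (by rw [detW_one, one_mul]) (by rw [detW_one, one_mul]) fun _ => rfl

theorem counit_t (h : IsQGen n q su A t d) (i j : Fin n) :
    h.counit (t i j) = if i = j then 1 else 0 := h.liftHom_t _ _ _ _ _ _ i j

theorem counit_d (h : IsQGen n q su A t d) : h.counit d = 1 := h.liftHom_d _ _ _ _ _ _

/-- The determinant of the inverse matrix is an inverse of `detW q t`, hence equals `d`. This is the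
determinant condition for defining the antipode and the `*`-operation by the universal property. -/
theorem det_op_s (hq : 0 < q) (h : IsQGen n q su A t d) :
    detW q (fun i j => MulOpposite.op (h.s hq i j)) = MulOpposite.op d :=
  MulOpposite.unop_injective (inv_unique_of_mul h.mul_det
    (h.frt.detW_mul_op_inv hq (h.matInv hq))).symm

/-- The antipode, as an algebra map to the opposite algebra. -/
def antipodeHom (hq : 0 < q) (h : IsQGen n q su A t d) : A →ₐ[ℂ] Aᵐᵒᵖ :=
  h.liftHom (fun i j => MulOpposite.op (h.s hq i j)) (MulOpposite.op (detW q t))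
    (h.frt.op_inv (h.matInv hq))
    (by rw [h.det_op_s, ← MulOpposite.op_mul, h.det_mul, MulOpposite.op_one])
    (by rw [h.det_op_s, ← MulOpposite.op_mul, h.mul_det, MulOpposite.op_one])
    (fun hs => by rw [h.det_eq_one hs, MulOpposite.op_one])

/-- The antipode. -/
def antipode (hq : 0 < q) (h : IsQGen n q su A t d) : A →ₗ[ℂ] A :=
  (MulOpposite.opLinearEquiv ℂ).symm.toLinearMap ∘ₗ (h.antipodeHom hq).toLinearMap

theorem antipode_apply (hq : 0 < q) (h : IsQGen n q su A t d) (a : A) :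
    h.antipode hq a = (h.antipodeHom hq a).unop := rfl

theorem antipode_mul (hq : 0 < q) (h : IsQGen n q su A t d) (a b : A) :
    h.antipode hq (a * b) = h.antipode hq b * h.antipode hq a := by
  simp [antipode_apply]

theorem antipode_algebraMap (hq : 0 < q) (h : IsQGen n q su A t d) (c : ℂ) :
    h.antipode hq (algebraMap ℂ A c) = algebraMap ℂ A c := by
  rw [antipode_apply, AlgHom.commutes]
  rfl

theorem antipode_one (hq : 0 < q) (h : IsQGen n q su A t d) : h.antipode hq 1 = 1 := by
  simpa using h.antipode_algebraMap hq 1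

theorem antipode_t (hq : 0 < q) (h : IsQGen n q su A t d) (i j : Fin n) :
    h.antipode hq (t i j) = h.s hq i j := by
  rw [antipode_apply, antipodeHom, liftHom_t, MulOpposite.unop_op]

theorem antipode_d (hq : 0 < q) (h : IsQGen n q su A t d) :
    h.antipode hq d = detW q t := by
  rw [antipode_apply, antipodeHom, liftHom_d, MulOpposite.unop_op]

/-- The `*`-operation, as an algebra map to the conjugate opposite algebra. -/
def starHom (hq : 0 < q) (h : IsQGen n q su A t d) : A →ₐ[ℂ] ConjOp A :=
  h.liftHom (fun i j => toConjOp (MulOpposite.op (h.s hq j i)))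
    (toConjOp (MulOpposite.op (detW q t)))
    (h.frt.op_inv (h.matInv hq)).transpose.conj
    (by rw [detW_conj, (h.frt.op_inv (h.matInv hq)).detW_transpose hq, h.det_op_s, ← map_mul,
      ← MulOpposite.op_mul, h.det_mul, MulOpposite.op_one, map_one])
    (by rw [detW_conj, (h.frt.op_inv (h.matInv hq)).detW_transpose hq, h.det_op_s, ← map_mul,
      ← MulOpposite.op_mul, h.mul_det, MulOpposite.op_one, map_one])
    (fun hs => by rw [h.det_eq_one hs, MulOpposite.op_one, map_one])

/-- The `*`-operation. -/
def starFun (hq : 0 < q) (h : IsQGen n q su A t d) (a : A) : A :=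
  (toConjOp.symm (h.starHom hq a)).unop

theorem starFun_t (hq : 0 < q) (h : IsQGen n q su A t d) (i j : Fin n) :
    h.starFun hq (t i j) = h.s hq j i := by
  rw [starFun, starHom, liftHom_t]; rfl

theorem starFun_d (hq : 0 < q) (h : IsQGen n q su A t d) :
    h.starFun hq d = detW q t := by
  rw [starFun, starHom, liftHom_d]; rfl

theorem starFun_mul (hq : 0 < q) (h : IsQGen n q su A t d) (a b : A) :
    h.starFun hq (a * b) = h.starFun hq b * h.starFun hq a := by
  simp [starFun]

theorem starFun_add (hq : 0 < q) (h : IsQGen n q su A t d) (a b : A) :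
    h.starFun hq (a + b) = h.starFun hq a + h.starFun hq b := by
  simp [starFun]

theorem starFun_algebraMap (hq : 0 < q) (h : IsQGen n q su A t d) (c : ℂ) :
    h.starFun hq (algebraMap ℂ A c) = algebraMap ℂ A (star c) := by
  rw [starFun, AlgHom.commutes]
  rfl

theorem starFun_smul (hq : 0 < q) (h : IsQGen n q su A t d) (c : ℂ) (a : A) :
    h.starFun hq (c • a) = star c • h.starFun hq a := by
  rw [Algebra.smul_def, starFun_mul, starFun_algebraMap, Algebra.smul_def, Algebra.commutes]

theorem starFun_sum (hq : 0 < q) (h : IsQGen n q su A t d) {ι : Type*} (S : Finset ι)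
    (f : ι → A) : h.starFun hq (∑ x ∈ S, f x) = ∑ x ∈ S, h.starFun hq (f x) :=
  map_sum (AddMonoidHom.mk' (h.starFun hq) (h.starFun_add hq)) f S

theorem starFun_one (hq : 0 < q) (h : IsQGen n q su A t d) : h.starFun hq 1 = 1 := by
  have := h.starFun_algebraMap hq 1
  simpa using this

/-- Applying `*` to `t s = 1` exhibits the transposed adjoint of `s` as a left inverse of `s`, which
can only be `t`. -/
theorem starFun_s (hq : 0 < q) (h : IsQGen n q su A t d) (i j : Fin n) :
    h.starFun hq (h.s hq i j) = t j i := by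
  have key : (fun i j => h.starFun hq (h.s hq j i)) = t := by
    refine (h.matInv hq).symm.eq_of_left fun i k => ?_
    have := congrArg (h.starFun hq) ((h.matInv hq).mul_eq k i)
    rw [starFun_sum] at this
    simp only [starFun_mul, starFun_t] at this
    rw [this, apply_ite (h.starFun hq), starFun_one]
    have h0 : h.starFun hq 0 = 0 := by simpa using h.starFun_algebraMap hq 0
    simp only [h0, eq_comm]
  exact congrFun (congrFun key j) i

theorem starFun_det (hq : 0 < q) (h : IsQGen n q su A t d) :
    h.starFun hq (detW q t) = d := by
  refine inv_unique_of_mul (x := detW q t) ?_ h.det_mul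
  calc _ = h.starFun hq (detW q t) * h.starFun hq d := by rw [h.starFun_d hq]
    _ = 1 := by rw [← starFun_mul, h.mul_det, starFun_one]

theorem starFun_starFun (hq : 0 < q) (h : IsQGen n q su A t d) (a : A) :
    h.starFun hq (h.starFun hq a) = a := by
  induction a using h.induction with
  | algebraMap c => simp [starFun_algebraMap]
  | add a b ha hb => rw [starFun_add, starFun_add, ha, hb]
  | mul a b ha hb => rw [starFun_mul, starFun_mul, ha, hb]
  | gen i j => rw [starFun_t, starFun_s]
  | inv => rw [starFun_d, starFun_det]

/-- The `*`-ring structure. -/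
abbrev starRing (hq : 0 < q) (h : IsQGen n q su A t d) : StarRing A where
  star := h.starFun hq
  star_involutive := h.starFun_starFun hq
  star_mul := h.starFun_mul hq
  star_add := h.starFun_add hq

theorem starModule (hq : 0 < q) (h : IsQGen n q su A t d) :
    letI := h.starRing hq
    StarModule ℂ A :=
  letI := h.starRing hq
  ⟨h.starFun_smul hq⟩

/-- The coproduct carries `s` to the inverse of the matrix `Δ(t)`, and the sum on the right is a
right inverse of `Δ(t)`. -/
theorem comul_s (hq : 0 < q) (h : IsQGen n q su A t d) (i j : Fin n) :
    h.comul hq (h.s hq i j) = ∑ k, h.s hq k j ⊗ₜ[ℂ] h.s hq i k := by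
  have h1 := (h.matInv hq).map (h.comul hq)
  simp only [comul_t] at h1
  have key : (fun i j => ∑ k, h.s hq k j ⊗ₜ[ℂ] h.s hq i k) = fun i j => h.comul hq (h.s hq i j) := by
    refine h1.eq_of_right fun i k => ?_
    calc ∑ j, (∑ x, t i x ⊗ₜ[ℂ] t x j) * ∑ y, h.s hq y k ⊗ₜ[ℂ] h.s hq j y
        = ∑ j, ∑ x, ∑ y, (t i x * h.s hq y k) ⊗ₜ[ℂ] (t x j * h.s hq j y) := by
          simp only [Finset.sum_mul_sum, Algebra.TensorProduct.tmul_mul_tmul]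
      _ = ∑ x, ∑ y, (t i x * h.s hq y k) ⊗ₜ[ℂ] ∑ j, (t x j * h.s hq j y) := by
          rw [Finset.sum_comm]
          simp only [TensorProduct.tmul_sum]
          exact Finset.sum_congr rfl fun x _ => Finset.sum_comm
      _ = ∑ x, (t i x * h.s hq x k) ⊗ₜ[ℂ] (1 : A) := by
          simp [(h.matInv hq).mul_eq, TensorProduct.tmul_ite]
      _ = _ := by
          rw [← TensorProduct.sum_tmul, (h.matInv hq).mul_eq]
          split_ifs <;> simp [Algebra.TensorProduct.one_def]
  exact (congrFun (congrFun key i) j).symm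

theorem comul_star (hq : 0 < q) (h : IsQGen n q su A t d) (a : A) :
    letI := h.starRing hq
    haveI := h.starModule hq
    h.comul hq (star a) = star (h.comul hq a) := by
  let := h.starRing hq
  have := h.starModule hq
  have hst : ∀ x : A, star x = h.starFun hq x := fun _ => rfl
  induction a using h.induction with
  | algebraMap c =>
    rw [hst, starFun_algebraMap, AlgHom.commutes, AlgHom.commutes,
      Algebra.TensorProduct.algebraMap_apply, Algebra.TensorProduct.algebraMap_apply,
      TensorProduct.star_tmul, hst, starFun_algebraMap, star_one]
  | add a b ha hb => rw [star_add, map_add, ha, hb, map_add, star_add]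
  | mul a b ha hb => rw [star_mul, map_mul, ha, hb, map_mul, star_tmul_mul]
  | gen i j =>
    rw [hst, starFun_t, comul_s, comul_t, star_sum]
    exact Finset.sum_congr rfl fun k _ => by
      rw [TensorProduct.star_tmul, hst, hst, starFun_t, starFun_t]
  | inv =>
    rw [hst, starFun_d, comul_d, TensorProduct.star_tmul, hst, starFun_d, map_detW]
    simp only [comul_t]
    exact h.det_comul hq

theorem counit_s (hq : 0 < q) (h : IsQGen n q su A t d) (i j : Fin n) :
    h.counit (h.s hq i j) = if i = j then 1 else 0 := by
  have h1 := (h.matInv hq).map h.counit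
  simp only [counit_t] at h1
  have key : (fun i j : Fin n => if i = j then (1 : ℂ) else 0) = fun i j => h.counit (h.s hq i j) :=
    h1.eq_of_right fun i k => by simp
  exact (congrFun (congrFun key i) j).symm

theorem counit_star (hq : 0 < q) (h : IsQGen n q su A t d) (a : A) :
    h.counit (h.starFun hq a) = star (h.counit a) := by
  induction a using h.induction with
  | algebraMap c => rw [starFun_algebraMap, AlgHom.commutes, AlgHom.commutes]; rfl
  | add a b ha hb => rw [starFun_add, map_add, ha, hb, map_add, star_add]
  | mul a b ha hb => rw [starFun_mul, map_mul, ha, hb, map_mul, star_mul]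
  | gen i j =>
    rw [starFun_t, counit_s, counit_t]
    simp only [eq_comm]
    split_ifs <;> simp
  | inv =>
    rw [starFun_d, counit_d, map_detW]
    simp only [counit_t]
    rw [detW_one, star_one]

theorem antipode_left (hq : 0 < q) (h : IsQGen n q su A t d) (a : A) :
    LinearMap.mul' ℂ A ((h.antipode hq).rTensor A (h.comul hq a)) =
      algebraMap ℂ A (h.counit a) := by
  -- As `S` reverses products, the factor contributed by `x` sits in the middle; being a scalar `c`,
  -- it comes out. The identity is therefore stable under products and need only be checked on
  -- generators.
  have key : ∀ x y : A ⊗[ℂ] A, ∀ c : ℂ,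
      LinearMap.mul' ℂ A ((h.antipode hq).rTensor A x) = algebraMap ℂ A c →
      LinearMap.mul' ℂ A ((h.antipode hq).rTensor A (x * y)) =
        c • LinearMap.mul' ℂ A ((h.antipode hq).rTensor A y) := by
    intro x y c hx
    induction y using TensorProduct.induction_on with
    | zero => simp
    | add y y' hy hy' => rw [mul_add, map_add, map_add, hy, hy', map_add, map_add, smul_add]
    | tmul b b' =>
      have h1 : ∀ x : A ⊗[ℂ] A, LinearMap.mul' ℂ A ((h.antipode hq).rTensor A (x * b ⊗ₜ[ℂ] b')) =
          h.antipode hq b * LinearMap.mul' ℂ A ((h.antipode hq).rTensor A x) * b' := by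
        intro x
        induction x using TensorProduct.induction_on with
        | zero => simp
        | add x x' hx hx' => rw [add_mul, map_add, map_add, hx, hx', map_add, map_add, mul_add,
            add_mul]
        | tmul a a' => simp [antipode_mul, mul_assoc]
      rw [h1, hx, ← Algebra.commutes, mul_assoc, Algebra.smul_def]
      simp
  induction a using h.induction with
  | algebraMap c =>
    rw [AlgHom.commutes, AlgHom.commutes, Algebra.TensorProduct.algebraMap_apply]
    simp [antipode_algebraMap]
  | add a b ha hb => simp only [map_add, ha, hb]
  | mul a b ha hb => rw [map_mul, key _ _ _ ha, hb, map_mul, map_mul, Algebra.smul_def]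
  | gen i j =>
    rw [comul_t, counit_t]
    simp only [map_sum, LinearMap.rTensor_tmul, LinearMap.mul'_apply, antipode_t,
      (h.matInv hq).eq_mul]
    split_ifs <;> simp
  | inv =>
    rw [comul_d, counit_d]
    simp [antipode_d, h.det_mul]

theorem antipode_right (hq : 0 < q) (h : IsQGen n q su A t d) (a : A) :
    LinearMap.mul' ℂ A ((h.antipode hq).lTensor A (h.comul hq a)) =
      algebraMap ℂ A (h.counit a) := by
  -- For `S` in the second leg it is the right factor `y` whose contribution is innermost.
  have key : ∀ x y : A ⊗[ℂ] A, ∀ c : ℂ,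
      LinearMap.mul' ℂ A ((h.antipode hq).lTensor A y) = algebraMap ℂ A c →
      LinearMap.mul' ℂ A ((h.antipode hq).lTensor A (x * y)) =
        c • LinearMap.mul' ℂ A ((h.antipode hq).lTensor A x) := by
    intro x y c hy
    induction x using TensorProduct.induction_on with
    | zero => simp
    | add x x' hx hx' => rw [add_mul, map_add, map_add, hx, hx', map_add, map_add, smul_add]
    | tmul b b' =>
      have h1 : ∀ y : A ⊗[ℂ] A, LinearMap.mul' ℂ A ((h.antipode hq).lTensor A (b ⊗ₜ[ℂ] b' * y)) =
          b * LinearMap.mul' ℂ A ((h.antipode hq).lTensor A y) * h.antipode hq b' := by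
        intro y
        induction y using TensorProduct.induction_on with
        | zero => simp
        | add x x' hx hx' => rw [mul_add, map_add, map_add, hx, hx', map_add, map_add, mul_add,
            add_mul]
        | tmul a a' => simp [antipode_mul, mul_assoc]
      rw [h1, hy, ← Algebra.commutes, mul_assoc, Algebra.smul_def]
      simp
  induction a using h.induction with
  | algebraMap c =>
    rw [AlgHom.commutes, AlgHom.commutes, Algebra.TensorProduct.algebraMap_apply]
    simp [antipode_one]
  | add a b ha hb => simp only [map_add, ha, hb]
  | mul a b ha hb => rw [map_mul, key _ _ _ hb, ha, map_mul, mul_comm, map_mul, Algebra.smul_def]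
  | gen i j =>
    rw [comul_t, counit_t]
    simp only [map_sum, LinearMap.lTensor_tmul, LinearMap.mul'_apply, antipode_t,
      (h.matInv hq).mul_eq]
    split_ifs <;> simp
  | inv =>
    rw [comul_d, counit_d]
    simp [antipode_d, h.mul_det]

/-- The Hopf `*`-algebra structure. -/
def hopfStar (hq : 0 < q) (h : IsQGen n q su A t d) : HopfStarStructure A where
  comul := h.comul hq
  counit := h.counit
  antipode := h.antipode hq
  coassoc := h.hom_ext fun i j => by
    simp only [AlgHom.comp_apply, comul_t, map_sum, Algebra.TensorProduct.map_tmul,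
      AlgHom.id_apply, TensorProduct.sum_tmul, TensorProduct.tmul_sum]
    rw [Finset.sum_comm]
    rfl
  rTensor_counit_comp_comul := h.hom_ext fun i j => by
    simp [comul_t, counit_t, TensorProduct.ite_tmul]
  lTensor_counit_comp_comul := h.hom_ext fun i j => by
    simp [comul_t, counit_t, TensorProduct.tmul_ite]
  mul_antipode_rTensor_comul := LinearMap.ext (h.antipode_left hq)
  mul_antipode_lTensor_comul := LinearMap.ext (h.antipode_right hq)
  starRing := h.starRing hq
  starModule := h.starModule hq
  comul_star := h.comul_star hq
  counit_star := h.counit_star hq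

end IsQGen

/-! ### `SU_q(n)` and `U_q(n)` as instances of the abstract presentation -/

theorem ofReal_Rmat (n : ℕ) (q : ℝ) (i j k l : Fin n) : (Rmat n q (i, j) (k, l) : ℂ) =
    ((q ^ (-(1 / n : ℝ)) : ℝ) : ℂ) *
      ((if k = i then if l = j then diagC q i j else 0 else 0) +
        if k = j then if l = i then offC q i j else 0 else 0) := by
  rw [Rmat, Matrix.of_apply]
  push_cast
  congr 1
  simp only [diagC, offC, apply_ite (Complex.ofReal), Complex.ofReal_sub, Complex.ofReal_inv,
    Complex.ofReal_zero, Complex.ofReal_one]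
  grind

theorem frtLeft_eq {n : ℕ} (q : ℝ) {A : Type} [Ring A] [Algebra ℂ A] (t : Fin n → Fin n → A)
    (i j a b : Fin n) : frtLeft q t i j a b = ((q ^ (-(1 / n : ℝ)) : ℝ) : ℂ) •
      (diagC q i j • (t i a * t j b) + offC q i j • (t j a * t i b)) := by
  rw [frtLeft]
  generalize hc : ((q ^ (-(1 / n : ℝ)) : ℝ) : ℂ) = c
  have h : diagC q i j • (t i a * t j b) + offC q i j • (t j a * t i b) = ∑ k, ∑ l,
      ((if k = i then if l = j then diagC q i j else 0 else 0) +
        if k = j then if l = i then offC q i j else 0 else 0) • (t k a * t l b) := by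
    simp [add_smul, ite_smul, Finset.sum_add_distrib]
  simp only [h, Finset.smul_sum, ofReal_Rmat, hc, mul_smul]

theorem frtRight_eq {n : ℕ} (q : ℝ) {A : Type} [Ring A] [Algebra ℂ A] (t : Fin n → Fin n → A)
    (i j a b : Fin n) : frtRight q t i j a b = ((q ^ (-(1 / n : ℝ)) : ℝ) : ℂ) •
      (diagC q a b • (t j b * t i a) + offC q b a • (t j a * t i b)) := by
  rw [frtRight]
  generalize hc : ((q ^ (-(1 / n : ℝ)) : ℝ) : ℂ) = c
  have h : ∀ k l : Fin n, ((if a = k then if b = l then diagC q k l else 0 else 0) +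
      if a = l then if b = k then offC q k l else 0 else 0) =
      (if k = a then if l = b then diagC q a b else 0 else 0) +
      if k = b then if l = a then offC q b a else 0 else 0 := by
    intro k l
    grind [offC, diagC]
  have h' : diagC q a b • (t j b * t i a) + offC q b a • (t j a * t i b) = ∑ k, ∑ l,
      ((if k = a then if l = b then diagC q a b else 0 else 0) +
        if k = b then if l = a then offC q b a else 0 else 0) • (t j l * t i k) := by
    simp [add_smul, ite_smul, Finset.sum_add_distrib]
  simp only [h', Finset.smul_sum, ofReal_Rmat, hc, h, mul_smul]

/-- The normalisation `q^{-1/n}` is a common nonzero factor of the two sides, so it can be dropped.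
-/
theorem frt_iff_left_eq_right {n : ℕ} {q : ℝ} (hq : 0 < q) {A : Type} [Ring A] [Algebra ℂ A]
    (t : Fin n → Fin n → A) : Frt q t ↔ ∀ i j a b, frtLeft q t i j a b = frtRight q t i j a b := by
  have h0 : ((q ^ (-(1 / n : ℝ)) : ℝ) : ℂ) ≠ 0 := by
    exact_mod_cast (Real.rpow_pos_of_pos hq _).ne'
  simp only [frtLeft_eq, frtRight_eq]
  exact ⟨fun h i j a b => congrArg _ (h i j a b),
    fun h i j a b => smul_right_injective A h0 (h i j a b)⟩

theorem map_frtLeft {n : ℕ} (q : ℝ) {A A' : Type} [Ring A] [Algebra ℂ A] [Ring A'] [Algebra ℂ A']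
    (f : A →ₐ[ℂ] A') (t : Fin n → Fin n → A) (i j a b : Fin n) :
    f (frtLeft q t i j a b) = frtLeft q (fun i j => f (t i j)) i j a b := by
  simp only [frtLeft, map_sum, map_smul, map_mul]

theorem map_frtRight {n : ℕ} (q : ℝ) {A A' : Type} [Ring A] [Algebra ℂ A] [Ring A'] [Algebra ℂ A']
    (f : A →ₐ[ℂ] A') (t : Fin n → Fin n → A) (i j a b : Fin n) :
    f (frtRight q t i j a b) = frtRight q (fun i j => f (t i j)) i j a b := by
  simp only [frtRight, map_sum, map_smul, map_mul]

theorem SUq.frt {n : ℕ} {q : ℝ} (hq : 0 < q) : Frt q (SUq.t : Fin n → Fin n → SUq n q) := by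
  rw [frt_iff_left_eq_right hq]
  intro i j a b
  have := RingQuot.mkAlgHom_rel ℂ (SUqRel.frt (n := n) (q := q) i j a b)
  rw [map_frtLeft, map_frtRight] at this
  exact this

theorem Uq.frt {n : ℕ} {q : ℝ} (hq : 0 < q) : Frt q (Uq.t : Fin n → Fin n → Uq n q) := by
  rw [frt_iff_left_eq_right hq]
  intro i j a b
  have := RingQuot.mkAlgHom_rel ℂ (UqRel.frt (n := n) (q := q) i j a b)
  rw [map_frtLeft, map_frtRight] at this
  exact this

theorem SUq.isQGen {n : ℕ} {q : ℝ} (hq : 0 < q) : IsQGen n q True (SUq n q) SUq.t 1 where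
  frt := SUq.frt hq
  det_mul := by
    rw [mul_one, ← (SUq.frt hq).qDet_eq hq]
    have := RingQuot.mkAlgHom_rel ℂ (SUqRel.det (n := n) (q := q))
    rw [map_qDet, map_one] at this
    exact this
  mul_det := by
    rw [one_mul, ← (SUq.frt hq).qDet_eq hq]
    have := RingQuot.mkAlgHom_rel ℂ (SUqRel.det (n := n) (q := q))
    rw [map_qDet, map_one] at this
    exact this
  inv_eq_one _ := rfl
  adjoin := by
    have h1 := congrArg (Subalgebra.map (RingQuot.mkAlgHom ℂ (SUqRel n q)))
      (FreeAlgebra.adjoin_range_ι ℂ (Fin n × Fin n))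
    rw [AlgHom.map_adjoin, Algebra.map_top,
      (AlgHom.range_eq_top _).2 (RingQuot.mkAlgHom_surjective ℂ (SUqRel n q))] at h1
    refine eq_top_iff.2 (h1.symm.le.trans (Algebra.adjoin_mono ?_))
    rintro _ ⟨_, ⟨p, rfl⟩, rfl⟩
    exact Or.inl ⟨p, rfl⟩
  lift u e hu h1 _ hs := by
    have hrel : ∀ ⦃x y⦄, SUqRel n q x y →
        FreeAlgebra.lift ℂ (fun p : Fin n × Fin n => u p.1 p.2) x =
          FreeAlgebra.lift ℂ (fun p : Fin n × Fin n => u p.1 p.2) y := by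
      have hg : ∀ i j, FreeAlgebra.lift ℂ (fun p : Fin n × Fin n => u p.1 p.2) (suFree i j) =
        u i j := fun i j => by simp [suFree]
      intro x y h
      cases h with
      | frt i j a b =>
        rw [map_frtLeft, map_frtRight]
        simp only [hg]
        exact (frt_iff_left_eq_right hq u).1 hu i j a b
      | det =>
        rw [map_qDet, map_one]
        simp only [hg]
        rw [hu.qDet_eq hq]
        rwa [hs trivial, mul_one] at h1
    refine ⟨RingQuot.liftAlgHom ℂ ⟨_, hrel⟩, fun i j => ?_, ?_⟩
    · exact (RingQuot.liftAlgHom_mkAlgHom_apply ℂ _ hrel (suFree i j)).trans (by simp [suFree])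
    · exact (map_one (RingQuot.liftAlgHom ℂ ⟨_, hrel⟩)).trans (hs trivial).symm

theorem Uq.isQGen {n : ℕ} {q : ℝ} (hq : 0 < q) :
    IsQGen n q False (Uq n q) Uq.t (Uq.detStar n q) where
  frt := Uq.frt hq
  det_mul := by
    rw [← (Uq.frt hq).qDet_eq hq]
    exact Uq.det_mul_detStar n q
  mul_det := by
    rw [← (Uq.frt hq).qDet_eq hq]
    exact Uq.detStar_mul_det n q
  inv_eq_one h := h.elim
  adjoin := by
    have h1 := congrArg (Subalgebra.map (RingQuot.mkAlgHom ℂ (UqRel n q)))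
      (FreeAlgebra.adjoin_range_ι ℂ (Option (Fin n × Fin n)))
    rw [AlgHom.map_adjoin, Algebra.map_top,
      (AlgHom.range_eq_top _).2 (RingQuot.mkAlgHom_surjective ℂ (UqRel n q))] at h1
    refine eq_top_iff.2 (h1.symm.le.trans (Algebra.adjoin_mono ?_))
    rintro _ ⟨_, ⟨p, rfl⟩, rfl⟩
    cases p with
    | none => exact Or.inr rfl
    | some p => exact Or.inl ⟨p, rfl⟩
  lift {C} _ _ u e hu h1 h2 _ := by
    let g : Option (Fin n × Fin n) → C := fun p => p.elim e fun p => u p.1 p.2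
    have hrel : ∀ ⦃x y⦄, UqRel n q x y → FreeAlgebra.lift ℂ g x = FreeAlgebra.lift ℂ g y := by
      have hg : ∀ i j, FreeAlgebra.lift ℂ g (uFree i j) = u i j := fun i j => by simp [uFree, g]
      have hg' : FreeAlgebra.lift ℂ g (FreeAlgebra.ι ℂ none) = e := by simp [g]
      intro x y h
      cases h with
      | frt i j a b =>
        rw [map_frtLeft, map_frtRight]
        simp only [hg]
        exact (frt_iff_left_eq_right hq u).1 hu i j a b
      | det_mul =>
        rw [map_mul, map_qDet, map_one, hg']
        simp only [hg]
        rwa [hu.qDet_eq hq]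
      | mul_det =>
        rw [map_mul, map_qDet, map_one, hg']
        simp only [hg]
        rwa [hu.qDet_eq hq]
    refine ⟨RingQuot.liftAlgHom ℂ ⟨_, hrel⟩, fun i j => ?_, ?_⟩
    · exact (RingQuot.liftAlgHom_mkAlgHom_apply ℂ _ hrel (uFree i j)).trans (by simp [uFree, g])
    · exact (RingQuot.liftAlgHom_mkAlgHom_apply ℂ _ hrel (FreeAlgebra.ι ℂ none)).trans (by simp [g])

theorem SUq.isStandard {n : ℕ} {q : ℝ} (hq : 0 < q) :
    SUq.IsStandard ((SUq.isQGen (n := n) hq).hopfStar hq) where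
  comul_t := (SUq.isQGen hq).comul_t hq
  counit_t := (SUq.isQGen hq).counit_t
  star_t i j := ((SUq.isQGen hq).starFun_t hq i j).trans ((SUq.isQGen hq).antipode_t hq j i).symm

theorem Uq.isStandard {n : ℕ} {q : ℝ} (hq : 0 < q) :
    Uq.IsStandard ((Uq.isQGen (n := n) hq).hopfStar hq) where
  comul_t := (Uq.isQGen hq).comul_t hq
  counit_t := (Uq.isQGen hq).counit_t
  star_t i j := ((Uq.isQGen hq).starFun_t hq i j).trans ((Uq.isQGen hq).antipode_t hq j i).symm
  star_det := by
    rw [(Uq.frt hq).qDet_eq hq]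
    exact (Uq.isQGen hq).starFun_det hq

/-! ### Block matrices and the map `SU_q(m + 1) → U_q(m)` -/

/-- The block diagonal matrix with blocks `e` and `t`. -/
def blockMat {m : ℕ} {A : Type*} [Zero A] (e : A) (t : Fin m → Fin m → A) :
    Fin (m + 1) → Fin (m + 1) → A :=
  Fin.cons (Fin.cons e fun _ => 0) fun i => Fin.cons 0 (t i)

section Block

variable {m : ℕ} {A : Type*} [Ring A]

theorem blockMat_zero_zero (e : A) (t : Fin m → Fin m → A) : blockMat e t 0 0 = e := rfl

theorem blockMat_zero_succ (e : A) (t : Fin m → Fin m → A) (j : Fin m) :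
    blockMat e t 0 j.succ = 0 := rfl

theorem blockMat_succ_zero (e : A) (t : Fin m → Fin m → A) (i : Fin m) :
    blockMat e t i.succ 0 = 0 := rfl

theorem blockMat_succ_succ (e : A) (t : Fin m → Fin m → A) (i j : Fin m) :
    blockMat e t i.succ j.succ = t i j := rfl

theorem matInv_blockMat {e e' : A} {t s : Fin m → Fin m → A} (h1 : e * e' = 1) (h2 : e' * e = 1)
    (h : MatInv t s) : MatInv (blockMat e t) (blockMat e' s) := by
  refine MatInv.of_sums (fun i k => ?_) fun i k => ?_ <;>
    refine Fin.cases ?_ (fun i => ?_) i <;> refine Fin.cases ?_ (fun k => ?_) k <;>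
    rw [Fin.sum_univ_succ] <;>
    simp [blockMat_zero_zero, blockMat_zero_succ, blockMat_succ_zero, blockMat_succ_succ, h1, h2,
      h.mul_eq, h.eq_mul, (Fin.succ_ne_zero _).symm]

theorem map_blockMat {A' F : Type*} [Ring A'] [FunLike F A A'] [AddMonoidHomClass F A A']
    (f : F) (e : A) (t : Fin m → Fin m → A) (i j : Fin (m + 1)) :
    f (blockMat e t i j) = blockMat (f e) (fun i j => f (t i j)) i j := by
  refine Fin.cases ?_ (fun i => ?_) i <;> refine Fin.cases ?_ (fun j => ?_) j <;>
    simp [blockMat_zero_zero, blockMat_zero_succ, blockMat_succ_zero, blockMat_succ_succ]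

variable [Algebra ℂ A] {q : ℝ}

theorem frt_blockMat {e : A} {t : Fin m → Fin m → A} (ht : Frt q t)
    (hc : ∀ i j, Commute e (t i j)) : Frt q (blockMat e t) := by
  intro i j a b
  refine Fin.cases ?_ (fun i => ?_) i <;> refine Fin.cases ?_ (fun j => ?_) j <;>
    refine Fin.cases ?_ (fun a => ?_) a <;> refine Fin.cases ?_ (fun b => ?_) b <;>
    simp only [blockMat_zero_zero, blockMat_zero_succ, blockMat_succ_zero, blockMat_succ_succ,
      mul_zero, zero_mul, smul_zero, add_zero, zero_add, diagC, offC, Fin.succ_ne_zero,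
      (Fin.succ_ne_zero _).symm, if_false, if_true, Fin.succ_pos, Fin.not_lt_zero, lt_irrefl,
      (hc _ _).eq, zero_smul, Fin.succ_inj, Fin.succ_lt_succ_iff]
  exact ht i j a b

/-- Only words beginning with the letter `0` survive, and their tails are permutations of the
remaining letters; the leading `0` creates no inversion. -/
theorem detW_of_row {u : Fin (m + 1) → Fin (m + 1) → A} (hu : ∀ j : Fin m, u 0 j.succ = 0) :
    detW q u = u 0 0 * detW q fun i j => u i.succ j.succ := by
  rw [detW, ← (Fin.consEquiv fun _ => Fin (m + 1)).sum_comp, Fintype.sum_prod_type,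
    Fin.sum_univ_succ]
  have e : ∀ j J, (Fin.consEquiv fun _ => Fin (m + 1)) (j, J) =
    (Fin.cons j J : Fin (m + 1) → Fin (m + 1)) := fun j J => rfl
  have h1 : ∀ j (J : Fin m → Fin (m + 1)), wmono u id (Fin.cons j J : Fin (m + 1) → Fin (m + 1)) =
      u 0 j * wmono u Fin.succ J := fun j J => by
    rw [wmono_succ]; rfl
  simp only [e, h1, hu, zero_mul, smul_zero, Finset.sum_const_zero, add_zero, epsW_cons]
  rw [sum_words_avoid 0 _ fun I hI => by rw [epsAvoid_eq_zero hI, mul_zero, zero_smul], detW,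
    sum_words_eq_sum_perm _ fun J hJ => by rw [epsW_of_not_inj hJ, zero_smul], Finset.mul_sum]
  refine Finset.sum_congr rfl fun σ _ => ?_
  rw [epsAvoid_succAbove, Fin.val_zero, pow_zero, one_mul, mul_smul_comm]
  rfl

theorem detW_blockMat (e : A) (t : Fin m → Fin m → A) :
    detW q (blockMat e t) = e * detW q t := detW_of_row (blockMat_zero_succ e t)

end Block

theorem commute_detStar {m : ℕ} {q : ℝ} (hq : 0 < q) (i j : Fin m) :
    Commute (Uq.detStar m q) (Uq.t i j) :=
  commute_inv_of_commute (Uq.isQGen hq).det_mul (Uq.isQGen hq).mul_det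
    ((Uq.frt hq).commute_detW hq i j)

/-- The map `δ : SU_q(m + 1) → U_q(m)`. -/
def deltaHom (m : ℕ) {q : ℝ} (hq : 0 < q) : SUq (m + 1) q →ₐ[ℂ] Uq m q :=
  (SUq.isQGen hq).liftHom (blockMat (Uq.detStar m q) Uq.t) 1
    (frt_blockMat (Uq.frt hq) (commute_detStar hq))
    (by rw [detW_blockMat, (Uq.isQGen hq).mul_det, one_mul])
    (by rw [detW_blockMat, (Uq.isQGen hq).mul_det, one_mul]) fun _ => rfl

theorem deltaHom_t {m : ℕ} {q : ℝ} (hq : 0 < q) (i j : Fin (m + 1)) :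
    deltaHom m hq (SUq.t i j) = blockMat (Uq.detStar m q) Uq.t i j :=
  IsQGen.liftHom_t _ _ _ _ _ _ _ i j

theorem deltaHom_s {m : ℕ} {q : ℝ} (hq : 0 < q) (i j : Fin (m + 1)) :
    deltaHom m hq ((SUq.isQGen hq).s hq i j) =
      blockMat (detW q (Uq.t : Fin m → Fin m → Uq m q)) ((Uq.isQGen hq).s hq) i j := by
  have h1 := ((SUq.isQGen (n := m + 1) hq).matInv hq).map (deltaHom m hq)
  simp only [deltaHom_t] at h1
  have h2 := matInv_blockMat (Uq.isQGen hq).mul_det (Uq.isQGen hq).det_mul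
    ((Uq.isQGen (n := m) hq).matInv hq)
  exact (congrFun (congrFun (h1.eq_of_left h2.eq_mul) i) j).symm

theorem deltaHom_surjective (m : ℕ) {q : ℝ} (hq : 0 < q) :
    Function.Surjective (deltaHom m hq) := by
  rw [← AlgHom.range_eq_top, eq_top_iff, ← (Uq.isQGen hq).adjoin]
  refine Algebra.adjoin_le ?_
  rintro _ (⟨p, rfl⟩ | rfl)
  · exact ⟨SUq.t p.1.succ p.2.succ, deltaHom_t hq _ _⟩
  · exact ⟨SUq.t 0 0, deltaHom_t hq _ _⟩

theorem deltaHom_isHopfStarHom (m : ℕ) {q : ℝ} (hq : 0 < q) :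
    IsHopfStarHom ((SUq.isQGen hq).hopfStar hq) ((Uq.isQGen hq).hopfStar hq) (deltaHom m hq) where
  map_comul := by
    refine (SUq.isQGen hq).hom_ext fun i j => ?_
    change (Uq.isQGen hq).comul hq (deltaHom m hq (SUq.t i j)) =
      Algebra.TensorProduct.map (deltaHom m hq) (deltaHom m hq) ((SUq.isQGen hq).comul hq (SUq.t i j))
    rw [(SUq.isQGen hq).comul_t, map_sum]
    have h : ∀ k, Algebra.TensorProduct.map (deltaHom m hq) (deltaHom m hq)
        (SUq.t i k ⊗ₜ[ℂ] SUq.t k j) = blockMat (Uq.detStar m q) Uq.t i k ⊗ₜ[ℂ]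
          blockMat (Uq.detStar m q) Uq.t k j := fun k => by
      rw [Algebra.TensorProduct.map_tmul, deltaHom_t, deltaHom_t]
    rw [Finset.sum_congr rfl fun k _ => h k, deltaHom_t, Fin.sum_univ_succ]
    refine Fin.cases ?_ (fun i => ?_) i <;> refine Fin.cases ?_ (fun j => ?_) j <;>
      simp [blockMat_zero_zero, blockMat_zero_succ, blockMat_succ_zero, blockMat_succ_succ,
        (Uq.isQGen hq).comul_t, (Uq.isQGen hq).comul_d]
  map_counit := by
    refine (SUq.isQGen hq).hom_ext fun i j => ?_
    change (Uq.isQGen hq).counit (deltaHom m hq (SUq.t i j)) = (SUq.isQGen hq).counit (SUq.t i j)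
    rw [(SUq.isQGen hq).counit_t, deltaHom_t]
    refine Fin.cases ?_ (fun i => ?_) i <;> refine Fin.cases ?_ (fun j => ?_) j <;>
      simp [blockMat_zero_zero, blockMat_zero_succ, blockMat_succ_zero, blockMat_succ_succ,
        (Uq.isQGen hq).counit_t, (Uq.isQGen hq).counit_d, (Fin.succ_ne_zero _).symm]
  map_antipode a := by
    change deltaHom m hq ((SUq.isQGen hq).antipode hq a) =
      (Uq.isQGen hq).antipode hq (deltaHom m hq a)
    induction a using (SUq.isQGen hq).induction with
    | algebraMap c => rw [IsQGen.antipode_algebraMap, AlgHom.commutes, IsQGen.antipode_algebraMap]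
    | add a b ha hb => simp only [map_add, ha, hb]
    | mul a b ha hb => rw [IsQGen.antipode_mul, map_mul, ha, hb, map_mul, IsQGen.antipode_mul]
    | gen i j =>
      rw [IsQGen.antipode_t, deltaHom_s, deltaHom_t, map_blockMat, IsQGen.antipode_d]
      simp only [IsQGen.antipode_t]
    | inv => rw [IsQGen.antipode_one, map_one, IsQGen.antipode_one]
  map_star a := by
    change deltaHom m hq ((SUq.isQGen hq).starFun hq a) =
      (Uq.isQGen hq).starFun hq (deltaHom m hq a)
    induction a using (SUq.isQGen hq).induction with
    | algebraMap c =>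
      rw [IsQGen.starFun_algebraMap, AlgHom.commutes, AlgHom.commutes, IsQGen.starFun_algebraMap]
    | add a b ha hb => rw [IsQGen.starFun_add, map_add, ha, hb, map_add, IsQGen.starFun_add]
    | mul a b ha hb => rw [IsQGen.starFun_mul, map_mul, ha, hb, map_mul, IsQGen.starFun_mul]
    | gen i j =>
      have h0 : (Uq.isQGen (n := m) hq).starFun hq 0 = 0 := by
        simpa using (Uq.isQGen (n := m) hq).starFun_algebraMap hq 0
      rw [IsQGen.starFun_t, deltaHom_s, deltaHom_t]
      refine Fin.cases ?_ (fun i => ?_) i <;> refine Fin.cases ?_ (fun j => ?_) j <;>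
        simp only [blockMat_zero_zero, blockMat_zero_succ, blockMat_succ_zero, blockMat_succ_succ,
          IsQGen.starFun_t, IsQGen.starFun_d, h0]
    | inv => rw [IsQGen.starFun_one, map_one, IsQGen.starFun_one]

/-! ### The first row of a quantum matrix and the first column of its inverse -/

section FirstRow

variable {n : ℕ} {A : Type*} [Ring A] [Algebra ℂ A] {q : ℝ}

/-- The relations rewrite the product with `t 0 a` or `t 0 b` as right factor. For `k ≠ 0` and `b =
0` the second of these need not lie in `I`, but its coefficient is a difference of two equal terms
`q - q⁻¹`. The lemma, with its transpose, makes `rowColIdeal` two-sided. -/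
theorem Frt.row_mul_mem {t : Fin (n + 1) → Fin (n + 1) → A} (hq : 0 < q) (ht : Frt q t)
    (I : Ideal A) (hI : ∀ a, a ≠ 0 → t 0 a ∈ I) {a : Fin (n + 1)} (ha : a ≠ 0)
    (k b : Fin (n + 1)) : t 0 a * t k b ∈ I := by
  have hq' := ofReal_ne_zero' hq
  have hsm : ∀ (c : ℂ) (x : A), x ∈ I → c • x ∈ I := fun c x hx => Submodule.smul_of_tower_mem I c hx
  have h := ht 0 k a b
  by_cases hk : k = 0
  · subst hk
    by_cases hb : b = 0
    · subst hb
      have h1 : t 0 a * t 0 0 = (q : ℂ) • (t 0 0 * t 0 a) := by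
        simp only [diagC, offC, if_true, lt_irrefl, if_false, zero_smul, add_zero, ha, one_smul,
          Fin.pos_iff_ne_zero.2 ha, sub_smul] at h
        have h2 : t 0 0 * t 0 a = (q : ℂ)⁻¹ • (t 0 a * t 0 0) := by
          rw [← sub_eq_zero] at h ⊢
          rw [← neg_eq_zero, ← h]
          abel
        rw [h2, smul_smul, mul_inv_cancel₀ hq', one_smul]
      rw [h1]
      exact hsm _ _ (I.mul_mem_left _ (hI a ha))
    · exact I.mul_mem_left _ (hI b hb)
  · have hk' : (0 : Fin (n + 1)) ≠ k := fun h => hk h.symm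
    have h1 : t 0 a * t k b = diagC q a b • (t k b * t 0 a) +
        (offC q b a - offC q 0 k) • (t k a * t 0 b) := by
      rw [sub_smul, ← add_sub_assoc, ← h, diagC, if_neg hk', one_smul, add_sub_cancel_right]
    rw [h1]
    refine I.add_mem (hsm _ _ (I.mul_mem_left _ (hI a ha))) ?_
    by_cases hb : b = 0
    · subst hb
      simp [offC, Fin.pos_iff_ne_zero.2 ha, Fin.pos_iff_ne_zero.2 hk]
    · exact hsm _ _ (I.mul_mem_left _ (hI b hb))

variable {t s : Fin (n + 1) → Fin (n + 1) → A}

/-- In the exchange relation with `i = b = 0`, the sum over `l > 0` is evaluated by `s t = 1`. This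
replaces the coefficient `q` of `s j 0 * t 0 a` by `q - (q - q⁻¹) = q⁻¹`. -/
theorem Frt.exchange_row (ht : Frt q t) (h : MatInv t s) (j a : Fin (n + 1)) :
    (q : ℂ)⁻¹ • (s j 0 * t 0 a) + (if j = a then algebraMap ℂ A (q - (q : ℂ)⁻¹) else 0) =
      diagC q a j • (t 0 a * s j 0) +
        if j = a then ∑ k, offC q k j • (t 0 k * s k 0) else 0 := by
  rw [← ht.exchange h 0 j a 0, if_pos rfl]
  have h1 : ∑ l, offC q 0 l • (s j l * t l a) =
      ((q : ℂ) - (q : ℂ)⁻¹) • ((if j = a then 1 else 0) - s j 0 * t 0 a) := by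
    rw [← h.eq_mul, Fin.sum_univ_succ, Fin.sum_univ_succ (fun l => s j l * t l a),
      add_sub_cancel_left, Finset.smul_sum]
    simp [offC, Fin.succ_pos]
  rw [h1, diagC, if_pos rfl, smul_sub, sub_smul, sub_smul]
  split_ifs
  · rw [Algebra.algebraMap_eq_smul_one, sub_smul]; abel
  · simp

theorem Frt.col_mul_row_of_ne (hq : 0 < q) (ht : Frt q t) (h : MatInv t s) {j a : Fin (n + 1)}
    (hja : j ≠ a) : s j 0 * t 0 a = (q : ℂ) • (t 0 a * s j 0) := by
  have h1 := ht.exchange_row h j a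
  rw [if_neg hja, if_neg hja, add_zero, add_zero, diagC, if_neg hja.symm, one_smul] at h1
  rw [← h1, smul_smul, mul_inv_cancel₀ (ofReal_ne_zero' hq), one_smul]

theorem Frt.col_mul_row_self (hq : 0 < q) (ht : Frt q t) (h : MatInv t s) (a : Fin (n + 1)) :
    s a 0 * t 0 a = t 0 a * s a 0 -
      ∑ k, (if a < k then (q : ℂ) ^ 2 - 1 else 0) • (t 0 k * s k 0) := by
  have hq' := ofReal_ne_zero' hq
  have h1 := ht.exchange_row h a a
  rw [if_pos rfl, if_pos rfl, diagC, if_pos rfl] at h1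
  -- The scalar is expanded by `∑ t 0 k * s k 0 = 1`, so that its terms with `k < a` cancel those on
  -- the other side.
  have h2 : algebraMap ℂ A (q - (q : ℂ)⁻¹) =
      ∑ k, ((q : ℂ) - (q : ℂ)⁻¹) • (t 0 k * s k 0) := by
    rw [← Finset.smul_sum, h.mul_eq, if_pos rfl, Algebra.algebraMap_eq_smul_one]
  have h3 : ∑ k, ((q : ℂ) - (q : ℂ)⁻¹) • (t 0 k * s k 0) = ∑ k, offC q k a • (t 0 k * s k 0) +
      ((q : ℂ) - (q : ℂ)⁻¹) • (t 0 a * s a 0) + ∑ k, offC q a k • (t 0 k * s k 0) := by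
    have h4 : ((q : ℂ) - (q : ℂ)⁻¹) • (t 0 a * s a 0) =
        ∑ k, (if k = a then (q : ℂ) - (q : ℂ)⁻¹ else 0) • (t 0 k * s k 0) := by simp
    rw [h4, ← Finset.sum_add_distrib, ← Finset.sum_add_distrib]
    refine Finset.sum_congr rfl fun k _ => ?_
    rw [← add_smul, ← add_smul]
    congr 1
    simp only [offC]
    rcases lt_trichotomy k a with h | rfl | h
    · simp [h, h.ne, h.not_gt]
    · simp
    · simp [h, h.ne', h.not_gt]
  rw [h2, h3] at h1
  have h5 : (q : ℂ)⁻¹ • (s a 0 * t 0 a) = (q : ℂ)⁻¹ • (t 0 a * s a 0) -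
      ∑ k, offC q a k • (t 0 k * s k 0) := by
    rw [sub_smul] at h1
    rw [← sub_eq_zero] at h1 ⊢
    rw [← h1]; abel
  have h6 := congrArg (fun x => (q : ℂ) • x) h5
  simp only [smul_sub, smul_smul, mul_inv_cancel₀ hq', one_smul, Finset.smul_sum] at h6
  rw [h6]
  congr 1
  refine Finset.sum_congr rfl fun k _ => ?_
  congr 1
  simp only [offC]
  split_ifs
  · rw [mul_sub, mul_inv_cancel₀ hq', sq]
  · rw [mul_zero]

theorem sum_ite_lt_geom (q : ℂ) {N : ℕ} (c : Fin N) :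
    ∑ a : Fin N, (if a < c then (q ^ 2) ^ (a : ℕ) * (q ^ 2 - 1) else 0) = (q ^ 2) ^ (c : ℕ) - 1 := by
  have h1 := Fin.sum_univ_eq_sum_range
    (fun a => if a < (c : ℕ) then (q ^ 2) ^ a * (q ^ 2 - 1) else 0) N
  have h2 : (Finset.range N).filter (· < (c : ℕ)) = Finset.range c := by
    ext a; simp only [Finset.mem_filter, Finset.mem_range]; have := c.2; omega
  rw [← Finset.sum_filter (s := Finset.range N), h2, ← Finset.sum_mul, geom_sum_mul] at h1
  exact h1

/-- With weights `q^{2a}`, the corrections in `col_mul_row_self` add up to `q^{2k} - 1` for each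
`k`, a geometric sum over `a < k`. What remains is `∑ t 0 k * s k 0 = 1`. -/
theorem Frt.sum_col_mul_row (hq : 0 < q) (ht : Frt q t) (h : MatInv t s) :
    ∑ a : Fin (_ + 1), ((q : ℂ) ^ 2) ^ (a : ℕ) • (s a 0 * t 0 a) = 1 := by
  simp only [ht.col_mul_row_self hq h, smul_sub, Finset.sum_sub_distrib, Finset.smul_sum, smul_smul]
  rw [Finset.sum_comm (f := fun (a k : Fin (n + 1)) => (((q : ℂ) ^ 2) ^ (a : ℕ) *
    (if a < k then (q : ℂ) ^ 2 - 1 else 0)) • (t 0 k * s k 0))]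
  simp only [← Finset.sum_smul, mul_ite, mul_zero, sum_ite_lt_geom]
  rw [← Finset.sum_sub_distrib]
  simp only [← sub_smul, sub_sub_cancel, one_smul]
  rw [h.mul_eq, if_pos rfl]

end FirstRow

/-! ### The kernel of `δ` -/

section Kernel

variable {m : ℕ} {q : ℝ}

/-- The left ideal generated by the off-diagonal entries of the first row and column. -/
def rowColIdeal (m : ℕ) (q : ℝ) : Ideal (SUq (m + 1) q) :=
  Ideal.span {x | ∃ i : Fin m, x = SUq.t 0 i.succ ∨ x = SUq.t i.succ 0}

theorem t_zero_succ_mem (i : Fin m) : (SUq.t 0 i.succ : SUq (m + 1) q) ∈ rowColIdeal m q :=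
  Ideal.subset_span ⟨i, Or.inl rfl⟩

theorem t_succ_zero_mem (i : Fin m) : (SUq.t i.succ 0 : SUq (m + 1) q) ∈ rowColIdeal m q :=
  Ideal.subset_span ⟨i, Or.inr rfl⟩

theorem rowColIdeal_mul_mem (hq : 0 < q) {x : SUq (m + 1) q} (hx : x ∈ rowColIdeal m q)
    (y : SUq (m + 1) q) : x * y ∈ rowColIdeal m q := by
  have h0 : ∀ {a : Fin (m + 1)}, a ≠ 0 → SUq.t 0 a ∈ rowColIdeal m q := fun {a} ha => by
    obtain ⟨b, rfl⟩ := Fin.exists_succ_eq.2 ha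
    exact t_zero_succ_mem b
  have h1 : ∀ {a : Fin (m + 1)}, a ≠ 0 → SUq.t a 0 ∈ rowColIdeal m q := fun {a} ha => by
    obtain ⟨b, rfl⟩ := Fin.exists_succ_eq.2 ha
    exact t_succ_zero_mem b
  induction y using (SUq.isQGen hq).induction generalizing x with
  | algebraMap c =>
    rw [← Algebra.commutes]
    exact Ideal.mul_mem_left _ _ hx
  | add a b ha hb => rw [mul_add]; exact Ideal.add_mem _ (ha hx) (hb hx)
  | mul a b ha hb => rw [← mul_assoc]; exact hb (ha hx)
  | gen k l =>
    refine Submodule.span_induction ?_ ?_ ?_ ?_ hx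
    · rintro _ ⟨i, rfl | rfl⟩
      · exact (SUq.frt hq).row_mul_mem hq _ (fun a ha => h0 ha) i.succ_ne_zero _ _
      · exact (SUq.frt hq).transpose.row_mul_mem hq _ (fun a ha => h1 ha) i.succ_ne_zero _ _
    · rw [zero_mul]; exact Ideal.zero_mem _
    · intro a b _ _ ha hb; rw [add_mul]; exact Ideal.add_mem _ ha hb
    · intro a b _ hb; rw [smul_eq_mul, mul_assoc]; exact Ideal.mul_mem_left _ _ hb
  | inv => rwa [mul_one]

theorem Frt.commute_detW_of_commute {n : ℕ} {A : Type*} [Ring A] [Algebra ℂ A] {q : ℝ}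
    {t : Fin n → Fin n → A} {x : A} (h : ∀ i j, Commute x (t i j)) : Commute x (detW q t) := by
  refine Commute.sum_right _ _ _ fun J _ => Commute.smul_right ?_ _
  refine Commute.list_prod_right _ _ fun y hy => ?_
  obtain ⟨k, rfl⟩ := List.mem_ofFn.1 hy
  exact h _ _

/-- Modulo the ideal the generating matrix is block diagonal, with corner entry inverse to the
determinant of the lower block. The universal property of `U_q(m)` gives a map to the quotient whose
composite with `δ` is the quotient map. -/
theorem ker_deltaHom_le (hq : 0 < q) {u : SUq (m + 1) q} (hu : deltaHom m hq u = 0) :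
    u ∈ rowColIdeal m q := by
  have : (rowColIdeal m q).IsTwoSided := ⟨fun b h => rowColIdeal_mul_mem hq h b⟩
  let f := Ideal.Quotient.mkₐ ℂ (rowColIdeal m q)
  have hf0 : ∀ x, x ∈ rowColIdeal m q → f x = 0 := fun x hx => Ideal.Quotient.eq_zero_iff_mem.2 hx
  have hT : Frt q fun i j : Fin (m + 1) => f (SUq.t i j) := (SUq.frt hq).map f
  have hT' : Frt q fun i j : Fin m => f (SUq.t i.succ j.succ) :=
    hT.comp (f := Fin.succ) (g := Fin.succ) (Fin.strictMono_succ) (Fin.strictMono_succ)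
  have hc : ∀ i j : Fin m, Commute (f (SUq.t 0 0)) (f (SUq.t i.succ j.succ)) := fun i j => by
    have := hT 0 i.succ 0 j.succ
    beta_reduce at this
    rw [hf0 _ (t_zero_succ_mem j)] at this
    exact show _ = _ by simpa [diagC, offC, (Fin.succ_ne_zero _).symm] using this
  have hd : f (SUq.t 0 0) * detW q (fun i j : Fin m => f (SUq.t i.succ j.succ)) = 1 := by
    rw [← detW_of_row (u := fun i j => f (SUq.t i j)) fun j => hf0 _ (t_zero_succ_mem j),
      ← map_detW, (SUq.isQGen hq).det_eq_one trivial, map_one]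
  let g : Uq m q →ₐ[ℂ] SUq (m + 1) q ⧸ rowColIdeal m q :=
    (Uq.isQGen hq).liftHom (fun i j => f (SUq.t i.succ j.succ)) (f (SUq.t 0 0)) hT'
      ((Frt.commute_detW_of_commute hc).eq ▸ hd) hd fun h => h.elim
  have hg : g.comp (deltaHom m hq) = f := by
    refine (SUq.isQGen hq).hom_ext fun i j => ?_
    rw [AlgHom.comp_apply, deltaHom_t]
    refine Fin.cases ?_ (fun i => ?_) i <;> refine Fin.cases ?_ (fun j => ?_) j
    · exact (Uq.isQGen hq).liftHom_d _ _ _ _ _ _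
    · rw [blockMat_zero_succ, map_zero, hf0 _ (t_zero_succ_mem j)]
    · rw [blockMat_succ_zero, map_zero, hf0 _ (t_succ_zero_mem i)]
    · exact (Uq.isQGen hq).liftHom_t _ _ _ _ _ _ i j
  exact Ideal.Quotient.eq_zero_iff_mem.1 (show f u = 0 by rw [← hg, AlgHom.comp_apply, hu, map_zero])

/-- The elements `s^a_0 t^0_b`, corrected by their counit. -/
def baseGen (hq : 0 < q) (a b : Fin (m + 1)) : SUq (m + 1) q :=
  (SUq.isQGen hq).s hq a 0 * SUq.t 0 b - if a = 0 ∧ b = 0 then 1 else 0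

/-- A row entry is `∑ t^0_a (s^a_0 t^0_i)`, by `t s = 1`. A column entry is `∑ q^{2a} t^i_0 (s^a_0
t^0_a)`, by `Frt.sum_col_mul_row`; only its term `a = 0` is not visibly in the ideal, and `∑ t^i_b
s^b_0 = 0` exchanges it for terms with `b ≠ 0`. -/
theorem rowColIdeal_le (hq : 0 < q) :
    rowColIdeal m q ≤ Ideal.span {x | ∃ a b, x = baseGen hq a b} := by
  set J := Ideal.span {x : SUq (m + 1) q | ∃ a b, x = baseGen hq a b}
  have hs := (SUq.isQGen (n := m + 1) hq).matInv hq
  set s := (SUq.isQGen (n := m + 1) hq).s hq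
  have hb : ∀ a b, ¬ (a = 0 ∧ b = 0) → s a 0 * SUq.t 0 b ∈ J := fun a b hab =>
    Ideal.subset_span ⟨a, b, by rw [baseGen, if_neg hab, sub_zero]⟩
  refine Ideal.span_le.2 ?_
  rintro _ ⟨i, rfl | rfl⟩
  · have h1 : (SUq.t 0 i.succ : SUq (m + 1) q) =
        ∑ a, SUq.t 0 a * (s a 0 * SUq.t 0 i.succ) := by
      simp only [← mul_assoc]
      rw [← Finset.sum_mul, hs.mul_eq, if_pos rfl, one_mul]
    rw [h1]
    exact Ideal.sum_mem _ fun a _ => Ideal.mul_mem_left _ _ (hb _ _ fun h => i.succ_ne_zero h.2)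
  · have h1 : (SUq.t i.succ 0 : SUq (m + 1) q) =
        ∑ a : Fin (_ + 1), ((q : ℂ) ^ 2) ^ (a : ℕ) • (SUq.t i.succ 0 * (s a 0 * SUq.t 0 a)) := by
      rw [Finset.sum_congr rfl fun a _ => (mul_smul_comm _ _ _).symm, ← Finset.mul_sum, (SUq.frt hq).sum_col_mul_row hq hs, mul_one]
    rw [h1]
    refine Ideal.sum_mem _ fun a _ => Submodule.smul_of_tower_mem _ _ ?_
    refine Fin.cases ?_ (fun a => Ideal.mul_mem_left _ _ (hb _ _ fun h => a.succ_ne_zero h.1)) a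
    have h2 : ∑ b, SUq.t i.succ b * (s b 0 * SUq.t 0 0) = 0 := by
      simp only [← mul_assoc]
      rw [← Finset.sum_mul, hs.mul_eq, if_neg i.succ_ne_zero, zero_mul]
    rw [Fin.sum_univ_succ, add_eq_zero_iff_eq_neg] at h2
    rw [h2]
    exact neg_mem (Ideal.sum_mem _ fun b _ =>
      Ideal.mul_mem_left _ _ (hb _ _ fun h => b.succ_ne_zero h.1))


/-- The coaction of `U_q(m)` on `SU_q(m + 1)`. -/
def suCoaction (m : ℕ) {q : ℝ} (hq : 0 < q) : SUq (m + 1) q →ₐ[ℂ] Uq m q ⊗[ℂ] SUq (m + 1) q :=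
  inducedCoaction ((SUq.isQGen hq).hopfStar hq).toHopfStructure (deltaHom m hq)

theorem suCoaction_apply (hq : 0 < q) (u : SUq (m + 1) q) : suCoaction m hq u =
    Algebra.TensorProduct.map (deltaHom m hq) (AlgHom.id ℂ _) ((SUq.isQGen hq).comul hq u) := rfl

theorem suCoaction_t (hq : 0 < q) (i j : Fin (m + 1)) : suCoaction m hq (SUq.t i j) =
    ∑ k, deltaHom m hq (SUq.t i k) ⊗ₜ[ℂ] SUq.t k j := by
  rw [suCoaction_apply, (SUq.isQGen hq).comul_t, map_sum]
  rfl

theorem suCoaction_t_zero (hq : 0 < q) (j : Fin (m + 1)) : suCoaction m hq (SUq.t 0 j) =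
    Uq.detStar m q ⊗ₜ[ℂ] SUq.t 0 j := by
  rw [suCoaction_t, Fin.sum_univ_succ]
  simp [deltaHom_t, blockMat_zero_zero, blockMat_zero_succ]

theorem suCoaction_s (hq : 0 < q) (i j : Fin (m + 1)) :
    suCoaction m hq ((SUq.isQGen hq).s hq i j) =
      ∑ k, deltaHom m hq ((SUq.isQGen hq).s hq k j) ⊗ₜ[ℂ] (SUq.isQGen hq).s hq i k := by
  rw [suCoaction_apply, (SUq.isQGen hq).comul_s, map_sum]
  rfl

theorem suCoaction_s_zero (hq : 0 < q) (i : Fin (m + 1)) :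
    suCoaction m hq ((SUq.isQGen hq).s hq i 0) =
      detW q (Uq.t : Fin m → Fin m → Uq m q) ⊗ₜ[ℂ] (SUq.isQGen hq).s hq i 0 := by
  rw [suCoaction_s, Fin.sum_univ_succ]
  simp [deltaHom_s, blockMat_zero_zero, blockMat_succ_zero]

theorem mem_coinvariants_iff {P A : Type} [Ring P] [Algebra ℂ P] [Ring A] [Algebra ℂ A]
    {β : P →ₐ[ℂ] A ⊗[ℂ] P} {u : P} : u ∈ coinvariants β ↔ β u = 1 ⊗ₜ[ℂ] u := Iff.rfl

/-- The coaction multiplies the two factors by `det` and `det^*`, which cancel. -/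
theorem s_mul_t_mem (hq : 0 < q) (a b : Fin (m + 1)) :
    (SUq.isQGen hq).s hq a 0 * SUq.t 0 b ∈ coinvariants (suCoaction m hq) := by
  rw [mem_coinvariants_iff, map_mul, suCoaction_s_zero, suCoaction_t_zero,
    Algebra.TensorProduct.tmul_mul_tmul, (Uq.isQGen hq).det_mul]

theorem baseGen_mem (hq : 0 < q) (a b : Fin (m + 1)) :
    baseGen hq a b ∈ coinvariants (suCoaction m hq) := by
  refine Subalgebra.sub_mem _ (s_mul_t_mem hq a b) ?_
  split_ifs
  exacts [Subalgebra.one_mem _, Subalgebra.zero_mem _]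

theorem deltaHom_baseGen (hq : 0 < q) (a b : Fin (m + 1)) :
    deltaHom m hq (baseGen hq a b) = 0 := by
  rw [baseGen, map_sub, map_mul, deltaHom_s, deltaHom_t, apply_ite (deltaHom m hq), map_one,
    map_zero]
  refine Fin.cases ?_ (fun a => ?_) a <;> refine Fin.cases ?_ (fun b => ?_) b <;>
    simp [blockMat_zero_zero, blockMat_zero_succ, blockMat_succ_zero, (Uq.isQGen hq).det_mul]

theorem starFun_baseGen (hq : 0 < q) (a b : Fin (m + 1)) :
    (SUq.isQGen hq).starFun hq (baseGen hq a b) = baseGen hq b a := by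
  let _ := (SUq.isQGen (n := m + 1) hq).starRing hq
  have h : ∀ x : SUq (m + 1) q, (SUq.isQGen hq).starFun hq x = star x := fun _ => rfl
  rw [baseGen, h, star_sub, ← h, ← h, IsQGen.starFun_mul, IsQGen.starFun_t, IsQGen.starFun_s, h,
    apply_ite star, star_one, star_zero, baseGen]
  simp only [and_comm]

/-- The kernel has been placed in a left ideal, whereas exactness asks for coinvariants on the left.
The `*`-operation preserves the kernel, permutes the generators `baseGen` and turns left ideals into
right ideals. -/
theorem deltaHom_isExactFor (hq : 0 < q) :
    IsExactFor (deltaHom m hq) (coinvariants (suCoaction m hq)) := by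
  intro u hu
  have h1 : deltaHom m hq ((SUq.isQGen hq).starFun hq u) = 0 := by
    have h2 := (deltaHom_isHopfStarHom m hq).map_star u
    change deltaHom m hq ((SUq.isQGen hq).starFun hq u) =
      (Uq.isQGen hq).starFun hq (deltaHom m hq u) at h2
    rw [h2, hu]
    simpa using (Uq.isQGen (n := m) hq).starFun_algebraMap hq 0
  have h2 := rowColIdeal_le hq (ker_deltaHom_le hq h1)
  have h3 : ∀ w ∈ Ideal.span {x : SUq (m + 1) q | ∃ a b, x = baseGen hq a b},
      (SUq.isQGen hq).starFun hq w ∈ Submodule.span ℂ {w | ∃ b ∈ coinvariants (suCoaction m hq),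
        deltaHom m hq b = 0 ∧ ∃ v, w = b * v} := by
    intro w hw
    induction hw using Submodule.span_induction with
    | mem x hx =>
      obtain ⟨a, b, rfl⟩ := hx
      rw [starFun_baseGen]
      exact Submodule.subset_span ⟨_, baseGen_mem hq b a, deltaHom_baseGen hq b a, 1,
        (mul_one _).symm⟩
    | zero =>
      have : (SUq.isQGen (n := m + 1) hq).starFun hq 0 = 0 := by
        simpa using (SUq.isQGen (n := m + 1) hq).starFun_algebraMap hq 0
      rw [this]
      exact Submodule.zero_mem _
    | add x y _ _ hx hy => rw [IsQGen.starFun_add]; exact Submodule.add_mem _ hx hy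
    | smul c x _ hx =>
      rw [smul_eq_mul, IsQGen.starFun_mul]
      refine Submodule.span_induction ?_ ?_ ?_ ?_ hx
      · rintro _ ⟨b, hb, hb', v, rfl⟩
        exact Submodule.subset_span ⟨b, hb, hb', v * (SUq.isQGen hq).starFun hq c, mul_assoc _ _ _⟩
      · rw [zero_mul]; exact Submodule.zero_mem _
      · intro a b _ _ ha hb; rw [add_mul]; exact Submodule.add_mem _ ha hb
      · intro a b _ hb; rw [smul_mul_assoc]; exact Submodule.smul_mem _ _ hb
  have h4 := h3 _ h2
  rwa [IsQGen.starFun_starFun] at h4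

end Kernel

/-! ### The bundle -/

section Bundle

variable {m : ℕ} {q : ℝ}

theorem canonicalMap_tmul {P A : Type} [Ring P] [Algebra ℂ P] [Ring A] [Algebra ℂ A]
    (β : P →ₐ[ℂ] A ⊗[ℂ] P) (u w : P) :
    canonicalMap β (u ⊗ₜ[ℂ] w) = β u * (1 ⊗ₜ[ℂ] w) := rfl

theorem mul_mem_range_canonicalMap {P A : Type} [Ring P] [Algebra ℂ P] [Ring A] [Algebra ℂ A]
    (β : P →ₐ[ℂ] A ⊗[ℂ] P) (u w : P) {x : A ⊗[ℂ] P} (hx : x ∈ LinearMap.range (canonicalMap β)) :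
    β u * x * (1 ⊗ₜ[ℂ] w) ∈ LinearMap.range (canonicalMap β) := by
  obtain ⟨y, rfl⟩ := hx
  induction y using TensorProduct.induction_on with
  | zero => simp
  | tmul a b =>
    refine ⟨(u * a) ⊗ₜ[ℂ] (b * w), ?_⟩
    rw [canonicalMap_tmul, canonicalMap_tmul, map_mul, mul_assoc, mul_assoc, mul_assoc,
      Algebra.TensorProduct.tmul_mul_tmul, one_mul]
  | add a b ha hb => rw [map_add, mul_add, add_mul]; exact Submodule.add_mem _ ha hb

/-- Since `a ⊗ 1` commutes with `1 ⊗ w`, it can be moved next to `β u`. Hence the `a` with `a ⊗ 1`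
in the range are closed under products, and surjectivity can be tested on generators. -/
theorem mul_tmul_one_mem_range {P A : Type} [Ring P] [Algebra ℂ P] [Ring A] [Algebra ℂ A]
    (β : P →ₐ[ℂ] A ⊗[ℂ] P) {a : A} (ha : a ⊗ₜ[ℂ] (1 : P) ∈ LinearMap.range (canonicalMap β))
    {x : A ⊗[ℂ] P} (hx : x ∈ LinearMap.range (canonicalMap β)) :
    x * (a ⊗ₜ[ℂ] 1) ∈ LinearMap.range (canonicalMap β) := by
  obtain ⟨y, rfl⟩ := hx
  induction y using TensorProduct.induction_on with
  | zero => simp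
  | tmul u w =>
    have h : canonicalMap β (u ⊗ₜ[ℂ] w) * (a ⊗ₜ[ℂ] 1) = β u * (a ⊗ₜ[ℂ] 1) * (1 ⊗ₜ[ℂ] w) := by
      simp [canonicalMap_tmul, mul_assoc]
    rw [h]
    exact mul_mem_range_canonicalMap β u w ha
  | add a b ha hb => rw [map_add, add_mul]; exact Submodule.add_mem _ ha hb

theorem canonicalMap_surjective (hq : 0 < q) :
    Function.Surjective (canonicalMap (suCoaction m hq)) := by
  have h1 : ∀ i j, deltaHom m hq (SUq.t i j) ⊗ₜ[ℂ] (1 : SUq (m + 1) q) ∈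
      LinearMap.range (canonicalMap (suCoaction m hq)) := fun i j => by
    -- The preimage `t^i_k ⊗ s^k_j` is `u₁ ⊗ S(u₂)` for `u = t^i_j`.
    refine ⟨∑ k, SUq.t i k ⊗ₜ[ℂ] (SUq.isQGen hq).s hq k j, ?_⟩
    simp only [map_sum, canonicalMap_tmul, suCoaction_t, Finset.sum_mul,
      Algebra.TensorProduct.tmul_mul_tmul, mul_one]
    rw [Finset.sum_comm]
    simp only [← TensorProduct.tmul_sum, ((SUq.isQGen hq).matInv hq).mul_eq]
    rw [Finset.sum_eq_single j (fun k _ hk => by rw [if_neg hk, TensorProduct.tmul_zero])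
      fun h => (h (Finset.mem_univ _)).elim, if_pos rfl]
  have h2 : ∀ a : Uq m q, a ⊗ₜ[ℂ] (1 : SUq (m + 1) q) ∈
      LinearMap.range (canonicalMap (suCoaction m hq)) := by
    intro a
    induction a using (Uq.isQGen hq).induction with
    | algebraMap c =>
      refine ⟨algebraMap ℂ _ c ⊗ₜ[ℂ] 1, ?_⟩
      rw [canonicalMap_tmul, AlgHom.commutes, Algebra.TensorProduct.algebraMap_apply]
      simp
    | add a b ha hb => rw [TensorProduct.add_tmul]; exact Submodule.add_mem _ ha hb
    | mul a b ha hb =>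
      have : (a * b) ⊗ₜ[ℂ] (1 : SUq (m + 1) q) = (a ⊗ₜ[ℂ] 1) * (b ⊗ₜ[ℂ] 1) := by simp
      rw [this]
      exact mul_tmul_one_mem_range _ hb ha
    | gen i j =>
      have := h1 i.succ j.succ
      rwa [deltaHom_t] at this
    | inv =>
      have := h1 0 0
      rwa [deltaHom_t] at this
  intro x
  change x ∈ LinearMap.range (canonicalMap (suCoaction m hq))
  induction x using TensorProduct.induction_on with
  | zero => exact Submodule.zero_mem _
  | tmul a w =>
    have := mul_mem_range_canonicalMap (suCoaction m hq) 1 w (h2 a)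
    rw [map_one, one_mul] at this
    simpa using this
  | add a b ha hb => exact Submodule.add_mem _ ha hb

theorem suCoaction_coassoc (hq : 0 < q) :
    ((Algebra.TensorProduct.assoc ℂ ℂ ℂ (Uq m q) (Uq m q) (SUq (m + 1) q)).toAlgHom.comp
      (Algebra.TensorProduct.map ((Uq.isQGen hq).comul hq) (AlgHom.id ℂ _))).comp
        (suCoaction m hq) =
    (Algebra.TensorProduct.map (AlgHom.id ℂ _) (suCoaction m hq)).comp (suCoaction m hq) := by
  have h1 : ∀ i j, (Uq.isQGen hq).comul hq (deltaHom m hq (SUq.t i j)) =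
      ∑ k, deltaHom m hq (SUq.t i k) ⊗ₜ[ℂ] deltaHom m hq (SUq.t k j) := fun i j => by
    have h2 := DFunLike.congr_fun (deltaHom_isHopfStarHom m hq).map_comul (SUq.t i j)
    refine h2.trans ?_
    change Algebra.TensorProduct.map _ _ ((SUq.isQGen hq).comul hq (SUq.t i j)) = _
    rw [(SUq.isQGen hq).comul_t, map_sum]
    rfl
  refine (SUq.isQGen hq).hom_ext fun i j => ?_
  rw [AlgHom.comp_apply, AlgHom.comp_apply, AlgHom.comp_apply, suCoaction_t, map_sum, map_sum,
    map_sum]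
  simp only [Algebra.TensorProduct.map_tmul, h1, TensorProduct.sum_tmul, map_sum,
    AlgHom.id_apply, suCoaction_t, TensorProduct.tmul_sum]
  rw [Finset.sum_comm]
  rfl

theorem suCoaction_counit (hq : 0 < q) :
    (Algebra.TensorProduct.map (Uq.isQGen hq).counit (AlgHom.id ℂ _)).comp (suCoaction m hq) =
      (Algebra.TensorProduct.lid ℂ (SUq (m + 1) q)).symm.toAlgHom := by
  have h1 : ∀ i j, (Uq.isQGen hq).counit (deltaHom m hq (SUq.t i j)) =
      if i = j then 1 else 0 := fun i j =>
    (DFunLike.congr_fun (deltaHom_isHopfStarHom m hq).map_counit (SUq.t i j)).trans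
      ((SUq.isQGen hq).counit_t i j)
  refine (SUq.isQGen hq).hom_ext fun i j => ?_
  rw [AlgHom.comp_apply, suCoaction_t, map_sum]
  simp only [Algebra.TensorProduct.map_tmul, h1, TensorProduct.ite_tmul, AlgHom.id_apply]
  simp

/-- The map `u ⊗ w ↦ u₁ ⊗ S(u₂)w`. -/
def inverseCanonicalMap (hq : 0 < q) :
    SUq (m + 1) q ⊗[ℂ] SUq (m + 1) q →ₗ[ℂ] SUq (m + 1) q ⊗[ℂ] SUq (m + 1) q :=
  TensorProduct.map LinearMap.id
      (LinearMap.mul' ℂ _ ∘ₗ ((SUq.isQGen hq).antipode hq).rTensor (SUq (m + 1) q)) ∘ₗ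
    (TensorProduct.assoc ℂ _ _ _).toLinearMap ∘ₗ
    ((SUq.isQGen hq).comul hq).toLinearMap.rTensor (SUq (m + 1) q)

/-- By coassociativity and the antipode and counit axioms, `u₁ ⊗ S(u₂)u₃ = u ⊗ 1`. -/
theorem inverseCanonicalMap_comul (hq : 0 < q) (u : SUq (m + 1) q) :
    inverseCanonicalMap hq ((SUq.isQGen hq).comul hq u) = u ⊗ₜ[ℂ] 1 := by
  have h1 := DFunLike.congr_fun ((SUq.isQGen (n := m + 1) hq).hopfStar hq).coassoc u
  have h2 : (TensorProduct.assoc ℂ _ _ _)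
      (((SUq.isQGen hq).comul hq).toLinearMap.rTensor (SUq (m + 1) q)
        ((SUq.isQGen hq).comul hq u)) =
      ((SUq.isQGen hq).comul hq).toLinearMap.lTensor (SUq (m + 1) q)
        ((SUq.isQGen hq).comul hq u) := h1
  have h3 := DFunLike.congr_fun
    ((SUq.isQGen (n := m + 1) hq).hopfStar hq).lTensor_counit_comp_comul u
  have h4 : (SUq.isQGen hq).counit.toLinearMap.lTensor (SUq (m + 1) q)
      ((SUq.isQGen hq).comul hq u) = u ⊗ₜ[ℂ] 1 := h3
  have h5 : ∀ x : SUq (m + 1) q ⊗[ℂ] SUq (m + 1) q, TensorProduct.map LinearMap.id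
      (LinearMap.mul' ℂ _ ∘ₗ ((SUq.isQGen hq).antipode hq).rTensor (SUq (m + 1) q))
      (((SUq.isQGen hq).comul hq).toLinearMap.lTensor (SUq (m + 1) q) x) =
      (Algebra.linearMap ℂ (SUq (m + 1) q)).lTensor (SUq (m + 1) q)
        ((SUq.isQGen hq).counit.toLinearMap.lTensor (SUq (m + 1) q) x) := by
    intro x
    induction x using TensorProduct.induction_on with
    | zero => simp
    | tmul a b =>
      rw [LinearMap.lTensor_tmul, LinearMap.lTensor_tmul, LinearMap.lTensor_tmul,
        TensorProduct.map_tmul]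
      exact congrArg (a ⊗ₜ[ℂ] ·) ((SUq.isQGen hq).antipode_left hq b)
    | add a b ha hb => simp only [map_add, ha, hb]
  rw [inverseCanonicalMap, LinearMap.comp_apply, LinearMap.comp_apply]
  refine (congrArg _ h2).trans ((h5 _).trans ?_)
  rw [h4, LinearMap.lTensor_tmul, Algebra.linearMap_apply, map_one]

theorem inverseCanonicalMap_mul (hq : 0 < q) (x : SUq (m + 1) q ⊗[ℂ] SUq (m + 1) q)
    (w : SUq (m + 1) q) : inverseCanonicalMap hq (x * (1 ⊗ₜ[ℂ] w)) =
      inverseCanonicalMap hq x * (1 ⊗ₜ[ℂ] w) := by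
  induction x using TensorProduct.induction_on with
  | zero => simp
  | tmul a b =>
    rw [Algebra.TensorProduct.tmul_mul_tmul, mul_one, inverseCanonicalMap]
    simp only [LinearMap.comp_apply, LinearMap.rTensor_tmul]
    generalize ((SUq.isQGen hq).comul hq).toLinearMap a = y
    induction y using TensorProduct.induction_on with
    | zero => simp
    | tmul c d => simp [mul_assoc]
    | add c d hc hd => simp only [TensorProduct.add_tmul, map_add, add_mul, hc, hd]
  | add a b ha hb => simp only [add_mul, map_add, ha, hb]

/-- For `b = baseGen hq a b` the image is `v₁ b₁ ⊗ S(b₂) S(v₂) w`. The legs `s^k_0 t^0_l` occurring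
in `b₁` are coinvariant, so modulo horizontal forms they cross the tensor sign; then `b₁ S(b₂)` is
the counit of `b`, which is zero. -/
theorem inverseCanonicalMap_mul_baseGen_mem (hq : 0 < q) (v w : SUq (m + 1) q)
    (a b : Fin (m + 1)) : inverseCanonicalMap hq ((v * baseGen hq a b) ⊗ₜ[ℂ] w) ∈
      horizontalForms (coinvariants (suCoaction m hq)) := by
  set N := horizontalForms (coinvariants (suCoaction m hq))
  set s := (SUq.isQGen (n := m + 1) hq).s hq
  have hs : MatInv SUq.t s := (SUq.isQGen (n := m + 1) hq).matInv hq
  let S := (SUq.isQGen (n := m + 1) hq).antipode hq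
  have hN : ∀ (x z : SUq (m + 1) q) (k l : Fin (m + 1)), (x * (s k 0 * SUq.t 0 l)) ⊗ₜ[ℂ] z -
      x ⊗ₜ[ℂ] (s k 0 * SUq.t 0 l * z) ∈ N := fun x z k l => by
    rw [← neg_sub]
    exact Submodule.neg_mem _ (Submodule.subset_span ⟨x, _, s_mul_t_mem hq k l, z, rfl⟩)
  -- This is `∑ b₁ S(b₂)` for `b = s^a_0 t^0_b`, contracted from the inside by `t s = 1`.
  have hS : ∑ k, ∑ l, s k 0 * SUq.t 0 l * S (s a k * SUq.t l b) =
      if a = 0 ∧ b = 0 then 1 else 0 := by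
    have h1 : ∀ k l, s k 0 * SUq.t 0 l * S (s a k * SUq.t l b) =
        s k 0 * (SUq.t 0 l * s l b) * S (s a k) := fun k l => by
      simp only [S, s]
      rw [IsQGen.antipode_mul, IsQGen.antipode_t]
      simp only [mul_assoc]
    simp only [h1, ← Finset.sum_mul, ← Finset.mul_sum, hs.mul_eq]
    have h2 : ∑ k, s k 0 * S (s a k) = if a = 0 then 1 else 0 := by
      have h3 : ∀ k, s k 0 * S (s a k) = S (s a k * SUq.t k 0) := fun k => by
        simp only [S, s]
        rw [IsQGen.antipode_mul, IsQGen.antipode_t]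
      simp only [h3, ← map_sum, hs.eq_mul]
      rw [apply_ite S, map_zero]
      exact if_congr Iff.rfl ((SUq.isQGen (n := m + 1) hq).antipode_one hq) rfl
    by_cases hb : b = 0
    · simp [hb, h2]
    · simp [hb, Ne.symm hb]
  have hΔ : (SUq.isQGen hq).comul hq (baseGen hq a b) =
      ∑ k, ∑ l, (s k 0 * SUq.t 0 l) ⊗ₜ[ℂ] (s a k * SUq.t l b) -
        (if a = 0 ∧ b = 0 then (1 : ℂ) else 0) • 1 := by
    rw [baseGen, map_sub, map_mul, IsQGen.comul_s, IsQGen.comul_t, Finset.sum_mul_sum]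
    simp only [Algebra.TensorProduct.tmul_mul_tmul, apply_ite ((SUq.isQGen hq).comul hq), map_one,
      map_zero, ite_smul, one_smul, zero_smul]
    rfl
  rw [inverseCanonicalMap]
  simp only [LinearMap.comp_apply, LinearMap.rTensor_tmul, AlgHom.toLinearMap_apply, map_mul, hΔ]
  generalize (SUq.isQGen hq).comul hq v = y
  induction y using TensorProduct.induction_on with
  | zero => simp
  | tmul x y =>
    have h1 := Submodule.sum_mem N fun k (_ : k ∈ Finset.univ) =>
      Submodule.sum_mem N fun l (_ : l ∈ Finset.univ) => hN x (S (s a k * SUq.t l b) * (S y * w)) k l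
    simp only [Finset.sum_sub_distrib, ← TensorProduct.tmul_sum, ← mul_assoc, ← Finset.sum_mul] at h1
    rw [hS] at h1
    have h2 : ∀ c, S (y * c) = S c * S y := (SUq.isQGen hq).antipode_mul hq y
    refine (congrArg (· ∈ N) ?_).mp h1
    simp only [mul_sub, Finset.mul_sum, Algebra.TensorProduct.tmul_mul_tmul, mul_smul_comm, mul_one,
      TensorProduct.sub_tmul, TensorProduct.sum_tmul, map_sub, map_sum, LinearEquiv.coe_coe,
      TensorProduct.assoc_tmul, TensorProduct.map_tmul, LinearMap.id_apply, LinearMap.comp_apply,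
      LinearMap.rTensor_tmul, LinearMap.mul'_apply, ← TensorProduct.smul_tmul', map_smul]
    congr 1
    · refine Finset.sum_congr rfl fun k _ => Finset.sum_congr rfl fun l _ => ?_
      rw [mul_assoc x]
      exact congrArg _ (congrArg (· * w) (h2 _).symm)
    · split_ifs
      · rw [one_mul, one_smul]
      · rw [zero_mul, zero_mul, TensorProduct.tmul_zero, zero_smul]
  | add x y hx hy =>
    rw [add_mul, TensorProduct.add_tmul, map_add, map_add]
    exact Submodule.add_mem _ hx hy

theorem inverseCanonicalMap_mem (hq : 0 < q) {x : SUq (m + 1) q} (hx : deltaHom m hq x = 0)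
    (w : SUq (m + 1) q) : inverseCanonicalMap hq (x ⊗ₜ[ℂ] w) ∈
      horizontalForms (coinvariants (suCoaction m hq)) := by
  have h := rowColIdeal_le hq (ker_deltaHom_le hq hx)
  -- A left factor is carried along, because `rowColIdeal_le` describes the kernel by a left ideal.
  have key : ∀ v, inverseCanonicalMap hq ((v * x) ⊗ₜ[ℂ] w) ∈
      horizontalForms (coinvariants (suCoaction m hq)) := by
    clear hx
    induction h using Submodule.span_induction with
    | mem x hx =>
      obtain ⟨a, b, rfl⟩ := hx
      exact fun v => inverseCanonicalMap_mul_baseGen_mem hq v w a b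
    | zero => intro v; simp
    | add a b _ _ ha hb =>
      intro v
      rw [mul_add, TensorProduct.add_tmul, map_add]
      exact Submodule.add_mem _ (ha v) (hb v)
    | smul c x _ hx =>
      intro v
      rw [smul_eq_mul, ← mul_assoc]
      exact hx _
  simpa using key 1

theorem canonicalMap_suCoaction (hq : 0 < q) (x : SUq (m + 1) q ⊗[ℂ] SUq (m + 1) q) :
    canonicalMap (suCoaction m hq) x = (deltaHom m hq).toLinearMap.rTensor (SUq (m + 1) q)
      (canonicalMap ((SUq.isQGen hq).comul hq) x) := by
  have h : ∀ z : SUq (m + 1) q ⊗[ℂ] SUq (m + 1) q,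
      (deltaHom m hq).toLinearMap.rTensor (SUq (m + 1) q) z =
        Algebra.TensorProduct.map (deltaHom m hq) (AlgHom.id ℂ _) z := fun _ => rfl
  induction x using TensorProduct.induction_on with
  | zero => simp
  | tmul u w =>
    rw [h, canonicalMap_tmul, canonicalMap_tmul, suCoaction_apply, map_mul,
      Algebra.TensorProduct.map_tmul, map_one, AlgHom.id_apply]
  | add a b ha hb => simp only [map_add, ha, hb]

theorem inverseCanonicalMap_canonicalMap (hq : 0 < q) (x : SUq (m + 1) q ⊗[ℂ] SUq (m + 1) q) :
    inverseCanonicalMap hq (canonicalMap ((SUq.isQGen hq).comul hq) x) = x := by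
  induction x using TensorProduct.induction_on with
  | zero => simp
  | tmul u w =>
    rw [canonicalMap_tmul, inverseCanonicalMap_mul, inverseCanonicalMap_comul,
      Algebra.TensorProduct.tmul_mul_tmul, mul_one, one_mul]
  | add a b ha hb => simp only [map_add, ha, hb]

/-- The canonical map is `δ ⊗ id` after the canonical map of the coproduct, which has a left
inverse. By right exactness of the tensor product the kernel of `δ ⊗ id` comes from `ker δ ⊗ P`,
whose image under that left inverse is horizontal. -/
theorem ker_canonicalMap_le (hq : 0 < q) : LinearMap.ker (canonicalMap (suCoaction m hq)) ≤
    horizontalForms (coinvariants (suCoaction m hq)) := by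
  intro x hx
  rw [LinearMap.mem_ker, canonicalMap_suCoaction] at hx
  rw [← inverseCanonicalMap_canonicalMap hq x]
  obtain ⟨y, hy⟩ := (rTensor_exact (SUq (m + 1) q)
    (LinearMap.exact_subtype_ker_map (deltaHom m hq).toLinearMap)
    (deltaHom_surjective m hq) _).1 hx
  rw [← hy]
  clear hx hy
  induction y using TensorProduct.induction_on with
  | zero => simp
  | tmul k w => exact inverseCanonicalMap_mem hq k.2 w
  | add a b ha hb => rw [map_add, map_add]; exact Submodule.add_mem _ ha hb

theorem isQuantumPrincipalBundle (hq : 0 < q) :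
    IsQuantumPrincipalBundle ((Uq.isQGen hq).hopfStar hq).toHopfStructure (suCoaction m hq)
      (coinvariants (suCoaction m hq)) where
  coassoc := suCoaction_coassoc hq
  counit := suCoaction_counit hq
  base := rfl
  free := canonicalMap_surjective hq
  exact := by
    refine le_antisymm (inf_le_left.trans (ker_canonicalMap_le hq)) (Submodule.span_le.2 ?_)
    rintro _ ⟨u, b, hb, v, rfl⟩
    refine ⟨?_, ?_⟩
    · rw [SetLike.mem_coe, LinearMap.mem_ker, map_sub, canonicalMap_tmul, canonicalMap_tmul,
        map_mul, mem_coinvariants_iff.1 hb, mul_assoc, Algebra.TensorProduct.tmul_mul_tmul,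
        mul_one, sub_self]
    · rw [SetLike.mem_coe, universalForms, LinearMap.mem_ker, map_sub, LinearMap.mul'_apply,
        LinearMap.mul'_apply, mul_assoc, sub_self]

end Bundle

/-! ### Explicit relations of the quantum sphere -/

section SphereRelations

variable {n : ℕ} {q : ℝ} {A : Type*} [Ring A] [Algebra ℂ A]

theorem lam_mul_rpow (n : ℕ) (hq : 0 < q) : lam n q * q ^ (1 / n : ℝ) = q := by
  rw [lam, ← Real.rpow_add hq, sub_add_cancel, Real.rpow_one]

theorem lam_inv_mul_rpow (n : ℕ) (hq : 0 < q) : (lam n q)⁻¹ * q ^ (-(1 / n : ℝ)) = q⁻¹ := by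
  rw [lam, ← Real.rpow_neg hq.le, ← Real.rpow_add hq, ← Real.rpow_neg_one]
  congr 1; ring

theorem ofReal_lam_inv_Rmat (hq : 0 < q) (i j k l : Fin n) :
    (((lam n q)⁻¹ * Rmat n q (i, j) (k, l) : ℝ) : ℂ) = (q : ℂ)⁻¹ *
      ((if k = i then if l = j then diagC q i j else 0 else 0) +
        if k = j then if l = i then offC q i j else 0 else 0) := by
  rw [Complex.ofReal_mul, ofReal_Rmat, ← mul_assoc, ← Complex.ofReal_mul, lam_inv_mul_rpow n hq,
    Complex.ofReal_inv]

theorem sum_vec_eq (hq : 0 < q) (v : Fin n → A) (i j : Fin n) :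
    ∑ k, ∑ l, (((lam n q)⁻¹ * Rmat n q (i, j) (k, l) : ℝ) : ℂ) • (v l * v k) =
      (q : ℂ)⁻¹ • (diagC q i j • (v j * v i) + offC q i j • (v i * v j)) := by
  simp only [ofReal_lam_inv_Rmat hq, mul_smul]
  simp only [← Finset.smul_sum (r := (q : ℂ)⁻¹)]
  simp [add_smul, ite_smul, Finset.sum_add_distrib]

theorem sum_covec_eq (hq : 0 < q) (x : Fin n → A) (i j : Fin n) :
    ∑ k, ∑ l, (((lam n q)⁻¹ * Rmat n q (k, l) (i, j) : ℝ) : ℂ) • (x l * x k) =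
      (q : ℂ)⁻¹ • (diagC q i j • (x j * x i) + offC q j i • (x i * x j)) := by
  simp only [Rmat_symm n q _ _ i j, ofReal_lam_inv_Rmat hq, mul_smul]
  simp only [← Finset.smul_sum (r := (q : ℂ)⁻¹)]
  simp [add_smul, ite_smul, Finset.sum_add_distrib, diagC_comm q i j]

theorem ofReal_lam_Rtilde (hq : 0 < q) (i j k l : Fin n) :
    ((lam n q * Rtilde n q (l, j) (i, k) : ℝ) : ℂ) =
      (if k = j then if l = i then if i = j then 1 else (q : ℂ) else 0 else 0) -
      if k = l then if i = j then
        if l < i then ((q : ℂ) ^ 2 - 1) * ((q : ℂ)⁻¹ ^ 2) ^ ((i : ℕ) - (l : ℕ)) else 0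
        else 0 else 0 := by
  have hq' := ofReal_ne_zero' hq
  rw [Rtilde_eq n q hq, RtildeExplicit, Matrix.of_apply, ← mul_assoc, lam_mul_rpow n hq]
  simp only [pow_mul, Complex.ofReal_mul, Complex.ofReal_add, Complex.ofReal_sub,
    apply_ite (Complex.ofReal), Complex.ofReal_inv, Complex.ofReal_zero, Complex.ofReal_one,
    Complex.ofReal_pow]
  have h1 : (q : ℂ) * (q : ℂ)⁻¹ = 1 := mul_inv_cancel₀ hq'
  have h2 : ∀ c : ℂ, (q : ℂ) * (((q : ℂ) - (q : ℂ)⁻¹) * c) = ((q : ℂ) ^ 2 - 1) * c := fun c => by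
    linear_combination -c * h1
  rw [mul_sub, mul_add, mul_ite, mul_ite, mul_ite, h1, h2, mul_zero, mul_one]
  grind

theorem sum_braid_eq_of_ne (hq : 0 < q) (v x : Fin n → A) {i j : Fin n} (hij : i ≠ j) :
    ∑ k, ∑ l, ((lam n q * Rtilde n q (l, j) (i, k) : ℝ) : ℂ) • (v k * x l) =
      (q : ℂ) • (v j * x i) := by
  simp only [ofReal_lam_Rtilde hq, if_neg hij, ite_self, sub_zero]
  simp [ite_smul]

theorem sum_braid_eq_self (hq : 0 < q) (v x : Fin n → A) (i : Fin n) :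
    ∑ k, ∑ l, ((lam n q * Rtilde n q (l, i) (i, k) : ℝ) : ℂ) • (v k * x l) =
      v i * x i - ∑ l, (if l < i then
        ((q : ℂ) ^ 2 - 1) * ((q : ℂ)⁻¹ ^ 2) ^ ((i : ℕ) - (l : ℕ)) else 0) • (v l * x l) := by
  simp only [ofReal_lam_Rtilde hq, if_true, sub_smul, Finset.sum_sub_distrib]
  simp [ite_smul]

/-- The diagonal entry is `1` minus a geometric sum over `c > a`. Reversing the order of the indices
brings it to the form of `sum_ite_lt_geom`, and it collapses to a single power. -/
theorem qMetric_eq (hq : 0 < q) (a b : Fin n) :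
    (qMetric n q a b : ℂ) = if a = b then ((q : ℂ)⁻¹ ^ 2) ^ (a.rev : ℕ) else 0 := by
  have hq' := ofReal_ne_zero' hq
  rw [qMetric, Finset.mul_sum, Complex.ofReal_sum]
  simp only [ofReal_lam_Rtilde hq]
  by_cases hab : a = b
  · subst hab
    have h1 : ∀ c : Fin n, ((if a = c then if a = c then if True then (1 : ℂ) else q else 0 else 0) -
        if a = a then if True then if a < c then
          ((q : ℂ) ^ 2 - 1) * ((q : ℂ)⁻¹ ^ 2) ^ ((c : ℕ) - (a : ℕ)) else 0 else 0 else 0) =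
        (if a = c then 1 else 0) - ((q : ℂ)⁻¹ ^ 2) ^ (a.rev : ℕ) * (if c.rev < a.rev then
          ((q : ℂ) ^ 2) ^ (c.rev : ℕ) * ((q : ℂ) ^ 2 - 1) else 0) := fun c => by
      simp only [if_true, Fin.rev_lt_rev]
      congr 1
      · split_ifs <;> rfl
      · rw [mul_ite, mul_zero]
        split_ifs with hac
        · have h2 : (a.rev : ℕ) = c.rev + (c - a) := by
            have : (a : ℕ) < c := hac
            have := c.2
            rw [Fin.val_rev, Fin.val_rev]; omega
          rw [h2, pow_add]
          have h3 : ((q : ℂ)⁻¹ ^ 2) ^ (c.rev : ℕ) * ((q : ℂ) ^ 2) ^ (c.rev : ℕ) = 1 := by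
            rw [← mul_pow, ← mul_pow, inv_mul_cancel₀ hq', one_pow, one_pow]
          linear_combination -((q : ℂ) ^ 2 - 1) * ((q : ℂ)⁻¹ ^ 2) ^ ((c : ℕ) - (a : ℕ)) * h3
        · rfl
    have h4 : ((q : ℂ)⁻¹ ^ 2) ^ (a.rev : ℕ) * ((q : ℂ) ^ 2) ^ (a.rev : ℕ) = 1 := by
      rw [← mul_pow, ← mul_pow, inv_mul_cancel₀ hq', one_pow, one_pow]
    have h5 := Equiv.sum_comp Fin.revPerm fun c : Fin n => if c < a.rev then
      ((q : ℂ) ^ 2) ^ (c : ℕ) * ((q : ℂ) ^ 2 - 1) else 0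
    rw [sum_ite_lt_geom] at h5
    simp only [Fin.revPerm_apply] at h5
    rw [Finset.sum_congr rfl fun c _ => h1 c, Finset.sum_sub_distrib, ← Finset.mul_sum, h5, if_pos rfl,
      Finset.sum_ite_eq, if_pos (Finset.mem_univ _)]
    linear_combination -h4
  · rw [if_neg hab]
    refine Finset.sum_eq_zero fun c _ => ?_
    rw [if_neg hab, sub_zero]
    split_ifs with h1 h2
    exacts [(hab (h1.trans h2.symm)).elim, rfl, rfl]

theorem sum_norm_eq (hq : 0 < q) (v x : Fin n → A) :
    ∑ a, ∑ b, (qMetric n q a b : ℂ) • (v a * x b) =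
      ∑ a, ((q : ℂ)⁻¹ ^ 2) ^ (a.rev : ℕ) • (v a * x a) := by
  simp only [qMetric_eq hq]
  simp [ite_smul]

end SphereRelations

/-! ### Universal property of the quantum sphere -/

namespace QSphere

variable {n : ℕ} {q : ℝ}

theorem induction {p : QSphere n q → Prop} (algebraMap : ∀ c, p (algebraMap ℂ _ c))
    (v : ∀ i, p (v i)) (x : ∀ i, p (x i)) (mul : ∀ a b, p a → p b → p (a * b))
    (add : ∀ a b, p a → p b → p (a + b)) (u : QSphere n q) : p u := by
  obtain ⟨u, rfl⟩ := RingQuot.mkAlgHom_surjective ℂ (SphereRel n q) u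
  induction u using FreeAlgebra.induction with
  | grade0 c => rw [AlgHom.commutes]; exact algebraMap c
  | grade1 i => cases i with
    | inl i => exact v i
    | inr i => exact x i
  | mul a b ha hb => rw [map_mul]; exact mul _ _ ha hb
  | add a b ha hb => rw [map_add]; exact add _ _ ha hb

/-- An algebra map out of the quantum sphere given by its values on the generators. -/
theorem exists_lift (hq : 0 < q) {C : Type*} [Ring C] [Algebra ℂ C] (w y : Fin n → C)
    (hv : ∀ i j, (q : ℂ) • (w i * w j) = diagC q i j • (w j * w i) + offC q i j • (w i * w j))
    (hx : ∀ i j, (q : ℂ) • (y i * y j) = diagC q i j • (y j * y i) + offC q j i • (y i * y j))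
    (hne : ∀ i j, i ≠ j → y i * w j = (q : ℂ) • (w j * y i))
    (hself : ∀ i, y i * w i = w i * y i - ∑ l, (if l < i then
      ((q : ℂ) ^ 2 - 1) * ((q : ℂ)⁻¹ ^ 2) ^ ((i : ℕ) - (l : ℕ)) else 0) • (w l * y l))
    (hnorm : ∑ a, ((q : ℂ)⁻¹ ^ 2) ^ (a.rev : ℕ) • (w a * y a) = 1) :
    ∃ f : QSphere n q →ₐ[ℂ] C, (∀ i, f (v i) = w i) ∧ ∀ i, f (x i) = y i := by
  have hq' := ofReal_ne_zero' hq
  let g : FreeAlgebra ℂ (Fin n ⊕ Fin n) →ₐ[ℂ] C := FreeAlgebra.lift ℂ (Sum.elim w y)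
  have gv : ∀ i, g (sphereFreeV i) = w i := fun i => by simp [g, sphereFreeV]
  have gx : ∀ i, g (sphereFreeX i) = y i := fun i => by simp [g, sphereFreeX]
  have hrel : ∀ ⦃a b⦄, SphereRel n q a b → g a = g b := by
    intro a b h
    cases h with
    | vec i j =>
      simp only [map_mul, map_sum, map_smul, gv]
      rw [sum_vec_eq hq, ← hv, smul_smul, inv_mul_cancel₀ hq', one_smul]
    | covec i j =>
      simp only [map_mul, map_sum, map_smul, gx]
      rw [sum_covec_eq hq, ← hx, smul_smul, inv_mul_cancel₀ hq', one_smul]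
    | braid i j =>
      simp only [map_mul, map_sum, map_smul, gv, gx]
      by_cases hij : i = j
      · subst hij
        rw [sum_braid_eq_self hq, hself]
      · rw [sum_braid_eq_of_ne hq _ _ hij, hne i j hij]
    | norm =>
      simp only [map_mul, map_sum, map_smul, gv, gx, map_one]
      rw [sum_norm_eq hq, hnorm]
  exact ⟨RingQuot.liftAlgHom ℂ ⟨g, hrel⟩,
    fun i => (RingQuot.liftAlgHom_mkAlgHom_apply ℂ g hrel _).trans (gv i),
    fun i => (RingQuot.liftAlgHom_mkAlgHom_apply ℂ g hrel _).trans (gx i)⟩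

/-! ### The grading of the quantum sphere -/

/-- The span of the `v^i`. -/
def spanV (n : ℕ) (q : ℝ) : Submodule ℂ (QSphere n q) := Submodule.span ℂ (Set.range v)

/-- The span of the `x_i`. -/
def spanX (n : ℕ) (q : ℝ) : Submodule ℂ (QSphere n q) := Submodule.span ℂ (Set.range x)

theorem v_mem (i : Fin n) : v i ∈ spanV n q := Submodule.subset_span ⟨i, rfl⟩

theorem x_mem (i : Fin n) : x i ∈ spanX n q := Submodule.subset_span ⟨i, rfl⟩

theorem spanX_mul_spanV_le : spanX n q * spanV n q ≤ spanV n q * spanX n q := by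
  rw [spanX, spanV, Submodule.span_mul_span, Submodule.span_le]
  rintro _ ⟨_, ⟨i, rfl⟩, _, ⟨j, rfl⟩, rfl⟩
  beta_reduce
  rw [braid]
  exact Submodule.sum_mem _ fun k _ => Submodule.sum_mem _ fun l _ =>
    Submodule.smul_mem _ _ (Submodule.mul_mem_mul (v_mem k) (x_mem l))

theorem one_mem_spanV_mul_spanX : (1 : QSphere n q) ∈ spanV n q * spanX n q := by
  rw [← norm_eq]
  exact Submodule.sum_mem _ fun k _ => Submodule.sum_mem _ fun l _ =>
    Submodule.smul_mem _ _ (Submodule.mul_mem_mul (v_mem k) (x_mem l))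

theorem spanX_mul_spanV_pow_le (k : ℕ) :
    spanX n q * spanV n q ^ k ≤ spanV n q ^ k * spanX n q := by
  induction k with
  | zero => rw [pow_zero, mul_one, one_mul]
  | succ k ih =>
    calc spanX n q * spanV n q ^ (k + 1) = spanX n q * spanV n q ^ k * spanV n q := by
          rw [pow_succ, mul_assoc]
      _ ≤ spanV n q ^ k * spanX n q * spanV n q := mul_le_mul_left ih _
      _ = spanV n q ^ k * (spanX n q * spanV n q) := mul_assoc _ _ _
      _ ≤ spanV n q ^ k * (spanV n q * spanX n q) := mul_le_mul_right spanX_mul_spanV_le _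
      _ = spanV n q ^ (k + 1) * spanX n q := by rw [pow_succ, mul_assoc]

/-- The sum contains `1` and is stable under left multiplication by `V`, and by `X` after reordering
with the braid relation. Hence it is stable under left multiplication by the whole algebra. -/
theorem iSup_spanV_pow_mul_spanX_pow :
    ⨆ p : ℕ × ℕ, spanV n q ^ p.1 * spanX n q ^ p.2 = ⊤ := by
  set T := ⨆ p : ℕ × ℕ, spanV n q ^ p.1 * spanX n q ^ p.2
  have hV : spanV n q * T ≤ T := by
    rw [Submodule.mul_iSup]
    refine iSup_le fun p => ?_
    rw [← mul_assoc, ← pow_succ']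
    exact le_iSup (fun p : ℕ × ℕ => spanV n q ^ p.1 * spanX n q ^ p.2) (p.1 + 1, p.2)
  have hX : spanX n q * T ≤ T := by
    rw [Submodule.mul_iSup]
    refine iSup_le fun p => ?_
    rw [← mul_assoc]
    refine (mul_le_mul_left (spanX_mul_spanV_pow_le p.1) _).trans ?_
    rw [mul_assoc, ← pow_succ']
    exact le_iSup (fun p : ℕ × ℕ => spanV n q ^ p.1 * spanX n q ^ p.2) (p.1, p.2 + 1)
  have h1 : (1 : QSphere n q) ∈ T := by
    refine le_iSup (fun p : ℕ × ℕ => spanV n q ^ p.1 * spanX n q ^ p.2) (0, 0) ?_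
    rw [pow_zero, pow_zero, one_mul]
    exact Submodule.one_le.1 le_rfl
  rw [eq_top_iff]
  intro u _
  suffices h : ∀ w ∈ T, u * w ∈ T by simpa using h 1 h1
  induction u using QSphere.induction with
  | algebraMap c => intro w hw; rw [← Algebra.smul_def]; exact Submodule.smul_mem _ _ hw
  | v i => exact fun w hw => hV (Submodule.mul_mem_mul (v_mem i) hw)
  | x i => exact fun w hw => hX (Submodule.mul_mem_mul (x_mem i) hw)
  | mul a b ha hb =>
    intro w hw
    rw [mul_assoc]
    exact ha trivial _ (hb trivial _ hw)
  | add a b ha hb =>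
    intro w hw
    rw [add_mul]
    exact Submodule.add_mem _ (ha trivial _ hw) (hb trivial _ hw)

theorem map_eq_of_mem_pow {A R : Type*} [Ring A] [Algebra ℂ A] [Ring R] [Algebra ℂ R]
    (f g : A →ₐ[ℂ] R) {z : R} (hz : ∀ a, Commute z (g a)) {M : Submodule ℂ A}
    (h : ∀ u ∈ M, f u = g u * z) (k : ℕ) : ∀ u ∈ M ^ k, f u = g u * z ^ k := by
  induction k with
  | zero =>
    intro u hu
    obtain ⟨c, rfl⟩ := Submodule.mem_one.1 (by simpa using hu)
    simp
  | succ k ih =>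
    intro u hu
    rw [pow_succ] at hu
    refine Submodule.mul_induction_on hu (fun a ha b hb => ?_) fun a b ha hb => ?_
    · rw [map_mul, map_mul, ih a ha, h b hb, pow_succ, mul_assoc, ← mul_assoc (z ^ k),
        ((hz b).pow_left k).eq]
      simp only [mul_assoc]
    · rw [map_add, map_add, ha, hb, add_mul]

theorem map_eq_of_mem_span {A R ι : Type*} [Ring A] [Algebra ℂ A] [Ring R] [Algebra ℂ R]
    (f g : A →ₐ[ℂ] R) {z : R} {w : ι → A} (h : ∀ i, f (w i) = g (w i) * z) :
    ∀ u ∈ Submodule.span ℂ (Set.range w), f u = g u * z := by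
  intro u hu
  refine Submodule.span_induction ?_ ?_ ?_ ?_ hu
  · rintro _ ⟨i, rfl⟩; exact h i
  · simp
  · intro a b _ _ ha hb; rw [map_add, map_add, ha, hb, add_mul]
  · intro c a _ ha; rw [map_smul, map_smul, ha, smul_mul_assoc]

/-- An algebra map rescaling the `v^i` by `z` and the `x_i` by `z'` acts on each bidegree by a
scale. -/
theorem map_eq_of_mem_mul {R : Type*} [Ring R] [Algebra ℂ R] (f g : QSphere n q →ₐ[ℂ] R) {z z' : R}
    (hz : ∀ a, Commute z (g a)) (hz' : ∀ a, Commute z' (g a))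
    (hv : ∀ i, f (v i) = g (v i) * z) (hx : ∀ i, f (x i) = g (x i) * z') (a b : ℕ) :
    ∀ u ∈ spanV n q ^ a * spanX n q ^ b, f u = g u * (z ^ a * z' ^ b) := by
  intro u hu
  refine Submodule.mul_induction_on hu (fun y hy w hw => ?_) fun y w hy hw => ?_
  · rw [map_mul, map_mul, map_eq_of_mem_pow f g hz (map_eq_of_mem_span f g hv) a y hy,
      map_eq_of_mem_pow f g hz' (map_eq_of_mem_span f g hx) b w hw, mul_assoc, ← mul_assoc (z ^ a),
      ((hz w).pow_left a).eq]
    simp only [mul_assoc]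
  · rw [map_add, map_add, hy, hw, add_mul]

theorem coaction_of_mem (a b : ℕ) {u : QSphere n q} (hu : u ∈ spanV n q ^ a * spanX n q ^ b) :
    coaction n q u = u ⊗ₜ[ℂ] (Uq.zStar q ^ a * Uq.z q ^ b) := by
  have := map_eq_of_mem_mul (coaction n q) Algebra.TensorProduct.includeLeft
    (z := 1 ⊗ₜ[ℂ] Uq.zStar q) (z' := 1 ⊗ₜ[ℂ] Uq.z q)
    (fun a => by simp [Commute, SemiconjBy]) (fun a => by simp [Commute, SemiconjBy])
    (fun i => by simp [coaction_v]) (fun i => by simp [coaction_x]) a b u hu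
  simpa [Algebra.TensorProduct.tmul_pow] using this

/-- The character `z ↦ T` of `U_q(1)` with values in Laurent polynomials. -/
def degreeHom (hq : 0 < q) : Uq 1 q →ₐ[ℂ] LaurentPolynomial ℂ :=
  have hF : Frt q fun _ _ : Fin 1 => (LaurentPolynomial.T 1 : LaurentPolynomial ℂ) :=
    fun i j a b => by simp [Subsingleton.elim i j, Subsingleton.elim a b, diagC, offC]
  have hd : detW q (fun _ _ : Fin 1 => (LaurentPolynomial.T 1 : LaurentPolynomial ℂ)) =
      LaurentPolynomial.T 1 := by rw [← hF.qDet_eq hq, qDet_one]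
  (Uq.isQGen hq).liftHom (fun _ _ => LaurentPolynomial.T 1) (LaurentPolynomial.T (-1)) hF
    (by rw [hd, ← LaurentPolynomial.T_add]; simp)
    (by rw [hd, ← LaurentPolynomial.T_add]; simp) fun h => h.elim

theorem degreeHom_z (hq : 0 < q) : degreeHom hq (Uq.z q) = LaurentPolynomial.T 1 := by
  rw [degreeHom]
  exact IsQGen.liftHom_t _ _ _ _ _ _ _ 0 0

theorem degreeHom_zStar (hq : 0 < q) : degreeHom hq (Uq.zStar q) = LaurentPolynomial.T (-1) := by
  rw [degreeHom]
  exact IsQGen.liftHom_d _ _ _ _ _ _ _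

/-- On bidegree `(a, b)` the coaction multiplies by `z^{*a} z^b`. Since `U_q(1)` maps to Laurent
polynomials, these are told apart by `b - a`, and taking the constant coefficient projects onto the
bidegrees with `a = b`. -/
theorem CPq_eq_iSup (hq : 0 < q) : Subalgebra.toSubmodule (CPq n q) =
    ⨆ k : ℕ, spanV n q ^ k * spanX n q ^ k := by
  apply le_antisymm
  · intro u hu
    let c : Uq 1 q →ₗ[ℂ] ℂ := Finsupp.lapply 0 ∘ₗ
      (AddMonoidAlgebra.coeffLinearEquiv ℂ : LaurentPolynomial ℂ ≃ₗ[ℂ] (ℤ →₀ ℂ)).toLinearMap ∘ₗ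
        (degreeHom hq).toLinearMap
    have hc : ∀ a b : ℕ, c (Uq.zStar q ^ a * Uq.z q ^ b) = if a = b then 1 else 0 := fun a b => by
      change (degreeHom hq (Uq.zStar q ^ a * Uq.z q ^ b)).coeff 0 = _
      rw [map_mul, map_pow, map_pow, degreeHom_z, degreeHom_zStar, LaurentPolynomial.T_pow,
        LaurentPolynomial.T_pow, ← LaurentPolynomial.T_add, LaurentPolynomial.T_apply]
      refine if_congr ?_ rfl rfl
      omega
    -- This map fixes invariant elements, kills the bidegrees with `a ≠ b` and is the identity on
    -- the others.
    let π : QSphere n q →ₗ[ℂ] QSphere n q :=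
      (TensorProduct.rid ℂ _).toLinearMap ∘ₗ c.lTensor _ ∘ₗ (coaction n q).toLinearMap
    have h1 : π u = u := by
      have : coaction n q u = u ⊗ₜ[ℂ] 1 := hu
      have h := hc 0 0
      rw [pow_zero, pow_zero, one_mul, if_pos rfl] at h
      simp [π, this, h]
    rw [← h1]
    have h2 : u ∈ ⨆ p : ℕ × ℕ, spanV n q ^ p.1 * spanX n q ^ p.2 :=
      iSup_spanV_pow_mul_spanX_pow ▸ Submodule.mem_top
    refine Submodule.iSup_induction _ (motive := fun u => π u ∈ _) h2 (fun p w hw => ?_) ?_ ?_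
    · have h3 : π w = (if p.1 = p.2 then (1 : ℂ) else 0) • w := by
        simp only [π, LinearMap.comp_apply, AlgHom.toLinearMap_apply, coaction_of_mem _ _ hw,
          LinearMap.lTensor_tmul, hc, LinearEquiv.coe_coe, TensorProduct.rid_tmul]
      rw [h3]
      split_ifs with hp
      · rw [one_smul]
        rw [← hp] at hw
        exact le_iSup (fun k : ℕ => spanV n q ^ k * spanX n q ^ k) p.1 hw
      · rw [zero_smul]; exact Submodule.zero_mem _
    · rw [map_zero]; exact Submodule.zero_mem _
    · intro a b ha hb; rw [map_add]; exact Submodule.add_mem _ ha hb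
  · refine iSup_le fun k u hu => ?_
    change coaction n q u = u ⊗ₜ[ℂ] 1
    rw [coaction_of_mem k k hu, ((show Commute (Uq.zStar q) (Uq.z q) from
      (Uq.zStar_mul_z q).trans (Uq.z_mul_zStar q).symm).mul_pow k).symm, Uq.zStar_mul_z, one_pow]

/-- The norm relation writes `1` as an element of `VX`, which is inserted in the middle. -/
theorem monotone_spanV_pow_mul_spanX_pow :
    Monotone fun k : ℕ => spanV n q ^ k * spanX n q ^ k := by
  refine monotone_nat_of_le_succ fun k => ?_
  calc spanV n q ^ k * spanX n q ^ k = spanV n q ^ k * 1 * spanX n q ^ k := by rw [mul_one]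
    _ ≤ spanV n q ^ k * (spanV n q * spanX n q) * spanX n q ^ k :=
      mul_le_mul_left (mul_le_mul_right (Submodule.one_le.2 one_mem_spanV_mul_spanX) _) _
    _ = spanV n q ^ (k + 1) * spanX n q ^ (k + 1) := by
      rw [pow_succ, pow_succ']; simp only [mul_assoc]

theorem mem_CPq_iff (hq : 0 < q) {u : QSphere n q} :
    u ∈ CPq n q ↔ ∃ k : ℕ, u ∈ spanV n q ^ k * spanX n q ^ k := by
  rw [← Subalgebra.mem_toSubmodule, CPq_eq_iSup hq,
    Submodule.mem_iSup_of_directed _ monotone_spanV_pow_mul_spanX_pow.directed_le]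

theorem star_mem_spanX_pow {u : QSphere n q} (k : ℕ) (hu : u ∈ spanV n q ^ k) :
    star u ∈ spanX n q ^ k := by
  induction k generalizing u with
  | zero =>
    rw [pow_zero] at hu ⊢
    obtain ⟨c, rfl⟩ := Submodule.mem_one.1 hu
    exact Submodule.mem_one.2 ⟨star c, (star_algebraMap c).symm⟩
  | succ k ih =>
    rw [pow_succ] at hu
    refine Submodule.mul_induction_on hu (fun a ha b hb => ?_) fun a b ha hb => ?_
    · rw [star_mul, pow_succ']
      refine Submodule.mul_mem_mul ?_ (ih ha)
      refine Submodule.span_induction ?_ ?_ ?_ ?_ hb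
      · rintro _ ⟨i, rfl⟩
        rw [star_v]; exact x_mem i
      · rw [star_zero]; exact Submodule.zero_mem _
      · intro a b _ _ ha hb; rw [star_add]; exact Submodule.add_mem _ ha hb
      · intro c a _ ha; rw [star_smul]; exact Submodule.smul_mem _ _ ha
    · rw [star_add]; exact Submodule.add_mem _ ha hb

theorem star_mem_spanV_pow {u : QSphere n q} (k : ℕ) (hu : u ∈ spanX n q ^ k) :
    star u ∈ spanV n q ^ k := by
  induction k generalizing u with
  | zero =>
    rw [pow_zero] at hu ⊢
    obtain ⟨c, rfl⟩ := Submodule.mem_one.1 hu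
    exact Submodule.mem_one.2 ⟨star c, (star_algebraMap c).symm⟩
  | succ k ih =>
    rw [pow_succ] at hu
    refine Submodule.mul_induction_on hu (fun a ha b hb => ?_) fun a b ha hb => ?_
    · rw [star_mul, pow_succ']
      refine Submodule.mul_mem_mul ?_ (ih ha)
      refine Submodule.span_induction ?_ ?_ ?_ ?_ hb
      · rintro _ ⟨i, rfl⟩
        rw [star_x]; exact v_mem i
      · rw [star_zero]; exact Submodule.zero_mem _
      · intro a b _ _ ha hb; rw [star_add]; exact Submodule.add_mem _ ha hb
      · intro c a _ ha; rw [star_smul]; exact Submodule.smul_mem _ _ ha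
    · rw [star_add]; exact Submodule.add_mem _ ha hb

theorem star_mem_CPq (hq : 0 < q) {u : QSphere n q} (hu : u ∈ CPq n q) : star u ∈ CPq n q := by
  rw [mem_CPq_iff hq] at hu ⊢
  obtain ⟨k, hk⟩ := hu
  refine ⟨k, Submodule.mul_induction_on hk (fun a ha b hb => ?_) fun a b ha hb => ?_⟩
  · rw [star_mul]
    exact Submodule.mul_mem_mul (star_mem_spanV_pow k hb) (star_mem_spanX_pow k ha)
  · rw [star_add]; exact Submodule.add_mem _ ha hb

end QSphere

/-! ### The map from the quantum sphere to `SU_q(m + 1)` -/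

section SphereMap

variable {m : ℕ} {q : ℝ}

/-- Reversing the indices matches the order conventions of the sphere with those of the relations of
`t` and `s`. The factor `q^{i.rev}` absorbs the powers `q^{-2(i - l)}` in the braid relation, and it
turns the quantum norm into `∑ t 0 a * s a 0 = 1`. -/
theorem exists_sphereMap (m : ℕ) {q : ℝ} (hq : 0 < q) :
    ∃ f : QSphere (m + 1) q →ₐ[ℂ] SUq (m + 1) q,
      (∀ i, f (QSphere.v i) = (q : ℂ) ^ (i.rev : ℕ) • SUq.t 0 i.rev) ∧
      ∀ i, f (QSphere.x i) = (q : ℂ) ^ (i.rev : ℕ) • (SUq.isQGen hq).s hq i.rev 0 := by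
  have hq' := ofReal_ne_zero' hq
  have ht : Frt q (SUq.t : _ → _ → SUq (m + 1) q) := SUq.frt hq
  have hs : MatInv SUq.t ((SUq.isQGen hq).s hq) := (SUq.isQGen (n := m + 1) hq).matInv hq
  set s := (SUq.isQGen (n := m + 1) hq).s hq
  have hd : ∀ i j : Fin (m + 1), diagC q i.rev j.rev = diagC q i j := fun i j => by
    simp [diagC]
  have ho : ∀ i j : Fin (m + 1), offC q i.rev j.rev = offC q j i := fun i j => by
    simp [offC]
  have hpow : ∀ i l : Fin (m + 1), l < i → (q : ℂ) ^ (i.rev : ℕ) * (q : ℂ) ^ (i.rev : ℕ) =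
      ((q : ℂ)⁻¹ ^ 2) ^ ((i : ℕ) - (l : ℕ)) * ((q : ℂ) ^ (l.rev : ℕ) * (q : ℂ) ^ (l.rev : ℕ)) := by
    intro i l h
    have h1 : (l.rev : ℕ) = i.rev + (i - l) := by
      have : (l : ℕ) < i := h
      have := i.2
      rw [Fin.val_rev, Fin.val_rev]; omega
    have h2 : ((q : ℂ)⁻¹) ^ ((i : ℕ) - (l : ℕ)) * (q : ℂ) ^ ((i : ℕ) - (l : ℕ)) = 1 := by
      rw [← mul_pow, inv_mul_cancel₀ hq', one_pow]
    rw [h1, pow_add, ← pow_mul, mul_comm 2, pow_mul]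
    linear_combination (-(q : ℂ) ^ (i.rev : ℕ) * (q : ℂ) ^ (i.rev : ℕ)) *
      (1 + ((q : ℂ)⁻¹) ^ ((i : ℕ) - (l : ℕ)) * (q : ℂ) ^ ((i : ℕ) - (l : ℕ))) * h2
  refine QSphere.exists_lift hq _ _ (fun i j => ?_) (fun i j => ?_) (fun i j hij => ?_)
    (fun i => ?_) ?_
  · have := ht 0 0 i.rev j.rev
    rw [hd, ho] at this
    simp only [smul_mul_smul_comm, smul_comm _ ((q : ℂ) ^ (_ : ℕ) * (q : ℂ) ^ (_ : ℕ))]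
    rw [mul_comm ((q : ℂ) ^ (j.rev : ℕ)), ← smul_add, ← this]
    simp [diagC, offC]
  · have := ht.op_inv hs i.rev j.rev 0 0
    rw [hd, ho] at this
    simp only [← MulOpposite.op_mul, ← MulOpposite.op_smul, ← MulOpposite.op_add] at this
    have := MulOpposite.op_injective this
    simp only [smul_mul_smul_comm, smul_comm _ ((q : ℂ) ^ (_ : ℕ) * (q : ℂ) ^ (_ : ℕ))]
    rw [mul_comm ((q : ℂ) ^ (j.rev : ℕ)), ← smul_add, this]
    simp [diagC, offC]
  · simp only [smul_mul_smul_comm]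
    rw [ht.col_mul_row_of_ne hq hs fun h => hij (Fin.rev_injective h), smul_comm (q : ℂ),
      mul_comm ((q : ℂ) ^ (j.rev : ℕ))]
  · simp only [smul_mul_smul_comm]
    rw [ht.col_mul_row_self hq hs, smul_sub, ← Equiv.sum_comp Fin.revPerm, Finset.smul_sum]
    congr 1
    refine Finset.sum_congr rfl fun l _ => ?_
    rw [Fin.revPerm_apply, smul_smul, smul_smul]
    congr 1
    simp only [Fin.rev_lt_rev]
    split_ifs with h
    · rw [hpow i l h]; ring
    · ring
  · simp only [smul_mul_smul_comm]
    have h1 : ∀ a : Fin (m + 1), ((q : ℂ)⁻¹ ^ 2) ^ (a.rev : ℕ) • ((q : ℂ) ^ (a.rev : ℕ) *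
        (q : ℂ) ^ (a.rev : ℕ)) • (SUq.t 0 a.rev * s a.rev 0) = SUq.t 0 a.rev * s a.rev 0 := by
      intro a
      rw [smul_smul, ← sq, pow_right_comm, ← mul_pow, ← mul_pow,
        inv_mul_cancel₀ hq', one_pow, one_pow, one_smul]
    rw [Finset.sum_congr rfl fun a _ => h1 a]
    have h2 := Equiv.sum_comp Fin.revPerm fun a => SUq.t 0 a * s a 0
    simp only [Fin.revPerm_apply] at h2
    rw [h2, hs.mul_eq, if_pos rfl]

/-- The map from the quantum sphere to `SU_q(m + 1)`. -/
def sphereMap (m : ℕ) {q : ℝ} (hq : 0 < q) : QSphere (m + 1) q →ₐ[ℂ] SUq (m + 1) q :=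
  (exists_sphereMap m hq).choose

theorem sphereMap_v (hq : 0 < q) (i : Fin (m + 1)) : sphereMap m hq (QSphere.v i) =
    (q : ℂ) ^ (i.rev : ℕ) • SUq.t 0 i.rev := (exists_sphereMap m hq).choose_spec.1 i

theorem sphereMap_x (hq : 0 < q) (i : Fin (m + 1)) : sphereMap m hq (QSphere.x i) =
    (q : ℂ) ^ (i.rev : ℕ) • (SUq.isQGen hq).s hq i.rev 0 := (exists_sphereMap m hq).choose_spec.2 i

theorem sphereMap_star (hq : 0 < q) (u : QSphere (m + 1) q) :
    sphereMap m hq (star u) = (SUq.isQGen hq).starFun hq (sphereMap m hq u) := by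
  induction u using QSphere.induction with
  | algebraMap c =>
    rw [QSphere.star_algebraMap, AlgHom.commutes, AlgHom.commutes, IsQGen.starFun_algebraMap]
  | v i =>
    rw [QSphere.star_v, sphereMap_v, sphereMap_x, IsQGen.starFun_smul, IsQGen.starFun_t]
    simp
  | x i =>
    rw [QSphere.star_x, sphereMap_v, sphereMap_x, IsQGen.starFun_smul, IsQGen.starFun_s]
    simp
  | mul a b ha hb => rw [star_mul, map_mul, hb, ha, map_mul, IsQGen.starFun_mul]
  | add a b ha hb => rw [star_add, map_add, ha, hb, map_add, IsQGen.starFun_add]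

theorem sphereMap_mem (hq : 0 < q) {u : QSphere (m + 1) q} (hu : u ∈ CPq (m + 1) q) :
    sphereMap m hq u ∈ coinvariants (suCoaction m hq) := by
  obtain ⟨k, hk⟩ := (QSphere.mem_CPq_iff hq).1 hu
  rw [mem_coinvariants_iff]
  have := QSphere.map_eq_of_mem_mul ((suCoaction m hq).comp (sphereMap m hq))
    ((Algebra.TensorProduct.includeRight : _ →ₐ[ℂ] Uq m q ⊗[ℂ] SUq (m + 1) q).comp (sphereMap m hq))
    (z := Uq.detStar m q ⊗ₜ[ℂ] 1) (z' := detW q (Uq.t : Fin m → Fin m → Uq m q) ⊗ₜ[ℂ] 1)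
    (fun a => by simp [Commute, SemiconjBy]) (fun a => by simp [Commute, SemiconjBy])
    (fun i => by
      rw [AlgHom.comp_apply, AlgHom.comp_apply, sphereMap_v, map_smul, suCoaction_t_zero, map_smul]
      simp)
    (fun i => by
      rw [AlgHom.comp_apply, AlgHom.comp_apply, sphereMap_x, map_smul, suCoaction_s_zero, map_smul]
      simp) k k u hk
  refine this.trans ?_
  have hc : Commute (Uq.detStar m q) (detW q (Uq.t : Fin m → Fin m → Uq m q)) :=
    (Uq.isQGen hq).mul_det.trans (Uq.isQGen hq).det_mul.symm
  simp only [Algebra.TensorProduct.tmul_pow, one_pow, Algebra.TensorProduct.tmul_mul_tmul, mul_one]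
  rw [← hc.mul_pow, (Uq.isQGen hq).mul_det, one_pow]
  simp

end SphereMap

/-! ### Upper triangular quantum matrices supported on the first row and the diagonal -/

/-- The matrix with first row `(e, x)` and remaining diagonal entries `y`. -/
def rowDiagMat {m : ℕ} {A : Type*} [Zero A] (e : A) (x y : Fin m → A) :
    Fin (m + 1) → Fin (m + 1) → A :=
  Fin.cons (Fin.cons e x) fun i => Fin.cons 0 fun j => if i = j then y i else 0

section RowDiag

variable {m : ℕ} {A : Type} [Ring A]

theorem rowDiagMat_zero_zero (e : A) (x y : Fin m → A) : rowDiagMat e x y 0 0 = e := rfl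

theorem rowDiagMat_zero_succ (e : A) (x y : Fin m → A) (j : Fin m) :
    rowDiagMat e x y 0 j.succ = x j := rfl

theorem rowDiagMat_succ_zero (e : A) (x y : Fin m → A) (i : Fin m) :
    rowDiagMat e x y i.succ 0 = 0 := rfl

theorem rowDiagMat_succ_succ (e : A) (x y : Fin m → A) (i j : Fin m) :
    rowDiagMat e x y i.succ j.succ = if i = j then y i else 0 := rfl

variable [Algebra ℂ A] {q : ℝ}

/-- The relations that make `rowDiagMat e x y` a quantum matrix. -/
structure RowDiagRel (q : ℝ) (e : A) (x y : Fin m → A) : Prop where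
  e_x : ∀ b, x b * e = (q : ℂ) • (e * x b)
  x_eq_zero : ∀ a b, a < b → x b = 0
  y_x_self : ∀ b, y b * x b = (q : ℂ) • (x b * y b)
  y_x_ne : ∀ b c, b ≠ c → y c * x b = x b * y c
  e_y : ∀ c, y c * e = e * y c
  y_y : ∀ b c, y b * y c = y c * y b

/-- A check by position of the four indices. The condition `x_eq_zero` leaves at most the entry `x
0`, which disposes of products `x a * x b` with `a ≠ b`. -/
theorem RowDiagRel.frt (hq : 0 < q) {e : A} {x y : Fin m → A} (h : RowDiagRel q e x y) :
    Frt q (rowDiagMat e x y) := by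
  have hq' := ofReal_ne_zero' hq
  have hk : ∀ z : A, ((q : ℂ) - (q : ℂ)⁻¹) • (q : ℂ) • z = ((q : ℂ) ^ 2 - 1) • z := fun z => by
    rw [smul_smul, sub_mul, inv_mul_cancel₀ hq', sq]
  have h1 : ∀ a b : Fin m, diagC q a.succ b.succ = diagC q a b := fun a b => by simp [diagC]
  have h2 : ∀ a b : Fin m, offC q a.succ b.succ = offC q a b := fun a b => by simp [offC]
  have h3 : ∀ a : Fin m, diagC q 0 a.succ = 1 := fun a => by simp [diagC, (Fin.succ_ne_zero _).symm]
  have h4 : ∀ a : Fin m, diagC q a.succ 0 = 1 := fun a => by simp [diagC, Fin.succ_ne_zero]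
  have h5 : ∀ a : Fin m, offC q 0 a.succ = (q : ℂ) - (q : ℂ)⁻¹ := fun a => by simp [offC]
  have h6 : ∀ a : Fin m, offC q a.succ 0 = 0 := fun a => by simp [offC]
  have h7 : diagC q (0 : Fin (m + 1)) 0 = q := by simp [diagC]
  have h8 : offC q (0 : Fin (m + 1)) 0 = 0 := by simp [offC]
  have h9 : ∀ z : A, z + (q : ℂ) • ((q : ℂ) - (q : ℂ)⁻¹) • z = (q : ℂ) • (q : ℂ) • z := fun z => by
    rw [smul_smul, smul_smul, mul_sub, mul_inv_cancel₀ hq', sub_smul, one_smul]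
    abel
  intro i j a b
  refine Fin.cases ?_ (fun i => ?_) i <;> refine Fin.cases ?_ (fun j => ?_) j <;>
    refine Fin.cases ?_ (fun a => ?_) a <;> refine Fin.cases ?_ (fun b => ?_) b <;>
    simp only [rowDiagMat_zero_zero, rowDiagMat_zero_succ, rowDiagMat_succ_zero,
      rowDiagMat_succ_succ, mul_zero, zero_mul, smul_zero, add_zero, zero_add, h1, h2, h3, h4, h5,
      h6, h7, h8, zero_smul, one_smul, h.e_x]
  · rw [smul_comm ((q : ℂ) - (q : ℂ)⁻¹) (q : ℂ)]
    exact (h9 _).symm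
  · rcases lt_trichotomy a b with hab | rfl | hab
    · simp [h.x_eq_zero a b hab]
    · simp [diagC, offC]
    · simp [h.x_eq_zero b a hab]
  · split_ifs <;> simp [h.e_y]
  · by_cases hjb : j = b <;> by_cases hja : j = a
    · subst hjb hja
      simp only [if_true, diagC, offC, lt_irrefl, if_false, zero_smul, add_zero, h.y_x_self]
      rw [smul_comm _ (q : ℂ) (x j * y j), h9]
    · subst hjb
      simp [hja, diagC, Ne.symm hja, h.y_x_ne a j (Ne.symm hja)]
    · subst hja
      rcases lt_trichotomy b j with hab | rfl | hab
      · simp [hjb, offC, hab]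
      · exact (hjb rfl).elim
      · simp [h.x_eq_zero j b hab, hjb]
    · simp [hja, hjb]
  · split_ifs <;> simp [h.e_y]
  · by_cases hia : i = a <;> by_cases hib : i = b
    · subst hia hib
      simp [diagC, offC, h.y_x_self]
    · subst hia
      simp [hib, diagC, h.y_x_ne b i (Ne.symm hib)]
    · subst hib
      rcases lt_trichotomy i a with hab | rfl | hab
      · simp [hia, h.x_eq_zero i a hab]
      · exact (hia rfl).elim
      · simp [hia, offC, hab.not_gt]
    · simp [hia, hib]
  · by_cases hia : i = a <;> by_cases hjb : j = b <;> by_cases hja : j = a <;>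
      by_cases hib : i = b <;> simp [hia, hjb, hja, hib, diagC, offC, h.y_y] <;> grind [h.y_y]

/-- The upper triangular matrix with a `2 × 2` block in the upper left corner and an identity block. -/
def elemMat {m : ℕ} (e x y : A) : Fin (m + 2) → Fin (m + 2) → A :=
  rowDiagMat e (Fin.cons x 0) (Fin.cons y 1)

theorem elemMat_zero_succ_zero (e x y : A) : (elemMat e x y : Fin (m + 2) → _ → A) 0 (Fin.succ 0) = x :=
  rfl

theorem elemMat_zero_succ_succ (e x y : A) (j : Fin m) : elemMat e x y 0 j.succ.succ = 0 := rfl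

theorem elemMat_succ_zero (e x y : A) (i : Fin (m + 1)) : elemMat e x y i.succ 0 = 0 := rfl

theorem elemMat_one_succ_zero (e x y : A) :
    (elemMat e x y : Fin (m + 2) → _ → A) (Fin.succ 0) (Fin.succ 0) = y := by
  rw [elemMat, rowDiagMat_succ_succ, if_pos rfl, Fin.cons_zero]

theorem elemMat_one_succ_succ (e x y : A) (j : Fin m) :
    elemMat e x y (Fin.succ 0) j.succ.succ = 0 := by
  rw [elemMat, rowDiagMat_succ_succ, if_neg (Fin.succ_ne_zero j).symm]

theorem frt_elemMat (hq : 0 < q) {e x y : A} (hx : x * e = (q : ℂ) • (e * x))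
    (hy : y * x = (q : ℂ) • (x * y)) (hey : y * e = e * y) :
    Frt q (elemMat e x y : Fin (m + 2) → _ → A) := by
  refine RowDiagRel.frt hq ⟨fun b => ?_, fun a b hab => ?_, fun b => ?_, fun b c hbc => ?_,
    fun c => ?_, fun b c => ?_⟩
  · refine Fin.cases ?_ (fun b => ?_) b <;> simp [hx]
  · have hb : b ≠ 0 := fun h => by simp [h] at hab
    obtain ⟨b, rfl⟩ := Fin.exists_succ_eq.2 hb
    rfl
  · refine Fin.cases ?_ (fun b => ?_) b <;> simp [hy]
  · revert hbc
    refine Fin.cases ?_ (fun b => ?_) b <;> refine Fin.cases ?_ (fun c => ?_) c <;> simp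
  · refine Fin.cases ?_ (fun c => ?_) c <;> simp [hey]
  · refine Fin.cases ?_ (fun b => ?_) b <;> refine Fin.cases ?_ (fun c => ?_) c <;> simp

theorem detW_elemMat (hq : 0 < q) {e x y : A} (hx : x * e = (q : ℂ) • (e * x))
    (hy : y * x = (q : ℂ) • (x * y)) (hey : y * e = e * y) (h1 : e * y = 1) :
    detW q (elemMat e x y : Fin (m + 2) → _ → A) = 1 := by
  -- In the transposed matrix the first row has only the entry `e`, so expansion along it applies.
  rw [← (frt_elemMat (m := m) hq hx hy hey).detW_transpose hq, detW_of_row fun j => rfl]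
  have h2 : (fun i j : Fin (m + 1) => elemMat e x y j.succ i.succ) =
      blockMat y fun i j : Fin m => if i = j then (1 : A) else 0 := by
    funext i j
    rw [elemMat, rowDiagMat_succ_succ]
    refine Fin.cases ?_ (fun i => ?_) i <;> refine Fin.cases ?_ (fun j => ?_) j <;>
      simp [blockMat_zero_zero, blockMat_zero_succ, blockMat_succ_zero, blockMat_succ_succ,
        (Fin.succ_ne_zero _).symm, eq_comm]
  have h3 := map_detW q (Algebra.ofId ℂ A) fun i j : Fin m => if i = j then (1 : ℂ) else 0
  rw [detW_one, map_one] at h3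
  simp only [apply_ite (Algebra.ofId ℂ A), map_one, map_zero] at h3
  rw [h2, detW_blockMat, ← h3, mul_one]
  exact h1

end RowDiag

/-! ### Triangular quantum matrices built from commuting `2 × 2` blocks -/

/-- Commuting families of solutions of the relations of an upper triangular `2 × 2` block. -/
structure IsBlockFamily {Ω A : Type*} [Ring A] [Algebra ℂ A] (q : ℝ) (e x y : Ω → A) : Prop where
  x_e : ∀ ω, x ω * e ω = (q : ℂ) • (e ω * x ω)
  y_x : ∀ ω, y ω * x ω = (q : ℂ) • (x ω * y ω)
  e_y : ∀ ω, e ω * y ω = 1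
  y_e : ∀ ω, y ω * e ω = 1
  comm : ∀ ω ω', ω ≠ ω' → ∀ a ∈ ({e ω, x ω, y ω} : Set A), ∀ b ∈ ({e ω', x ω', y ω'} : Set A),
    Commute a b

section BlockProducts

variable {Ω : Type*} {A : Type} [Ring A] [Algebra ℂ A] {q : ℝ} {e x y : Ω → A}

/-- The product of the blocks in positions `(0, 1), (1, 2), …`. -/
def upMat (e x y : Ω → A) : ∀ m : ℕ, (Fin m → Ω) → Fin (m + 1) → Fin (m + 1) → A
  | 0, _ => fun _ _ => 1
  | m + 1, κ => fun i j => ∑ k, elemMat (e (κ 0)) (x (κ 0)) (y (κ 0)) i k *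
      blockMat 1 (upMat e x y m (κ ∘ Fin.succ)) k j

/-- The product of the blocks in the opposite order. -/
def downMat (e x y : Ω → A) : ∀ m : ℕ, (Fin m → Ω) → Fin (m + 1) → Fin (m + 1) → A
  | 0, _ => fun _ _ => 1
  | m + 1, κ => fun i j => ∑ k, blockMat 1 (downMat e x y m (κ ∘ Fin.succ)) i k *
      elemMat (e (κ 0)) (x (κ 0)) (y (κ 0)) k j

theorem commute_blockMat {m : ℕ} {a b : A} {t : Fin m → Fin m → A} (hb : Commute a b)
    (h : ∀ i j, Commute a (t i j)) (i j : Fin (m + 1)) : Commute a (blockMat b t i j) := by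
  refine Fin.cases ?_ (fun i => ?_) i <;> refine Fin.cases ?_ (fun j => ?_) j
  · exact hb
  · exact Commute.zero_right a
  · exact Commute.zero_right a
  · exact h i j

theorem commute_elemMat {m : ℕ} {a e x y : A} (he : Commute a e) (hx : Commute a x)
    (hy : Commute a y) (i j : Fin (m + 2)) : Commute a (elemMat e x y i j) := by
  refine Fin.cases ?_ (fun i => ?_) i <;> refine Fin.cases ?_ (fun j => ?_) j
  · exact he
  · refine Fin.cases ?_ (fun j => ?_) j
    exacts [hx, Commute.zero_right a]
  · exact Commute.zero_right a
  · rw [elemMat, rowDiagMat_succ_succ]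
    split_ifs
    · refine Fin.cases ?_ (fun i => ?_) i
      exacts [hy, Commute.one_right a]
    · exact Commute.zero_right a

theorem commute_upMat {a : A} : ∀ {m : ℕ} {κ : Fin m → Ω}, (∀ j, ∀ b ∈ ({e (κ j), x (κ j),
    y (κ j)} : Set A), Commute a b) → ∀ i j, Commute a (upMat e x y m κ i j)
  | 0, _, _, _, _ => Commute.one_right a
  | m + 1, κ, h, i, j => Commute.sum_right _ _ _ fun k _ =>
    (commute_elemMat (h 0 _ (by simp)) (h 0 _ (by simp)) (h 0 _ (by simp)) i k).mul_right
      (commute_blockMat (Commute.one_right a) (commute_upMat fun j => h j.succ) k j)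

theorem commute_downMat {a : A} : ∀ {m : ℕ} {κ : Fin m → Ω}, (∀ j, ∀ b ∈ ({e (κ j), x (κ j),
    y (κ j)} : Set A), Commute a b) → ∀ i j, Commute a (downMat e x y m κ i j)
  | 0, _, _, _, _ => Commute.one_right a
  | m + 1, κ, h, i, j => Commute.sum_right _ _ _ fun k _ =>
    (commute_blockMat (Commute.one_right a) (commute_downMat fun j => h j.succ) i k).mul_right
      (commute_elemMat (h 0 _ (by simp)) (h 0 _ (by simp)) (h 0 _ (by simp)) k j)

theorem IsBlockFamily.commute_elemMat_upMat (h : IsBlockFamily q e x y) {m : ℕ} {n : ℕ}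
    {κ : Fin m → Ω} {ω : Ω} (hω : ∀ j, ω ≠ κ j) (i j : Fin (n + 2)) (k l : Fin (m + 1)) :
    Commute (elemMat (e ω) (x ω) (y ω) i j) (upMat e x y m κ k l) := by
  refine commute_upMat (fun j' b hb => (commute_elemMat ?_ ?_ ?_ i j).symm) k l <;>
    exact (h.comm _ _ (hω j') _ (by simp) b hb).symm

theorem IsBlockFamily.commute_elemMat_downMat (h : IsBlockFamily q e x y) {m : ℕ} {n : ℕ}
    {κ : Fin m → Ω} {ω : Ω} (hω : ∀ j, ω ≠ κ j) (i j : Fin (n + 2)) (k l : Fin (m + 1)) :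
    Commute (elemMat (e ω) (x ω) (y ω) i j) (downMat e x y m κ k l) := by
  refine commute_downMat (fun j' b hb => (commute_elemMat ?_ ?_ ?_ i j).symm) k l <;>
    exact (h.comm _ _ (hω j') _ (by simp) b hb).symm

theorem IsBlockFamily.frt_elemMat (hq : 0 < q) (h : IsBlockFamily q e x y) {m : ℕ} (ω : Ω) :
    Frt q (elemMat (e ω) (x ω) (y ω) : Fin (m + 2) → _ → A) :=
  _root_.frt_elemMat hq (h.x_e ω) (h.y_x ω) ((h.y_e ω).trans (h.e_y ω).symm)

theorem IsBlockFamily.detW_elemMat (hq : 0 < q) (h : IsBlockFamily q e x y) {m : ℕ} (ω : Ω) :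
    detW q (elemMat (e ω) (x ω) (y ω) : Fin (m + 2) → _ → A) = 1 :=
  _root_.detW_elemMat hq (h.x_e ω) (h.y_x ω) ((h.y_e ω).trans (h.e_y ω).symm) (h.e_y ω)

theorem frt_const_one (q : ℝ) : Frt q fun _ _ : Fin 1 => (1 : A) := fun i j a b => by
  simp [Subsingleton.elim i j, Subsingleton.elim a b, diagC, offC]

theorem detW_const_one (hq : 0 < q) : detW q (fun _ _ : Fin 1 => (1 : A)) = 1 := by
  rw [← (frt_const_one q).qDet_eq hq, qDet_one]

/-- Injectivity of `κ` makes the blocks belong to distinct letters, so their entries commute and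
products of quantum matrices remain quantum matrices. -/
theorem IsBlockFamily.frt_upMat (hq : 0 < q) (h : IsBlockFamily q e x y) :
    ∀ {m : ℕ} {κ : Fin m → Ω}, Function.Injective κ → Frt q (upMat e x y m κ)
  | 0, _, _ => frt_const_one q
  | m + 1, κ, hκ => by
    refine (h.frt_elemMat hq (κ 0)).matMul (frt_blockMat (h.frt_upMat hq
      (hκ.comp (Fin.succ_injective _))) fun _ _ => Commute.one_left _) fun i j k l => ?_
    exact commute_blockMat (Commute.one_right _)
      (h.commute_elemMat_upMat (fun j hj => (Fin.succ_ne_zero j) (hκ hj).symm) i j) k l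

theorem IsBlockFamily.frt_downMat (hq : 0 < q) (h : IsBlockFamily q e x y) :
    ∀ {m : ℕ} {κ : Fin m → Ω}, Function.Injective κ → Frt q (downMat e x y m κ)
  | 0, _, _ => frt_const_one q
  | m + 1, κ, hκ => by
    refine (frt_blockMat (h.frt_downMat hq (hκ.comp (Fin.succ_injective _)))
      fun _ _ => Commute.one_left _).matMul (h.frt_elemMat hq (κ 0)) fun k l i j => ?_
    exact (commute_blockMat (Commute.one_right _)
      (h.commute_elemMat_downMat (fun j hj => (Fin.succ_ne_zero j) (hκ hj).symm) i j) k l).symm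

theorem IsBlockFamily.detW_upMat (hq : 0 < q) (h : IsBlockFamily q e x y) :
    ∀ {m : ℕ} {κ : Fin m → Ω}, Function.Injective κ → detW q (upMat e x y m κ) = 1
  | 0, _, _ => detW_const_one hq
  | m + 1, κ, hκ => by
    refine (Frt.detW_matMul hq (h.frt_elemMat hq (κ 0)) (frt_blockMat (h.frt_upMat hq
      (hκ.comp (Fin.succ_injective _))) fun _ _ => Commute.one_left _) fun i j k l => ?_).trans ?_
    · exact commute_blockMat (Commute.one_right _)
        (h.commute_elemMat_upMat (fun j hj => (Fin.succ_ne_zero j) (hκ hj).symm) i j) k l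
    · rw [h.detW_elemMat hq, detW_blockMat, h.detW_upMat hq (hκ.comp (Fin.succ_injective _)), mul_one,
        mul_one]

theorem IsBlockFamily.detW_downMat (hq : 0 < q) (h : IsBlockFamily q e x y) :
    ∀ {m : ℕ} {κ : Fin m → Ω}, Function.Injective κ → detW q (downMat e x y m κ) = 1
  | 0, _, _ => detW_const_one hq
  | m + 1, κ, hκ => by
    refine (Frt.detW_matMul hq (frt_blockMat (h.frt_downMat hq (hκ.comp (Fin.succ_injective _)))
      fun _ _ => Commute.one_left _) (h.frt_elemMat hq (κ 0)) fun k l i j => ?_).trans ?_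
    · exact (commute_blockMat (Commute.one_right _)
        (h.commute_elemMat_downMat (fun j hj => (Fin.succ_ne_zero j) (hκ hj).symm) i j) k l).symm
    · rw [h.detW_elemMat hq, detW_blockMat, h.detW_downMat hq (hκ.comp (Fin.succ_injective _)),
        mul_one, mul_one]

/-- The first row of the inverse of `downMat`, for the opposite multiplication. -/
def downRow (e x y : Ω → A) : ∀ m : ℕ, (Fin m → Ω) → Fin (m + 1) → A
  | 0, _ => fun _ => 1
  | m + 1, κ => Fin.cons (y (κ 0)) fun j =>
      -(e (κ 0) * x (κ 0) * y (κ 0)) * downRow e x y m (κ ∘ Fin.succ) j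

/-- Contraction with the inner factor leaves the vector `(y, -e x y, 0, …)`, which the `2 × 2` block
sends to the first unit vector because `e y = y e = 1`. Commuting blocks allow the factors to be
exchanged. As `downMat` enters the representation transposed, this row gives the first column of the
inverse there. -/
theorem IsBlockFamily.mul_downRow (h : IsBlockFamily q e x y) :
    ∀ {m : ℕ} {κ : Fin m → Ω}, Function.Injective κ → ∀ j : Fin (m + 1),
      ∑ k, downMat e x y m κ k j * downRow e x y m κ k = if j = 0 then 1 else 0
  | 0, _, _, j => by
    have hj : j = 0 := Fin.ext (Nat.lt_one_iff.1 j.2)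
    simp [downRow, downMat, hj]
  | m + 1, κ, hκ, j => by
    have hc : ∀ b ∈ ({e (κ 0), x (κ 0), y (κ 0)} : Set A), ∀ k l,
        Commute b (downMat e x y m (κ ∘ Fin.succ) k l) := fun b hb =>
      commute_downMat fun j => h.comm _ _ (fun hj => Fin.succ_ne_zero j (hκ hj).symm) b hb
    have h1 : ∀ l, ∑ k, blockMat 1 (downMat e x y m (κ ∘ Fin.succ)) k l * downRow e x y (m + 1) κ k =
        (Fin.cons (y (κ 0)) (Fin.cons (-(e (κ 0) * x (κ 0) * y (κ 0))) 0) : Fin (m + 2) → A) l := by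
      intro l
      rw [Fin.sum_univ_succ]
      refine Fin.cases ?_ (fun l => ?_) l
      · simp [downRow, blockMat_zero_zero, blockMat_succ_zero]
      · have h2 : ∀ k, downMat e x y m (κ ∘ Fin.succ) k l * (-(e (κ 0) * x (κ 0) * y (κ 0)) *
            downRow e x y m (κ ∘ Fin.succ) k) = -(e (κ 0) * x (κ 0) * y (κ 0)) *
            (downMat e x y m (κ ∘ Fin.succ) k l * downRow e x y m (κ ∘ Fin.succ) k) := fun k => by
          rw [← mul_assoc, ← mul_assoc]
          exact congrArg (· * _) (Commute.neg_left (((hc _ (by simp) k l).mul_left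
            (hc _ (by simp) k l)).mul_left (hc _ (by simp) k l))).eq.symm
        simp only [downRow, blockMat_zero_succ, blockMat_succ_succ, zero_mul, zero_add, Fin.cons_succ,
          h2, ← Finset.mul_sum, h.mul_downRow (hκ.comp (Fin.succ_injective _))]
        refine Fin.cases ?_ (fun l => ?_) l <;> simp
    have h2 : ∑ k, downMat e x y (m + 1) κ k j * downRow e x y (m + 1) κ k =
        ∑ l, elemMat (e (κ 0)) (x (κ 0)) (y (κ 0)) l j *
          ∑ k, blockMat 1 (downMat e x y m (κ ∘ Fin.succ)) k l * downRow e x y (m + 1) κ k := by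
      simp only [downMat, Finset.mul_sum, Finset.sum_mul]
      rw [Finset.sum_comm]
      refine Finset.sum_congr rfl fun l _ => Finset.sum_congr rfl fun k _ => ?_
      rw [← mul_assoc]
      refine congrArg (· * _) ?_
      exact (commute_blockMat (Commute.one_right _) (h.commute_elemMat_downMat
        (fun j hj => (Fin.succ_ne_zero j) (hκ hj).symm) l j) k l).eq.symm
    rw [h2]
    simp only [h1]
    rw [Fin.sum_univ_succ, Fin.sum_univ_succ]
    simp only [Fin.cons_zero, Fin.cons_succ, Pi.zero_apply, mul_zero, Finset.sum_const_zero, add_zero]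
    refine Fin.cases ?_ (fun j => ?_) j
    · rw [elemMat_succ_zero, zero_mul, add_zero, if_pos rfl]
      exact h.e_y _
    · rw [if_neg (Fin.succ_ne_zero j)]
      refine Fin.cases ?_ (fun j => ?_) j
      · rw [elemMat_zero_succ_zero, elemMat_one_succ_zero, mul_neg, ← mul_assoc, ← mul_assoc, h.y_e,
          one_mul, add_neg_cancel]
      · rw [elemMat_zero_succ_succ, elemMat_one_succ_succ, zero_mul, zero_mul, add_zero]

theorem upMat_zero_zero {m : ℕ} (κ : Fin (m + 1) → Ω) : upMat e x y (m + 1) κ 0 0 = e (κ 0) := by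
  simp only [upMat]
  rw [Fin.sum_univ_succ]
  simp [blockMat_zero_zero, blockMat_succ_zero, elemMat, rowDiagMat_zero_zero]

theorem upMat_zero_succ {m : ℕ} (κ : Fin (m + 1) → Ω) (j : Fin (m + 1)) :
    upMat e x y (m + 1) κ 0 j.succ = x (κ 0) * upMat e x y m (κ ∘ Fin.succ) 0 j := by
  simp only [upMat]
  rw [Fin.sum_univ_succ, Fin.sum_univ_succ, elemMat_zero_succ_zero]
  simp only [elemMat_zero_succ_succ, zero_mul, Finset.sum_const_zero, add_zero, blockMat_zero_succ,
    blockMat_succ_succ, mul_zero, zero_add]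

theorem upMat_succ_zero {m : ℕ} (κ : Fin m → Ω) (i : Fin m) : upMat e x y m κ i.succ 0 = 0 := by
  cases m with
  | zero => exact i.elim0
  | succ m =>
    simp only [upMat]
    rw [Fin.sum_univ_succ]
    simp [blockMat_succ_zero, elemMat_succ_zero]

theorem downMat_zero {m : ℕ} (κ : Fin (m + 1) → Ω) (j : Fin (m + 2)) :
    downMat e x y (m + 1) κ 0 j = elemMat (e (κ 0)) (x (κ 0)) (y (κ 0)) 0 j := by
  simp only [downMat]
  rw [Fin.sum_univ_succ]
  simp [blockMat_zero_zero, blockMat_zero_succ]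

theorem downMat_succ_zero {m : ℕ} (κ : Fin m → Ω) (i : Fin m) :
    downMat e x y m κ i.succ 0 = 0 := by
  cases m with
  | zero => exact i.elim0
  | succ m =>
    simp only [downMat]
    rw [Fin.sum_univ_succ]
    simp [blockMat_succ_zero, elemMat_succ_zero]

theorem downMat_succ_succ {m : ℕ} (κ : Fin (m + 1) → Ω) (i j : Fin (m + 1)) :
    downMat e x y (m + 1) κ i.succ j.succ = downMat e x y m (κ ∘ Fin.succ) i j *
      (Fin.cons (y (κ 0)) 1 : Fin (m + 1) → A) j := by
  simp only [downMat]
  rw [Fin.sum_univ_succ]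
  simp [blockMat_succ_zero, blockMat_succ_succ, elemMat, rowDiagMat_succ_succ]

end BlockProducts

/-! ### Weighted shifts -/

section WeightedShift

variable {Ω : Type} [DecidableEq Ω]

/-- The weighted shift `e_S ↦ w(S) e_{T + S}`. -/
def weightedShift (w : Multiset Ω → ℂ) (T : Multiset Ω) : Module.End ℂ (Multiset Ω →₀ ℂ) :=
  Finsupp.linearCombination ℂ fun S => Finsupp.single (T + S) (w S)

theorem weightedShift_single (w : Multiset Ω → ℂ) (T S : Multiset Ω) (c : ℂ) :
    weightedShift w T (Finsupp.single S c) = Finsupp.single (T + S) (c * w S) := by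
  rw [weightedShift, Finsupp.linearCombination_single, Finsupp.smul_single, smul_eq_mul]

theorem weightedShift_mul (w w' : Multiset Ω → ℂ) (T T' : Multiset Ω) :
    weightedShift w T * weightedShift w' T' =
      weightedShift (fun S => w (T' + S) * w' S) (T + T') := by
  refine Finsupp.lhom_ext fun S c => ?_
  rw [Module.End.mul_apply, weightedShift_single, weightedShift_single, weightedShift_single,
    add_assoc, mul_assoc, mul_comm (w' S)]

theorem weightedShift_one : weightedShift (fun _ => 1) 0 = (1 : Module.End ℂ (Multiset Ω →₀ ℂ)) := by
  refine Finsupp.lhom_ext fun S c => ?_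
  rw [weightedShift_single, zero_add, mul_one, Module.End.one_apply]

theorem smul_weightedShift (c : ℂ) (w : Multiset Ω → ℂ) (T : Multiset Ω) :
    c • weightedShift w T = weightedShift (fun S => c * w S) T := by
  refine Finsupp.lhom_ext fun S d => ?_
  rw [LinearMap.smul_apply, weightedShift_single, weightedShift_single, Finsupp.smul_single,
    smul_eq_mul, mul_left_comm]

theorem weightedShift_apply (w : Multiset Ω → ℂ) (T : Multiset Ω) (f : Multiset Ω →₀ ℂ)
    (S : Multiset Ω) : weightedShift w T f S = if T ≤ S then w (S - T) * f (S - T) else 0 := by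
  induction f using Finsupp.induction_linear with
  | zero => simp
  | add f g hf hg =>
    rw [map_add, Finsupp.add_apply, hf, hg, Finsupp.add_apply, mul_add]
    split_ifs <;> simp
  | single S' c =>
    rw [weightedShift_single, Finsupp.single_apply, Finsupp.single_apply]
    by_cases h : T ≤ S
    · rw [if_pos h]
      by_cases h' : S' = S - T
      · rw [if_pos h', h', add_tsub_cancel_of_le h, if_pos rfl, mul_comm]
      · rw [if_neg h', if_neg, mul_zero]
        rintro rfl
        exact h' (add_tsub_cancel_left T S').symm
    · rw [if_neg h, if_neg]
      rintro rfl
      exact h (Multiset.le_add_right _ _)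

/-- `O` raises degrees by at least `d`. -/
def Raises (d : ℕ) (O : Module.End ℂ (Multiset Ω →₀ ℂ)) : Prop :=
  ∀ f D, (∀ S, f S ≠ 0 → D ≤ S.card) → ∀ S, O f S ≠ 0 → D + d ≤ S.card

theorem Raises.mono {d d' : ℕ} {O : Module.End ℂ (Multiset Ω →₀ ℂ)} (h : Raises d O) (hd : d' ≤ d) :
    Raises d' O := fun f D hf S hS => (Nat.add_le_add_left hd D).trans (h f D hf S hS)

theorem Raises.mul {d d' : ℕ} {O O' : Module.End ℂ (Multiset Ω →₀ ℂ)} (h : Raises d O)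
    (h' : Raises d' O') : Raises (d' + d) (O * O') := fun f D hf S hS => by
  rw [← add_assoc]
  exact h _ _ (h' f D hf) S hS

theorem raises_zero (d : ℕ) : Raises d (0 : Module.End ℂ (Multiset Ω →₀ ℂ)) :=
  fun _ _ _ _ hS => (hS rfl).elim

theorem Raises.add {d : ℕ} {O O' : Module.End ℂ (Multiset Ω →₀ ℂ)} (h : Raises d O)
    (h' : Raises d O') : Raises d (O + O') := fun f D hf S hS => by
  by_cases h1 : O f S = 0
  · refine h' f D hf S fun h2 => hS ?_
    rw [LinearMap.add_apply, Finsupp.add_apply, h1, h2, add_zero]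
  · exact h f D hf S h1

theorem Raises.sum {d : ℕ} {ι : Type*} (s : Finset ι) {O : ι → Module.End ℂ (Multiset Ω →₀ ℂ)}
    (h : ∀ i ∈ s, Raises d (O i)) : Raises d (∑ i ∈ s, O i) :=
  Finset.sum_induction _ _ (fun _ _ => Raises.add) (raises_zero d) h

theorem Raises.smul {d : ℕ} {O : Module.End ℂ (Multiset Ω →₀ ℂ)} (h : Raises d O) (c : ℂ) :
    Raises d (c • O) := fun f D hf S hS => h f D hf S fun h0 => hS (by
  rw [LinearMap.smul_apply, Finsupp.smul_apply, h0, smul_zero])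

theorem raises_weightedShift (w : Multiset Ω → ℂ) (T : Multiset Ω) :
    Raises T.card (weightedShift w T) := fun f D hf S hS => by
  rw [weightedShift_apply] at hS
  have hT : T ≤ S := by
    by_contra h
    exact hS (if_neg h)
  rw [if_pos hT] at hS
  have h1 := hf _ (right_ne_zero_of_mul hS)
  rw [Multiset.card_sub hT] at h1
  have := Multiset.card_le_card hT
  omega

/-- `f` is a nonzero multiple of `e_S` plus terms of higher degree. -/
def Leads (f : Multiset Ω →₀ ℂ) (S : Multiset Ω) : Prop :=
  f S ≠ 0 ∧ ∀ S', f S' ≠ 0 → S' = S ∨ S.card < S'.card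

/-- `O` is a nonvanishing weighted shift by `T` plus terms raising the degree more. -/
def HasLead (O : Module.End ℂ (Multiset Ω →₀ ℂ)) (T : Multiset Ω) : Prop :=
  ∃ w R, (∀ S, w S ≠ 0) ∧ Raises (T.card + 1) R ∧ O = weightedShift w T + R

theorem HasLead.smul {O : Module.End ℂ (Multiset Ω →₀ ℂ)} {T : Multiset Ω} (h : HasLead O T) {c : ℂ}
    (hc : c ≠ 0) : HasLead (c • O) T := by
  obtain ⟨w, R, hw, hR, rfl⟩ := h
  exact ⟨_, c • R, fun S => mul_ne_zero hc (hw S), hR.smul c, by rw [smul_add, smul_weightedShift]⟩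

/-- The shift moves the lowest term of `f` from `S` to `T + S`. The remainder of the operator raises
degree by more than `T.card`, hence contributes only above that term. -/
theorem HasLead.leads {O : Module.End ℂ (Multiset Ω →₀ ℂ)} {T S : Multiset Ω} (h : HasLead O T)
    {f : Multiset Ω →₀ ℂ} (hf : Leads f S) : Leads (O f) (T + S) := by
  obtain ⟨w, R, hw, hR, rfl⟩ := h
  have hR' := hR f S.card fun S' hS' => (hf.2 S' hS').elim (fun h => h ▸ le_rfl) le_of_lt
  refine ⟨?_, fun S' hS' => ?_⟩
  · have h1 : R f (T + S) = 0 := by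
      by_contra h
      have := hR' _ h
      rw [Multiset.card_add] at this
      omega
    rw [LinearMap.add_apply, Finsupp.add_apply, h1, add_zero, weightedShift_apply,
      if_pos (Multiset.le_add_right _ _), add_tsub_cancel_left]
    exact mul_ne_zero (hw S) hf.1
  · by_cases h1 : R f S' = 0
    · rw [LinearMap.add_apply, Finsupp.add_apply, h1, add_zero, weightedShift_apply] at hS'
      have hT : T ≤ S' := by
        by_contra h
        exact hS' (if_neg h)
      rw [if_pos hT] at hS'
      rcases hf.2 _ (right_ne_zero_of_mul hS') with h | h
      · left
        rw [← h, add_tsub_cancel_of_le hT]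
      · right
        rw [Multiset.card_sub hT] at h
        rw [Multiset.card_add]
        omega
    · right
      have := hR' _ h1
      rw [Multiset.card_add]
      omega

theorem leads_prod {ι : Type*} {O : ι → Module.End ℂ (Multiset Ω →₀ ℂ)} {T : ι → Multiset Ω}
    (h : ∀ i, HasLead (O i) (T i)) (l : List ι) {f : Multiset Ω →₀ ℂ} {S : Multiset Ω}
    (hf : Leads f S) : Leads ((l.map O).prod f) ((l.map T).sum + S) := by
  induction l with
  | nil => simpa using hf
  | cons i l ih =>
    rw [List.map_cons, List.prod_cons, Module.End.mul_apply, List.map_cons, List.sum_cons, add_assoc]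
    exact (h i).leads ih

/-- In a nontrivial relation take an index `i` in the support for which `p i` has least degree. No
other vector of the support has a coefficient at `p i`. -/
theorem linearIndependent_of_leads {ι : Type*} {b : ι → Multiset Ω →₀ ℂ} {p : ι → Multiset Ω}
    (hp : Function.Injective p) (h : ∀ i, Leads (b i) (p i)) : LinearIndependent ℂ b := by
  rw [linearIndependent_iff]
  intro l hl
  by_contra hne
  obtain ⟨i, hi, hmin⟩ := l.support.exists_min_image (fun i => (p i).card)
    (Finsupp.support_nonempty_iff.2 hne)
  have h1 := DFunLike.congr_fun hl (p i)
  rw [Finsupp.linearCombination_apply, Finsupp.sum, Finsupp.finsetSum_apply,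
    Finset.sum_eq_single i] at h1
  · exact mul_ne_zero (Finsupp.mem_support_iff.1 hi) (h i).1 h1
  · intro j hj hji
    by_contra h2
    rcases (h j).2 _ (right_ne_zero_of_mul h2) with h3 | h3
    · exact hji (hp h3).symm
    · exact absurd (hmin j hj) (not_le.2 h3)
  · intro h2; exact (h2 hi).elim

variable {q : ℝ}

/-- The diagonal operator `q^{-n}`. -/
def eOp (q : ℝ) (ω : Ω) : Module.End ℂ (Multiset Ω →₀ ℂ) :=
  weightedShift (fun S => (q : ℂ)⁻¹ ^ S.count ω) 0

/-- The diagonal operator `q^n`. -/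
def yOp (q : ℝ) (ω : Ω) : Module.End ℂ (Multiset Ω →₀ ℂ) :=
  weightedShift (fun S => (q : ℂ) ^ S.count ω) 0

/-- The creation operator. -/
def xOp (ω : Ω) : Module.End ℂ (Multiset Ω →₀ ℂ) := weightedShift (fun _ => 1) {ω}

/-- With `N` the number operator of a letter, creation raises `N` by one and so `q`-commutes with
`q^{±N}`. Operators of different letters involve different counts. -/
theorem isBlockFamily (hq : 0 < q) :
    IsBlockFamily q (eOp q : Ω → _) xOp (yOp q) where
  x_e ω := by
    have hq' := ofReal_ne_zero' hq
    simp only [eOp, xOp, weightedShift_mul, smul_weightedShift, zero_add, add_zero, one_mul, mul_one]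
    congr 1
    funext S
    rw [Multiset.singleton_add, Multiset.count_cons_self, pow_succ']
    field_simp
  y_x ω := by
    simp only [yOp, xOp, weightedShift_mul, smul_weightedShift, zero_add, add_zero, one_mul, mul_one]
    congr 1
    funext S
    rw [Multiset.singleton_add, Multiset.count_cons_self, pow_succ']
  e_y ω := by
    simp only [yOp, eOp, weightedShift_mul, zero_add, ← mul_pow, inv_mul_cancel₀ (ofReal_ne_zero' hq),
      one_pow, weightedShift_one]
  y_e ω := by
    simp only [yOp, eOp, weightedShift_mul, zero_add, ← mul_pow, mul_inv_cancel₀ (ofReal_ne_zero' hq),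
      one_pow, weightedShift_one]
  comm ω ω' h a ha b hb := by
    simp only [Set.mem_insert_iff, Set.mem_singleton_iff] at ha hb
    have h' : ω' ≠ ω := h.symm
    rcases ha with rfl | rfl | rfl <;> rcases hb with rfl | rfl | rfl <;>
      simp only [Commute, SemiconjBy, eOp, xOp, yOp, weightedShift_mul, zero_add, add_zero,
        Multiset.singleton_add, Multiset.count_cons_of_ne h, Multiset.count_cons_of_ne h', one_mul,
        mul_one] <;>
      first
      | (congr 1; funext S; ring)
      | (congr 1; exact Multiset.cons_swap _ _ _)
      | rfl

/-- The shift of the `b`-th entry of the first row. -/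
def rowShift : ∀ m : ℕ, (Fin m → Ω) → Fin (m + 1) → Multiset Ω
  | 0, _ => fun _ => 0
  | m + 1, κ => Fin.cons 0 fun b => {κ 0} + rowShift m (κ ∘ Fin.succ) b

theorem card_rowShift : ∀ {m : ℕ} (κ : Fin m → Ω) (b : Fin (m + 1)), (rowShift m κ b).card = b
  | 0, _, b => by simp [rowShift, Nat.lt_one_iff.1 b.2]
  | m + 1, κ, b => by
    refine Fin.cases ?_ (fun b => ?_) b
    · simp [rowShift]
    · simp [rowShift, card_rowShift, add_comm]

theorem count_rowShift_of_notMem {ω : Ω} : ∀ {m : ℕ} {κ : Fin m → Ω}, (∀ j, κ j ≠ ω) →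
    ∀ b : Fin (m + 1), (rowShift m κ b).count ω = 0
  | 0, _, _, b => by simp [rowShift]
  | m + 1, κ, h, b => by
    refine Fin.cases ?_ (fun b => ?_) b
    · simp [rowShift]
    · simp [rowShift, Multiset.count_cons_of_ne (h 0).symm, Multiset.count_singleton, (h 0).symm,
        count_rowShift_of_notMem (κ := κ ∘ Fin.succ) fun j => h j.succ]

theorem count_rowShift : ∀ {m : ℕ} {κ : Fin m → Ω}, Function.Injective κ → ∀ (b : Fin (m + 1))
    (j : Fin m), (rowShift m κ b).count (κ j) = if (j : ℕ) < b then 1 else 0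
  | 0, _, _, _, j => j.elim0
  | m + 1, κ, hκ, b, j => by
    refine Fin.cases ?_ (fun b => ?_) b
    · simp [rowShift]
    · refine Fin.cases ?_ (fun j => ?_) j
      · simp [rowShift, count_rowShift_of_notMem (κ := κ ∘ Fin.succ) (ω := κ 0)
          fun j hj => Fin.succ_ne_zero j (hκ hj)]
      · have h1 : κ j.succ ≠ κ 0 := fun hj => Fin.succ_ne_zero j (hκ hj)
        have := count_rowShift (hκ.comp (Fin.succ_injective _)) b j
        rw [Function.comp_apply] at this
        simp only [rowShift, Fin.cons_succ, Multiset.count_add, Multiset.count_singleton, if_neg h1,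
          this, zero_add, Fin.val_succ, Nat.add_lt_add_iff_right]

theorem upMat_zero_eq (hq : 0 < q) : ∀ {m : ℕ} (κ : Fin m → Ω) (b : Fin (m + 1)),
    ∃ w, (∀ S, w S ≠ 0) ∧ upMat (eOp q) xOp (yOp q) m κ 0 b = weightedShift w (rowShift m κ b)
  | 0, _, _ => ⟨fun _ => 1, fun _ => one_ne_zero, weightedShift_one.symm⟩
  | m + 1, κ, b => by
    refine Fin.cases ?_ (fun b => ?_) b
    · exact ⟨_, fun S => pow_ne_zero _ (inv_ne_zero (ofReal_ne_zero' hq)), upMat_zero_zero κ⟩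
    · obtain ⟨w, hw, h⟩ := upMat_zero_eq hq (κ ∘ Fin.succ) b
      refine ⟨_, ?_, (upMat_zero_succ κ b).trans ((congrArg _ h).trans (weightedShift_mul _ _ _ _))⟩
      exact fun S => mul_ne_zero one_ne_zero (hw S)

theorem downRow_eq (hq : 0 < q) : ∀ {m : ℕ} (κ : Fin m → Ω) (b : Fin (m + 1)),
    ∃ w, (∀ S, w S ≠ 0) ∧ downRow (eOp q) xOp (yOp q) m κ b = weightedShift w (rowShift m κ b)
  | 0, _, _ => ⟨fun _ => 1, fun _ => one_ne_zero, weightedShift_one.symm⟩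
  | m + 1, κ, b => by
    have hq' := ofReal_ne_zero' hq
    refine Fin.cases ?_ (fun b => ?_) b
    · exact ⟨_, fun S => pow_ne_zero _ hq', rfl⟩
    · obtain ⟨w, hw, h⟩ := downRow_eq hq (κ ∘ Fin.succ) b
      have h1 : downRow (eOp q) xOp (yOp q) (m + 1) κ b.succ =
        -(eOp q (κ 0) * xOp (κ 0) * yOp q (κ 0)) * downRow (eOp q) xOp (yOp q) m (κ ∘ Fin.succ) b := rfl
      rw [h1, h, ← neg_one_smul ℂ (_ * yOp q (κ 0)), eOp, xOp, yOp]
      rw [smul_mul_assoc, weightedShift_mul, weightedShift_mul, weightedShift_mul, smul_weightedShift,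
        zero_add, add_zero]
      refine ⟨_, fun S => ?_, rfl⟩
      exact mul_ne_zero (neg_ne_zero.2 one_ne_zero) (mul_ne_zero (mul_ne_zero (mul_ne_zero
        (pow_ne_zero _ (inv_ne_zero hq')) one_ne_zero) (pow_ne_zero _ hq')) (hw S))

theorem downMat_diag_eq (hq : 0 < q) : ∀ {m : ℕ} (κ : Fin m → Ω) (b : Fin (m + 1)),
    ∃ w, (∀ S, w S ≠ 0) ∧ downMat (eOp q) xOp (yOp q) m κ b b = weightedShift w 0
  | 0, _, _ => ⟨fun _ => 1, fun _ => one_ne_zero, weightedShift_one.symm⟩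
  | m + 1, κ, b => by
    have hq' := ofReal_ne_zero' hq
    refine Fin.cases ?_ (fun b => ?_) b
    · exact ⟨_, fun S => pow_ne_zero _ (inv_ne_zero hq'), downMat_zero κ 0⟩
    · obtain ⟨w, hw, h⟩ := downMat_diag_eq hq (κ ∘ Fin.succ) b
      rw [downMat_succ_succ, h]
      refine Fin.cases ?_ (fun b => ?_) b
      · rw [Fin.cons_zero, yOp, weightedShift_mul]
        exact ⟨_, fun S => mul_ne_zero (hw _) (pow_ne_zero _ hq'), rfl⟩
      · rw [Fin.cons_succ, Pi.one_apply, mul_one]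
        exact ⟨w, hw, rfl⟩

/-- Passing from row `b` to column `c` takes `c - b` creation operators. For `c < b` the truncated
difference is `0` and the bound claims nothing more. -/
theorem raises_downMat : ∀ {m : ℕ} (κ : Fin m → Ω) (b c : Fin (m + 1)),
    Raises (c - b : ℕ) (downMat (eOp q) xOp (yOp q) m κ b c)
  | 0, _, b, c => by
    have := raises_weightedShift (Ω := Ω) (fun _ => 1) 0
    rw [weightedShift_one] at this
    exact this.mono (by have := c.2; simp)
  | m + 1, κ, b, c => by
    refine Fin.cases ?_ (fun b => ?_) b <;> refine Fin.cases ?_ (fun c => ?_) c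
    · rw [downMat_zero]
      exact raises_weightedShift _ 0
    · rw [downMat_zero]
      refine Fin.cases ?_ (fun c => ?_) c
      · exact raises_weightedShift _ {κ 0}
      · exact raises_zero _
    · rw [downMat_succ_zero]; exact raises_zero _
    · rw [downMat_succ_succ]
      refine Raises.mono (d := 0 + (c - b : ℕ)) (Raises.mul (raises_downMat (κ ∘ Fin.succ) b c) ?_)
        (by simp)
      refine Fin.cases ?_ (fun c => ?_) c
      · exact raises_weightedShift _ 0
      · have := raises_weightedShift (Ω := Ω) (fun _ => 1) 0
        rwa [weightedShift_one] at this

theorem downMat_eq_zero {A : Type} [Ring A] [Algebra ℂ A] {Ω : Type*} {e x y : Ω → A} :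
    ∀ {m : ℕ} (κ : Fin m → Ω) {b c : Fin (m + 1)}, c < b → downMat e x y m κ b c = 0
  | 0, _, b, c, h => by have := b.2; omega
  | m + 1, κ, b, c, h => by
    revert h
    refine Fin.cases (fun h => (Fin.not_lt_zero _ h).elim) (fun b => ?_) b
    refine Fin.cases (fun _ => downMat_succ_zero κ b) (fun c h => ?_) c
    rw [downMat_succ_succ, downMat_eq_zero _ (Fin.succ_lt_succ_iff.1 h), zero_mul]

end WeightedShift

/-! ### The sphere map is injective on projective space -/

/-! ### Sorted monomials in quasi-commuting generators -/

section QuasiCommuting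

variable {ι A : Type*} [Ring A] [Algebra ℂ A] {g : ι → A}

theorem exists_prod_eq_smul_of_perm (h : ∀ i j, ∃ c : ℂ, g i * g j = c • (g j * g i))
    {l l' : List ι} (hl : l.Perm l') : ∃ c : ℂ, (l.map g).prod = c • (l'.map g).prod := by
  induction hl with
  | nil => exact ⟨1, by simp⟩
  | cons i _ ih =>
    obtain ⟨c, hc⟩ := ih
    exact ⟨c, by rw [List.map_cons, List.prod_cons, hc, List.map_cons, List.prod_cons, mul_smul_comm]⟩
  | swap i j l =>
    obtain ⟨c, hc⟩ := h j i
    refine ⟨c, ?_⟩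
    simp only [List.map_cons, List.prod_cons]
    rw [← mul_assoc, hc, smul_mul_assoc, mul_assoc]
  | trans _ _ ih ih' =>
    obtain ⟨c, hc⟩ := ih
    obtain ⟨c', hc'⟩ := ih'
    exact ⟨c * c', by rw [hc, hc', smul_smul]⟩

/-- Permuting the factors of a product costs only a scalar, so up to scalars a product depends only
on the multiset of its factors. -/
theorem span_range_pow_le (h : ∀ i j, ∃ c : ℂ, g i * g j = c • (g j * g i)) (k : ℕ) :
    Submodule.span ℂ (Set.range g) ^ k ≤
      Submodule.span ℂ (Set.range fun M : {M : Multiset ι // M.card = k} =>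
        (M.1.toList.map g).prod) := by
  rw [Submodule.span_pow, Submodule.span_le]
  intro a ha
  obtain ⟨f, rfl⟩ := Set.mem_pow.1 ha
  choose p hp using fun i => (f i).2
  have h1 : (List.ofFn fun i => (f i : A)) = (List.ofFn p).map g := by
    rw [List.map_ofFn]
    exact congrArg _ (funext fun i => (hp i).symm)
  obtain ⟨c, hc⟩ := exists_prod_eq_smul_of_perm h (l := List.ofFn p)
    (l' := ((List.ofFn p : List ι) : Multiset ι).toList)
    (Multiset.coe_eq_coe.1 (Multiset.coe_toList _).symm)
  rw [h1, hc]
  exact Submodule.smul_mem _ _ (Submodule.subset_span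
    ⟨⟨((List.ofFn p : List ι) : Multiset ι), by simp⟩, rfl⟩)

end QuasiCommuting

section

variable {ι A : Type*} [LinearOrder ι] [Ring A] [Algebra ℂ A] {q : ℝ}

/-- The coefficient `q - offC q i j` is `q` or `q⁻¹`, in either case invertible. -/
theorem exists_eq_smul_of_hecke (hq : 0 < q) {i j : ι} {a b : A}
    (h : (q : ℂ) • a = diagC q i j • b + offC q i j • a) : ∃ c : ℂ, a = c • b := by
  have hq' := ofReal_ne_zero' hq
  have h1 : (q : ℂ) - offC q i j ≠ 0 := by
    rw [offC]
    split_ifs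
    · simpa using hq'
    · simpa using hq'
  refine ⟨((q : ℂ) - offC q i j)⁻¹ * diagC q i j, ?_⟩
  rw [mul_smul, eq_sub_of_add_eq h.symm, ← sub_smul, smul_smul, inv_mul_cancel₀ h1, one_smul]

end

/-- Multiplicities are differences of consecutive tail counts; the cardinality supplies the tail
count that includes every letter. The tail counts are what can be read off from leading terms in the
shift representation. -/
theorem Multiset.eq_of_countP_lt {m : ℕ} {M M' : Multiset (Fin (m + 1))} (hc : M.card = M'.card)
    (h : ∀ j : Fin m, M.countP (fun k => (j : ℕ) < k.rev) = M'.countP (fun k => (j : ℕ) < k.rev)) :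
    M = M' := by
  have h1 : ∀ (N : Multiset (Fin (m + 1))) (i : Fin (m + 1)),
      N.countP (fun k => (i.rev : ℕ) ≤ k.rev) = N.count i + N.countP (fun k => (i.rev : ℕ) < k.rev) := by
    intro N i
    induction N using Multiset.induction with
    | empty => simp
    | cons a N ih =>
      simp only [Multiset.countP_cons, Multiset.count_cons, ih]
      have h2 : i = a ↔ (i.rev : ℕ) = a.rev := by
        rw [← Fin.ext_iff, Fin.rev_inj]
      simp only [h2]
      split_ifs <;> omega
  have h3 : ∀ a : ℕ, M.countP (fun k => a < (k.rev : ℕ)) = M'.countP (fun k => a < (k.rev : ℕ)) := by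
    intro a
    by_cases ha : a < m
    · exact h ⟨a, ha⟩
    · have h4 : ∀ N : Multiset (Fin (m + 1)), N.countP (fun k => a < (k.rev : ℕ)) = 0 := fun N =>
        Multiset.countP_eq_zero.2 fun k _ => by have := k.rev.2; omega
      rw [h4, h4]
  have h5 : ∀ a : ℕ, M.countP (fun k => a ≤ (k.rev : ℕ)) = M'.countP (fun k => a ≤ (k.rev : ℕ)) := by
    intro a
    cases a with
    | zero => simpa using hc
    | succ a => exact h3 a
  refine Multiset.ext.2 fun i => ?_
  have := h1 M i
  have := h1 M' i
  have := h3 i.rev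
  have := h5 i.rev
  omega

/-! ### The weighted shift representation and its leading terms -/

section ShiftRep

variable {q : ℝ} (m : ℕ)

/-- A product of two commuting triangular quantum matrices of weighted shift operators. -/
def shiftMat (q : ℝ) (i j : Fin (m + 1)) : Module.End ℂ (Multiset (Fin m ⊕ Fin m) →₀ ℂ) :=
  ∑ c, upMat (eOp q) xOp (yOp q) m Sum.inl i c * downMat (eOp q) xOp (yOp q) m Sum.inr j c

variable {m}

theorem commute_upMat_downMat (hq : 0 < q) (i j k l : Fin (m + 1)) :
    Commute (upMat (eOp q) xOp (yOp q) m (Sum.inl : Fin m → Fin m ⊕ Fin m) i j)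
      (downMat (eOp q) xOp (yOp q) m (Sum.inr : Fin m → Fin m ⊕ Fin m) k l) :=
  commute_downMat (fun _ b hb => (commute_upMat (fun _ c hc =>
    ((isBlockFamily hq).comm _ _ Sum.inr_ne_inl b hb c hc)) i j).symm) k l

theorem frt_shiftMat (hq : 0 < q) : Frt q (shiftMat m q) :=
  ((isBlockFamily hq).frt_upMat hq Sum.inl_injective).matMul
    ((isBlockFamily hq).frt_downMat hq Sum.inr_injective).transpose
    fun i j k l => commute_upMat_downMat hq i j l k

theorem detW_shiftMat (hq : 0 < q) : detW q (shiftMat m q) = 1 := by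
  have h := (isBlockFamily (Ω := Fin m ⊕ Fin m) hq).frt_downMat hq Sum.inr_injective
  refine (Frt.detW_matMul hq ((isBlockFamily hq).frt_upMat hq Sum.inl_injective)
    h.transpose fun i j k l => commute_upMat_downMat hq i j l k).trans ?_
  rw [(isBlockFamily hq).detW_upMat hq Sum.inl_injective, h.detW_transpose hq,
    (isBlockFamily hq).detW_downMat hq Sum.inr_injective, mul_one]

/-- The representation of `SU_q(m + 1)` by weighted shifts. -/
def shiftRep (m : ℕ) (hq : 0 < q) :
    SUq (m + 1) q →ₐ[ℂ] Module.End ℂ (Multiset (Fin m ⊕ Fin m) →₀ ℂ) :=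
  (SUq.isQGen hq).liftHom (shiftMat m q) 1 (frt_shiftMat hq)
    (by rw [detW_shiftMat hq, one_mul]) (by rw [detW_shiftMat hq, one_mul]) fun _ => rfl

theorem shiftRep_t (hq : 0 < q) (i j : Fin (m + 1)) : shiftRep m hq (SUq.t i j) = shiftMat m q i j :=
  (SUq.isQGen hq).liftHom_t _ _ _ _ _ _ i j

/-- The entry is a sum over `c` of products of entries of `upMat` and `downMat`. The term `c = b` is
a shift of degree `b`, the terms `c < b` vanish, and those with `c > b` raise the degree by at least
`c + (c - b)`. -/
theorem hasLead_shiftRep_t (hq : 0 < q) (b : Fin (m + 1)) :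
    HasLead (shiftRep m hq (SUq.t 0 b)) (rowShift m Sum.inl b) := by
  obtain ⟨w, hw, h1⟩ := upMat_zero_eq hq (Sum.inl : Fin m → Fin m ⊕ Fin m) b
  obtain ⟨w', hw', h2⟩ := downMat_diag_eq hq (Sum.inr : Fin m → Fin m ⊕ Fin m) b
  rw [shiftRep_t, shiftMat, ← Finset.add_sum_erase _ _ (Finset.mem_univ b), h1, h2, weightedShift_mul,
    add_zero]
  refine ⟨_, _, fun S => mul_ne_zero (hw _) (hw' _), Raises.sum _ fun c hc => ?_, rfl⟩
  rcases lt_or_ge c b with hcb | hcb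
  · rw [downMat_eq_zero _ hcb, mul_zero]
    exact raises_zero _
  · obtain ⟨w, hw, h1⟩ := upMat_zero_eq hq (Sum.inl : Fin m → Fin m ⊕ Fin m) c
    rw [h1]
    refine ((raises_weightedShift w _).mul (raises_downMat _ b c)).mono ?_
    have := lt_of_le_of_ne hcb (Finset.ne_of_mem_erase hc).symm
    rw [card_rowShift, card_rowShift]
    omega

/-- The first column of the inverse is determined by its product with the representing matrix.
`downRow` reduces the lower factor to the first unit vector, and the first column of `upMat` has
only its diagonal entry; dividing by that entry gives the column as weighted shifts. -/
theorem hasLead_shiftRep_s (hq : 0 < q) (a : Fin (m + 1)) :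
    HasLead (shiftRep m hq ((SUq.isQGen hq).s hq a 0)) (rowShift m Sum.inr a) := by
  obtain ⟨w, hw, h1⟩ := upMat_zero_eq hq (Sum.inl : Fin m → Fin m ⊕ Fin m) 0
  have hw0 : rowShift m (Sum.inl : Fin m → Fin m ⊕ Fin m) 0 = 0 :=
    Multiset.card_eq_zero.1 (card_rowShift _ _)
  rw [hw0] at h1
  obtain ⟨w', hw', h2⟩ := downRow_eq hq (Sum.inr : Fin m → Fin m ⊕ Fin m) a
  -- A shift by the empty multiset is diagonal and is inverted weight by weight.
  have hinv : weightedShift w 0 * weightedShift (fun S => (w S)⁻¹) 0 = 1 := by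
    rw [weightedShift_mul, add_zero, ← weightedShift_one]
    congr 1
    funext S
    rw [zero_add, mul_inv_cancel₀ (hw S)]
  have hinvs := ((SUq.isQGen (n := m + 1) hq).matInv hq).map (shiftRep m hq)
  have hcol : ∀ i, ∑ j, shiftRep m hq (SUq.t i j) * (downRow (eOp q) xOp (yOp q) m Sum.inr j *
      weightedShift (fun S => (w S)⁻¹) 0) = if i = 0 then 1 else 0 := by
    intro i
    simp only [shiftRep_t, shiftMat, Finset.sum_mul]
    rw [Finset.sum_comm]
    have h3 : ∀ c, ∑ j, upMat (eOp q) xOp (yOp q) m Sum.inl i c *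
        downMat (eOp q) xOp (yOp q) m Sum.inr j c * (downRow (eOp q) xOp (yOp q) m Sum.inr j *
        weightedShift (fun S => (w S)⁻¹) 0) = upMat (eOp q) xOp (yOp q) m Sum.inl i c *
        ((if c = 0 then 1 else 0) * weightedShift (fun S => (w S)⁻¹) 0) := fun c => by
      rw [← (isBlockFamily hq).mul_downRow Sum.inr_injective c, Finset.sum_mul, Finset.mul_sum]
      simp only [mul_assoc]
    simp only [h3, ite_mul, zero_mul, mul_ite, mul_zero, Finset.sum_ite_eq', Finset.mem_univ, if_true,
      one_mul]
    refine Fin.cases ?_ (fun i => ?_) i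
    · rw [h1, hinv, if_pos rfl]
    · rw [upMat_succ_zero, zero_mul, if_neg (Fin.succ_ne_zero i)]
  have hs : shiftRep m hq ((SUq.isQGen hq).s hq a 0) =
      downRow (eOp q) xOp (yOp q) m Sum.inr a * weightedShift (fun S => (w S)⁻¹) 0 := by
    have h3 : ∑ i, shiftRep m hq ((SUq.isQGen hq).s hq a i) * ∑ j, shiftRep m hq (SUq.t i j) *
        (downRow (eOp q) xOp (yOp q) m Sum.inr j * weightedShift (fun S => (w S)⁻¹) 0) =
        ∑ j, (∑ i, shiftRep m hq ((SUq.isQGen hq).s hq a i) * shiftRep m hq (SUq.t i j)) *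
        (downRow (eOp q) xOp (yOp q) m Sum.inr j * weightedShift (fun S => (w S)⁻¹) 0) := by
      simp only [Finset.mul_sum, Finset.sum_mul, mul_assoc]
      exact Finset.sum_comm
    simp only [hcol, hinvs.eq_mul] at h3
    simpa using h3
  rw [hs, h2, weightedShift_mul, add_zero]
  exact ⟨_, 0, fun S => mul_ne_zero (hw' _) (inv_ne_zero (hw _)), raises_zero _, (add_zero _).symm⟩

end ShiftRep

namespace QSphere

variable {n m : ℕ} {q : ℝ}

theorem exists_v_mul_v (hq : 0 < q) (i j : Fin n) :
    ∃ c : ℂ, (v i * v j : QSphere n q) = c • (v j * v i) :=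
  exists_eq_smul_of_hecke hq (i := i) (j := j) (by
    conv_lhs => rw [vec, sum_vec_eq hq, smul_inv_smul₀ (ofReal_ne_zero' hq)])

theorem exists_x_mul_x (hq : 0 < q) (i j : Fin n) :
    ∃ c : ℂ, (x i * x j : QSphere n q) = c • (x j * x i) :=
  exists_eq_smul_of_hecke hq (i := j) (j := i) (by
    conv_lhs => rw [covec, sum_covec_eq hq, smul_inv_smul₀ (ofReal_ne_zero' hq), diagC_comm])

theorem spanV_pow_mul_spanX_pow_le (hq : 0 < q) (k : ℕ) :
    spanV n q ^ k * spanX n q ^ k ≤ Submodule.span ℂ (Set.range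
      fun p : {M : Multiset (Fin n) // M.card = k} × {M : Multiset (Fin n) // M.card = k} =>
        (p.1.1.toList.map (v : Fin n → QSphere n q)).prod * (p.2.1.toList.map x).prod) := by
  refine (mul_le_mul' (span_range_pow_le (exists_v_mul_v hq) k)
    (span_range_pow_le (exists_x_mul_x hq) k)).trans ?_
  rw [Submodule.span_mul_span, Submodule.span_le]
  rintro _ ⟨_, ⟨M, rfl⟩, _, ⟨M', rfl⟩, rfl⟩
  exact Submodule.subset_span ⟨(M, M'), rfl⟩

end QSphere

/-! ### Injectivity on projective space by comparing leading terms -/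

section Injectivity

open QSphere

variable {m : ℕ} {q : ℝ}

theorem count_sum_rowShift {Ω : Type} [DecidableEq Ω] {κ : Fin m → Ω} (hκ : Function.Injective κ)
    (M : Multiset (Fin (m + 1))) (j : Fin m) :
    ((M.toList.map fun i => rowShift m κ i.rev).sum).count (κ j) =
      M.countP fun k => (j : ℕ) < k.rev := by
  conv_rhs => rw [← M.coe_toList]
  induction M.toList with
  | nil => simp
  | cons a l ih =>
    rw [List.map_cons, List.sum_cons, Multiset.count_add, ih, count_rowShift hκ, ← Multiset.cons_coe,
      Multiset.countP_cons, add_comm]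

theorem count_sum_rowShift_of_notMem {Ω : Type} [DecidableEq Ω] {κ : Fin m → Ω} {ω : Ω}
    (hω : ∀ j, κ j ≠ ω) (l : List (Fin (m + 1))) :
    ((l.map fun i => rowShift m κ i.rev).sum).count ω = 0 := by
  induction l with
  | nil => simp
  | cons a l ih =>
    rw [List.map_cons, List.sum_cons, Multiset.count_add, ih, count_rowShift_of_notMem hω]

/-- Sorted monomials in `v` and `x` span `V^k X^k`. Applied to the vacuum, their images lead with a
multiset whose left letters count the tails of the `v`-multiset and whose right letters count those
of the `x`-multiset; both multisets are recovered, so the leads are distinct. -/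
theorem sphereMap_eq_zero (hq : 0 < q) {u : QSphere (m + 1) q} (hu : u ∈ CPq (m + 1) q)
    (h0 : sphereMap m hq u = 0) : u = 0 := by
  have hq' := ofReal_ne_zero' hq
  obtain ⟨k, hk⟩ := (mem_CPq_iff hq).1 hu
  obtain ⟨c, rfl⟩ := Finsupp.mem_span_range_iff_exists_finsupp.1 (spanV_pow_mul_spanX_pow_le hq k hk)
  -- The vector `single 0 1` is the vacuum, the basis vector of the empty multiset.
  let L : QSphere (m + 1) q →ₗ[ℂ] (Multiset (Fin m ⊕ Fin m) →₀ ℂ) :=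
    (LinearMap.applyₗ (Finsupp.single 0 1)) ∘ₗ ((shiftRep m hq).comp (sphereMap m hq)).toLinearMap
  have hL : ∀ u, L u = shiftRep m hq (sphereMap m hq u) (Finsupp.single 0 1) := fun u => rfl
  have hlead : ∀ p : {M : Multiset (Fin (m + 1)) // M.card = k} ×
      {M : Multiset (Fin (m + 1)) // M.card = k},
      Leads (L ((p.1.1.toList.map (v : Fin (m + 1) → QSphere (m + 1) q)).prod *
        (p.2.1.toList.map x).prod)) ((p.1.1.toList.map fun i => rowShift m Sum.inl i.rev).sum +
          ((p.2.1.toList.map fun i => rowShift m Sum.inr i.rev).sum + 0)) := fun p => by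
    rw [hL, map_mul, map_mul, Module.End.mul_apply, map_list_prod, map_list_prod, map_list_prod,
      map_list_prod, List.map_map, List.map_map, List.map_map, List.map_map]
    refine leads_prod (fun i => ?_) _ (leads_prod (fun i => ?_) _ ⟨?_, fun S' hS' => Or.inl ?_⟩)
    · rw [Function.comp_apply, Function.comp_apply, sphereMap_v, map_smul]
      exact (hasLead_shiftRep_t hq _).smul (pow_ne_zero _ hq')
    · rw [Function.comp_apply, Function.comp_apply, sphereMap_x, map_smul]
      exact (hasLead_shiftRep_s hq _).smul (pow_ne_zero _ hq')
    · simp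
    · by_contra h
      exact hS' (Finsupp.single_eq_of_ne h)
  have hli := linearIndependent_of_leads (b := fun p => L _) (fun p p' hp => ?_) hlead
  · have h1 : L (c.sum fun i a => a • ((i.1.1.toList.map (v : Fin (m + 1) → QSphere (m + 1) q)).prod *
        (i.2.1.toList.map x).prod)) = 0 := by rw [hL, h0, map_zero, LinearMap.zero_apply]
    rw [map_finsuppSum] at h1
    simp only [map_smul] at h1
    rw [linearIndependent_iff.1 hli c h1, Finsupp.sum_zero_index]
  · refine Prod.ext (Subtype.ext (Multiset.eq_of_countP_lt (p.1.2.trans p'.1.2.symm) fun j => ?_))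
      (Subtype.ext (Multiset.eq_of_countP_lt (p.2.2.trans p'.2.2.symm) fun j => ?_))
    · have h1 := congrArg (Multiset.count (Sum.inl j : Fin m ⊕ Fin m)) hp
      simpa only [Multiset.count_add, count_sum_rowShift Sum.inl_injective, Multiset.count_zero,
        add_zero, count_sum_rowShift_of_notMem (κ := (Sum.inr : Fin m → Fin m ⊕ Fin m))
          (ω := Sum.inl j) fun j => Sum.inr_ne_inl] using h1
    · have h1 := congrArg (Multiset.count (Sum.inr j : Fin m ⊕ Fin m)) hp
      simpa only [Multiset.count_add, count_sum_rowShift Sum.inr_injective, Multiset.count_zero,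
        add_zero, zero_add, count_sum_rowShift_of_notMem (κ := (Sum.inl : Fin m → Fin m ⊕ Fin m))
          (ω := Sum.inr j) fun j => Sum.inl_ne_inr] using h1

end Injectivity

/-! ### Equivariant projections and invariant covectors -/

/-- The orthogonal projection with kernel `K` commutes with the operators which preserve `K`
together with their adjoints. -/
theorem exists_equivariant_projection {ι : Type*} [Fintype ι] (K : Submodule ℂ (ι → ℂ)) :
    ∃ p : (ι → ℂ) →ₗ[ℂ] (ι → ℂ), (∀ f, p f = 0 ↔ f ∈ K) ∧ (∀ f, p (p f) = p f) ∧
      ∀ H H' : (ι → ℂ) →ₗ[ℂ] (ι → ℂ),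
        (∀ f g, ∑ i, star (f i) * H g i = ∑ i, star (H' f i) * g i) →
        (∀ f ∈ K, H f ∈ K) → (∀ f ∈ K, H' f ∈ K) → ∀ f, p (H f) = H (p f) := by
  let L : Submodule ℂ (ι → ℂ) :=
    { carrier := {r | ∀ g ∈ K, ∑ i, star (g i) * r i = 0}
      zero_mem' := fun g _ => by simp
      add_mem' := fun ha hb g hg => by
        simp only [Pi.add_apply, mul_add, Finset.sum_add_distrib, ha g hg, hb g hg, add_zero]
      smul_mem' := fun c a ha g hg => by
        simp only [Pi.smul_apply, smul_eq_mul, mul_left_comm, ← Finset.mul_sum, ha g hg, mul_zero] }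
  have hL : ∀ r, r ∈ L ↔ ∀ g ∈ K, ∑ i, star (g i) * r i = 0 := fun _ => Iff.rfl
  have hdisj : Disjoint L K := by
    rw [Submodule.disjoint_def]
    intro f hf hfK
    have h1 := hf f hfK
    have h2 : ∑ i, ‖f i‖ ^ 2 = 0 := by
      have : ((∑ i, ‖f i‖ ^ 2 : ℝ) : ℂ) = ∑ i, star (f i) * f i := by
        push_cast
        exact Finset.sum_congr rfl fun i _ => (Complex.conj_mul' (f i)).symm
      exact_mod_cast this.trans h1
    rw [Finset.sum_eq_zero_iff_of_nonneg fun i _ => sq_nonneg _] at h2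
    funext i
    simpa using h2 i (Finset.mem_univ i)
  have hcod : Codisjoint L K := by
    rw [codisjoint_iff, eq_top_iff]
    intro f _
    -- The orthogonal decomposition is obtained in Euclidean space and carried back to plain
    -- functions.
    let e := WithLp.linearEquiv 2 ℂ (ι → ℂ)
    let K' := K.comap e.toLinearMap
    refine Submodule.mem_sup.2 ⟨e (e.symm f - K'.starProjection (e.symm f)), fun g hg => ?_,
      e (K'.starProjection (e.symm f)), K'.starProjection_apply_mem _, ?_⟩
    · have h1 := K'.sub_starProjection_mem_orthogonal (e.symm f) (e.symm g)
        (show e (e.symm g) ∈ K by simpa using hg)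
      rw [PiLp.inner_apply] at h1
      rw [← h1]
      refine Finset.sum_congr rfl fun i _ => ?_
      rw [RCLike.inner_apply, mul_comm]
      rfl
    · rw [← map_add, sub_add_cancel, LinearEquiv.apply_symm_apply]
  have hc : IsCompl L K := ⟨hdisj, hcod⟩
  have hpL : ∀ l ∈ L, L.projection K hc l = l := fun l hl =>
    Submodule.projection_apply_left hc ⟨l, hl⟩
  have hpK : ∀ k ∈ K, L.projection K hc k = 0 := fun k hk =>
    Submodule.projection_apply_right hc ⟨k, hk⟩
  refine ⟨L.projection K hc, fun f => Submodule.projection_apply_eq_zero_iff hc,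
    fun f => hpL _ (Submodule.projection_apply_mem hc f), fun H H' hHH' hH hH' f => ?_⟩
  obtain ⟨l, hl, k, hk, rfl⟩ := Submodule.mem_sup.1 (hcod.eq_top ▸ Submodule.mem_top : f ∈ L ⊔ K)
  -- `H` preserves the orthogonal complement because its adjoint `H'` preserves `K`.
  have hHl : H l ∈ L := fun g hg => by rw [hHH']; exact hl _ (hH' g hg)
  rw [map_add, map_add, map_add, hpL _ hHl, hpK _ (hH k hk), hpL l hl, hpK k hk, add_zero, add_zero]

/-! ### Averaging coinvariants to invariant covectors -/

section InvariantCovectors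

variable {ι P A : Type} [Fintype ι] [Ring P] [Algebra ℂ P] [Ring A] [Algebra ℂ A]

/-- Coinvariant combinations of the coefficients of a unitary corepresentation come from
invariant covectors. -/
theorem exists_invariant_covectors (β : P →ₗ[ℂ] A ⊗[ℂ] P) (w : ι → ι → P) (W : ι → ι → A)
    (hβ : ∀ i j, β (w i j) = ∑ k, W i k ⊗ₜ[ℂ] w k j) (φ : A →ₛₗ[starRingEnd ℂ] A)
    (hφ : ∀ i j, φ (W i j) = W j i) (c : ι × ι → ℂ)
    (hc : β (∑ x, c x • w x.1 x.2) = 1 ⊗ₜ[ℂ] ∑ x, c x • w x.1 x.2) :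
    ∃ c' : ι × ι → ℂ, ∑ x, c x • w x.1 x.2 = ∑ x, c' x • w x.1 x.2 ∧
      ∀ j k, ∑ i, c' (i, j) • W i k = c' (k, j) • (1 : A) := by
  let F : (ι × ι → ℂ) →ₗ[ℂ] P := Fintype.linearCombination ℂ fun x => w x.1 x.2
  have hF : ∀ c, F c = ∑ x, c x • w x.1 x.2 := fun c => Fintype.linearCombination_apply _ _ _
  -- A functional `f` on `A` acts on coefficient families by slicing the corepresentation; under `F`
  -- this becomes `(f ⊗ id) ∘ β`, so the action preserves `ker F`.
  let H : (A →ₗ[ℂ] ℂ) → (ι × ι → ℂ) →ₗ[ℂ] (ι × ι → ℂ) := fun f =>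
    { toFun := fun c x => ∑ i, c (i, x.2) * f (W i x.1)
      map_add' := fun a b => by
        funext x
        simp only [Pi.add_apply, add_mul, Finset.sum_add_distrib]
      map_smul' := fun r a => by
        funext x
        simp only [Pi.smul_apply, smul_eq_mul, mul_assoc, Finset.mul_sum, RingHom.id_apply] }
  have hH : ∀ f c x, H f c x = ∑ i, c (i, x.2) * f (W i x.1) := fun _ _ _ => rfl
  have hFH : ∀ f c, F (H f c) = TensorProduct.lid ℂ P (f.rTensor P (β (F c))) := by
    intro f c
    simp only [hF, hH, map_sum, map_smul, hβ, LinearMap.rTensor_tmul, TensorProduct.lid_tmul,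
      Fintype.sum_prod_type, Finset.sum_smul, Finset.smul_sum, mul_smul]
    rw [Finset.sum_comm]
    conv_rhs => rw [Finset.sum_comm]
    refine Finset.sum_congr rfl fun j _ => ?_
    rw [Finset.sum_comm]
  obtain ⟨p, hp0, hpp, hp⟩ := exists_equivariant_projection (LinearMap.ker F)
  have hker : ∀ f, ∀ c ∈ LinearMap.ker F, H f c ∈ LinearMap.ker F := fun f c hc => by
    rw [LinearMap.mem_ker] at hc ⊢
    rw [hFH, hc, map_zero, map_zero, map_zero]
  have hcomm : ∀ f c, p (H f c) = H f (p c) := by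
    intro f
    -- Unitarity enters here: since `φ` transposes `W`, the adjoint of the action of `f` is the
    -- action of `g = conj ∘ f ∘ φ`. The orthogonal projection along `ker F` therefore commutes with
    -- all these actions.
    let g : A →ₗ[ℂ] ℂ :=
      { toFun := fun a => star (f (φ a))
        map_add' := fun a b => by rw [map_add, map_add, star_add]
        map_smul' := fun r a => by
          rw [map_smulₛₗ, map_smul, smul_eq_mul, star_mul', RingHom.id_apply, smul_eq_mul]
          simp }
    have hg : ∀ a, g a = star (f (φ a)) := fun _ => rfl
    refine hp (H f) (H g) (fun d c => ?_) (hker f) (hker g)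
    simp only [hH, hg, hφ, star_sum, star_mul', star_star, Fintype.sum_prod_type, Finset.mul_sum,
      Finset.sum_mul]
    rw [Finset.sum_comm]
    conv_rhs => rw [Finset.sum_comm]
    refine Finset.sum_congr rfl fun j _ => ?_
    rw [Finset.sum_comm]
    refine Finset.sum_congr rfl fun i _ => Finset.sum_congr rfl fun k _ => ?_
    ring
  refine ⟨p c, ?_, fun j k => ?_⟩
  · rw [← hF, ← hF, ← sub_eq_zero, ← map_sub, ← LinearMap.mem_ker, ← hp0, map_sub, hpp, sub_self]
  · rw [← sub_eq_zero, ← Module.forall_dual_apply_eq_zero_iff ℂ]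
    intro f
    -- Coinvariance only says that `f` acts on `c` as the scalar `f 1` modulo `ker F`; after
    -- projection this holds exactly.
    have h1 : H f c - f 1 • c ∈ LinearMap.ker F := by
      rw [LinearMap.mem_ker, map_sub, map_smul, hFH, hF, hc, LinearMap.rTensor_tmul,
        TensorProduct.lid_tmul, sub_self]
    rw [← hp0, map_sub, map_smul, hcomm, sub_eq_zero] at h1
    have h2 := congrFun h1 (k, j)
    rw [hH, Pi.smul_apply, smul_eq_mul] at h2
    rw [map_sub, map_sum, map_smul, smul_eq_mul]
    simp only [map_smul, smul_eq_mul, h2]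
    ring

end InvariantCovectors

/-! ### Localization at the quantum determinant -/

section Localization

variable {m : ℕ} {q : ℝ} {A : Type} [Ring A] [Algebra ℂ A] {t : Fin m → Fin m → A} {d : A}

/-- A central element generates an Ore set. -/
abbrev oreSetPowers {R : Type*} [Ring R] (D : R) (h : ∀ r, Commute D r) :
    OreLocalization.OreSet (Submonoid.powers D) :=
  have hs : ∀ (r : R) (s : Submonoid.powers D), (s : R) * r = r * s := fun r s => by
    obtain ⟨_, k, rfl⟩ := s
    exact ((h r).pow_left k).eq
  { ore_right_cancel := fun r₁ r₂ s h => ⟨s, by rw [hs, hs, h]⟩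
    oreNum := fun r _ => r
    oreDenom := fun _ s => s
    ore_eq := fun r s => hs r s }

/-- Central elements can be inverted. -/
theorem exists_localization {R : Type} [Ring R] [Algebra ℂ R] (D : R) (h : ∀ r, Commute D r) :
    ∃ (E : Type) (_ : Ring E) (_ : Algebra ℂ E) (f : R →ₐ[ℂ] E), IsUnit (f D) ∧
      ∀ a b, f a = f b → ∃ k : ℕ, D ^ k * a = D ^ k * b := by
  letI := oreSetPowers D h
  refine ⟨OreLocalization (Submonoid.powers D) R, inferInstance, inferInstance,
    { OreLocalization.numeratorRingHom with commutes' := fun c => ?_ }, ?_, fun a b hab => ?_⟩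
  · rfl
  · exact OreLocalization.numerator_isUnit (⟨D, Submonoid.mem_powers D⟩ : Submonoid.powers D)
  · have h1 : (a /ₒ 1 : OreLocalization (Submonoid.powers D) R) = b /ₒ 1 := hab
    obtain ⟨⟨_, k, rfl⟩, v, h2, h3⟩ := OreLocalization.oreDiv_eq_iff.1 h1
    refine ⟨k, ?_⟩
    simp only [OneMemClass.coe_one, mul_one] at h3
    simp only [smul_eq_mul, ← h3] at h2
    exact h2.symm

/-- Eigencovectors over the localized algebra are eigencovectors for all quantum matrices, up to
powers of the quantum determinant. -/
theorem IsQGen.exists_pow_detW (h : IsQGen m q False A t d) (hq : 0 < q) {R : Type} [Ring R]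
    [Algebra ℂ R] {τ : Fin m → Fin m → R} (hτ : Frt q τ) {N : ℕ} (ξ : (Fin N → Fin m) → ℂ) (z : ℕ)
    (hξ : ∀ K, ∑ I, ξ I • wmono t I K = ξ K • detW q t ^ z) :
    ∃ s : ℕ, ∀ K, ∑ I, ξ I • (detW q τ ^ s * wmono τ I K) = ξ K • detW q τ ^ (s + z) := by
  -- The determinant is central only in the subalgebra generated by the entries of `τ`, so the
  -- localization is made there.
  let R0 := Algebra.adjoin ℂ (Set.range fun p : Fin m × Fin m => τ p.1 p.2)
  let τ0 : Fin m → Fin m → R0 := fun i j => ⟨τ i j, Algebra.subset_adjoin ⟨(i, j), rfl⟩⟩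
  have hval : ∀ i j, R0.val (τ0 i j) = τ i j := fun _ _ => rfl
  have hτ0 : Frt q τ0 := fun i j a b => Subtype.ext (hτ i j a b)
  have hdet : R0.val (detW q τ0) = detW q τ := map_detW q R0.val τ0
  have hD : ∀ r : R0, Commute (detW q τ0) r := by
    rintro ⟨r, hr⟩
    refine Subtype.ext ?_
    change R0.val (detW q τ0) * r = r * R0.val (detW q τ0)
    rw [hdet]
    change Commute (detW q τ) r
    induction hr using Algebra.adjoin_induction with
    | mem x hx =>
      obtain ⟨p, rfl⟩ := hx
      exact hτ.commute_detW hq p.1 p.2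
    | algebraMap c => exact (Algebra.commute_algebraMap_left c _).symm
    | add x y _ _ hx hy => exact hx.add_right hy
    | mul x y _ _ hx hy => exact hx.mul_right hy
  obtain ⟨E, _, _, f, ⟨U, hU⟩, hf⟩ := exists_localization (detW q τ0) hD
  have hdf : detW q (fun i j => f (τ0 i j)) = U := by rw [hU, map_detW]
  -- With its determinant made invertible, the matrix `τ` receives a map from the universal algebra,
  -- and the eigenvector identity is transported.
  let g := h.liftHom (fun i j => f (τ0 i j)) (↑U⁻¹ : E) (hτ0.map f) (by rw [hdf, Units.mul_inv])
    (by rw [hdf, Units.inv_mul]) False.elim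
  have hg : ∀ i j, g (t i j) = f (τ0 i j) := fun i j => h.liftHom_t _ _ _ _ _ _ i j
  have h1 : ∀ K, ∃ k : ℕ, detW q τ0 ^ k * ∑ I, ξ I • wmono τ0 I K =
      detW q τ0 ^ k * (ξ K • detW q τ0 ^ z) := fun K => by
    refine hf _ _ ?_
    have h2 := congrArg g (hξ K)
    simp only [map_sum, map_smul, map_wmono, hg, map_pow, map_detW] at h2 ⊢
    exact h2
  choose k hk using h1
  -- Each of the finitely many words needs its own power of the determinant to return from the
  -- localization; their total serves for all.
  refine ⟨∑ K, k K, fun K => ?_⟩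
  have h3 := congrArg (R0.val) (hk K)
  simp only [map_mul, map_pow, map_sum, map_smul, map_wmono, hdet] at h3
  have h4 := congrArg (detW q τ ^ (∑ K ∈ Finset.univ.erase K, k K) * ·) h3
  simp only [← mul_assoc, ← pow_add, Finset.sum_erase_add _ _ (Finset.mem_univ K)] at h4
  rw [Finset.mul_sum] at h4
  simp only [mul_smul_comm, ← pow_add] at h4
  exact h4

end Localization

/-! ### Families of intertwiners of the Hecke operators -/

section HeckeFamily

variable {m : ℕ} {q : ℝ}

/-- Families of matrices, indexed by words of each length, commuting with the Hecke operators. -/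
def HeckeFamily (m : ℕ) (q : ℝ) :
    Submodule ℂ (∀ N, (Fin N → Fin m) → (Fin N → Fin m) → ℂ) where
  carrier := {X | ∀ N (a b : Fin N), (a : ℕ) + 1 = b → ∀ I J,
    hecke q a b (fun I => X N I J) I = hecke q a b (fun J => X N I J) J}
  zero_mem' := fun N a b _ I J => by simp [hecke]
  add_mem' := fun {X Y} hX hY N a b h I J => by
    have h1 := hX N a b h I J
    have h2 := hY N a b h I J
    simp only [hecke, Pi.add_apply, smul_eq_mul] at h1 h2 ⊢
    linear_combination h1 + h2
  smul_mem' := fun c X hX N a b h I J => by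
    have h1 := hX N a b h I J
    simp only [hecke, Pi.smul_apply, smul_eq_mul] at h1 ⊢
    linear_combination c * h1

theorem snoc_comp_swap {N : ℕ} {α : Type*} (I : Fin N → α) (i : α) (a b : Fin N) :
    (Fin.snoc I i : Fin (N + 1) → α) ∘ Equiv.swap a.castSucc b.castSucc =
      (Fin.snoc (I ∘ Equiv.swap a b) i : Fin (N + 1) → α) := by
  funext k
  refine Fin.lastCases ?_ (fun k => ?_) k
  · rw [Function.comp_apply, Equiv.swap_apply_of_ne_of_ne (Fin.castSucc_lt_last a).ne'
      (Fin.castSucc_lt_last b).ne', Fin.snoc_last, Fin.snoc_last]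
  · rw [Function.comp_apply, Fin.snoc_castSucc, (Fin.castSucc_injective N).swap_apply,
      Fin.snoc_castSucc, Function.comp_apply]

theorem snoc_snoc_comp_swap {N : ℕ} {α : Type*} (I : Fin N → α) (i j : α) :
    (Fin.snoc (Fin.snoc I i : Fin (N + 1) → α) j : Fin (N + 2) → α) ∘
      Equiv.swap (Fin.last N).castSucc (Fin.last (N + 1)) =
      (Fin.snoc (Fin.snoc I j : Fin (N + 1) → α) i : Fin (N + 2) → α) := by
  funext k
  refine Fin.lastCases ?_ (fun k => ?_) k
  · rw [Function.comp_apply, Equiv.swap_apply_right, Fin.snoc_castSucc, Fin.snoc_last, Fin.snoc_last]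
  · refine Fin.lastCases ?_ (fun k => ?_) k
    · rw [Function.comp_apply, Equiv.swap_apply_left, Fin.snoc_castSucc, Fin.snoc_last, Fin.snoc_last]
    · have h1 : k.castSucc.castSucc ≠ (Fin.last N).castSucc := fun h =>
        (Fin.castSucc_lt_last k).ne (Fin.castSucc_injective _ h)
      rw [Function.comp_apply, Equiv.swap_apply_of_ne_of_ne h1 (Fin.castSucc_lt_last _).ne]
      simp only [Fin.snoc_castSucc]

/-- Evaluation of the last letters of both words. -/
def snocOp (q : ℝ) (i j : Fin m) : Module.End ℂ (HeckeFamily m q) where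
  toFun X := ⟨fun N I J => X.1 (N + 1) (Fin.snoc I i : Fin (N + 1) → Fin m)
      (Fin.snoc J j : Fin (N + 1) → Fin m), fun N a b h I J => by
    have h1 := X.2 (N + 1) a.castSucc b.castSucc h (Fin.snoc I i : Fin (N + 1) → Fin m)
      (Fin.snoc J j : Fin (N + 1) → Fin m)
    simpa only [hecke, snoc_comp_swap, Fin.snoc_castSucc] using h1⟩
  map_add' _ _ := rfl
  map_smul' _ _ := rfl

theorem snocOp_apply (i j : Fin m) (X : HeckeFamily m q) (N : ℕ) (I J : Fin N → Fin m) :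
    (snocOp q i j X).1 N I J = X.1 (N + 1) (Fin.snoc I i : Fin (N + 1) → Fin m)
      (Fin.snoc J j : Fin (N + 1) → Fin m) := rfl

/-- The relation between two such operators is the Hecke condition on a family at the last two
places of its words. -/
theorem frt_snocOp : Frt q (snocOp q : Fin m → Fin m → _) := by
  intro i j a b
  refine LinearMap.ext fun X => Subtype.ext ?_
  funext N I J
  have h1 := X.2 (N + 2) (Fin.last N).castSucc (Fin.last (N + 1)) rfl
    (Fin.snoc (Fin.snoc I j : Fin (N + 1) → Fin m) i : Fin (N + 2) → Fin m)
    (Fin.snoc (Fin.snoc J a : Fin (N + 1) → Fin m) b : Fin (N + 2) → Fin m)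
  simp only [hecke, snoc_snoc_comp_swap, Fin.snoc_castSucc, Fin.snoc_last] at h1
  rw [diagC_comm q j i] at h1
  exact h1

/-- Evaluation at empty words recovers every entry of `X` from products of the operators, so an
identity among these products holds for all Hecke families. -/
theorem wmono_snocOp {N : ℕ} (I K : Fin N → Fin m) (X : HeckeFamily m q) (I0 J0 : Fin 0 → Fin m) :
    (wmono (snocOp q) I K X).1 0 I0 J0 = X.1 N I K := by
  induction N generalizing X with
  | zero =>
    rw [wmono_zero, Module.End.one_apply, Subsingleton.elim I0 I, Subsingleton.elim J0 K]
  | succ N ih =>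
    rw [← Fin.snoc_init_self I, ← Fin.snoc_init_self K, wmono_snoc, Module.End.mul_apply, ih,
      snocOp_apply]

theorem sum_wmono_snocOp {N : ℕ} (ξ : (Fin N → Fin m) → ℂ) (K : Fin N → Fin m)
    (X : HeckeFamily m q) (I0 J0 : Fin 0 → Fin m) :
    ((∑ I, ξ I • wmono (snocOp q) I K) X).1 0 I0 J0 = ∑ I, ξ I * X.1 N I K := by
  have h1 : (((∑ I, ξ I • wmono (snocOp q) I K) X : HeckeFamily m q) :
      ∀ N, (Fin N → Fin m) → (Fin N → Fin m) → ℂ) =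
      ∑ I, ξ I • (wmono (snocOp q) I K X : HeckeFamily m q).1 := by
    rw [LinearMap.sum_apply, Submodule.coe_sum]
    rfl
  rw [h1]
  simp only [Finset.sum_apply, Pi.smul_apply, wmono_snocOp, smul_eq_mul]

/-- The Hecke operator as a linear map. -/
def heckeHom {N : ℕ} (q : ℝ) (a b : Fin N) :
    ((Fin N → Fin m) → ℂ) →ₗ[ℂ] ((Fin N → Fin m) → ℂ) where
  toFun f := hecke q a b f
  map_add' f g := by
    funext I
    simp only [hecke, Pi.add_apply, smul_eq_mul]
    ring
  map_smul' c f := by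
    funext I
    simp only [hecke, Pi.smul_apply, smul_eq_mul, RingHom.id_apply]
    ring

theorem heckeHom_apply {N : ℕ} (a b : Fin N) (f : (Fin N → Fin m) → ℂ) (I : Fin N → Fin m) :
    heckeHom q a b f I = hecke q a b f I := rfl

theorem star_diagC {α : Type*} [DecidableEq α] (i j : α) : star (diagC q i j) = diagC q i j := by
  rw [diagC]; split_ifs <;> simp

theorem star_offC {α : Type*} [LinearOrder α] (i j : α) : star (offC q i j) = offC q i j := by
  rw [offC]; split_ifs <;> simp

theorem heckeHom_selfAdjoint {N : ℕ} (a b : Fin N) (f g : (Fin N → Fin m) → ℂ) :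
    ∑ I, star (f I) * heckeHom q a b g I = ∑ I, star (heckeHom q a b f I) * g I := by
  have h1 := sum_hecke_smul q a b (fun I => star (f I)) g
  simp only [smul_eq_mul] at h1
  simp only [heckeHom_apply]
  rw [h1]
  refine Finset.sum_congr rfl fun I _ => congrArg (· * _) ?_
  simp only [hecke, smul_eq_mul, star_add, star_mul', star_diagC, star_offC]

/-- The covectors whose contraction with `u` lies in `Z`. -/
def contractMem {P κ : Type*} [Ring P] [Algebra ℂ P] (u : Fin m → κ → P) (Z : Submodule ℂ P) (N : ℕ) :
    Submodule ℂ ((Fin N → Fin m) → ℂ) where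
  carrier := {f | ∀ J : Fin N → κ, ∑ I, f I • wmono u I J ∈ Z}
  zero_mem' J := by simp
  add_mem' {f g} hf hg J := by
    simp only [Pi.add_apply, add_smul, Finset.sum_add_distrib]
    exact Z.add_mem (hf J) (hg J)
  smul_mem' c f hf J := by
    simp only [Pi.smul_apply, smul_eq_mul, mul_smul, ← Finset.smul_sum]
    exact Z.smul_mem c (hf J)

/-- The Hecke operator moves from the covector to the column word, where the contraction changes
only to a combination of contractions already in `Z`. -/
theorem hecke_mem_contractMem {P κ : Type*} [Ring P] [Algebra ℂ P] [LinearOrder κ] {u : Fin m → κ → P}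
    (hu : Frt q u) (Z : Submodule ℂ P) {N : ℕ} {a b : Fin N} (h : (a : ℕ) + 1 = b)
    {f : (Fin N → Fin m) → ℂ} (hf : f ∈ contractMem u Z N) : hecke q a b f ∈ contractMem u Z N := by
  intro J
  rw [← sum_hecke_smul]
  simp only [wmono_hecke hu h]
  have h1 := hecke_sum q a b Finset.univ f (fun I J => wmono u I J) J
  rw [← h1, hecke]
  exact Z.add_mem (Z.smul_mem _ (hf _)) (Z.smul_mem _ (hf _))

/-- The family of projections with kernels `contractMem u Z N`. -/
theorem exists_heckeFamily {P κ : Type*} [Ring P] [Algebra ℂ P] [LinearOrder κ] {u : Fin m → κ → P}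
    (hu : Frt q u) (Z : Submodule ℂ P) : ∃ X : HeckeFamily m q, ∀ (N : ℕ) (f : (Fin N → Fin m) → ℂ),
      f ∈ contractMem u Z N ↔ ∀ K, ∑ I, f I * X.1 N I K = 0 := by
  choose p hp0 _ hp using fun N => exists_equivariant_projection (contractMem u Z N)
  refine ⟨⟨fun N I J => p N (Pi.single I 1) J, fun N a b h I J => ?_⟩, fun N f => ?_⟩
  · have h1 := hp N (heckeHom q a b) (heckeHom q a b) (heckeHom_selfAdjoint a b)
      (fun f hf => hecke_mem_contractMem hu Z h hf) (fun f hf => hecke_mem_contractMem hu Z h hf)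
      (Pi.single I 1)
    have h2 : heckeHom q a b (Pi.single I 1) =
        diagC q (I a) (I b) • Pi.single (I ∘ Equiv.swap a b) (1 : ℂ) +
          offC q (I b) (I a) • Pi.single I 1 := by
      funext K
      rw [heckeHom_apply, hecke, Pi.add_apply, Pi.smul_apply, Pi.smul_apply]
      have h3 : (Pi.single I 1 : (Fin N → Fin m) → ℂ) (K ∘ Equiv.swap a b) =
          (Pi.single (I ∘ Equiv.swap a b) 1 : (Fin N → Fin m) → ℂ) K := by
        rw [Pi.single_apply, Pi.single_apply]
        refine if_congr ⟨fun h => ?_, fun h => ?_⟩ rfl rfl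
        · rw [← h]; funext k; simp
        · rw [h]; funext k; simp
      rw [h3]
      congr 1
      · by_cases hK : K = I ∘ Equiv.swap a b
        · rw [hK, diagC_comm]; simp
        · rw [Pi.single_eq_of_ne hK, smul_zero, smul_zero]
      · by_cases hK : K = I
        · rw [hK]
        · rw [Pi.single_eq_of_ne hK, smul_zero, smul_zero]
    rw [h2] at h1
    have h4 := congrFun h1 J
    rw [map_add, map_smul, map_smul] at h4
    exact h4
  · rw [← hp0]
    have h1 : ∀ K, p N f K = ∑ I, f I * p N (Pi.single I 1) K := fun K => by
      conv_lhs => rw [← Finset.univ_sum_single f]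
      rw [map_sum, Finset.sum_apply]
      refine Finset.sum_congr rfl fun I _ => ?_
      rw [← smul_eq_mul, ← Pi.smul_apply, ← map_smul, ← Pi.single_smul, smul_eq_mul, mul_one]
    rw [funext_iff]
    simp only [h1, Pi.zero_apply]

end HeckeFamily

/-! ### The first fundamental theorem -/

section FundamentalTheorem

variable {m : ℕ} {q : ℝ}

/-- The covector `ε ⊗ ξ`. -/
def prependEps (q : ℝ) {N : ℕ} (ξ : (Fin N → Fin m) → ℂ) (I : Fin (m + N) → Fin m) : ℂ :=
  epsW q (fun k => I (Fin.castAdd N k)) * ξ fun k => I (Fin.natAdd m k)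

theorem prependEps_append {N : ℕ} (ξ : (Fin N → Fin m) → ℂ) (L : Fin m → Fin m) (I : Fin N → Fin m) :
    prependEps q ξ (Fin.append L I) = epsW q L * ξ I := by
  simp only [prependEps, Fin.append_left, Fin.append_right]

theorem sum_prependEps {P κ : Type*} [Ring P] [Algebra ℂ P] (u : Fin m → κ → P) {N : ℕ}
    (ξ : (Fin N → Fin m) → ℂ) (J : Fin m → κ) (K : Fin N → κ) :
    ∑ I, prependEps q ξ I • wmono u I (Fin.append J K) =
      (∑ L, epsW q L • wmono u L J) * ∑ I, ξ I • wmono u I K := by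
  rw [← (Fin.appendEquiv m N).sum_comp, Fintype.sum_prod_type, Finset.sum_mul]
  refine Finset.sum_congr rfl fun L _ => ?_
  rw [Finset.mul_sum]
  refine Finset.sum_congr rfl fun I _ => ?_
  change prependEps q ξ (Fin.append L I) • wmono u (Fin.append L I) _ = _
  rw [prependEps_append, wmono_append, smul_mul_smul_comm]

/-- The span of the maximal minors. -/
def minorSpan {P κ : Type*} [Ring P] [Algebra ℂ P] (q : ℝ) (u : Fin m → κ → P) : Submodule ℂ P :=
  Submodule.span ℂ (Set.range fun J : Fin m → κ => ∑ L, epsW q L • wmono u L J)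

theorem minor_mem {P κ : Type*} [Ring P] [Algebra ℂ P] (u : Fin m → κ → P) (J : Fin m → κ) :
    ∑ L, epsW q L • wmono u L J ∈ minorSpan q u := Submodule.subset_span ⟨J, rfl⟩

theorem append_eq {N : ℕ} {α : Type*} (J : Fin (m + N) → α) :
    J = Fin.append (fun k => J (Fin.castAdd N k)) fun k => J (Fin.natAdd m k) :=
  Fin.append_castAdd_natAdd.symm

/-- The witness is `ε^{⊗r}`: on `τ` each factor `ε` yields a determinant, on `u` it yields a maximal
minor. -/
theorem exists_eigencovector (hq : 0 < q) {P κ : Type*} [Ring P] [Algebra ℂ P] (u : Fin m → κ → P)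
    {R : Type} [Ring R] [Algebra ℂ R] {τ : Fin m → Fin m → R} (hτ : Frt q τ) (r : ℕ) :
    ∃ (N : ℕ) (ξ : (Fin N → Fin m) → ℂ), (∃ I, ξ I ≠ 0) ∧
      (∀ K, ∑ I, ξ I • wmono τ I K = ξ K • detW q τ ^ r) ∧
      ∀ J : Fin N → κ, ∑ I, ξ I • wmono u I J ∈ minorSpan q u ^ r := by
  induction r with
  | zero =>
    refine ⟨0, fun _ => 1, ⟨Fin.elim0, one_ne_zero⟩, fun K => ?_, fun J => ?_⟩
    · simp [wmono_zero]
    · simpa [wmono_zero] using Submodule.one_le.1 (le_refl (1 : Submodule ℂ P))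
  | succ r ih =>
    obtain ⟨N, ξ, ⟨I0, hI0⟩, h1, h2⟩ := ih
    refine ⟨m + N, prependEps q ξ, ⟨Fin.append id I0, ?_⟩, fun K => ?_, fun J => ?_⟩
    · rwa [prependEps_append, epsW_id, one_mul]
    · rw [append_eq K, sum_prependEps, hτ.sum_eps_left hq, h1, prependEps_append, smul_mul_smul_comm,
        pow_succ']
    · rw [append_eq J, sum_prependEps, pow_succ']
      exact Submodule.mul_mem_mul (minor_mem u _) (h2 _)

/-- On the Hecke family of projections, any eigencovector with eigenvalue `y` is multiplied by one
scalar, the value of `y X` at empty words. The scalar vanishes because `θ` is nonzero and lies in a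
kernel, so `ξ` lies in a kernel too. -/
theorem mem_contractMem_of_eigencovector {P κ : Type*} [Ring P] [Algebra ℂ P] [LinearOrder κ]
    {u : Fin m → κ → P} (hu : Frt q u) (Z : Submodule ℂ P)
    {y : Module.End ℂ (HeckeFamily m q)} {N M : ℕ} {ξ : (Fin N → Fin m) → ℂ}
    {θ : (Fin M → Fin m) → ℂ} (hξ : ∀ K, ∑ I, ξ I • wmono (snocOp q) I K = ξ K • y)
    (hθ : ∀ K, ∑ I, θ I • wmono (snocOp q) I K = θ K • y) {I₀ : Fin M → Fin m} (hθ0 : θ I₀ ≠ 0)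
    (hmem : θ ∈ contractMem u Z M) : ξ ∈ contractMem u Z N := by
  obtain ⟨X, hX⟩ := exists_heckeFamily hu Z
  have key : ∀ {N : ℕ} {ξ : (Fin N → Fin m) → ℂ},
      (∀ K, ∑ I, ξ I • wmono (snocOp q) I K = ξ K • y) → ∀ K, ∑ I, ξ I * X.1 N I K =
        ξ K * (y X).1 0 Fin.elim0 Fin.elim0 := fun h K => by
    rw [← sum_wmono_snocOp _ K X Fin.elim0 Fin.elim0, h]
    rfl
  have h1 : (y X).1 0 Fin.elim0 Fin.elim0 = 0 := by
    have h2 := (hX M θ).1 hmem I₀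
    rw [key hθ] at h2
    exact (mul_eq_zero.1 h2).resolve_left hθ0
  rw [hX]
  intro K
  rw [key hξ, h1, mul_zero]

/-- Eigencovectors of a quantum matrix are, up to products of maximal minors on the left, spanned by
products of maximal minors. -/
theorem IsQGen.exists_sum_mem {A : Type} [Ring A] [Algebra ℂ A] {t : Fin m → Fin m → A} {d : A}
    (h : IsQGen m q False A t d) (hq : 0 < q) {P κ : Type*} [Ring P] [Algebra ℂ P] [LinearOrder κ]
    {u : Fin m → κ → P} (hu : Frt q u) {V : Submodule ℂ P} (hV : 1 ∈ V * minorSpan q u) {N : ℕ}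
    (ξ : (Fin N → Fin m) → ℂ) (z : ℕ)
    (hξ : ∀ K, ∑ I, ξ I • wmono t I K = ξ K • detW q t ^ z) :
    ∃ s : ℕ, ∀ J, ∑ I, ξ I • wmono u I J ∈ V ^ s * minorSpan q u ^ (s + z) := by
  obtain ⟨s, hs⟩ := h.exists_pow_detW hq (frt_snocOp (m := m) (q := q)) ξ z hξ
  refine ⟨s, ?_⟩
  -- The comparison covector has the eigenvalue that `ξ` acquires after multiplication by the `s`-th
  -- power of the determinant.
  obtain ⟨M, θ, ⟨I₀, hI₀⟩, hθ, hθu⟩ := exists_eigencovector hq u (frt_snocOp (m := m) (q := q)) (s + z)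
  generalize minorSpan q u ^ (s + z) = Z at hθu ⊢
  generalize detW q (snocOp q : Fin m → Fin m → _) ^ (s + z) = y at hs hθ
  clear hξ
  -- With the target `Z` and the eigenvalue `y` fixed, each step absorbs one power of the
  -- determinant by prepending `ε` to `ξ`.
  induction s generalizing N ξ with
  | zero =>
    simp only [pow_zero, one_mul] at hs ⊢
    exact mem_contractMem_of_eigencovector hu Z hs hθ hI₀ hθu
  | succ s ih =>
    have h1 := ih (prependEps q ξ) fun K => by
      rw [append_eq K]
      simp only [← mul_smul_comm, ← Finset.mul_sum] at hs ⊢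
      rw [sum_prependEps, (frt_snocOp (m := m) (q := q)).sum_eps_left hq, smul_mul_assoc,
        mul_smul_comm, ← mul_assoc, ← pow_succ, hs, prependEps_append, mul_smul]
    intro J
    -- A minor times the contraction of `ξ` is the contraction of `ε ⊗ ξ`. Since `1` lies in `V *
    -- minorSpan q u`, the prepended `ε` is removed at the cost of one factor `V`.
    have h2 : ∀ x ∈ V * minorSpan q u, x * ∑ I, ξ I • wmono u I J ∈ V * (V ^ s * Z) := by
      intro x hx
      refine Submodule.mul_induction_on hx (fun v hv y hy => ?_) fun x y hx hy => ?_
      · rw [mul_assoc]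
        refine Submodule.mul_mem_mul hv ?_
        refine Submodule.span_induction (fun y hy => ?_) ?_ (fun y y' _ _ hy hy' => ?_)
          (fun c y _ hy => ?_) hy
        · obtain ⟨K, rfl⟩ := hy
          simp only
          rw [← sum_prependEps]
          exact h1 _
        · rw [zero_mul]
          exact Submodule.zero_mem _
        · rw [add_mul]
          exact Submodule.add_mem _ hy hy'
        · rw [smul_mul_assoc]
          exact Submodule.smul_mem _ _ hy
      · rw [add_mul]
        exact Submodule.add_mem _ hx hy
    have h3 := h2 1 hV
    rwa [one_mul, ← mul_assoc, ← pow_succ'] at h3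

end FundamentalTheorem

/-! ### Eigencovectors of block diagonal quantum matrices -/

section Words

variable {α κ P : Type*} [Ring P] [Algebra ℂ P]

theorem sum_words_cons {M : Type*} [AddCommMonoid M] [Fintype α] {N : ℕ} (F : (Fin (N + 1) → α) → M) :
    ∑ I, F I = ∑ i, ∑ I : Fin N → α, F (Fin.cons i I : Fin (N + 1) → α) := by
  rw [← (Fin.consEquiv fun _ => α).sum_comp, Fintype.sum_prod_type]
  rfl

theorem wmono_eq_zero (t : α → κ → P) {N : ℕ} {I : Fin N → α} {J : Fin N → κ} (k : Fin N)
    (h : t (I k) (J k) = 0) : wmono t I J = 0 := by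
  induction N with
  | zero => exact k.elim0
  | succ N ih =>
    rw [wmono_succ]
    revert h
    refine Fin.cases (fun h => ?_) (fun k h => ?_) k
    · rw [h, zero_mul]
    · rw [ih k h, mul_zero]

theorem comul_wmono [Fintype α] {A P' : Type*} [Ring A] [Algebra ℂ A] [Ring P'] [Algebra ℂ P']
    (β : P' →ₐ[ℂ] A ⊗[ℂ] P) {t : α → κ → P'} {T : α → α → A} {u : α → κ → P}
    (h : ∀ i j, β (t i j) = ∑ k, T i k ⊗ₜ[ℂ] u k j) {N : ℕ} (I : Fin N → α) (J : Fin N → κ) :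
    β (wmono t I J) = ∑ K, wmono T I K ⊗ₜ[ℂ] wmono u K J := by
  induction N with
  | zero =>
    simp only [wmono_zero, map_one, Fintype.sum_unique]
    rfl
  | succ N ih =>
    rw [wmono_succ, map_mul, h, ih, sum_words_cons, Finset.sum_mul]
    refine Finset.sum_congr rfl fun k _ => ?_
    rw [Finset.mul_sum]
    refine Finset.sum_congr rfl fun K _ => ?_
    rw [Algebra.TensorProduct.tmul_mul_tmul, wmono_succ, wmono_succ]
    rfl

/-- `ξ` is an eigencovector of the tensor powers of `T` with eigenvalue `y`. -/
def IsEigen [Fintype α] {A : Type*} [Ring A] [Algebra ℂ A] (T : α → α → A) {N : ℕ}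
    (ξ : (Fin N → α) → ℂ) (y : A) : Prop :=
  ∀ K, ∑ I, ξ I • wmono T I K = ξ K • y

variable [Fintype α] {A : Type*} [Ring A] [Algebra ℂ A] {T : α → α → A} {N : ℕ}

theorem IsEigen.sub {ξ η : (Fin N → α) → ℂ} {y : A} (hξ : IsEigen T ξ y) (hη : IsEigen T η y) :
    IsEigen T (fun I => ξ I - η I) y := fun K => by
  simp only [sub_smul, Finset.sum_sub_distrib, hξ K, hη K]

theorem IsEigen.smul {ξ : (Fin N → α) → ℂ} {y : A} (hξ : IsEigen T ξ y) (c : ℂ) :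
    IsEigen T (fun I => c * ξ I) y := fun K => by
  simp only [mul_smul, ← Finset.smul_sum, hξ K]

theorem IsEigen.hecke [LinearOrder α] {q : ℝ} (hT : Frt q T) {ξ : (Fin N → α) → ℂ} {y : A}
    (hξ : IsEigen T ξ y) {a b : Fin N} (h : (a : ℕ) + 1 = b) : IsEigen T (hecke q a b ξ) y := by
  intro K
  rw [← sum_hecke_smul]
  simp only [wmono_hecke hT h]
  have h1 := hecke_sum q a b Finset.univ ξ (fun I K => wmono T I K) K
  have h2 : (fun K => ∑ I, ξ I • wmono T I K) = fun K => ξ K • y := funext hξ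
  rw [h2] at h1
  rw [← h1, _root_.hecke, _root_.hecke, smul_smul, smul_smul, add_smul]
  rfl

/-- The component of a covector on words with a given pattern. -/
theorem IsEigen.component {ρ : Type*} [DecidableEq ρ] {pat : α → ρ}
    (hT : ∀ i j, pat i ≠ pat j → T i j = 0) {ξ : (Fin N → α) → ℂ} {y : A} (hξ : IsEigen T ξ y)
    (π : Fin N → ρ) : IsEigen T (fun I => if pat ∘ I = π then ξ I else 0) y := by
  have h0 : ∀ I K : Fin N → α, pat ∘ I ≠ pat ∘ K → wmono T I K = 0 := fun I K h => by
    obtain ⟨k, hk⟩ := Function.ne_iff.1 h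
    exact wmono_eq_zero T k (hT _ _ hk)
  intro K
  simp only [ite_smul, zero_smul]
  by_cases hK : pat ∘ K = π
  · rw [if_pos hK, ← hξ K]
    refine Finset.sum_congr rfl fun I _ => ?_
    by_cases hI : pat ∘ I = π
    · rw [if_pos hI]
    · rw [if_neg hI, h0 I K fun h => hI (h.trans hK), smul_zero]
  · rw [if_neg hK]
    refine Finset.sum_eq_zero fun I _ => ?_
    split_ifs with hI
    · rw [h0 I K fun h => hK (h.symm.trans hI), smul_zero]
    · rfl

/-- Removal of the first letter. -/
theorem IsEigen.tail [DecidableEq α] {e : α} {y y' z : A} (hT : ∀ j, T e j = if j = e then y else 0)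
    (hy : y' * y = 1) {ξ : (Fin (N + 1) → α) → ℂ} (hξ : IsEigen T ξ z)
    (h0 : ∀ I, ξ I ≠ 0 → I 0 = e) :
    IsEigen T (fun I => ξ (Fin.cons e I : Fin (N + 1) → α)) (y' * z) := by
  intro K
  have h1 := hξ (Fin.cons e K : Fin (N + 1) → α)
  rw [sum_words_cons, Finset.sum_eq_single e] at h1
  · simp only [wmono_cons, hT, if_true, ← mul_smul_comm, ← Finset.mul_sum] at h1
    beta_reduce
    rw [← mul_smul_comm, ← h1, ← mul_assoc, hy, one_mul]
  · intro i _ hi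
    refine Finset.sum_eq_zero fun I _ => ?_
    by_contra h
    exact hi (h0 (Fin.cons i I : Fin (N + 1) → α) fun h' => h (by rw [h', zero_smul]))
  · intro h
    exact (h (Finset.mem_univ e)).elim

theorem sum_wmono_tail {e : α} {u : α → κ → P} {ξ : (Fin (N + 1) → α) → ℂ}
    (h0 : ∀ I, ξ I ≠ 0 → I 0 = e) (J : Fin (N + 1) → κ) :
    ∑ I, ξ I • wmono u I J = u e (J 0) *
      ∑ I : Fin N → α, ξ (Fin.cons e I : Fin (N + 1) → α) • wmono u I fun k => J k.succ := by
  rw [sum_words_cons, Finset.sum_eq_single e]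
  · rw [Finset.mul_sum]
    refine Finset.sum_congr rfl fun I _ => ?_
    rw [wmono_succ, mul_smul_comm]
    rfl
  · intro i _ hi
    refine Finset.sum_eq_zero fun I _ => ?_
    by_contra h
    exact hi (h0 (Fin.cons i I : Fin (N + 1) → α) fun h' => h (by rw [h', zero_smul]))
  · intro h
    exact (h (Finset.mem_univ e)).elim

/-- Sums over the words supported on the image of an injection of alphabets. -/
theorem sum_words_image {α' : Type*} [Fintype α'] {e : α' → α} (he : Function.Injective e)
    {ξ : (Fin N → α) → ℂ} (h0 : ∀ I, ξ I ≠ 0 → ∀ k, I k ∈ Set.range e) (F : (Fin N → α) → P) :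
    ∑ I, ξ I • F I = ∑ I : Fin N → α', ξ (e ∘ I) • F (e ∘ I) := by
  symm
  refine Finset.sum_of_injOn (fun I => e ∘ I) (fun I _ I' _ h => funext fun k => he (congrFun h k))
    (by simp) (fun I _ hI => ?_) (fun _ _ => rfl)
  by_contra h
  have h1 := h0 I fun h' => h (by rw [h', zero_smul])
  choose I' hI' using h1
  exact hI ⟨I', by simp, funext hI'⟩

theorem IsEigen.of_image {α' : Type*} [Fintype α'] {e : α' → α} (he : Function.Injective e)
    {ξ : (Fin N → α) → ℂ} (h0 : ∀ I, ξ I ≠ 0 → ∀ k, I k ∈ Set.range e) {y : A} (h : IsEigen T ξ y) :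
    IsEigen (fun i j => T (e i) (e j)) (fun I => ξ (e ∘ I)) y := fun K => by
  have h1 := h (e ∘ K)
  rw [sum_words_image he h0] at h1
  exact h1

end Words

/-! ### Sorting the letters of a covector by type -/

section Sorting

variable {α ρ : Type*} [LinearOrder α] [LinearOrder ρ] {q : ℝ} {N : ℕ} {pat : α → ρ}

/-- Exchanging two neighbouring letters of different types by Hecke operators. -/
theorem hecke_comp_swap (hpat : Monotone pat) {ξ : (Fin N → α) → ℂ} {π : Fin N → ρ}
    (hξ : ∀ I, ξ I ≠ 0 → pat ∘ I = π) {a b : Fin N} (hab : π b < π a) :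
    hecke q a b (fun I => ξ (I ∘ Equiv.swap a b)) = ξ ∧
      (fun I => ξ (I ∘ Equiv.swap a b)) =
        fun I => hecke q a b ξ I - ((q : ℂ) - (q : ℂ)⁻¹) * ξ I := by
  -- On the support of `ξ` the letters at `a` and `b` descend strictly. There the Hecke operator is
  -- an exchange plus a scalar, and on the exchanged support it is the exchange alone.
  have hlt : ∀ I, ξ I ≠ 0 → I b < I a := fun I hI => by
    have h1 := hξ I hI
    by_contra h
    have h2 := hpat (not_lt.1 h)
    rw [← h1] at hab
    exact not_lt.2 h2 hab
  have hss : ∀ I : Fin N → α, (I ∘ Equiv.swap a b) ∘ Equiv.swap a b = I := fun I => by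
    funext k; simp
  have hsw : ∀ I : Fin N → α, I a = I b → I ∘ Equiv.swap a b = I := fun I h => by
    funext k
    rw [Function.comp_apply, Equiv.swap_apply_def]
    split_ifs with h1 h2
    · rw [h1, h]
    · rw [h2, h]
    · rfl
  constructor
  · funext I
    rw [hecke, hss]
    have h1 : diagC q (I a) (I b) • ξ I = ξ I := by
      by_cases h : ξ I = 0
      · rw [h, smul_zero]
      · rw [diagC, if_neg (hlt I h).ne', one_smul]
    have h2 : offC q (I b) (I a) • ξ (I ∘ Equiv.swap a b) = 0 := by
      by_cases h : ξ (I ∘ Equiv.swap a b) = 0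
      · rw [h, smul_zero]
      · have := hlt _ h
        simp only [Function.comp_apply, Equiv.swap_apply_left, Equiv.swap_apply_right] at this
        rw [offC, if_neg this.not_gt, zero_smul]
    rw [h1, h2, add_zero]
  · funext I
    have h1 : diagC q (I a) (I b) • ξ (I ∘ Equiv.swap a b) = ξ (I ∘ Equiv.swap a b) := by
      by_cases h : I a = I b
      · have h0 : ξ I = 0 := by
          by_contra h0
          exact (hlt I h0).ne' h
        rw [hsw I h, h0, smul_zero]
      · rw [diagC, if_neg h, one_smul]
    have h2 : offC q (I b) (I a) • ξ I = ((q : ℂ) - (q : ℂ)⁻¹) * ξ I := by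
      by_cases h : ξ I = 0
      · rw [h, smul_zero, mul_zero]
      · rw [offC, if_pos (hlt I h), smul_eq_mul]
    rw [hecke, h1, h2, add_sub_cancel_right]

end Sorting

/-- It suffices to contract eigencovectors supported on words sorted by type. -/
theorem contractMem_of_sorted {n N : ℕ} {ρ κ P A : Type*} [LinearOrder ρ] [Fintype ρ] [LinearOrder κ]
    [Ring P] [Algebra ℂ P] [Ring A] [Algebra ℂ A] {q : ℝ} {pat : Fin n → ρ} (hpat : Monotone pat)
    {T : Fin n → Fin n → A} (hT : Frt q T) (hT0 : ∀ i j, pat i ≠ pat j → T i j = 0)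
    {u : Fin n → κ → P} (hu : Frt q u) (Z : Submodule ℂ P) {y : A}
    (h : ∀ ξ : (Fin N → Fin n) → ℂ, IsEigen T ξ y → ∀ π : Fin N → ρ, Monotone π →
      (∀ I, ξ I ≠ 0 → pat ∘ I = π) → ξ ∈ contractMem u Z N)
    {ξ : (Fin N → Fin n) → ℂ} (hξ : IsEigen T ξ y) : ξ ∈ contractMem u Z N := by
  have h1 : ∀ (π : Fin N → ρ) (ξ : (Fin N → Fin n) → ℂ), IsEigen T ξ y →
      (∀ I, ξ I ≠ 0 → pat ∘ I = π) → ξ ∈ contractMem u Z N := by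
    intro π
    induction π using bubble_induction with
    | h0 π hπ => exact fun ξ hξ hs => h ξ hξ π hπ hs
    | h1 π a b hab hlt ih =>
      intro ξ hξ hs
      obtain ⟨e1, e2⟩ := hecke_comp_swap (q := q) hpat hs hlt
      -- The covector is a Hecke operator applied to its exchanged version. The latter is again an
      -- eigencovector, being a combination of `ξ` and its Hecke image, and has a better sorted
      -- pattern.
      rw [← e1]
      refine hecke_mem_contractMem hu Z hab (ih _ ?_ fun I hI => ?_)
      · rw [e2]
        exact (hξ.hecke hT hab).sub (hξ.smul _)
      · rw [← hs _ hI]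
        funext k
        simp
  have h2 : ξ = ∑ π : Fin N → ρ, fun I => if pat ∘ I = π then ξ I else 0 := by
    funext I
    simp
  rw [h2]
  refine Submodule.sum_mem _ fun π _ => h1 π _ (hξ.component hT0 π) fun I hI => ?_
  by_contra h3
  exact hI (if_neg h3)

/-! ### The coinvariants come from projective space -/

section Surjectivity

variable {m : ℕ} {q : ℝ}

/-- The span of the first row of the generating matrix. -/
def rowSpan (m : ℕ) (q : ℝ) : Submodule ℂ (SUq (m + 1) q) :=
  Submodule.span ℂ (Set.range fun j => SUq.t 0 j)

/-- The lower rows of the generating matrix. -/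
def lowerMat (m : ℕ) (q : ℝ) (i : Fin m) (j : Fin (m + 1)) : SUq (m + 1) q := SUq.t i.succ j

/-- The span of the first column of the inverse of the generating matrix. -/
def colSpan (m : ℕ) (hq : 0 < q) : Submodule ℂ (SUq (m + 1) q) :=
  Submodule.span ℂ (Set.range fun j => (SUq.isQGen hq).s hq j 0)

theorem frt_lowerMat (hq : 0 < q) : Frt q (lowerMat m q) := fun i j a b => by
  have h1 := SUq.frt (n := m + 1) hq i.succ j.succ a b
  simpa [diagC, offC, lowerMat] using h1

/-- Column expansion of the determinant, which is `1`, is multiplied by `s k 0` and summed over the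
last column letter `k`. The relation `t s = 1` forces the last row letter to be `0`, leaving minors
of the lower rows. -/
theorem minor_eq (hq : 0 < q) (J : Fin m → Fin (m + 1)) :
    (-(q : ℂ)⁻¹) ^ m • ∑ L, epsW q L • wmono (lowerMat m q) L J =
      ∑ k, epsW q (Fin.snoc J k : Fin (m + 1) → Fin (m + 1)) • (SUq.isQGen hq).s hq k 0 := by
  have ht := SUq.frt (n := m + 1) hq
  have hd := (SUq.isQGen (n := m + 1) hq).det_eq_one trivial
  have hs := (SUq.isQGen (n := m + 1) hq).matInv hq
  have h1 : ∀ k, epsW q (Fin.snoc J k : Fin (m + 1) → Fin (m + 1)) • (SUq.isQGen hq).s hq k 0 =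
      ∑ i, ∑ K : Fin m → Fin (m + 1), epsW q (Fin.snoc K i : Fin (m + 1) → Fin (m + 1)) •
        (wmono SUq.t K J * (SUq.t i k * (SUq.isQGen hq).s hq k 0)) := fun k => by
    have h2 := congrArg (· * (SUq.isQGen hq).s hq k 0)
      (ht.sum_eps_left hq (Fin.snoc J k : Fin (m + 1) → Fin (m + 1)))
    simp only [hd, smul_mul_assoc, one_mul] at h2
    rw [← h2, ← (Fin.snocEquiv fun _ => Fin (m + 1)).sum_comp, Fintype.sum_prod_type, Finset.sum_mul]
    refine Finset.sum_congr rfl fun i _ => ?_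
    rw [Finset.sum_mul]
    refine Finset.sum_congr rfl fun K _ => ?_
    have e : (Fin.snocEquiv fun _ => Fin (m + 1)) (i, K) = (Fin.snoc K i : Fin (m + 1) → _) := rfl
    rw [e, smul_mul_assoc, ← mul_assoc]
    congr 2
    exact wmono_snoc _ i k K J
  rw [Finset.sum_congr rfl fun k _ => h1 k, Finset.sum_comm]
  have h2 : ∀ i, ∑ k, ∑ K : Fin m → Fin (m + 1),
      epsW q (Fin.snoc K i : Fin (m + 1) → Fin (m + 1)) •
        (wmono SUq.t K J * (SUq.t i k * (SUq.isQGen hq).s hq k 0)) =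
      if i = 0 then ∑ K : Fin m → Fin (m + 1),
        epsW q (Fin.snoc K i : Fin (m + 1) → Fin (m + 1)) • (wmono SUq.t K J : SUq (m + 1) q)
      else 0 := fun i => by
    rw [Finset.sum_comm]
    simp only [← Finset.smul_sum, ← Finset.mul_sum, hs.mul_eq]
    split_ifs <;> simp
  rw [Finset.sum_congr rfl fun i _ => h2 i, Finset.sum_ite_eq', if_pos (Finset.mem_univ _)]
  simp only [epsW_snoc, Fin.val_zero, Nat.sub_zero, mul_smul, ← Finset.smul_sum]
  congr 1
  rw [sum_words_avoid 0 _ fun I hI => by rw [epsAvoid_eq_zero hI, zero_smul],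
    sum_words_eq_sum_perm _ fun L hL => by rw [epsW_of_not_inj hL, zero_smul]]
  refine Finset.sum_congr rfl fun σ _ => ?_
  rw [epsAvoid_succAbove, Fin.succAbove_zero]
  rfl

theorem minorSpan_lowerMat (hq : 0 < q) : minorSpan q (lowerMat m q) = colSpan m hq := by
  have hc : (-(q : ℂ)⁻¹) ^ m ≠ 0 := pow_ne_zero _ (neg_ne_zero.2 (inv_ne_zero (ofReal_ne_zero' hq)))
  apply le_antisymm
  · refine Submodule.span_le.2 ?_
    rintro _ ⟨J, rfl⟩
    beta_reduce
    rw [← inv_smul_smul₀ hc (∑ L, epsW q L • wmono (lowerMat m q) L J), minor_eq hq]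
    exact Submodule.smul_mem _ _ (Submodule.sum_mem _ fun k _ =>
      Submodule.smul_mem _ _ (Submodule.subset_span ⟨k, rfl⟩))
  · refine Submodule.span_le.2 ?_
    rintro _ ⟨j, rfl⟩
    -- The columns other than `j` isolate the single entry `s j 0`.
    have h1 := minor_eq hq j.succAbove
    rw [Finset.sum_eq_single j] at h1
    · have h2 : epsAvoid q j j.succAbove = 1 := by
        have := epsAvoid_succAbove (q := q) j 1
        rwa [Equiv.Perm.coe_one, Function.comp_id, epsW_id] at this
      rw [epsW_snoc, h2, mul_one] at h1
      have hc' : (-(q : ℂ)⁻¹) ^ (m - j : ℕ) ≠ 0 :=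
        pow_ne_zero _ (neg_ne_zero.2 (inv_ne_zero (ofReal_ne_zero' hq)))
      beta_reduce
      rw [← inv_smul_smul₀ hc' ((SUq.isQGen hq).s hq j 0), ← h1]
      exact Submodule.smul_mem _ _ (Submodule.smul_mem _ _ (minor_mem _ _))
    · intro k _ hk
      rw [epsW_snoc, epsAvoid_eq_zero, mul_zero, zero_smul]
      rintro ⟨-, h⟩
      exact h (by rw [Fin.range_succAbove]; exact hk)
    · intro h
      exact (h (Finset.mem_univ j)).elim

theorem one_mem_rowSpan_mul_colSpan (hq : 0 < q) : 1 ∈ rowSpan m q * colSpan m hq := by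
  have h1 := ((SUq.isQGen (n := m + 1) hq).matInv hq).mul_eq 0 0
  rw [if_pos rfl] at h1
  rw [← h1]
  exact Submodule.sum_mem _ fun j _ => Submodule.mul_mem_mul (Submodule.subset_span ⟨j, rfl⟩)
    (Submodule.subset_span ⟨j, rfl⟩)

/-- The elements of weight `z`. -/
def weightSpan (m : ℕ) (hq : 0 < q) (z : ℕ) : Submodule ℂ (SUq (m + 1) q) :=
  ⨆ k, rowSpan m q ^ k * colSpan m hq ^ (k + z)

theorem rowSpan_mul_weightSpan_le (hq : 0 < q) (z : ℕ) :
    rowSpan m q * weightSpan m hq (z + 1) ≤ weightSpan m hq z := by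
  rw [weightSpan, Submodule.mul_iSup]
  refine iSup_le fun k => ?_
  rw [← mul_assoc, ← pow_succ', show k + (z + 1) = (k + 1) + z by omega]
  exact le_iSup (fun k => rowSpan m q ^ k * colSpan m hq ^ (k + z)) (k + 1)

/-- The generating matrix enlarged by an entry `1`. -/
def paddedMat (m : ℕ) (q : ℝ) : Fin (m + 2) → Fin (m + 2) → SUq (m + 1) q := blockMat 1 SUq.t

/-- The image of `paddedMat` in `U_q(m)`. -/
def paddedBlock (m : ℕ) (q : ℝ) : Fin (m + 2) → Fin (m + 2) → Uq m q :=
  blockMat 1 (blockMat (Uq.detStar m q) Uq.t)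

theorem frt_paddedMat (hq : 0 < q) : Frt q (paddedMat m q) :=
  frt_blockMat (SUq.frt hq) fun _ _ => Commute.one_left _

theorem frt_paddedBlock (hq : 0 < q) : Frt q (paddedBlock m q) :=
  frt_blockMat (frt_blockMat (Uq.frt hq) (commute_detStar hq)) fun _ _ => Commute.one_left _

/-- The type of a letter. -/
def letterType (i : Fin (m + 2)) : Fin 3 := ⟨min i 2, by omega⟩

theorem monotone_letterType : Monotone (letterType : Fin (m + 2) → Fin 3) := fun i j h => by
  have : (i : ℕ) ≤ j := h
  simp only [letterType, Fin.mk_le_mk]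
  omega

theorem letterType_zero : letterType (0 : Fin (m + 2)) = 0 := rfl

theorem letterType_succ_zero : letterType (Fin.succ 0 : Fin (m + 2)) = 1 := rfl

theorem letterType_succ_succ (i : Fin m) : letterType i.succ.succ = 2 := by
  simp [letterType]

theorem paddedBlock_eq_zero (i j : Fin (m + 2)) (h : letterType i ≠ letterType j) :
    paddedBlock m q i j = 0 := by
  revert h
  refine Fin.cases ?_ (fun i => ?_) i <;> refine Fin.cases ?_ (fun j => ?_) j
  · exact fun h => (h rfl).elim
  · exact fun _ => rfl
  · exact fun _ => rfl
  · refine Fin.cases ?_ (fun i => ?_) i <;> refine Fin.cases ?_ (fun j => ?_) j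
    · exact fun h => (h rfl).elim
    · exact fun _ => rfl
    · exact fun _ => rfl
    · intro h
      rw [letterType_succ_succ, letterType_succ_succ] at h
      exact (h rfl).elim

/-- Such a covector lives on the letters of `U_q(m)`, so `IsQGen.exists_sum_mem` applies to the
lower rows, whose maximal minors span the first column of `s`. -/
theorem contract_mem_of_lower (hq : 0 < q) {N : ℕ} (z : ℕ) {ξ : (Fin N → Fin (m + 2)) → ℂ}
    (hξ : IsEigen (paddedBlock m q) ξ (detW q Uq.t ^ z))
    (h0 : ∀ I, ξ I ≠ 0 → letterType ∘ I = fun _ => 2) :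
    ξ ∈ contractMem (paddedMat m q) (weightSpan m hq z) N := by
  have hinj : Function.Injective fun i : Fin m => i.succ.succ := fun i j h =>
    Fin.succ_injective _ (Fin.succ_injective _ h)
  have hsupp : ∀ I, ξ I ≠ 0 → ∀ k, I k ∈ Set.range fun i : Fin m => i.succ.succ := by
    intro I hI k
    have h1 := congrFun (h0 I hI) k
    rw [Function.comp_apply] at h1
    revert h1
    refine Fin.cases (fun h1 => ?_) (fun i => ?_) (I k)
    · exact absurd h1 (by rw [letterType_zero]; decide)
    · refine Fin.cases (fun h1 => ?_) (fun i _ => ⟨i, rfl⟩) i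
      exact absurd h1 (by rw [letterType_succ_zero]; decide)
  have h1 : IsEigen (Uq.t : _ → _ → Uq m q) (fun I => ξ ((fun i : Fin m => i.succ.succ) ∘ I))
    (detW q Uq.t ^ z) := hξ.of_image hinj hsupp
  obtain ⟨s, hs⟩ := (Uq.isQGen hq).exists_sum_mem hq (frt_lowerMat (m := m) hq)
    (V := rowSpan m q) (by rw [minorSpan_lowerMat hq]; exact one_mem_rowSpan_mul_colSpan hq) _ z h1
  rw [minorSpan_lowerMat hq] at hs
  intro J
  rw [sum_words_image hinj hsupp]
  -- The padding column has no entry in the lower rows, so a letter `0` in `J` makes the contraction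
  -- vanish.
  by_cases hJ : ∀ k, J k ≠ 0
  · choose J' hJ' using fun k => Fin.exists_succ_eq.2 (hJ k)
    have h2 := hs J'
    rw [show J = Fin.succ ∘ J' from funext fun k => (hJ' k).symm]
    exact le_iSup (fun k => rowSpan m q ^ k * colSpan m hq ^ (k + z)) s h2
  · push Not at hJ
    obtain ⟨k, hk⟩ := hJ
    rw [Finset.sum_eq_zero fun I _ => ?_]
    · exact Submodule.zero_mem _
    · rw [wmono_eq_zero _ k, smul_zero]
      rw [hk]
      rfl

/-- For a sorted covector the first letter decides. The padding letter contributes the factor `1`;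
the letter of `det^*` contributes an entry of the first row and, once removed, raises the weight `z`
by one; any other first letter means that all letters belong to the lower block. -/
theorem contract_mem_weightSpan (hq : 0 < q) {N : ℕ} (z : ℕ) {ξ : (Fin N → Fin (m + 2)) → ℂ}
    (hξ : IsEigen (paddedBlock m q) ξ (detW q Uq.t ^ z)) :
    ξ ∈ contractMem (paddedMat m q) (weightSpan m hq z) N := by
  induction N generalizing z with
  | zero => exact contract_mem_of_lower hq z hξ fun I _ => Subsingleton.elim _ _
  | succ N ih =>
    refine contractMem_of_sorted monotone_letterType (frt_paddedBlock hq) paddedBlock_eq_zero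
      (frt_paddedMat hq) _ (fun ξ hξ π hπ hs => ?_) hξ
    have h3 : π 0 = 0 ∨ π 0 = 1 ∨ π 0 = 2 := by
      generalize π 0 = i
      revert i
      decide
    rcases h3 with h | h | h
    · have h0 : ∀ I, ξ I ≠ 0 → I 0 = 0 := fun I hI => by
        have h1 := congrFun (hs I hI) 0
        rw [h, Function.comp_apply] at h1
        revert h1
        refine Fin.cases (fun _ => rfl) (fun i => ?_) (I 0)
        refine Fin.cases (fun h1 => ?_) (fun i h1 => ?_) i
        · rw [letterType_succ_zero] at h1; exact absurd h1 (by decide)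
        · rw [letterType_succ_succ] at h1; exact absurd h1 (by decide)
      have h1 := ih z (ξ := fun I => ξ (Fin.cons 0 I : Fin (N + 1) → Fin (m + 2))) (by
        have := hξ.tail (e := 0) (y := 1) (y' := 1) (fun j => by
          refine Fin.cases ?_ (fun j => ?_) j
          · rw [if_pos rfl]; rfl
          · rw [if_neg (Fin.succ_ne_zero j)]; rfl) (one_mul 1) h0
        rwa [one_mul] at this)
      intro J
      rw [sum_wmono_tail h0]
      refine Fin.cases ?_ (fun j => ?_) (J 0)
      · have h2 : paddedMat m q 0 0 = 1 := rfl
        rw [h2, one_mul]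
        exact h1 _
      · have h2 : paddedMat m q 0 j.succ = 0 := rfl
        rw [h2, zero_mul]
        exact Submodule.zero_mem _
    · have h0 : ∀ I, ξ I ≠ 0 → I 0 = Fin.succ 0 := fun I hI => by
        have h1 := congrFun (hs I hI) 0
        rw [h, Function.comp_apply] at h1
        revert h1
        refine Fin.cases (fun h1 => ?_) (fun i => ?_) (I 0)
        · rw [letterType_zero] at h1; exact absurd h1 (by decide)
        refine Fin.cases (fun _ => rfl) (fun i h1 => ?_) i
        rw [letterType_succ_succ] at h1; exact absurd h1 (by decide)
      have h1 := ih (z + 1) (ξ := fun I => ξ (Fin.cons (Fin.succ 0) I : Fin (N + 1) → Fin (m + 2))) (by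
        have := hξ.tail (e := Fin.succ 0) (y := Uq.detStar m q) (y' := detW q Uq.t) (fun j => by
          refine Fin.cases ?_ (fun j => ?_) j
          · rw [if_neg (Fin.succ_ne_zero _).symm]; rfl
          · refine Fin.cases ?_ (fun j => ?_) j
            · rw [if_pos rfl]; rfl
            · rw [if_neg fun h => Fin.succ_ne_zero j (Fin.succ_injective _ h)]; rfl)
          (Uq.isQGen hq).det_mul h0
        rwa [← pow_succ'] at this)
      intro J
      rw [sum_wmono_tail h0]
      refine Fin.cases ?_ (fun j => ?_) (J 0)
      · have h2 : paddedMat m q (Fin.succ 0) 0 = 0 := rfl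
        rw [h2, zero_mul]
        exact Submodule.zero_mem _
      · exact rowSpan_mul_weightSpan_le hq z (Submodule.mul_mem_mul
          (Submodule.subset_span ⟨j, rfl⟩) (h1 _))
    · refine contract_mem_of_lower hq z hξ fun I hI => ?_
      rw [hs I hI]
      funext k
      have h1 := hπ (Fin.zero_le k)
      rw [h] at h1
      exact le_antisymm (Fin.le_last _) h1

theorem suCoaction_paddedMat (hq : 0 < q) (i j : Fin (m + 2)) :
    suCoaction m hq (paddedMat m q i j) =
      ∑ k, paddedBlock m q i k ⊗ₜ[ℂ] paddedMat m q k j := by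
  rw [Fin.sum_univ_succ]
  have h1 : ∀ i j, paddedMat m q (Fin.succ i) (Fin.succ j) = SUq.t i j := fun _ _ => rfl
  have h2 : ∀ i j, paddedBlock m q (Fin.succ i) (Fin.succ j) = deltaHom m hq (SUq.t i j) :=
    fun i j => (deltaHom_t hq i j).symm
  have h3 : ∀ j, paddedMat m q 0 (Fin.succ j) = 0 := fun _ => rfl
  have h4 : ∀ j, paddedMat m q (Fin.succ j) 0 = 0 := fun _ => rfl
  have h5 : ∀ j, paddedBlock m q 0 (Fin.succ j) = 0 := fun _ => rfl
  have h6 : ∀ j, paddedBlock m q (Fin.succ j) 0 = 0 := fun _ => rfl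
  have h7 : paddedMat m q 0 0 = 1 := rfl
  have h8 : paddedBlock m q 0 0 = 1 := rfl
  refine Fin.cases ?_ (fun i => ?_) i <;> refine Fin.cases ?_ (fun j => ?_) j
  · simp [h4, h7, h8, Algebra.TensorProduct.one_def]
  · simp [h3, h5]
  · simp [h4, h6]
  · simp only [h1, h2, h6, h3, suCoaction_t, TensorProduct.zero_tmul, zero_add]

/-- This is the unitarity that `exists_invariant_covectors` requires. -/
theorem star_antipode_paddedBlock (hq : 0 < q) (i j : Fin (m + 2)) :
    (Uq.isQGen hq).starFun hq ((Uq.isQGen hq).antipode hq (paddedBlock m q i j)) =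
      paddedBlock m q j i := by
  have h0 : (Uq.isQGen (n := m) hq).starFun hq ((Uq.isQGen hq).antipode hq 0) = 0 := by
    rw [map_zero]
    have := (Uq.isQGen (n := m) hq).starFun_algebraMap hq 0
    simpa using this
  refine Fin.cases ?_ (fun i => ?_) i <;> refine Fin.cases ?_ (fun j => ?_) j
  · change (Uq.isQGen hq).starFun hq ((Uq.isQGen hq).antipode hq 1) = 1
    rw [IsQGen.antipode_one, IsQGen.starFun_one]
  · exact h0
  · exact h0
  · refine Fin.cases ?_ (fun i => ?_) i <;> refine Fin.cases ?_ (fun j => ?_) j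
    · change (Uq.isQGen hq).starFun hq ((Uq.isQGen hq).antipode hq (Uq.detStar m q)) = Uq.detStar m q
      rw [IsQGen.antipode_d, IsQGen.starFun_det]
    · exact h0
    · exact h0
    · change (Uq.isQGen hq).starFun hq ((Uq.isQGen hq).antipode hq (Uq.t i j)) = Uq.t j i
      rw [IsQGen.antipode_t, IsQGen.starFun_s]

/-- The composition of the antipode and the `*`-operation. -/
def starAntipode (m : ℕ) (hq : 0 < q) : Uq m q →ₛₗ[starRingEnd ℂ] Uq m q where
  toFun a := (Uq.isQGen hq).starFun hq ((Uq.isQGen hq).antipode hq a)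
  map_add' a b := by rw [map_add, IsQGen.starFun_add]
  map_smul' c a := by rw [map_smul, IsQGen.starFun_smul]; rfl

theorem starAntipode_wmono (hq : 0 < q) {N : ℕ} (I J : Fin N → Fin (m + 2)) :
    starAntipode m hq (wmono (paddedBlock m q) I J) = wmono (paddedBlock m q) J I := by
  let f : Uq m q →* Uq m q :=
    { toFun := starAntipode m hq
      map_one' := star_antipode_paddedBlock hq 0 0
      map_mul' := fun a b => by
        change (Uq.isQGen hq).starFun hq ((Uq.isQGen hq).antipode hq (a * b)) = _
        rw [IsQGen.antipode_mul, IsQGen.starFun_mul]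
        rfl }
  have h1 := map_wmono f (paddedBlock m q) I J
  refine h1.trans ?_
  rw [show (fun i j => f (paddedBlock m q i j)) = fun i j => paddedBlock m q j i from
    funext fun i => funext fun j => star_antipode_paddedBlock hq i j]
  rfl

/-- The padding entry `1` lengthens short products, so all terms of an element can be written with
words of one common length. -/
theorem exists_sum_paddedMat (hq : 0 < q) (b : SUq (m + 1) q) : ∃ N : ℕ,
    b ∈ Submodule.span ℂ (Set.range fun x : (Fin N → Fin (m + 2)) × (Fin N → Fin (m + 2)) =>
      wmono (paddedMat m q) x.1 x.2) := by
  let E := Submodule.span ℂ (Set.range fun x : Fin (m + 2) × Fin (m + 2) => paddedMat m q x.1 x.2)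
  have h1 : (1 : SUq (m + 1) q) ∈ E := Submodule.subset_span ⟨(0, 0), rfl⟩
  have hmono : Monotone fun N : ℕ => E ^ N := pow_right_mono₀ (Submodule.one_le.2 h1)
  have h2 : ∃ N : ℕ, b ∈ E ^ N := by
    induction b using (SUq.isQGen hq).induction with
    | algebraMap c => exact ⟨0, by rw [pow_zero]; exact Submodule.algebraMap_mem c⟩
    | add a b ha hb =>
      obtain ⟨N, ha⟩ := ha
      obtain ⟨M, hb⟩ := hb
      exact ⟨max N M, Submodule.add_mem _ (hmono (le_max_left N M) ha) (hmono (le_max_right N M) hb)⟩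
    | mul a b ha hb =>
      obtain ⟨N, ha⟩ := ha
      obtain ⟨M, hb⟩ := hb
      exact ⟨N + M, by rw [pow_add]; exact Submodule.mul_mem_mul ha hb⟩
    | gen i j => exact ⟨1, by rw [pow_one]; exact Submodule.subset_span ⟨(i.succ, j.succ), rfl⟩⟩
    | inv => exact ⟨1, by rwa [pow_one]⟩
  obtain ⟨N, hN⟩ := h2
  refine ⟨N, ?_⟩
  rw [Submodule.span_pow] at hN
  refine Submodule.span_mono ?_ hN
  intro a ha
  obtain ⟨f, rfl⟩ := Set.mem_pow.1 ha
  choose p hp using fun i => (f i).2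
  refine ⟨(fun i => (p i).1, fun i => (p i).2), ?_⟩
  exact congrArg List.prod (congrArg _ (funext fun i => hp i))

/-- After replacing the coefficients by invariant covectors, each column word contributes the
contraction of an eigencovector with eigenvalue `1 = det^0`, which has weight zero. -/
theorem coinvariants_le_weightSpan (hq : 0 < q) {b : SUq (m + 1) q}
    (hb : b ∈ coinvariants (suCoaction m hq)) : b ∈ weightSpan m hq 0 := by
  obtain ⟨N, hN⟩ := exists_sum_paddedMat hq b
  obtain ⟨c, rfl⟩ := (Submodule.mem_span_range_iff_exists_fun ℂ).1 hN
  obtain ⟨c', h1, h2⟩ := exists_invariant_covectors (suCoaction m hq).toLinearMap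
    (fun I J => wmono (paddedMat m q) I J) (fun I J => wmono (paddedBlock m q) I J)
    (comul_wmono (suCoaction m hq) (suCoaction_paddedMat hq)) (starAntipode m hq)
    (starAntipode_wmono hq) c (mem_coinvariants_iff.1 hb)
  rw [h1, Fintype.sum_prod_type, Finset.sum_comm]
  refine Submodule.sum_mem _ fun J _ => ?_
  exact contract_mem_weightSpan hq 0 (ξ := fun I => c' (I, J))
    (fun K => by rw [pow_zero]; exact h2 J K) J

theorem exists_sphereMap_eq (hq : 0 < q) {b : SUq (m + 1) q}
    (hb : b ∈ coinvariants (suCoaction m hq)) : ∃ u ∈ CPq (m + 1) q, sphereMap m hq u = b := by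
  have hq' := ofReal_ne_zero' hq
  have hV : rowSpan m q ≤ (QSphere.spanV (m + 1) q).map (sphereMap m hq).toLinearMap := by
    refine Submodule.span_le.2 ?_
    rintro _ ⟨j, rfl⟩
    refine ⟨((q : ℂ) ^ (j : ℕ))⁻¹ • QSphere.v j.rev, Submodule.smul_mem _ _ (QSphere.v_mem _), ?_⟩
    rw [AlgHom.toLinearMap_apply, map_smul, sphereMap_v, Fin.rev_rev, inv_smul_smul₀ (pow_ne_zero _ hq')]
  have hX : colSpan m hq ≤ (QSphere.spanX (m + 1) q).map (sphereMap m hq).toLinearMap := by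
    refine Submodule.span_le.2 ?_
    rintro _ ⟨j, rfl⟩
    refine ⟨((q : ℂ) ^ (j : ℕ))⁻¹ • QSphere.x j.rev, Submodule.smul_mem _ _ (QSphere.x_mem _), ?_⟩
    rw [AlgHom.toLinearMap_apply, map_smul, sphereMap_x, Fin.rev_rev, inv_smul_smul₀ (pow_ne_zero _ hq')]
  have h1 : weightSpan m hq 0 ≤
      (Subalgebra.toSubmodule (CPq (m + 1) q)).map (sphereMap m hq).toLinearMap := by
    refine iSup_le fun k => ?_
    refine (mul_le_mul' (pow_le_pow_left' hV k) (pow_le_pow_left' hX (k + 0))).trans ?_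
    rw [← Submodule.map_pow, ← Submodule.map_pow, ← Submodule.map_mul, add_zero]
    exact Submodule.map_mono fun u hu => (QSphere.mem_CPq_iff hq).2 ⟨k, hu⟩
  exact h1 (coinvariants_le_weightSpan hq hb)

end Surjectivity

/-- The sphere map restricts to an isomorphism of projective space with the coinvariants. -/
def projectiveEquiv (m : ℕ) {q : ℝ} (hq : 0 < q) :
    CPq (m + 1) q ≃ₐ[ℂ] coinvariants (suCoaction m hq) :=
  AlgEquiv.ofBijective
    (((sphereMap m hq).comp (CPq (m + 1) q).val).codRestrict (coinvariants (suCoaction m hq))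
      fun u => sphereMap_mem hq u.2)
    ⟨(injective_iff_map_eq_zero _).2 fun u hu => Subtype.ext
        (sphereMap_eq_zero hq u.2 (congrArg Subtype.val hu)),
      fun b => by
        obtain ⟨u, hu, h⟩ := exists_sphereMap_eq hq b.2
        exact ⟨⟨u, hu⟩, Subtype.ext h⟩⟩

end

/-- With `n = m + 1`: `SU_q(n)` with the coaction `(δ_n ⊗ id) ∘ Δ` is a quantum principal bundle
with structure quantum group `U_q(n-1)` and base `SU_q(n)^{U_q(n-1)} ≅ ℂP_q^{n-1}`. -/
theorem theorem3p3 (m : ℕ) (q : ℝ) (hq : 0 < q) :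
    ∃ (H : HopfStarStructure (SUq (m + 1) q)) (K : HopfStarStructure (Uq m q))
      (δ : SUq (m + 1) q →ₐ[ℂ] Uq m q),
      SUq.IsStandard H ∧ Uq.IsStandard K ∧
      -- `δ` is the surjective morphism of Hopf `*`-algebras given on generators by
      (δ (SUq.t 0 0) = K.starRing.star (qDet q Uq.t) ∧
        (∀ i : Fin m, δ (SUq.t 0 i.succ) = 0) ∧
        (∀ i : Fin m, δ (SUq.t i.succ 0) = 0) ∧
        ∀ i j : Fin m, δ (SUq.t i.succ j.succ) = Uq.t i j) ∧
      IsHopfStarHom H K δ ∧ Function.Surjective δ ∧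
      -- the principal bundle, the exactness of `δ`, and the base
      IsQuantumPrincipalBundle K.toHopfStructure (inducedCoaction H.toHopfStructure δ)
        (coinvariants (inducedCoaction H.toHopfStructure δ)) ∧
      IsExactFor δ (coinvariants (inducedCoaction H.toHopfStructure δ)) ∧
      ∃ e : CPq (m + 1) q ≃ₐ[ℂ] coinvariants (inducedCoaction H.toHopfStructure δ),
        ∀ u : CPq (m + 1) q, ∃ hu : star (u : QSphere (m + 1) q) ∈ CPq (m + 1) q,
          (e ⟨star (u : QSphere (m + 1) q), hu⟩ : SUq (m + 1) q) =
            H.starRing.star (e u : SUq (m + 1) q) := by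
  refine ⟨(SUq.isQGen hq).hopfStar hq, (Uq.isQGen hq).hopfStar hq, deltaHom m hq,
    SUq.isStandard hq, Uq.isStandard hq, ⟨?_, fun i => ?_, fun i => ?_, fun i j => ?_⟩,
    deltaHom_isHopfStarHom m hq, deltaHom_surjective m hq, isQuantumPrincipalBundle hq,
    deltaHom_isExactFor hq, projectiveEquiv m hq,
    fun u => ⟨QSphere.star_mem_CPq hq u.2, sphereMap_star hq (u : QSphere (m + 1) q)⟩⟩
  · rw [deltaHom_t, blockMat_zero_zero, (Uq.frt hq).qDet_eq hq]
    exact ((Uq.isQGen hq).starFun_det hq).symm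
  · rw [deltaHom_t, blockMat_zero_succ]
  · rw [deltaHom_t, blockMat_succ_zero]
  · rw [deltaHom_t, blockMat_succ_succ]
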